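/- Let $V$ be a finite-dimensional complex vector space and let $A=T(V)/(R)$, $R\subseteq V\otimes V$, be a commutative quadratic algebra, i.e. $u\otimes v-v\otimes u\in R$ for all $u,v\in V$; thus $A=S(V)/I$ with $I$ generated by quadratic elements. Assume that $A$ is Koszul: $\mathrm{Ext}_A^{i,j}(\mathbb C,\mathbb C)=0$ whenever $i\ne j$, where $i$ is the cohomological and $j$ the internal degree. Let $A^!=T(V^*)/(R^\perp)$ be the Koszul dual algebra, where $R^\perp\subseteq V^*\otimes V^*$ is the annihilator of $R$, and let $L=\bigoplus_{m\ge1}L_m$ be a graded Lie superalgebra with finite-dimensional components (elements of $L_m$ have parity $m \bmod 2$) such that $A^!=U(L)$ as graded algebras; in particular $L_1=V^*$. Let $\mathrm{CE}(L)$ be the Chevalley–Eilenberg complex of $L$ with homological grading: the free graded-commutative algebra on $\bigoplus_{p\ge 1}L_p^*$ with $L_p^*$ placed in degree $p-1$ (the exterior algebra on $L^*$ in the super sense), with differential $d$ the extension, as a derivation of degree $-1$, of the map dual to the bracket: in terms of a homogeneous basis $(e_a)$ of $L$, $e_a\in L_{p_a}$, with dual basis $(e_a^*)$, $$d\varphi=\tfrac12\sum_{a,b}(-1)^{p_a-1}\,\varphi([e_a,e_b])\,e_a^*e_b^*\qquad(\varphi\in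 L_n^*).$$ Then $\mathrm{CE}(L)$ is a minimal model of $A$. That is, put $W_k=L_{k+1}^*$ in degree $k$ for $k\ge1$, and $V=L_1^*$ in degree $0$. Then: 1. $\mathrm{CE}(L)$ is a commutative DG algebra (graded by homological degree), and it is the semi-free extension $S(V)[W]=S(V)\otimes S(W_{\mathrm{even}})\otimes\bigwedge W_{\mathrm{odd}}$ of $S(V)$; 2. the canonical quotient $S(V)[W]\to S(V)\to A$, which sends $W$ to zero, is a map of DG algebras ($A$ being placed in degree $0$ with zero differential) and an isomorphism in homology: $H_0(\mathrm{CE}(L))=A$ and $H_k(\mathrm{CE}(L))=0$ for $k>0$; 3. the differential is decomposable: $d(W)\subseteq S_\bullet^{\ge2}(V\oplus W)$, the span of the products of at least two elements of $V\oplus W$. -/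

import Mathlib

open scoped TensorProduct DirectSum

noncomputable section

namespace KoszulCE

universe u v w

section Quadratic

variable {V : Type u} [AddCommGroup V] [Module ℂ V]

/-- The embedding of `V ⊗ V` into the tensor algebra `T(V)`. -/
def tensorSq (V : Type u) [AddCommGroup V] [Module ℂ V] :
    V ⊗[ℂ] V →ₗ[ℂ] TensorAlgebra ℂ V :=
  LinearMap.mul' ℂ (TensorAlgebra ℂ V) ∘ₗ
    TensorProduct.map (TensorAlgebra.ι ℂ) (TensorAlgebra.ι ℂ)

/-- The relations `t = 0` for `t` in a space `R ⊆ V ⊗ V` of quadratic relations. -/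
inductive QuadRel (R : Submodule ℂ (V ⊗[ℂ] V)) :
    TensorAlgebra ℂ V → TensorAlgebra ℂ V → Prop
  | of (t : V ⊗[ℂ] V) (ht : t ∈ R) : QuadRel R (tensorSq V t) 0

/-- The quadratic algebra `T(V)/(R)`. -/
def QuadAlg (R : Submodule ℂ (V ⊗[ℂ] V)) : Type u := RingQuot (QuadRel R)

instance (R : Submodule ℂ (V ⊗[ℂ] V)) : Ring (QuadAlg R) :=
  inferInstanceAs (Ring (RingQuot (QuadRel R)))

instance (R : Submodule ℂ (V ⊗[ℂ] V)) : Algebra ℂ (QuadAlg R) :=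
  inferInstanceAs (Algebra ℂ (RingQuot (QuadRel R)))

/-- The canonical map from `V` to `T(V)/(R)`. -/
def QuadAlg.gen (R : Submodule ℂ (V ⊗[ℂ] V)) : V →ₗ[ℂ] QuadAlg R :=
  (RingQuot.mkAlgHom ℂ (QuadRel R)).toLinearMap ∘ₗ TensorAlgebra.ι ℂ

/-- The component of degree `n` of `T(V)/(R)`: the span of the products of `n` generators. -/
def QuadAlg.deg (R : Submodule ℂ (V ⊗[ℂ] V)) (n : ℕ) : Submodule ℂ (QuadAlg R) :=
  LinearMap.range (QuadAlg.gen R) ^ n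

/-- The annihilator in `V* ⊗ V*` of `R ⊆ V ⊗ V`, under the pairing
`⟨f ⊗ g, u ⊗ v⟩ = f u * g v`. -/
def annihilator (R : Submodule ℂ (V ⊗[ℂ] V)) :
    Submodule ℂ (Module.Dual ℂ V ⊗[ℂ] Module.Dual ℂ V) where
  carrier := {t | ∀ r ∈ R, TensorProduct.dualDistrib ℂ V V t r = 0}
  add_mem' := by
    intro a b ha hb r hr
    simp [ha r hr, hb r hr]
  zero_mem' := by
    intro r _
    simp
  smul_mem' := by
    intro c a ha r hr
    simp [ha r hr]

/-- The Koszul dual `A^! = T(V*)/(R^⊥)` of `A = T(V)/(R)`. -/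
abbrev KoszulDual (R : Submodule ℂ (V ⊗[ℂ] V)) : Type u := QuadAlg (annihilator R)

/-- The augmentation ideal `A_+` of `A = T(V)/(R)`: the non-unital subalgebra generated
by `V`. -/
abbrev QuadAlg.aug (R : Submodule ℂ (V ⊗[ℂ] V)) : NonUnitalSubalgebra ℂ (QuadAlg R) :=
  NonUnitalAlgebra.adjoin ℂ (Set.range (QuadAlg.gen R))

/-- The cochains of cohomological degree `i` of the complex `Hom_A(Bar(A), ℂ)`, where
`Bar(A) = A ⊗ A_+^{⊗ •}` is the normalized bar resolution of the trivial module `ℂ`: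
the multilinear forms in `i` variables from `A_+`. -/
abbrev BarCochain (R : Submodule ℂ (V ⊗[ℂ] V)) (i : ℕ) : Type u :=
  MultilinearMap ℂ (fun _ : Fin i => QuadAlg.aug R) ℂ

/-- A bar cochain has internal degree `j` if it vanishes on all tuples of homogeneous elements
of total degree different from `j`. -/
def BarCochain.HasDegree {R : Submodule ℂ (V ⊗[ℂ] V)} {i : ℕ} (f : BarCochain R i) (j : ℕ) :
    Prop :=
  ∀ (a : Fin i → QuadAlg.aug R) (n : Fin i → ℕ),
    (∀ r, (a r : QuadAlg R) ∈ QuadAlg.deg R (n r)) → ∑ r, n r ≠ j → f a = 0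

/-- The bar differential
`(δ f)(a_0, …, a_i) = ∑_{r < i} (-1)^(r+1) f(a_0, …, a_r a_{r+1}, …, a_i)`. The two outer terms
are zero because `A_+` acts by zero on `ℂ`. -/
def BarCochain.diff {R : Submodule ℂ (V ⊗[ℂ] V)} {i : ℕ} (f : BarCochain R i)
    (a : Fin (i + 1) → QuadAlg.aug R) : ℂ :=
  ∑ r : Fin i, (-1 : ℂ) ^ ((r : ℕ) + 1) * f (Fin.contractNth r.castSucc (· * ·) a)

/-- `Ext_A^{i,j}(ℂ, ℂ) = 0`, where `i` is the cohomological and `j` the internal degree: every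
cocycle of bidegree `(i, j)` is a coboundary (there are no cochains in degree `i = -1`). -/
def ExtVanishes (R : Submodule ℂ (V ⊗[ℂ] V)) : ℕ → ℕ → Prop
  | 0, j => ∀ f : BarCochain R 0, f.HasDegree j → (∀ a, f.diff a = 0) → f = 0
  | i + 1, j => ∀ f : BarCochain R (i + 1), f.HasDegree j → (∀ a, f.diff a = 0) →
      ∃ g : BarCochain R i, g.HasDegree j ∧ ∀ a, f a = g.diff a

/-- `A = T(V)/(R)` is a Koszul algebra: `Ext_A^{i,j}(ℂ, ℂ) = 0` whenever `i ≠ j`. -/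
def IsKoszul (R : Submodule ℂ (V ⊗[ℂ] V)) : Prop :=
  ∀ i j : ℕ, i ≠ j → ExtVanishes R i j

end Quadratic

/-- A graded Lie superalgebra `L = ⨁_{m ≥ 1} L_m` over `ℂ`; the parity of an element of `L_m`
is the parity of `m`. -/
structure GradedLieSuperalgebra (L : Type v) [AddCommGroup L] [Module ℂ L] where
  /-- the homogeneous components -/
  comp : ℕ → Submodule ℂ L
  isInternal : DirectSum.IsInternal comp
  comp_zero : comp 0 = ⊥
  /-- the bracket -/
  br : L →ₗ[ℂ] L →ₗ[ℂ] L
  br_mem : ∀ {i j : ℕ} {x y : L}, x ∈ comp i → y ∈ comp j → br x y ∈ comp (i + j)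
  skew : ∀ {i j : ℕ} {x y : L}, x ∈ comp i → y ∈ comp j →
    br x y = -((-1 : ℂ) ^ (i * j) • br y x)
  jacobi : ∀ {i j k : ℕ} {x y z : L}, x ∈ comp i → y ∈ comp j → z ∈ comp k →
    (-1 : ℂ) ^ (i * k) • br x (br y z) + (-1 : ℂ) ^ (j * i) • br y (br z x) +
      (-1 : ℂ) ^ (k * j) • br z (br x y) = 0

section Lie

variable {L : Type v} [AddCommGroup L] [Module ℂ L] (G : GradedLieSuperalgebra L)

/-- The relations `x y - (-1)^{|x||y|} y x = [x, y]` of the universal enveloping algebra. -/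
inductive EnvRel : TensorAlgebra ℂ L → TensorAlgebra ℂ L → Prop
  | of (i j : ℕ) (x y : L) (hx : x ∈ G.comp i) (hy : y ∈ G.comp j) :
      EnvRel
        (TensorAlgebra.ι ℂ x * TensorAlgebra.ι ℂ y -
          (-1 : ℂ) ^ (i * j) • (TensorAlgebra.ι ℂ y * TensorAlgebra.ι ℂ x))
        (TensorAlgebra.ι ℂ (G.br x y))

/-- The universal enveloping algebra `U(L)` of a graded Lie superalgebra. -/
def Env : Type v := RingQuot (EnvRel G)

instance : Ring (Env G) := inferInstanceAs (Ring (RingQuot (EnvRel G)))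

instance : Algebra ℂ (Env G) := inferInstanceAs (Algebra ℂ (RingQuot (EnvRel G)))

/-- The canonical map from `L` to `U(L)`. -/
def Env.ι : L →ₗ[ℂ] Env G :=
  (RingQuot.mkAlgHom ℂ (EnvRel G)).toLinearMap ∘ₗ TensorAlgebra.ι ℂ

/-- An identification `A^! = U(L)` of graded algebras, for `A = T(V)/(R)`. As `A^!` is generated
by its component `V*` of degree one, and the component of degree one of `U(L)` is `L_1`, it is an
isomorphism of algebras which restricts to an isomorphism from `V*` to `L_1`. -/
structure DualEnvIso {V : Type u} [AddCommGroup V] [Module ℂ V]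
    (R : Submodule ℂ (V ⊗[ℂ] V)) where
  /-- the isomorphism `A^! ≅ U(L)` -/
  equiv : KoszulDual R ≃ₐ[ℂ] Env G
  /-- its restriction `V* ≅ L_1` -/
  degOne : Module.Dual ℂ V ≃ₗ[ℂ] G.comp 1
  equiv_gen : ∀ f : Module.Dual ℂ V,
    equiv (QuadAlg.gen (annihilator R) f) = Env.ι G (degOne f : L)

/-- The space `⨁_p L_p^*`. -/
abbrev GradedDual : Type v := ⨁ p : ℕ, Module.Dual ℂ (G.comp p)

/-- The inclusion of `L_p^*` into the tensor algebra on the graded dual of `L`. -/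
def preGen (p : ℕ) : Module.Dual ℂ (G.comp p) →ₗ[ℂ] TensorAlgebra ℂ (GradedDual G) :=
  TensorAlgebra.ι ℂ ∘ₗ DirectSum.lof ℂ ℕ (fun p => Module.Dual ℂ (G.comp p)) p

/-- Graded commutativity: `φ ψ = (-1)^{(p-1)(q-1)} ψ φ` for `φ ∈ L_p^*`, `ψ ∈ L_q^*`, which have
homological degrees `p - 1` and `q - 1`. -/
inductive CERel : TensorAlgebra ℂ (GradedDual G) → TensorAlgebra ℂ (GradedDual G) → Prop
  | of (p q : ℕ) (φ : Module.Dual ℂ (G.comp p)) (ψ : Module.Dual ℂ (G.comp q)) :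
      CERel (preGen G p φ * preGen G q ψ)
        ((-1 : ℂ) ^ ((p + 1) * (q + 1)) • (preGen G q ψ * preGen G p φ))

/-- The algebra underlying the Chevalley–Eilenberg complex of `L`: the exterior algebra on `L^*`
in the super sense, polynomial on the `L_p^*` with `p` odd and exterior on those with `p` even. -/
def CE : Type v := RingQuot (CERel G)

instance : Ring (CE G) := inferInstanceAs (Ring (RingQuot (CERel G)))

instance : Algebra ℂ (CE G) := inferInstanceAs (Algebra ℂ (RingQuot (CERel G)))

/-- The inclusion of `L_p^*` into `CE(L)`. -/
def CE.gen (p : ℕ) : Module.Dual ℂ (G.comp p) →ₗ[ℂ] CE G :=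
  (RingQuot.mkAlgHom ℂ (CERel G)).toLinearMap ∘ₗ preGen G p

/-- The homological grading: `L_p^*` is put in degree `p - 1`, so that a product of `r` elements
`φ_s ∈ L_{p_s}^*` has degree `k` when `∑ p_s = k + r`. -/
def CE.deg (k : ℕ) : Submodule ℂ (CE G) :=
  Submodule.span ℂ {b | ∃ l : List (Σ p : ℕ, Module.Dual ℂ (G.comp p)),
    (l.map Sigma.fst).sum = k + l.length ∧ b = (l.map fun s => CE.gen G s.1 s.2).prod}

/-- The component `L_i ⊗ L_j → L_n`, `n = i + j`, of the bracket. -/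
def brComp {i j n : ℕ} (h : i + j = n) : G.comp i ⊗[ℂ] G.comp j →ₗ[ℂ] G.comp n :=
  TensorProduct.lift (LinearMap.mk₂ ℂ
    (fun (x : G.comp i) (y : G.comp j) =>
      (⟨G.br x y, h ▸ G.br_mem x.2 y.2⟩ : G.comp n))
    (by intro a b c; ext; simp) (by intro a b c; ext; simp)
    (by intro a b c; ext; simp) (by intro a b c; ext; simp))

/-- The product `L_i^* ⊗ L_j^* → CE(L)`. -/
def CE.mulGen (i j : ℕ) :
    Module.Dual ℂ (G.comp i) ⊗[ℂ] Module.Dual ℂ (G.comp j) →ₗ[ℂ] CE G :=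
  LinearMap.mul' ℂ (CE G) ∘ₗ TensorProduct.map (CE.gen G i) (CE.gen G j)

theorem CE.gen_mul_gen (p q : ℕ) (φ : Module.Dual ℂ (G.comp p)) (ψ : Module.Dual ℂ (G.comp q)) :
    CE.gen G p φ * CE.gen G q ψ =
      (-1 : ℂ) ^ ((p + 1) * (q + 1)) • (CE.gen G q ψ * CE.gen G p φ) := by
  have h := RingQuot.mkAlgHom_rel ℂ (CERel.of (G := G) p q φ ψ)
  rw [map_smul, map_mul, map_mul] at h
  exact h

variable [∀ m, FiniteDimensional ℂ (G.comp m)]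

/-- The map dual to the bracket, `L_n^* → CE(L)`: in terms of homogeneous bases `e_a` of the
`L_i`, with `e_a ∈ L_{i_a}`,
`φ ↦ (1/2) ∑_{a, b} (-1)^{i_a - 1} φ([e_a, e_b]) e_a^* e_b^*`.
The sign turns the super-antisymmetry of the bracket into graded commutativity with respect to
the homological degree. -/
def CE.dualBracket (n : ℕ) : Module.Dual ℂ (G.comp n) →ₗ[ℂ] CE G :=
  (1 / 2 : ℂ) • ∑ x ∈ (Finset.HasAntidiagonal.antidiagonal n).attach,
    (-1 : ℂ) ^ (x.1.1 + 1) •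
      (CE.mulGen G x.1.1 x.1.2 ∘ₗ
        (TensorProduct.dualDistribEquiv ℂ (G.comp x.1.1) (G.comp x.1.2)).symm.toLinearMap ∘ₗ
        (brComp G (Finset.HasAntidiagonal.mem_antidiagonal.mp x.2)).dualMap)

theorem CE.dualBracket_mul_gen (p q : ℕ) (φ : Module.Dual ℂ (G.comp p))
    (ψ : Module.Dual ℂ (G.comp q)) :
    CE.dualBracket G p φ * CE.gen G q ψ =
      (-1 : ℂ) ^ (p * (q + 1)) • (CE.gen G q ψ * CE.dualBracket G p φ) := by
  have key : ∀ (i j : ℕ), i + j = p →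
      ∀ t : Module.Dual ℂ (G.comp i) ⊗[ℂ] Module.Dual ℂ (G.comp j),
      CE.mulGen G i j t * CE.gen G q ψ =
        (-1 : ℂ) ^ (p * (q + 1)) • (CE.gen G q ψ * CE.mulGen G i j t) := by
    intro i j hij t
    induction t using TensorProduct.induction_on with
    | zero => simp
    | add x y hx hy => rw [map_add, add_mul, hx, hy, mul_add (CE.gen G q ψ), smul_add]
    | tmul a b =>
      have e : CE.mulGen G i j (a ⊗ₜ b) = CE.gen G i a * CE.gen G j b := by
        simp [CE.mulGen]
      rw [e, mul_assoc, CE.gen_mul_gen G j q, mul_smul_comm, ← mul_assoc,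
        CE.gen_mul_gen G i q, smul_mul_assoc, smul_smul, mul_assoc, ← pow_add]
      congr 1
      have : (j + 1) * (q + 1) + (i + 1) * (q + 1) = p * (q + 1) + 2 * (q + 1) := by
        subst hij; ring
      rw [this, pow_add, pow_mul _ 2]
      simp
  simp only [CE.dualBracket, LinearMap.smul_apply, LinearMap.sum_apply, smul_mul_assoc,
    mul_smul_comm, Finset.sum_mul, Finset.mul_sum, Finset.smul_sum]
  refine Finset.sum_congr rfl fun x _ => ?_
  rw [LinearMap.comp_apply, key _ _ (Finset.HasAntidiagonal.mem_antidiagonal.mp x.2),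
    smul_comm ((-1 : ℂ) ^ (p * (q + 1))), smul_comm ((-1 : ℂ) ^ (p * (q + 1)))]

/-- On `L_p^*`, the map `φ ↦ !![(-1)^{p-1} φ, dφ; 0, φ]`. A map `b ↦ !![σ b, d b; 0, b]` is
multiplicative exactly when `σ` is and `d (a b) = (d a) b + (σ a) (d b)`. -/
def CE.matGen (p : ℕ) : Module.Dual ℂ (G.comp p) →ₗ[ℂ] Matrix (Fin 2) (Fin 2) (CE G) where
  toFun φ := !![(-1 : ℂ) ^ (p + 1) • CE.gen G p φ, CE.dualBracket G p φ; 0, CE.gen G p φ]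
  map_add' a b := by
    ext i j
    fin_cases i <;> fin_cases j <;> simp
  map_smul' c a := by
    ext i j
    fin_cases i <;> fin_cases j <;> simp [smul_comm c]

/-- The homomorphism `b ↦ !![σ b, d b; 0, b]`, where `σ` is multiplication by `(-1)^k` in degree
`k` and `d` the differential of `CE(L)`. -/
def CE.mat : CE G →ₐ[ℂ] Matrix (Fin 2) (Fin 2) (CE G) :=
  RingQuot.liftAlgHom ℂ
    ⟨TensorAlgebra.lift ℂ (DirectSum.toModule ℂ ℕ _ (CE.matGen G)), by
      rintro _ _ ⟨p, q, φ, ψ⟩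
      have e : ∀ (p : ℕ) (φ : Module.Dual ℂ (G.comp p)),
          TensorAlgebra.lift ℂ (DirectSum.toModule ℂ ℕ _ (CE.matGen G)) (preGen G p φ) =
            CE.matGen G p φ := by
        intro p φ
        simp [preGen]
      rw [map_smul, map_mul, map_mul, e, e]
      have h1 := CE.gen_mul_gen G p q φ ψ
      have h2 := CE.dualBracket_mul_gen G p q φ ψ
      have h3 := CE.dualBracket_mul_gen G q p ψ φ
      have sq : ∀ n : ℕ, (-1 : ℂ) ^ n * (-1 : ℂ) ^ n = 1 := by
        intro n
        rw [← mul_pow]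
        simp
      have s1 : (-1 : ℂ) ^ ((p + 1) * (q + 1)) * (-1 : ℂ) ^ (q + 1) =
          (-1 : ℂ) ^ (p * (q + 1)) := by
        rw [add_mul, one_mul, pow_add, mul_assoc, sq, mul_one]
      have s2 : (-1 : ℂ) ^ ((p + 1) * (q + 1)) * (-1 : ℂ) ^ (q * (p + 1)) =
          (-1 : ℂ) ^ (p + 1) := by
        rw [mul_comm (p + 1), add_mul, one_mul, pow_add, mul_right_comm, sq, one_mul]
      ext i j
      fin_cases i <;> fin_cases j
      · simp [CE.matGen, Matrix.mul_apply, Fin.sum_univ_two]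
        rw [h1]
        simp only [smul_smul]
        congr 1
        ring
      · simp [CE.matGen, Matrix.mul_apply, Fin.sum_univ_two]
        rw [h2, h3]
        simp only [smul_smul, s1, s2]
        rw [add_comm]
      · simp [CE.matGen, Matrix.mul_apply, Fin.sum_univ_two]
      · simp [CE.matGen, Matrix.mul_apply, Fin.sum_univ_two]
        exact h1⟩

/-- The Chevalley–Eilenberg differential: the extension as a derivation of the map dual to the
bracket. -/
def CE.d : CE G →ₗ[ℂ] CE G where
  toFun b := CE.mat G b 0 1
  map_add' a b := by simp
  map_smul' c a := by simp

end Lie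

section MinimalModel

variable {B : Type v} [Ring B] [Algebra ℂ B]

/-- `(B, d)` with the grading `𝓑` by homological degree is a commutative DG algebra. -/
structure IsCDGA (𝓑 : ℕ → Submodule ℂ B) (d : B →ₗ[ℂ] B) : Prop where
  isInternal : DirectSum.IsInternal 𝓑
  one_mem : (1 : B) ∈ 𝓑 0
  mul_mem : ∀ {k l : ℕ} {a b : B}, a ∈ 𝓑 k → b ∈ 𝓑 l → a * b ∈ 𝓑 (k + l)
  comm : ∀ {k l : ℕ} {a b : B}, a ∈ 𝓑 k → b ∈ 𝓑 l → a * b = (-1 : ℂ) ^ (k * l) • (b * a)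
  d_mem : ∀ {k : ℕ} {a : B}, a ∈ 𝓑 (k + 1) → d a ∈ 𝓑 k
  d_zero : ∀ {a : B}, a ∈ 𝓑 0 → d a = 0
  leibniz : ∀ {k : ℕ} {a : B} (b : B), a ∈ 𝓑 k →
    d (a * b) = d a * b + (-1 : ℂ) ^ k • (a * d b)
  d_d : ∀ a : B, d (d a) = 0

variable {V : Type u} [AddCommGroup V] [Module ℂ V]
variable {W : ℕ+ → Type w} [∀ k, AddCommGroup (W k)] [∀ k, Module ℂ (W k)]

/-- The part of even degree of a positively graded vector space. -/
abbrev EvenPart (W : ℕ+ → Type w) [∀ k, AddCommGroup (W k)] [∀ k, Module ℂ (W k)] : Type w :=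
  ⨁ k : {k : ℕ+ // Even (k : ℕ)}, W k.1

/-- The part of odd degree of a positively graded vector space. -/
abbrev OddPart (W : ℕ+ → Type w) [∀ k, AddCommGroup (W k)] [∀ k, Module ℂ (W k)] : Type w :=
  ⨁ k : {k : ℕ+ // Odd (k : ℕ)}, W k.1

/-- The algebra `S(V)[W] = S(V) ⊗ S(W_even) ⊗ ⋀ W_odd`. -/
abbrev SemiFreeAlg (V : Type u) [AddCommGroup V] [Module ℂ V]
    (W : ℕ+ → Type w) [∀ k, AddCommGroup (W k)] [∀ k, Module ℂ (W k)] : Type (max u w) :=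
  SymmetricAlgebra ℂ V ⊗[ℂ]
    (SymmetricAlgebra ℂ (EvenPart W) ⊗[ℂ] ExteriorAlgebra ℂ (OddPart W))

/-- `B` is, as a graded algebra, `S(V)[W]` with `V` in degree zero and `W_k` in degree `k`; the
maps `vmap` and `wmap k` are the inclusions of `V` and `W_k`. -/
structure IsSemiFree (𝓑 : ℕ → Submodule ℂ B) (vmap : V →ₗ[ℂ] B)
    (wmap : ∀ k, W k →ₗ[ℂ] B) : Prop where
  vmap_mem : ∀ v, vmap v ∈ 𝓑 0
  wmap_mem : ∀ (k : ℕ+) (w : W k), wmap k w ∈ 𝓑 k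
  exists_equiv : ∃ Ψ : SemiFreeAlg V W ≃ₐ[ℂ] B,
    (∀ v : V, Ψ (SymmetricAlgebra.ι ℂ V v ⊗ₜ (1 ⊗ₜ 1)) = vmap v) ∧
    (∀ (k : {k : ℕ+ // Even (k : ℕ)}) (w : W k.1),
      Ψ (1 ⊗ₜ (SymmetricAlgebra.ι ℂ (EvenPart W)
        (DirectSum.lof ℂ _ (fun k : {k : ℕ+ // Even (k : ℕ)} => W k.1) k w) ⊗ₜ 1)) =
          wmap k.1 w) ∧
    (∀ (k : {k : ℕ+ // Odd (k : ℕ)}) (w : W k.1),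
      Ψ (1 ⊗ₜ (1 ⊗ₜ ExteriorAlgebra.ι ℂ
        (DirectSum.lof ℂ _ (fun k : {k : ℕ+ // Odd (k : ℕ)} => W k.1) k w))) = wmap k.1 w)

/-- The map of DG algebras `π` from `(B, d)` to an algebra `A`, placed in degree zero with zero
differential, induces an isomorphism in homology. -/
structure IsResolution {A : Type w} [Ring A] [Algebra ℂ A]
    (𝓑 : ℕ → Submodule ℂ B) (d : B →ₗ[ℂ] B) (π : B →ₐ[ℂ] A) : Prop where
  map_pos : ∀ {k : ℕ} {b : B}, 0 < k → b ∈ 𝓑 k → π b = 0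
  map_d : ∀ b : B, π (d b) = 0
  exact_pos : ∀ {k : ℕ} {b : B}, 0 < k → b ∈ 𝓑 k → d b = 0 → ∃ c ∈ 𝓑 (k + 1), d c = b
  exact_zero : ∀ {b : B}, b ∈ 𝓑 0 → π b = 0 → ∃ c ∈ 𝓑 1, d c = b
  surjective : ∀ a : A, ∃ b ∈ 𝓑 0, π b = a

/-- `(B, d)`, as the semi-free extension `S(V)[W]` of `S(V)`, is a minimal model of the
commutative algebra `A = S(V)/I`, where `gen : V → A` is the canonical map: the quotient map
`S(V)[W] → S(V) → A` induces an isomorphism in homology, and the differential is decomposable,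
that is, `d W` lies in the span `S^{≥ 2}(V ⊕ W)` of the products of at least two elements
of `V ⊕ W`. -/
structure IsMinimalModel {A : Type*} [Ring A] [Algebra ℂ A] (gen : V →ₗ[ℂ] A)
    (𝓑 : ℕ → Submodule ℂ B) (d : B →ₗ[ℂ] B) (vmap : V →ₗ[ℂ] B)
    (wmap : ∀ k, W k →ₗ[ℂ] B) : Prop where
  isCDGA : IsCDGA 𝓑 d
  isSemiFree : IsSemiFree 𝓑 vmap wmap
  resolution : ∃ π : B →ₐ[ℂ] A, (∀ v, π (vmap v) = gen v) ∧ (∀ k w, π (wmap k w) = 0) ∧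
    IsResolution 𝓑 d π
  decomposable : ∀ (k : ℕ+) (w : W k), d (wmap k w) ∈
    ⨆ (n : ℕ) (_ : 2 ≤ n),
      (LinearMap.range vmap ⊔ ⨆ k, LinearMap.range (wmap k) : Submodule ℂ B) ^ n

end MinimalModel

section Generators

variable {L : Type v} [AddCommGroup L] [Module ℂ L] (G : GradedLieSuperalgebra L)

/-- The inclusion of `V = L_1^*` into `CE(L)`, through the identification of `L_1` with `V*`. -/
def CE.vmap {V : Type u} [AddCommGroup V] [Module ℂ V] {R : Submodule ℂ (V ⊗[ℂ] V)}
    (e : DualEnvIso G R) : V →ₗ[ℂ] CE G :=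
  CE.gen G 1 ∘ₗ e.degOne.symm.toLinearMap.dualMap ∘ₗ Module.Dual.eval ℂ V

/-- The inclusion of `W_k = L_{k+1}^*` into `CE(L)`. -/
def CE.wmap (k : ℕ+) : Module.Dual ℂ (G.comp ((k : ℕ) + 1)) →ₗ[ℂ] CE G :=
  CE.gen G ((k : ℕ) + 1)

end Generators

end KoszulCE

end

/-! The differential squares to zero by the Jacobi identity, it is quadratic on generators because
it is dual to a bracket, and freeness over `S(V)` follows from comparing universal properties. The
substance is that `CE(L) → A` is a quasi-isomorphism. This is obtained by comparing two complexes
with the same fibre.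

The fibre is `Cof`, the free graded-commutative algebra on a copy of `⨁ L_p^*` with the opposite
parities; it plays the role of the graded dual of `U(L) = A^!`. The algebra `Acyc`, which is `CE(L)
⊗ Cof` as a vector space, carries a differential extending that of `CE(L)` and a homotopy `h` such
that `dh + hd` is multiplication by the weight (`Acyc.d_h_add_h_d`). It is therefore acyclic in
positive weight. The quotient map `DualEnvIso.pi : CE(L) → A` kills boundaries (`DualEnvIso.pi_d`),
because `R^⊥⊥ = R` and the relations of `A^!` hold in `L`. Pushing the coefficients forward along it
turns `Acyc` into `A ⊗ Cof`, the Koszul complex of `A`, with differential `HomBasis.dK`.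

The complex `A ⊗ Cof` consists of free `A`-modules, and its differential has linear entries.
Contractions with elements of `L` and Cartan's formula make `Cof` a representation of `U(L)`
(`Acyc.rep`), and the differential of an element of `Cof` records the action of `L_1`. Exactness in
internal degree zero holds because `L` is generated by `L_1` (`HomBasis.lc_exact_zero`). In internal
degree one, a cycle is a cochain on `L_1` compatible with the relations of `A^!`; since `A^! =
U(L)`, it extends to a cocycle on all of `L` (`DualEnvIso.exists_cocycle`), and the homotopy makes
it a boundary (`HomBasis.lc_exact_one`). Koszulness propagates this to all internal degrees
(`IsLinearComplex.exact_of_isKoszul`): bar cohomology is `Ext^1` of iterated syzygies, dimension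
shifting along the complex confines the `Ext^1` of each module of cycles to one internal degree, and
the cycles are therefore generated in the lowest degree.

Let `K` be the kernel of `CE(L) → A`. Since `CE(L) ⊗ Cof` and `A ⊗ Cof` are both exact in positive
weight, so is `K ⊗ Cof`. Filtering by the weight of `Cof` and inducting on the total weight, the
cycles of `K` are boundaries of elements of `K` (`HomBasis.descend`, `CE.exists_primitive_of_mem`),
which is the claim on homology. -/

noncomputable section

namespace KoszulCE

universe u v w

set_option linter.unusedSectionVars false

/-! ### Gradings of algebras, encoded as coactions. -/

section Coaction

variable {C : Type u} [Ring C] [Algebra ℂ C] {Γ : Type} [AddCommMonoid Γ] [DecidableEq Γ]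

/-- A grading of the algebra `C` generated by the elements `g s`, with `g s` of degree `γ s`,
given by a homomorphism `C → C[Γ]` with `g s ↦ g s ⬝ t^(γ s)`. -/
structure Coaction {σ : Type v} (g : σ → C) (γ : σ → Γ) where
  /-- the coaction -/
  hom : C →ₐ[ℂ] AddMonoidAlgebra C Γ
  hom_gen : ∀ s, hom (g s) = AddMonoidAlgebra.single (γ s) (g s)
  adjoin_eq_top : Algebra.adjoin ℂ (Set.range g) = ⊤

namespace Coaction

variable {σ : Type v} {g : σ → C} {γ : σ → Γ} (Δ : Coaction g γ)

/-- The homogeneous component of degree `n`. -/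
def comp (n : Γ) : Submodule ℂ C where
  carrier := {c | Δ.hom c = AddMonoidAlgebra.single n c}
  add_mem' := by
    intro a b ha hb
    simp only [Set.mem_ofPred_eq] at *
    rw [map_add, ha, hb, AddMonoidAlgebra.single_add]
  zero_mem' := by simp
  smul_mem' := by
    intro c a ha
    simp only [Set.mem_ofPred_eq] at *
    rw [map_smul, ha, AddMonoidAlgebra.smul_single]

theorem mem_comp {n : Γ} {c : C} : c ∈ Δ.comp n ↔ Δ.hom c = AddMonoidAlgebra.single n c := Iff.rfl

theorem gen_mem (s : σ) : g s ∈ Δ.comp (γ s) := Δ.hom_gen s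

theorem one_mem : (1 : C) ∈ Δ.comp 0 := by
  rw [mem_comp, map_one]; rfl

theorem mul_mem {m n : Γ} {a b : C} (ha : a ∈ Δ.comp m) (hb : b ∈ Δ.comp n) :
    a * b ∈ Δ.comp (m + n) := by
  rw [mem_comp] at *
  rw [map_mul, ha, hb, AddMonoidAlgebra.single_mul_single]

/-- The projection to the component of degree `n`. -/
def proj (n : Γ) : C →ₗ[ℂ] C where
  toFun c := (Δ.hom c).coeff n
  map_add' a b := by simp
  map_smul' r a := by simp

theorem proj_of_mem {m : Γ} {c : C} (hc : c ∈ Δ.comp m) (n : Γ) :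
    Δ.proj n c = if m = n then c else 0 := by
  change (Δ.hom c).coeff n = _
  rw [Δ.mem_comp.1 hc, AddMonoidAlgebra.coeff_single, Finsupp.single_apply]

theorem proj_same {m : Γ} {c : C} (hc : c ∈ Δ.comp m) : Δ.proj m c = c := by
  simp [Δ.proj_of_mem hc]

/-- The sum of the subspaces `D n` is a unital subalgebra that contains all generators. -/
theorem iSup_eq_top_of_mul {D : Γ → Submodule ℂ C} (hone : (1 : C) ∈ D 0)
    (hgen : ∀ s, g s ∈ D (γ s))
    (hmul : ∀ m n, ∀ a ∈ D m, ∀ b ∈ D n, a * b ∈ D (m + n))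
    (htop : Algebra.adjoin ℂ (Set.range g) = ⊤) : iSup D = ⊤ := by
  rw [eq_top_iff]
  rintro c -
  have hc : c ∈ Algebra.adjoin ℂ (Set.range g) := by rw [htop]; trivial
  induction hc using Algebra.adjoin_induction with
  | mem x hx => obtain ⟨s, rfl⟩ := hx; exact Submodule.mem_iSup_of_mem _ (hgen s)
  | algebraMap r =>
    rw [Algebra.algebraMap_eq_smul_one]
    exact Submodule.smul_mem _ _ (Submodule.mem_iSup_of_mem _ hone)
  | add x y _ _ hx hy => exact Submodule.add_mem _ hx hy
  | mul x y _ _ hx hy =>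
    clear * - hx hy hmul
    induction hx using Submodule.iSup_induction' with
    | zero => simp
    | add a b _ _ ha hb => rw [add_mul]; exact Submodule.add_mem _ ha hb
    | mem m a ha =>
      induction hy using Submodule.iSup_induction' with
      | zero => simp
      | add b c _ _ hb hc => rw [mul_add]; exact Submodule.add_mem _ hb hc
      | mem n b hb => exact Submodule.mem_iSup_of_mem _ (hmul m n a ha b hb)

theorem iSup_comp : iSup Δ.comp = ⊤ :=
  iSup_eq_top_of_mul Δ.one_mem Δ.gen_mem (fun _ _ _ ha _ hb => Δ.mul_mem ha hb) Δ.adjoin_eq_top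

/-- A linear induction principle for the grading. -/
theorem induction_comp {p : C → Prop} (hadd : ∀ a b, p a → p b → p (a + b)) (h0 : p 0)
    (hcomp : ∀ n, ∀ a ∈ Δ.comp n, p a) (c : C) : p c := by
  have hc : c ∈ iSup Δ.comp := by rw [iSup_comp]; trivial
  induction hc using Submodule.iSup_induction' with
  | zero => exact h0
  | add a b _ _ ha hb => exact hadd a b ha hb
  | mem m a ha => exact hcomp m a ha

theorem proj_mem (n : Γ) (c : C) : Δ.proj n c ∈ Δ.comp n := by
  induction c using Δ.induction_comp with
  | h0 => simp
  | hadd a b ha hb => rw [map_add]; exact Submodule.add_mem _ ha hb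
  | hcomp m a ha =>
    rw [Δ.proj_of_mem ha]
    split_ifs with h
    · exact h ▸ ha
    · simp

/-- The coefficients of the coaction are projections that recover each component of a sum, which
gives directness; spanning comes from the generators. -/
theorem isInternal : DirectSum.IsInternal Δ.comp := by
  constructor
  · intro x x' hx
    have key : ∀ (y : ⨁ n, Δ.comp n) (n : Γ),
        Δ.proj n (DirectSum.coeAddMonoidHom Δ.comp y) = (y n : C) := by
      intro y n
      induction y using DirectSum.induction_on with
      | zero => simp
      | add a b ha hb => rw [map_add, map_add, ha, hb]; simp
      | of m c =>
        rw [DirectSum.coeAddMonoidHom_of, Δ.proj_of_mem c.2]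
        split_ifs with h
        · subst h; simp
        · rw [DirectSum.of_eq_of_ne _ _ _ (Ne.symm h)]; simp
    ext n
    rw [← key x n, hx, key x' n]
  · intro c
    induction c using Δ.induction_comp with
    | h0 => exact ⟨0, by simp⟩
    | hadd a b ha hb =>
      obtain ⟨x, rfl⟩ := ha
      obtain ⟨y, rfl⟩ := hb
      exact ⟨x + y, by simp⟩
    | hcomp m a ha => exact ⟨DirectSum.of (fun n => Δ.comp n) m ⟨a, ha⟩, by simp⟩

/-- Every element is the sum of finitely many of its components. -/
theorem exists_sum_proj (c : C) : ∃ s : Finset Γ, c = ∑ n ∈ s, Δ.proj n c := by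
  have key : ∃ s : Finset Γ, ∀ t, s ⊆ t → c = ∑ n ∈ t, Δ.proj n c := by
    induction c using Δ.induction_comp with
    | h0 => exact ⟨∅, by simp⟩
    | hadd a b ha hb =>
      obtain ⟨s, hs⟩ := ha
      obtain ⟨t, ht⟩ := hb
      refine ⟨s ∪ t, fun r hr => ?_⟩
      simp only [map_add, Finset.sum_add_distrib]
      rw [← hs r (Finset.union_subset_left hr), ← ht r (Finset.union_subset_right hr)]
    | hcomp m a ha =>
      refine ⟨{m}, fun t ht => ?_⟩
      simp [Δ.proj_of_mem ha, Finset.singleton_subset_iff.1 ht]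
  obtain ⟨s, hs⟩ := key
  exact ⟨s, hs s subset_rfl⟩

/-- Projecting a decomposition along `D` to degree `n` keeps only the summand in `D n`, so a smaller
family that still spans cannot be strictly smaller. This identifies the various explicit gradings
with those coming from coactions. -/
theorem eq_comp_of_le {D : Γ → Submodule ℂ C} (hle : ∀ n, D n ≤ Δ.comp n) (htop : iSup D = ⊤)
    (n : Γ) : D n = Δ.comp n := by
  refine le_antisymm (hle n) fun c hc => ?_
  have key : ∀ c : C, Δ.proj n c ∈ D n := by
    intro c
    have hc : c ∈ iSup D := by rw [htop]; trivial
    induction hc using Submodule.iSup_induction' with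
    | zero => simp
    | add a b _ _ ha hb => rw [map_add]; exact Submodule.add_mem _ ha hb
    | mem m a ha =>
      rw [Δ.proj_of_mem (hle m ha)]
      split_ifs with h
      · exact h ▸ ha
      · simp
  rw [← Δ.proj_same hc]
  exact key c

/-- Makes induction over words in the generators available for homogeneous elements. -/
theorem comp_eq_span (n : Γ) : Δ.comp n =
    Submodule.span ℂ {b | ∃ l : List σ, (l.map γ).sum = n ∧ b = (l.map g).prod} := by
  symm
  refine Δ.eq_comp_of_le
    (D := fun n => Submodule.span ℂ {b | ∃ l : List σ, (l.map γ).sum = n ∧ b = (l.map g).prod})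
    ?_ ?_ n
  · intro n
    rw [Submodule.span_le]
    rintro _ ⟨l, rfl, rfl⟩
    induction l with
    | nil => exact Δ.one_mem
    | cons a l ih =>
      simp only [List.map_cons, List.sum_cons, List.prod_cons]
      exact Δ.mul_mem (Δ.gen_mem a) ih
  · refine iSup_eq_top_of_mul (g := g) (γ := γ) ?_ ?_ ?_ Δ.adjoin_eq_top
    · exact Submodule.subset_span ⟨[], by simp⟩
    · exact fun s => Submodule.subset_span ⟨[s], by simp⟩
    · intro m n a ha b hb
      have := Submodule.mul_mem_mul ha hb
      rw [Submodule.span_mul_span] at this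
      refine Submodule.span_mono ?_ this
      rintro _ ⟨_, ⟨l, rfl, rfl⟩, _, ⟨l', rfl, rfl⟩, rfl⟩
      exact ⟨l ++ l', by simp, by simp⟩

theorem proj_add_mul_of_mem [IsCancelAdd Γ] {m : Γ} {x : C} (hx : x ∈ Δ.comp m)
    (n : Γ) (b : C) : Δ.proj (n + m) (b * x) = Δ.proj n b * x := by
  induction b using Δ.induction_comp with
  | h0 => simp
  | hadd a b ha hb => rw [add_mul, map_add, ha, hb, map_add, add_mul]
  | hcomp k a ha =>
    rw [Δ.proj_of_mem (Δ.mul_mem ha hx), Δ.proj_of_mem ha]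
    simp only [add_left_inj]
    split_ifs <;> simp

theorem proj_add_mul_of_mem_left [IsCancelAdd Γ] {m : Γ} {x : C} (hx : x ∈ Δ.comp m)
    (n : Γ) (b : C) : Δ.proj (m + n) (x * b) = x * Δ.proj n b := by
  induction b using Δ.induction_comp with
  | h0 => simp
  | hadd a b ha hb => rw [mul_add, map_add, ha, hb, map_add, mul_add]
  | hcomp k a ha =>
    rw [Δ.proj_of_mem (Δ.mul_mem hx ha), Δ.proj_of_mem ha]
    simp only [add_right_inj]
    split_ifs <;> simp

/-- A linear map that preserves all components commutes with the projections. -/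
theorem proj_comm {C' : Type w} [Ring C'] [Algebra ℂ C'] {σ' : Type*} {g' : σ' → C'} {γ' : σ' → Γ}
    (Δ' : Coaction g' γ') (f : C →ₗ[ℂ] C') (hf : ∀ n, ∀ c ∈ Δ.comp n, f c ∈ Δ'.comp n) (n : Γ)
    (c : C) : Δ'.proj n (f c) = f (Δ.proj n c) := by
  induction c using Δ.induction_comp with
  | h0 => simp
  | hadd a b ha hb => rw [map_add, map_add, ha, hb, map_add, map_add]
  | hcomp m a ha =>
    rw [Δ.proj_of_mem ha, Δ'.proj_of_mem (hf m a ha)]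
    split_ifs <;> simp

end Coaction

end Coaction

/-! ### Free graded-commutative algebras. -/

section FGC

variable {ι : Type} [DecidableEq ι] (pr : ι → ℕ) (P : ι → Type v) [∀ i, AddCommGroup (P i)]
  [∀ i, Module ℂ (P i)]

/-- Graded commutativity, for generators in `P i` of parity `pr i`. -/
inductive FGCRel : TensorAlgebra ℂ (⨁ i, P i) → TensorAlgebra ℂ (⨁ i, P i) → Prop
  | of (i j : ι) (x : P i) (y : P j) :
      FGCRel (TensorAlgebra.ι ℂ (DirectSum.lof ℂ ι P i x) *
          TensorAlgebra.ι ℂ (DirectSum.lof ℂ ι P j y))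
        ((-1 : ℂ) ^ (pr i * pr j) • (TensorAlgebra.ι ℂ (DirectSum.lof ℂ ι P j y) *
          TensorAlgebra.ι ℂ (DirectSum.lof ℂ ι P i x)))

/-- The free graded-commutative algebra on the spaces `P i`, of parity `pr i`. -/
def FGC : Type v := RingQuot (FGCRel pr P)

instance : Ring (FGC pr P) := inferInstanceAs (Ring (RingQuot (FGCRel pr P)))

instance : Algebra ℂ (FGC pr P) := inferInstanceAs (Algebra ℂ (RingQuot (FGCRel pr P)))

namespace FGC

variable {P}

/-- The inclusion of the generators. -/
def gen (i : ι) : P i →ₗ[ℂ] FGC pr P :=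
  (RingQuot.mkAlgHom ℂ (FGCRel pr P)).toLinearMap ∘ₗ TensorAlgebra.ι ℂ ∘ₗ DirectSum.lof ℂ ι P i

/-- The generators, as a family over a sigma type. -/
def sgen (s : Σ i, P i) : FGC pr P := gen pr s.1 s.2

theorem gen_mul_gen (i j : ι) (x : P i) (y : P j) :
    gen pr i x * gen pr j y = (-1 : ℂ) ^ (pr i * pr j) • (gen pr j y * gen pr i x) := by
  have h := RingQuot.mkAlgHom_rel ℂ (FGCRel.of (pr := pr) (P := P) i j x y)
  rw [map_smul, map_mul, map_mul] at h
  exact h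

/-- The universal property. -/
def lift {D : Type w} [Ring D] [Algebra ℂ D] (f : ∀ i, P i →ₗ[ℂ] D)
    (hf : ∀ i j x y, f i x * f j y = (-1 : ℂ) ^ (pr i * pr j) • (f j y * f i x)) :
    FGC pr P →ₐ[ℂ] D :=
  RingQuot.liftAlgHom ℂ ⟨TensorAlgebra.lift ℂ (DirectSum.toModule ℂ ι D f), by
    rintro _ _ ⟨i, j, x, y⟩
    simpa using hf i j x y⟩

@[simp]
theorem lift_gen {D : Type w} [Ring D] [Algebra ℂ D] (f : ∀ i, P i →ₗ[ℂ] D)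
    (hf : ∀ i j x y, f i x * f j y = (-1 : ℂ) ^ (pr i * pr j) • (f j y * f i x)) (i : ι) (x : P i) :
    lift pr f hf (gen pr i x) = f i x := by
  have : lift pr f hf (gen pr i x) =
      TensorAlgebra.lift ℂ (DirectSum.toModule ℂ ι D f)
        (TensorAlgebra.ι ℂ (DirectSum.lof ℂ ι P i x)) :=
    RingQuot.liftAlgHom_mkAlgHom_apply _ _ _ _
  rw [this]
  simp

theorem hom_ext {D : Type w} [Ring D] [Algebra ℂ D] {f f' : FGC pr P →ₐ[ℂ] D}
    (h : ∀ i x, f (gen pr i x) = f' (gen pr i x)) : f = f' := by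
  refine RingQuot.ringQuot_ext' ℂ _ _ (TensorAlgebra.hom_ext (DirectSum.linearMap_ext ℂ fun i => ?_))
  ext x
  exact h i x

/-- The universal property gives a map into the subalgebra spanned by the generators; followed by
the inclusion it fixes the generators, so it is the identity. -/
theorem adjoin_eq_top : Algebra.adjoin ℂ (Set.range (sgen pr (P := P))) = ⊤ := by
  set S := Algebra.adjoin ℂ (Set.range (sgen pr (P := P)))
  have hm : ∀ i x, gen pr i x ∈ S := fun i x => Algebra.subset_adjoin ⟨⟨i, x⟩, rfl⟩
  let f : FGC pr P →ₐ[ℂ] S := lift pr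
    (fun i => (gen pr i).codRestrict (Subalgebra.toSubmodule S) (hm i))
    (fun i j x y => Subtype.ext (gen_mul_gen pr i j x y))
  have hf : S.val.comp f = AlgHom.id ℂ _ := hom_ext pr fun i x => by simp only [f, AlgHom.comp_apply, lift_gen]; rfl
  rw [eq_top_iff]
  rintro c -
  have : S.val (f c) = c := DFunLike.congr_fun hf c
  rw [← this]
  exact (f c).2

/-- The grading with `P i` in degree `γ i`. -/
def coaction {Γ : Type} [AddCommMonoid Γ] (γ : ι → Γ) :
    Coaction (sgen pr (P := P)) (fun s => γ s.1) where
  hom := lift pr (fun i =>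
    { toFun := fun x => AddMonoidAlgebra.single (γ i) (gen pr i x)
      map_add' := by simp
      map_smul' := by simp }) (fun i j x y => by
      simp only [LinearMap.coe_mk, AddHom.coe_mk, AddMonoidAlgebra.single_mul_single,
        AddMonoidAlgebra.smul_single]
      rw [gen_mul_gen, add_comm])
  hom_gen s := by
    rw [sgen, lift_gen]; rfl
  adjoin_eq_top := adjoin_eq_top pr

end FGC

end FGC

/-! ### The universal property of `CE(L)` and its gradings. -/

section CELift

variable {L : Type v} [AddCommGroup L] [Module ℂ L] (G : GradedLieSuperalgebra L)

/-- The generators of `CE(L)`, as a family over a sigma type. -/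
def CE.sgen (s : Σ p : ℕ, Module.Dual ℂ (G.comp p)) : CE G := CE.gen G s.1 s.2

/-- The universal property of `CE(L)`. -/
def CE.lift {D : Type w} [Semiring D] [Algebra ℂ D] (f : ∀ p, Module.Dual ℂ (G.comp p) →ₗ[ℂ] D)
    (hf : ∀ p q x y, f p x * f q y = (-1 : ℂ) ^ ((p + 1) * (q + 1)) • (f q y * f p x)) :
    CE G →ₐ[ℂ] D :=
  RingQuot.liftAlgHom ℂ ⟨TensorAlgebra.lift ℂ (DirectSum.toModule ℂ ℕ D f), by
    rintro _ _ ⟨i, j, x, y⟩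
    simpa [preGen] using hf i j x y⟩

@[simp]
theorem CE.lift_gen {D : Type w} [Semiring D] [Algebra ℂ D]
    (f : ∀ p, Module.Dual ℂ (G.comp p) →ₗ[ℂ] D)
    (hf : ∀ p q x y, f p x * f q y = (-1 : ℂ) ^ ((p + 1) * (q + 1)) • (f q y * f p x))
    (p : ℕ) (x : Module.Dual ℂ (G.comp p)) :
    CE.lift G f hf (CE.gen G p x) = f p x := by
  have : CE.lift G f hf (CE.gen G p x) =
      TensorAlgebra.lift ℂ (DirectSum.toModule ℂ ℕ D f) (preGen G p x) :=
    RingQuot.liftAlgHom_mkAlgHom_apply _ _ _ _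
  rw [this]
  simp [preGen]

theorem CE.hom_ext {D : Type w} [Semiring D] [Algebra ℂ D] {f f' : CE G →ₐ[ℂ] D}
    (h : ∀ p x, f (CE.gen G p x) = f' (CE.gen G p x)) : f = f' := by
  refine RingQuot.ringQuot_ext' ℂ _ _ (TensorAlgebra.hom_ext (DirectSum.linearMap_ext ℂ fun i => ?_))
  ext x
  exact h i x

theorem CE.adjoin_eq_top : Algebra.adjoin ℂ (Set.range (CE.sgen G)) = ⊤ := by
  set S := Algebra.adjoin ℂ (Set.range (CE.sgen G))
  have hm : ∀ p x, CE.gen G p x ∈ S := fun i x => Algebra.subset_adjoin ⟨⟨i, x⟩, rfl⟩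
  let f : CE G →ₐ[ℂ] S := CE.lift G
    (fun i => (CE.gen G i).codRestrict (Subalgebra.toSubmodule S) (hm i))
    (fun i j x y => Subtype.ext (CE.gen_mul_gen G i j x y))
  have hf : S.val.comp f = AlgHom.id ℂ _ := CE.hom_ext G fun i x => by
    simp only [f, AlgHom.comp_apply, CE.lift_gen]; rfl
  rw [eq_top_iff]
  rintro c -
  have : S.val (f c) = c := DFunLike.congr_fun hf c
  rw [← this]
  exact (f c).2

/-- The grading of `CE(L)` with `L_p^*` in degree `γ p`. -/
def CE.coaction {Γ : Type} [AddCommMonoid Γ] (γ : ℕ → Γ) :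
    Coaction (CE.sgen G) (fun s => γ s.1) where
  hom := CE.lift G (fun i =>
    { toFun := fun x => AddMonoidAlgebra.single (γ i) (CE.gen G i x)
      map_add' := by simp
      map_smul' := by simp }) (fun i j x y => by
      simp only [LinearMap.coe_mk, AddHom.coe_mk, AddMonoidAlgebra.single_mul_single,
        AddMonoidAlgebra.smul_single]
      rw [CE.gen_mul_gen, add_comm])
  hom_gen s := by
    rw [CE.sgen, CE.lift_gen]; rfl
  adjoin_eq_top := CE.adjoin_eq_top G

end CELift

/-! ### Quadratic algebras: universal property, grading, augmentation. -/

section QuadAlgBasic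

variable {V : Type u} [AddCommGroup V] [Module ℂ V] (R : Submodule ℂ (V ⊗[ℂ] V))

namespace QuadAlg

/-- The universal property of `T(V)/(R)`. -/
def lift {D : Type w} [Ring D] [Algebra ℂ D] (f : V →ₗ[ℂ] D)
    (hf : ∀ t ∈ R, LinearMap.mul' ℂ D (TensorProduct.map f f t) = 0) : QuadAlg R →ₐ[ℂ] D :=
  RingQuot.liftAlgHom ℂ ⟨TensorAlgebra.lift ℂ f, by
    rintro _ _ ⟨t, ht⟩
    rw [map_zero, ← hf t ht]
    induction t using TensorProduct.induction_on with
    | zero => simp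
    | tmul x y => simp [tensorSq]
    | add x y hx hy =>
      have : ∀ t : V ⊗[ℂ] V, TensorAlgebra.lift ℂ f (tensorSq V t) =
          LinearMap.mul' ℂ D (TensorProduct.map f f t) := by
        intro t
        induction t using TensorProduct.induction_on with
        | zero => simp
        | tmul x y => simp [tensorSq]
        | add x y hx hy => simp only [map_add, hx, hy]
      exact this _⟩

@[simp]
theorem lift_gen {D : Type w} [Ring D] [Algebra ℂ D] (f : V →ₗ[ℂ] D)
    (hf : ∀ t ∈ R, LinearMap.mul' ℂ D (TensorProduct.map f f t) = 0) (x : V) :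
    lift R f hf (gen R x) = f x := by
  have : lift R f hf (gen R x) = TensorAlgebra.lift ℂ f (TensorAlgebra.ι ℂ x) :=
    RingQuot.liftAlgHom_mkAlgHom_apply _ _ _ _
  rw [this]
  simp

theorem hom_ext {D : Type w} [Ring D] [Algebra ℂ D] {f f' : QuadAlg R →ₐ[ℂ] D}
    (h : ∀ x, f (gen R x) = f' (gen R x)) : f = f' := by
  refine RingQuot.ringQuot_ext' ℂ _ _ (TensorAlgebra.hom_ext ?_)
  ext x
  exact h x

/-- The image of `V ⊗ V` in `T(V)/(R)`. -/
theorem mul_map_gen_eq_zero {t : V ⊗[ℂ] V} (ht : t ∈ R) :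
    LinearMap.mul' ℂ (QuadAlg R) (TensorProduct.map (gen R) (gen R) t) = 0 := by
  have h := RingQuot.mkAlgHom_rel ℂ (QuadRel.of (R := R) t ht)
  rw [map_zero] at h
  refine Eq.trans ?_ h
  clear h ht
  induction t using TensorProduct.induction_on with
  | zero => simp; rfl
  | tmul x y =>
    simp only [TensorProduct.map_tmul, LinearMap.mul'_apply, tensorSq, LinearMap.comp_apply]
    rw [map_mul]
    rfl
  | add x y hx hy => simp only [map_add, hx, hy]; rfl

theorem adjoin_eq_top : Algebra.adjoin ℂ (Set.range (gen R)) = ⊤ := by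
  set S := Algebra.adjoin ℂ (Set.range (gen R))
  have hm : ∀ x, gen R x ∈ S := fun x => Algebra.subset_adjoin ⟨x, rfl⟩
  let f : QuadAlg R →ₐ[ℂ] S := lift R
    ((gen R).codRestrict (Subalgebra.toSubmodule S) hm) (by
      intro t ht
      apply Subtype.ext
      refine Eq.trans ?_ (mul_map_gen_eq_zero R ht)
      clear ht
      induction t using TensorProduct.induction_on with
      | zero => simp
      | tmul x y => rfl
      | add x y hx hy => simp only [map_add, ← hx, ← hy]; rfl)
  have hf : S.val.comp f = AlgHom.id ℂ _ := hom_ext R fun x => by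
    simp only [f, AlgHom.comp_apply, lift_gen]; rfl
  rw [eq_top_iff]
  rintro c -
  have : S.val (f c) = c := DFunLike.congr_fun hf c
  rw [← this]
  exact (f c).2

theorem induction_gen {p : QuadAlg R → Prop} (hadd : ∀ a b, p a → p b → p (a + b))
    (hmap : ∀ r : ℂ, p (algebraMap ℂ _ r)) (hgen : ∀ x, p (gen R x))
    (hmul : ∀ a b, p a → p b → p (a * b)) (c : QuadAlg R) : p c := by
  have hc : c ∈ Algebra.adjoin ℂ (Set.range (gen R)) := by rw [adjoin_eq_top]; trivial
  induction hc using Algebra.adjoin_induction with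
  | mem x hx => obtain ⟨s, rfl⟩ := hx; exact hgen s
  | algebraMap r => exact hmap r
  | add x y _ _ hx hy => exact hadd x y hx hy
  | mul x y _ _ hx hy => exact hmul x y hx hy

/-- The grading of `T(V)/(R)`. -/
def coaction {Γ : Type} [AddCommMonoid Γ] (γ : Γ) : Coaction (gen R) (fun _ => γ) where
  hom := lift R
    { toFun := fun x => AddMonoidAlgebra.single γ (gen R x)
      map_add' := by simp
      map_smul' := by simp } (by
      have key : ∀ t : V ⊗[ℂ] V, LinearMap.mul' ℂ _ (TensorProduct.map
          (({ toFun := fun x => AddMonoidAlgebra.single γ (gen R x)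
              map_add' := by simp
              map_smul' := by simp } : V →ₗ[ℂ] AddMonoidAlgebra (QuadAlg R) Γ)) (
            { toFun := fun x => AddMonoidAlgebra.single γ (gen R x)
              map_add' := by simp
              map_smul' := by simp } : V →ₗ[ℂ] AddMonoidAlgebra (QuadAlg R) Γ) t) =
          AddMonoidAlgebra.single (γ + γ)
            (LinearMap.mul' ℂ (QuadAlg R) (TensorProduct.map (gen R) (gen R) t)) := by
        intro t
        induction t using TensorProduct.induction_on with
        | zero => simp
        | tmul x y => simp [AddMonoidAlgebra.single_mul_single]
        | add x y hx hy => simp only [map_add, hx, hy, AddMonoidAlgebra.single_add]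
      intro t ht
      rw [key, mul_map_gen_eq_zero R ht, AddMonoidAlgebra.single_zero])
  hom_gen s := by rw [lift_gen]; rfl
  adjoin_eq_top := adjoin_eq_top R

/-- Makes the projections of the coaction available for the grading by powers of the space of
generators. -/
theorem comp_coaction_eq_deg (n : ℕ) : (coaction R (1 : ℕ)).comp n = deg R n := by
  symm
  refine (coaction R (1 : ℕ)).eq_comp_of_le ?_ ?_ n
  · intro n
    induction n with
    | zero =>
      rw [deg, pow_zero, Submodule.one_le]
      exact (coaction R (1 : ℕ)).one_mem
    | succ n ih =>
      rw [deg, pow_succ, Submodule.mul_le]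
      intro a ha b hb
      obtain ⟨x, rfl⟩ := hb
      exact (coaction R (1 : ℕ)).mul_mem (ih ha) ((coaction R (1 : ℕ)).gen_mem x)
  · refine Coaction.iSup_eq_top_of_mul (g := gen R) (γ := fun _ => 1) ?_ ?_ ?_ (adjoin_eq_top R)
    · rw [deg, pow_zero]; exact Submodule.one_le.1 le_rfl
    · intro s; rw [deg, pow_one]; exact ⟨s, rfl⟩
    · intro m n a ha b hb
      rw [deg, pow_add]
      exact Submodule.mul_mem_mul ha hb

theorem gen_mem_deg (x : V) : gen R x ∈ deg R 1 := by
  rw [deg, pow_one]; exact ⟨x, rfl⟩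

theorem mul_mem_deg {m n : ℕ} {a b : QuadAlg R} (ha : a ∈ deg R m) (hb : b ∈ deg R n) :
    a * b ∈ deg R (m + n) := by
  rw [deg, pow_add]
  exact Submodule.mul_mem_mul ha hb

/-- The augmentation. -/
def eps : QuadAlg R →ₐ[ℂ] ℂ := lift R 0 (by simp)

theorem eps_gen (x : V) : eps R (gen R x) = 0 := by simp [eps]

theorem eps_deg {n : ℕ} (hn : 0 < n) {a : QuadAlg R} (ha : a ∈ deg R n) : eps R a = 0 := by
  obtain ⟨n, rfl⟩ : ∃ m, n = m + 1 := ⟨n - 1, by omega⟩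
  rw [deg, pow_succ] at ha
  induction ha using Submodule.mul_induction_on' with
  | mem_mul_mem a _ b hb =>
    obtain ⟨x, rfl⟩ := hb
    rw [map_mul, eps_gen, mul_zero]
  | add x _ y _ hx hy => rw [map_add, hx, hy, add_zero]

theorem eq_smul_one_of_mem_deg_zero {a : QuadAlg R} (ha : a ∈ deg R 0) : a = eps R a • 1 := by
  rw [deg, pow_zero, Submodule.mem_one] at ha
  obtain ⟨c, rfl⟩ := ha
  rw [AlgHom.commutes, Algebra.algebraMap_eq_smul_one]
  rfl

theorem sub_eps_mem_aug (a : QuadAlg R) : a - algebraMap ℂ _ (eps R a) ∈ aug R := by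
  induction a using induction_gen with
  | hadd a b ha hb =>
    convert add_mem ha hb using 1
    rw [map_add, map_add]; abel
  | hmap r => simp [zero_mem]
  | hgen x =>
    rw [eps_gen, map_zero, sub_zero]
    exact NonUnitalAlgebra.subset_adjoin _ ⟨x, rfl⟩
  | hmul a b ha hb =>
    have e : a * b - algebraMap ℂ _ (eps R (a * b)) =
        (a - algebraMap ℂ _ (eps R a)) * (b - algebraMap ℂ _ (eps R b)) +
        (eps R a • (b - algebraMap ℂ _ (eps R b)) + eps R b • (a - algebraMap ℂ _ (eps R a))) := by
      simp only [Algebra.algebraMap_eq_smul_one, map_mul, mul_sub, sub_mul, smul_sub,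
        smul_mul_assoc, mul_smul_comm, one_mul, mul_one, smul_smul, mul_comm (eps R b)]
      abel
    rw [e]
    exact add_mem (mul_mem ha hb) (add_mem (SMulMemClass.smul_mem _ hb) (SMulMemClass.smul_mem _ ha))

/-- The non-unital subalgebra generated by `V` is the kernel of the augmentation, because `a - ε(a)`
always lies in it. -/
theorem mem_aug {a : QuadAlg R} : a ∈ aug R ↔ eps R a = 0 := by
  constructor
  · intro ha
    induction ha using NonUnitalAlgebra.adjoin_induction with
    | mem x hx => obtain ⟨v, rfl⟩ := hx; exact eps_gen R v
    | zero => simp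
    | add x y _ _ hx hy => rw [map_add, hx, hy, add_zero]
    | mul x y _ _ hx hy => rw [map_mul, hx, zero_mul]
    | smul r x _ hx => rw [map_smul, hx, smul_zero]
  · intro ha
    have := sub_eps_mem_aug R a
    rwa [ha, map_zero, sub_zero] at this

instance : Nontrivial (QuadAlg R) := (eps R).toRingHom.domain_nontrivial

/-- A representation that detects the components of degree one and two: `V` acts on `ℂ ⊕ V ⊕ ℂ`
by `v ⬝ (c, u, k) = (0, c v, l (v ⊗ u))`. -/
def detectGen (l : Module.Dual ℂ (V ⊗[ℂ] V)) : V →ₗ[ℂ] Module.End ℂ (ℂ × V × ℂ) :=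
  LinearMap.mk₂ ℂ (fun v x => (0, x.1 • v, l (v ⊗ₜ x.2.1)))
    (fun a b c => by simp [TensorProduct.add_tmul]) (fun r a b => by
      simp [smul_comm r, ← TensorProduct.smul_tmul'])
    (fun a b c => by simp [add_smul, TensorProduct.tmul_add])
    (fun r a b => by simp [smul_smul])

/-- Two generators in succession carry the first summand to the last through the form `l`. Hence the
representation descends to `T(V)/(R)` exactly when `l` kills `R`. -/
theorem mul_map_detectGen (l : Module.Dual ℂ (V ⊗[ℂ] V)) (t : V ⊗[ℂ] V) (x : ℂ × V × ℂ) :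
    LinearMap.mul' ℂ _ (TensorProduct.map (detectGen l) (detectGen l) t) x =
      (0, 0, x.1 * l t) := by
  induction t using TensorProduct.induction_on with
  | zero => simp [Prod.zero_eq_mk]
  | tmul a b => simp [detectGen, LinearMap.mul'_apply]
  | add a b ha hb => simp only [map_add, LinearMap.add_apply, ha, hb]; simp [mul_add]

theorem gen_injective : Function.Injective (gen R) := by
  rw [injective_iff_map_eq_zero]
  intro v hv
  have h := lift_gen R (detectGen (0 : Module.Dual ℂ (V ⊗[ℂ] V)))
    (fun t _ => LinearMap.ext fun x => by rw [mul_map_detectGen]; simp) v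
  rw [hv, map_zero] at h
  have := congrArg (fun f => (f (1, 0, 0)).2.1) h
  simpa [detectGen] using this.symm

end QuadAlg

end QuadAlgBasic

/-! ### Syzygies, `Ext^1` and dimension shifting over a non-unital algebra. -/

section Syzygy

variable {I : Type u} [NonUnitalRing I] [Module ℂ I] [IsScalarTower ℂ I I] [SMulCommClass ℂ I I]

variable (I) in
/-- A multiplicative family of subspaces of `I`, which plays the role of a grading. -/
structure NonUnitalGrading where
  /-- the component of degree `n` -/
  deg : ℕ → Submodule ℂ I
  mul_mem : ∀ {m n a b}, a ∈ deg m → b ∈ deg n → a * b ∈ deg (m + n)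

variable (R : NonUnitalGrading I)

/-- A module over the non-unital algebra `I`, with a family of subspaces that plays the role of a
grading; `R` is the grading of `I`. -/
structure AugMod where
  /-- the underlying space -/
  carrier : Type (max u w)
  [grp : AddCommGroup carrier]
  [mod : Module ℂ carrier]
  /-- the action -/
  act : I →ₗ[ℂ] carrier →ₗ[ℂ] carrier
  act_mul : ∀ a b x, act (a * b) x = act a (act b x)
  /-- the component of degree `n` -/
  deg : ℕ → Submodule ℂ carrier
  act_deg : ∀ {m n a x}, a ∈ R.deg m → x ∈ deg n → act a x ∈ deg (m + n)

attribute [instance] AugMod.grp AugMod.mod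

namespace AugMod

variable {R}

/-- A functional of degree `j`. -/
def HasDeg (X : AugMod.{u, w} R) (f : Module.Dual ℂ X.carrier) (j : ℕ) : Prop :=
  ∀ k, k ≠ j → ∀ x ∈ X.deg k, f x = 0

/-- The kernel of `A ⊗ X → X`, identified with `A_+ ⊗ X`, with the action
`a ⬝ (b ⊗ x) = a b ⊗ x - a ⊗ b x`. -/
abbrev omega (X : AugMod.{u, w} R) : AugMod.{u, w} R where
  carrier := I ⊗[ℂ] X.carrier
  act :=
    { toFun := fun a => (LinearMap.mulLeft ℂ a).rTensor X.carrier -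
        (TensorProduct.mk ℂ _ X.carrier a) ∘ₗ TensorProduct.lift X.act
      map_add' := fun a b => by
        ext x y
        simp [add_mul, TensorProduct.add_tmul]
        abel
      map_smul' := fun c a => by
        ext x y
        simp [TensorProduct.smul_tmul', smul_sub, smul_mul_assoc] }
  act_mul a b x := by
    induction x using TensorProduct.induction_on with
    | zero => simp
    | tmul c x => simp [X.act_mul]
    | add x y hx hy => rw [map_add, hx, hy, map_add, map_add]
  deg n := Submodule.span ℂ {t | ∃ k l, k + l = n ∧ ∃ a : I,
    a ∈ R.deg k ∧ ∃ x ∈ X.deg l, t = a ⊗ₜ x}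
  act_deg {m n a t} ha ht := by
    induction ht using Submodule.span_induction with
    | zero => simp
    | add x y _ _ hx hy => rw [map_add]; exact Submodule.add_mem _ hx hy
    | smul c x _ hx => rw [map_smul]; exact Submodule.smul_mem _ _ hx
    | mem x hx =>
      obtain ⟨k, l, rfl, b, hb, x, hx, rfl⟩ := hx
      refine Submodule.sub_mem _ (Submodule.subset_span ⟨m + k, l, by ring, a * b,
        R.mul_mem ha hb, x, hx, rfl⟩) (Submodule.subset_span ⟨m, k + l, rfl, a, ha, X.act b x,
        X.act_deg hb hx, rfl⟩)

theorem omega_act_tmul (X : AugMod.{u, w} R) (a b : I) (x : X.carrier) :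
    X.omega.act a (b ⊗ₜ[ℂ] x : I ⊗[ℂ] X.carrier) =
      ((a * b) ⊗ₜ[ℂ] x - a ⊗ₜ[ℂ] X.act b x : I ⊗[ℂ] X.carrier) := by
  rfl

/-- `Ext^1(X, ℂ)` vanishes in internal degree `j`. -/
def ExtOne (X : AugMod.{u, w} R) (j : ℕ) : Prop :=
  ∀ f : Module.Dual ℂ X.omega.carrier, X.omega.HasDeg f j → (∀ a t, f (X.omega.act a t) = 0) →
    ∃ g : Module.Dual ℂ X.carrier, X.HasDeg g j ∧
      ∀ (a : I) (x : X.carrier),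
        f (a ⊗ₜ[ℂ] x : I ⊗[ℂ] X.carrier) = g (X.act a x)

/-- A short exact sequence `0 → Z → F → X → 0` with a splitting `s`, `r`, and with a contraction
`κ` of `F`, all homogeneous. -/
structure SplitSeq (Z F X : AugMod.{u, w} R) where
  /-- the inclusion -/
  i : Z.carrier →ₗ[ℂ] F.carrier
  /-- the projection -/
  p : F.carrier →ₗ[ℂ] X.carrier
  /-- the section -/
  s : X.carrier →ₗ[ℂ] F.carrier
  /-- the retraction -/
  r : F.carrier →ₗ[ℂ] Z.carrier
  /-- the contraction -/
  κ : F.carrier →ₗ[ℂ] F.omega.carrier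
  i_act : ∀ a z, i (Z.act a z) = F.act a (i z)
  p_act : ∀ a y, p (F.act a y) = X.act a (p y)
  p_s : ∀ x, p (s x) = x
  r_i : ∀ z, r (i z) = z
  split : ∀ y, i (r y) + s (p y) = y
  κ_act : ∀ (b : I) (y : F.carrier), κ (F.act b y) =
    (b ⊗ₜ[ℂ] y : I ⊗[ℂ] F.carrier) + F.omega.act b (κ y)
  i_deg : ∀ n, ∀ z ∈ Z.deg n, i z ∈ F.deg n
  p_deg : ∀ n, ∀ y ∈ F.deg n, p y ∈ X.deg n
  s_deg : ∀ n, ∀ x ∈ X.deg n, s x ∈ F.deg n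
  r_deg : ∀ n, ∀ y ∈ F.deg n, r y ∈ Z.deg n
  κ_deg : ∀ n, ∀ y ∈ F.deg n, κ y ∈ F.omega.deg n

namespace SplitSeq

variable {Z F X : AugMod.{u, w} R} (Q : SplitSeq Z F X)

theorem p_i (z : Z.carrier) : Q.p (Q.i z) = 0 := by
  have h := Q.split (Q.i z)
  rw [Q.r_i, add_eq_left] at h
  rw [← Q.p_s (Q.p (Q.i z)), h, map_zero]

theorem lTensor_deg {X Y : AugMod.{u, w} R} (f : X.carrier →ₗ[ℂ] Y.carrier)
    (hf : ∀ n, ∀ x ∈ X.deg n, f x ∈ Y.deg n) (n : ℕ) (t : X.omega.carrier)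
    (ht : t ∈ X.omega.deg n) : f.lTensor I t ∈ Y.omega.deg n := by
  change t ∈ Submodule.comap (f.lTensor I) (Y.omega.deg n)
  refine Submodule.span_le.2 ?_ ht
  rintro _ ⟨k, l, hkl, a, ha, x, hx, rfl⟩
  exact Submodule.subset_span ⟨k, l, hkl, a, ha, f x, hf l x hx, by simp⟩

theorem lTensor_act {X Y : AugMod.{u, w} R} (f : X.carrier →ₗ[ℂ] Y.carrier)
    (hf : ∀ a x, f (X.act a x) = Y.act a (f x)) (a : I) (t : X.omega.carrier) :
    f.lTensor I (X.omega.act a t) =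
      Y.omega.act a (f.lTensor I t) := by
  induction t using TensorProduct.induction_on with
  | zero => simp
  | tmul b x =>
    rw [omega_act_tmul, map_sub, LinearMap.lTensor_tmul, LinearMap.lTensor_tmul,
      LinearMap.lTensor_tmul, omega_act_tmul, hf]
  | add x y hx hy => rw [map_add, map_add, hx, hy, map_add, map_add]

/-- The sequence `0 → ΩZ → ΩF → ΩX → 0`. -/
def omega : SplitSeq Z.omega F.omega X.omega where
  i := Q.i.lTensor _
  p := Q.p.lTensor _
  s := Q.s.lTensor _
  r := Q.r.lTensor _
  -- The sign compensates the minus sign in `a ⬝ (b ⊗ x) = a b ⊗ x - a ⊗ b x`; with it the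
  -- contraction identity passes from `F` to its syzygy.
  κ := -(Q.κ.lTensor I)
  i_act := lTensor_act _ Q.i_act
  p_act := lTensor_act _ Q.p_act
  p_s x := by
    rw [← LinearMap.comp_apply, ← LinearMap.lTensor_comp,
      show Q.p ∘ₗ Q.s = LinearMap.id from LinearMap.ext Q.p_s, LinearMap.lTensor_id]
    rfl
  r_i x := by
    rw [← LinearMap.comp_apply, ← LinearMap.lTensor_comp,
      show Q.r ∘ₗ Q.i = LinearMap.id from LinearMap.ext Q.r_i, LinearMap.lTensor_id]
    rfl
  split y := by
    rw [← LinearMap.comp_apply, ← LinearMap.lTensor_comp, ← LinearMap.comp_apply,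
      ← LinearMap.lTensor_comp, ← LinearMap.add_apply, ← LinearMap.lTensor_add,
      show Q.i ∘ₗ Q.r + Q.s ∘ₗ Q.p = LinearMap.id from LinearMap.ext Q.split, LinearMap.lTensor_id]
    rfl
  κ_act b y := by
    induction y using TensorProduct.induction_on with
    | zero => simp
    | tmul a x =>
      rw [omega_act_tmul, map_sub, LinearMap.neg_apply, LinearMap.neg_apply, LinearMap.neg_apply,
        LinearMap.lTensor_tmul, LinearMap.lTensor_tmul, LinearMap.lTensor_tmul, map_neg,
        omega_act_tmul, Q.κ_act, TensorProduct.tmul_add]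
      abel
    | add x y hx hy =>
      rw [map_add, map_add, hx, hy, map_add, map_add, TensorProduct.tmul_add]
      abel
  i_deg := lTensor_deg _ Q.i_deg
  p_deg := lTensor_deg _ Q.p_deg
  s_deg := lTensor_deg _ Q.s_deg
  r_deg := lTensor_deg _ Q.r_deg
  κ_deg n y hy := by
    rw [LinearMap.neg_apply]
    exact Submodule.neg_mem _ (lTensor_deg _ Q.κ_deg n y hy)

/-- Dimension shifting. -/
theorem extOne_of_omega (Q : SplitSeq Z F X) {j : ℕ} (h : X.omega.ExtOne j) : Z.ExtOne j := by
  intro f hf hcoc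
  -- The cocycle on the syzygy of `Z` is extended by the retraction. The extension need not be a
  -- cocycle, but its failure `f' (a t)` depends only on the image of `t` in the syzygy of `X`
  -- (`hker`).
  let f' : Module.Dual ℂ F.omega.carrier := f ∘ₗ Q.r.lTensor I
  have hfi : ∀ t : Z.omega.carrier, f' (Q.i.lTensor I t) = f t := by
    intro t
    exact congrArg f (Q.omega.r_i t)
  have hvan : ∀ a t, f' (F.omega.act a (Q.i.lTensor I t)) = 0 := by
    intro a t
    rw [← lTensor_act _ Q.i_act, hfi, hcoc]
  have hsub : ∀ t : F.omega.carrier,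
      Q.i.lTensor I (Q.r.lTensor I t) =
      t - Q.s.lTensor I (Q.p.lTensor I t) := fun t =>
    eq_sub_of_add_eq (Q.omega.split t)
  have hker : ∀ a t, Q.p.lTensor I t = 0 → f' (F.omega.act a t) = 0 := by
    intro a t ht
    have := hvan a (Q.r.lTensor I t)
    rwa [hsub t, ht, map_zero, sub_zero] at this
  -- The failure of `f'` to be a cocycle is itself a cocycle, one syzygy higher on `X`. The
  -- hypothesis on `X.omega` writes it as the coboundary of `h'`.
  let f'' : Module.Dual ℂ X.omega.omega.carrier := TensorProduct.lift
    { toFun := fun a => f' ∘ₗ F.omega.act a ∘ₗ Q.s.lTensor I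
      map_add' := fun a b => LinearMap.ext fun t => by
        simp only [map_add, LinearMap.comp_apply, LinearMap.add_apply]
      map_smul' := fun c a => by ext; simp }
  have hf'' : ∀ (a : I) (t : X.omega.carrier),
      f'' (a ⊗ₜ[ℂ] t : I ⊗[ℂ] X.omega.carrier) =
        f' (F.omega.act a (Q.s.lTensor I t)) := fun a t => by simp [f'']
  have hps : ∀ t : X.omega.carrier, Q.p.lTensor I (Q.s.lTensor I t) = t := Q.omega.p_s
  have hf'deg : F.omega.HasDeg f' j := fun k hk t ht => hf k hk _ (lTensor_deg _ Q.r_deg k t ht)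
  obtain ⟨h', h'deg, hh'⟩ := h f'' (by
    intro k hk t ht
    induction ht using Submodule.span_induction with
    | zero => simp
    | add x y _ _ hx hy => rw [map_add, hx, hy, add_zero]
    | smul c x _ hx => rw [map_smul, hx, smul_zero]
    | mem x hx =>
      obtain ⟨m, l, rfl, a, ha, t, ht, rfl⟩ := hx
      rw [hf'']
      exact hf'deg _ hk _ (F.omega.act_deg ha (lTensor_deg _ Q.s_deg l t ht))) (by
    intro a t
    induction t using TensorProduct.induction_on with
    | zero => simp
    | add x y hx hy => rw [map_add, map_add, hx, hy, add_zero]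
    | tmul b t =>
      rw [omega_act_tmul, map_sub, hf'', hf'', F.omega.act_mul, ← map_sub, ← map_sub]
      refine hker _ _ ?_
      rw [map_sub, lTensor_act _ Q.p_act, hps, hps, sub_self])
  -- Subtracting the pullback of `h'` corrects `f'` to a genuine cocycle on the syzygy of `F`.
  let k : Module.Dual ℂ F.omega.carrier := f' - h' ∘ₗ Q.p.lTensor I
  have hk : ∀ a t, k (F.omega.act a t) = 0 := by
    intro a t
    change f' _ - h' (Q.p.lTensor I (F.omega.act a t)) = 0
    rw [lTensor_act _ Q.p_act, ← hh', hf'', ← map_sub, ← map_sub]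
    refine hker _ _ ?_
    rw [map_sub, hps, sub_self]
  -- The contraction trivializes cocycles on `F`: applying `k` to `κ (a y) = a ⊗ y + a κ(y)` kills
  -- the last term. The primitive on `Z` is the restriction of `k ∘ κ`, since the correction term
  -- vanishes on `Z`.
  refine ⟨k ∘ₗ Q.κ ∘ₗ Q.i, ?_, ?_⟩
  · intro n hn z hz
    have h1 := Q.κ_deg n _ (Q.i_deg n z hz)
    change f' (Q.κ (Q.i z)) - h' (Q.p.lTensor I (Q.κ (Q.i z))) = 0
    rw [hf'deg n hn _ h1, h'deg n hn _ (lTensor_deg _ Q.p_deg n _ h1), sub_zero]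
  · intro a z
    change _ = k (Q.κ (Q.i (Z.act a z)))
    rw [Q.i_act, Q.κ_act, map_add, hk, add_zero]
    change _ = f' (a ⊗ₜ[ℂ] Q.i z) - h' (Q.p.lTensor I (a ⊗ₜ[ℂ] Q.i z))
    rw [LinearMap.lTensor_tmul, Q.p_i, TensorProduct.tmul_zero, map_zero, sub_zero,
      ← LinearMap.lTensor_tmul, hfi]

/-- A functional on `Z` that vanishes on `I Z` is zero if `Ext^1(X, ℂ)` vanishes and `Z` is
contained in `I F`. -/
theorem functional_eq_zero (Q : SplitSeq Z F X) {j : ℕ} (h : X.ExtOne j)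
    (hmin : ∀ z, Q.i z ∈ Submodule.span ℂ {y | ∃ a x, y = F.act a x})
    (ζ : Module.Dual ℂ Z.carrier) (hζ : Z.HasDeg ζ j) (hact : ∀ a z, ζ (Z.act a z) = 0) :
    ζ = 0 := by
  have hker : ∀ a y, Q.p y = 0 → ζ (Q.r (F.act a y)) = 0 := by
    intro a y hy
    have e := Q.split y
    rw [hy, map_zero, add_zero] at e
    rw [← e, ← Q.i_act, Q.r_i, hact]
  -- The connecting map: pulled back to `F` by the retraction, `ζ` defines a 1-cocycle on `X`. Its
  -- triviality provides `g`.
  let f : Module.Dual ℂ X.omega.carrier := TensorProduct.lift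
    { toFun := fun a => ζ ∘ₗ Q.r ∘ₗ F.act a ∘ₗ Q.s
      map_add' := fun a b => by ext; simp
      map_smul' := fun c a => by ext; simp }
  have hf : ∀ (a : I) (x : X.carrier), f (a ⊗ₜ[ℂ] x : I ⊗[ℂ] X.carrier) =
      ζ (Q.r (F.act a (Q.s x))) := fun a t => by simp [f]
  obtain ⟨g, -, hg⟩ := h f (by
    intro k hk t ht
    induction ht using Submodule.span_induction with
    | zero => simp
    | add x y _ _ hx hy => rw [map_add, hx, hy, add_zero]
    | smul c x _ hx => rw [map_smul, hx, smul_zero]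
    | mem x hx =>
      obtain ⟨m, l, rfl, a, ha, t, ht, rfl⟩ := hx
      rw [hf]
      exact hζ _ hk _ (Q.r_deg _ _ (F.act_deg ha (Q.s_deg l t ht)))) (by
    intro a t
    induction t using TensorProduct.induction_on with
    | zero => simp
    | add x y hx hy => rw [map_add, map_add, hx, hy, add_zero]
    | tmul b t =>
      rw [omega_act_tmul, map_sub, hf, hf, F.act_mul, ← map_sub, ← map_sub, ← map_sub]
      refine hker _ _ ?_
      rw [map_sub, Q.p_act, Q.p_s t, Q.p_s, sub_self])
  -- On `I F` the functional `ζ ∘ r` factors through `p`. As `Z` lies in `I F` and is killed by `p`,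
  -- this forces `ζ = 0`.
  have hk : ∀ y ∈ Submodule.span ℂ {y | ∃ a x, y = F.act a x}, ζ (Q.r y) = g (Q.p y) := by
    intro y hy
    induction hy using Submodule.span_induction with
    | zero => simp
    | add x y _ _ hx hy => simp only [map_add, hx, hy]
    | smul c x _ hx => simp only [map_smul, hx]
    | mem x hx =>
      obtain ⟨a, x, rfl⟩ := hx
      rw [Q.p_act, ← hg, hf, ← sub_eq_zero, ← map_sub, ← map_sub, ← map_sub]
      refine hker _ _ ?_
      rw [map_sub, Q.p_s, sub_self]
  ext z
  rw [← Q.r_i z, hk _ (hmin z), Q.p_i, map_zero, LinearMap.zero_apply]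

end SplitSeq

/-- The iterated syzygy `Ω^n X`. -/
def omegaPow (X : AugMod.{u, w} R) : ℕ → AugMod.{u, w} R
  | 0 => X
  | n + 1 => (omegaPow X n).omega

/-- The sequence `0 → Ω^n Z → Ω^n F → Ω^n X → 0`. -/
def SplitSeq.omegaPow {Z F X : AugMod.{u, w} R} (Q : SplitSeq Z F X) :
    ∀ n, SplitSeq (Z.omegaPow n) (F.omegaPow n) (X.omegaPow n)
  | 0 => Q
  | n + 1 => (Q.omegaPow n).omega

end AugMod

end Syzygy

/-! ### Bar cohomology as `Ext^1` of iterated syzygies. -/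

section Bar

section Pure

variable {I : Type u} [NonUnitalRing I] [Module ℂ I] [IsScalarTower ℂ I I] [SMulCommClass ℂ I I]
  {D : NonUnitalGrading I} (X : AugMod.{u, w} D) (ψ : X.carrier ≃ₗ[ℂ] I)

/-- The multilinear map `(a_0, …, a_{n+1}) ↦ a_0 ⊗ g(a_1, …, a_{n+1})`. -/
def consMultilinear {Y : Type*} [AddCommGroup Y] [Module ℂ Y] {n : ℕ}
    (g : MultilinearMap ℂ (fun _ : Fin (n + 1) => I) Y) :
    MultilinearMap ℂ (fun _ : Fin (n + 2) => I) (I ⊗[ℂ] Y) :=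
  LinearMap.uncurryLeft
    ({ toFun := fun a => (TensorProduct.mk ℂ I Y a).compMultilinearMap g
       map_add' := fun a b => by ext; simp
       map_smul' := fun c a => by ext; simp [TensorProduct.smul_tmul'] } :
      I →ₗ[ℂ] MultilinearMap ℂ (fun _ : Fin (n + 1) => I) (I ⊗[ℂ] Y))

/-- For `X` isomorphic to `I`, the tensor `a_0 ⊗ ⋯ ⊗ a_n` in `Ω^n X = I ⊗ ⋯ ⊗ I ⊗ X`. -/
def pureTensor : ∀ n, MultilinearMap ℂ (fun _ : Fin (n + 1) => I) (X.omegaPow n).carrier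
  | 0 => (MultilinearMap.ofSubsingleton ℂ I X.carrier (0 : Fin 1) ψ.symm.toLinearMap :
      MultilinearMap ℂ (fun _ : Fin 1 => I) X.carrier)
  | n + 1 => consMultilinear (pureTensor n)

theorem pureTensor_zero (a : Fin 1 → I) : pureTensor X ψ 0 a = ψ.symm (a 0) := rfl

theorem pureTensor_succ (n : ℕ) (a : Fin (n + 2) → I) : pureTensor X ψ (n + 1) a =
    (a 0 ⊗ₜ[ℂ] pureTensor X ψ n (Fin.tail a) : I ⊗[ℂ] (X.omegaPow n).carrier) := rfl

/-- The functional on `Ω^n X` defined by a multilinear form. -/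
def ofMultilinear : ∀ n, MultilinearMap ℂ (fun _ : Fin (n + 1) => I) ℂ →ₗ[ℂ]
    Module.Dual ℂ (X.omegaPow n).carrier
  | 0 =>
    { toFun := fun g => (MultilinearMap.ofSubsingleton ℂ I ℂ (0 : Fin 1)).symm g ∘ₗ ψ.toLinearMap
      map_add' := fun _ _ => rfl
      map_smul' := fun _ _ => rfl }
  | n + 1 =>
    { toFun := fun g => TensorProduct.lift (M := I) (N := (X.omegaPow n).carrier)
        (ofMultilinear n ∘ₗ g.curryLeft)
      map_add' := fun g h => by
        refine TensorProduct.ext' (M := I) (N := (X.omegaPow n).carrier) fun a x => ?_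
        exact DFunLike.congr_fun (map_add (ofMultilinear n) (g.curryLeft a) (h.curryLeft a)) x
      map_smul' := fun c g => by
        refine TensorProduct.ext' (M := I) (N := (X.omegaPow n).carrier) fun a x => ?_
        exact DFunLike.congr_fun (map_smul (ofMultilinear n) c (g.curryLeft a)) x }

theorem ofMultilinear_succ_tmul (n : ℕ) (g : MultilinearMap ℂ (fun _ : Fin (n + 2) => I) ℂ)
    (a : I) (x : (X.omegaPow n).carrier) :
    ofMultilinear X ψ (n + 1) g (a ⊗ₜ[ℂ] x : I ⊗[ℂ] (X.omegaPow n).carrier) =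
      ofMultilinear X ψ n (g.curryLeft a) x := rfl

theorem ofMultilinear_pureTensor (n : ℕ) (g : MultilinearMap ℂ (fun _ : Fin (n + 1) => I) ℂ)
    (a : Fin (n + 1) → I) : ofMultilinear X ψ n g (pureTensor X ψ n a) = g a := by
  induction n with
  | zero =>
    rw [pureTensor_zero]
    change g (fun _ => ψ (ψ.symm (a 0))) = g a
    congr 1
    funext i
    rw [LinearEquiv.apply_symm_apply, Fin.fin_one_eq_zero i]
  | succ n ih =>
    rw [pureTensor_succ, ofMultilinear_succ_tmul, ih, MultilinearMap.curryLeft_apply]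
    congr 1
    exact Fin.cons_self_tail a

theorem functional_ext_pureTensor (n : ℕ) {f g : Module.Dual ℂ (X.omegaPow n).carrier}
    (h : ∀ a, f (pureTensor X ψ n a) = g (pureTensor X ψ n a)) : f = g := by
  induction n with
  | zero =>
    ext x
    have := h fun _ => ψ x
    exact (congrArg f (ψ.symm_apply_apply x)).symm.trans
      (this.trans (congrArg g (ψ.symm_apply_apply x)))
  | succ n ih =>
    refine TensorProduct.ext' (M := I) (N := (X.omegaPow n).carrier) fun a x => ?_
    have : (f ∘ₗ TensorProduct.mk ℂ I (X.omegaPow n).carrier a : Module.Dual ℂ _) =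
        (g ∘ₗ TensorProduct.mk ℂ I (X.omegaPow n).carrier a : Module.Dual ℂ _) := by
      apply ih
      intro b
      have := h (Fin.cons a b)
      rwa [pureTensor_succ, Fin.cons_zero, Fin.tail_cons] at this
    exact DFunLike.congr_fun this x

theorem contractNth_zero_cons (n : ℕ) (a : Fin (n + 3) → I) :
    Fin.contractNth 0 (· * ·) a = (Fin.cons (a 0 * a 1) (Fin.tail (Fin.tail a)) :
      Fin (n + 2) → I) := by
  funext k
  refine Fin.cases ?_ (fun k => ?_) k
  · simp [Fin.contractNth]
  · simp [Fin.contractNth, Fin.tail]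

theorem contractNth_succ_cons (n : ℕ) (r : Fin (n + 2)) (a : Fin (n + 3) → I) :
    Fin.contractNth r.succ (· * ·) a =
      (Fin.cons (a 0) (Fin.contractNth r (· * ·) (Fin.tail a)) : Fin (n + 2) → I) := by
  funext k
  refine Fin.cases ?_ (fun k => ?_) k
  · simp [Fin.contractNth]
  · simp [Fin.contractNth, Fin.tail]

/-- The bar differential is the action on the iterated syzygy: each syzygy contributes one product
of neighbours, and the minus sign in its action produces the alternating signs. -/
theorem act_pureTensor (hψ : ∀ a x, ψ (X.act a x) = a * ψ x) (n : ℕ) (a : Fin (n + 2) → I) :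
    (X.omegaPow n).act (a 0) (pureTensor X ψ n (Fin.tail a)) =
      ∑ r : Fin (n + 1), (-1 : ℂ) ^ (r : ℕ) •
        pureTensor X ψ n (Fin.contractNth r.castSucc (· * ·) a) := by
  induction n with
  | zero =>
    simp only [Nat.reduceAdd, Finset.univ_unique, Fin.default_eq_zero, Fin.val_eq_zero, pow_zero,
      Finset.sum_singleton, pureTensor_zero]
    apply ψ.injective
    change ψ (X.act _ _) = _
    rw [hψ]
    simp only [Fin.contractNth, Fin.tail]
    simp only [Fin.succ_zero_eq_one, LinearEquiv.apply_symm_apply]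
    exact ((congrArg ψ (one_smul ℂ _)).trans (ψ.apply_symm_apply _)).symm
  | succ n ih =>
    rw [pureTensor_succ, Fin.sum_univ_succ]
    change (X.omegaPow n).omega.act _ _ = _
    rw [AugMod.omega_act_tmul]
    rw [show Fin.tail a 0 = (Fin.tail a) 0 from rfl, ih (Fin.tail a), Fin.castSucc_zero,
      contractNth_zero_cons, pureTensor_succ, TensorProduct.tmul_sum, sub_eq_add_neg]
    simp only [Fin.castSucc_succ, contractNth_succ_cons, pureTensor_succ, Fin.cons_zero,
      Fin.tail_cons, Fin.val_succ, pow_succ, TensorProduct.tmul_smul]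
    congr 1
    · exact (one_smul ℂ _).symm
    · rw [← Finset.sum_neg_distrib]
      refine Finset.sum_congr rfl fun r _ => ?_
      rw [mul_neg_one]
      exact (neg_smul _ _).symm

theorem pureTensor_mem_deg (hψ : ∀ n, ∀ a ∈ D.deg n, ψ.symm a ∈ X.deg n) (n : ℕ)
    (a : Fin (n + 1) → I) (k : Fin (n + 1) → ℕ) (ha : ∀ r, a r ∈ D.deg (k r)) :
    pureTensor X ψ n a ∈ (X.omegaPow n).deg (∑ r, k r) := by
  induction n with
  | zero =>
    rw [show ∑ r, k r = k 0 from Fin.sum_univ_one k]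
    exact hψ _ _ (ha 0)
  | succ n ih =>
    rw [Fin.sum_univ_succ]
    change _ ∈ (X.omegaPow n).omega.deg _
    exact Submodule.subset_span ⟨_, _, rfl, a 0, ha 0, _, ih (Fin.tail a) (fun r => k r.succ)
      (fun r => ha r.succ), rfl⟩

/-- A predicate on degrees is used in place of a fixed degree because fixing the first argument
shifts the condition on the remaining ones. -/
theorem ofMultilinear_eq_zero (hψ : ∀ n, ∀ x ∈ X.deg n, ψ x ∈ D.deg n) (n : ℕ)
    (g : MultilinearMap ℂ (fun _ : Fin (n + 1) => I) ℂ) (P : ℕ → Prop)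
    (hg : ∀ (a : Fin (n + 1) → I) (k : Fin (n + 1) → ℕ), (∀ r, a r ∈ D.deg (k r)) →
      P (∑ r, k r) → g a = 0) (m : ℕ) (hm : P m) (x : (X.omegaPow n).carrier)
    (hx : x ∈ (X.omegaPow n).deg m) : ofMultilinear X ψ n g x = 0 := by
  induction n generalizing P m with
  | zero => exact hg (fun _ => ψ x) (fun _ => m) (fun _ => hψ _ _ hx) (by simpa using hm)
  | succ n ih =>
    induction hx using Submodule.span_induction with
    | zero => exact map_zero _
    | add x y _ _ hx hy => exact (map_add _ _ _).trans (by rw [hx, hy, add_zero])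
    | smul c x _ hx => exact (map_smul _ _ _).trans (by rw [hx, smul_zero])
    | mem x hx =>
      obtain ⟨k, l, rfl, a, ha, x, hx, rfl⟩ := hx
      rw [ofMultilinear_succ_tmul]
      refine ih (g.curryLeft a) (fun m => P (k + m)) ?_ l hm x hx
      intro b k' hb hP
      rw [MultilinearMap.curryLeft_apply]
      refine hg (Fin.cons a b) (Fin.cons k k') (fun r => ?_) ?_
      · refine Fin.cases ?_ (fun r => ?_) r
        · simpa using ha
        · simpa using hb r
      · rw [Fin.sum_univ_succ]
        simpa using hP

end Pure

variable {V : Type u} [AddCommGroup V] [Module ℂ V] (R : Submodule ℂ (V ⊗[ℂ] V))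

/-- The grading of the augmentation ideal. -/
def augGrading : NonUnitalGrading (QuadAlg.aug R) where
  deg n :=
    { carrier := {a | (a : QuadAlg R) ∈ QuadAlg.deg R n}
      add_mem' := fun ha hb => Submodule.add_mem _ ha hb
      zero_mem' := Submodule.zero_mem _
      smul_mem' := fun c _ ha => Submodule.smul_mem _ c ha }
  mul_mem ha hb := QuadAlg.mul_mem_deg R ha hb

variable {R}

/-- As `A_+` is the first syzygy of `ℂ`, functionals on the `i`-th syzygy of `A_+` are bar cochains
in `i + 1` variables, and its `Ext^1` is `Ext^{i+2}(ℂ, ℂ)`. Koszulness confines this to internal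
degree `i + 2`. -/
theorem extOne_omegaPow_of_isKoszul (hK : IsKoszul R) (X : AugMod.{u, w} (augGrading R))
    (ψ : X.carrier ≃ₗ[ℂ] QuadAlg.aug R) (hψ : ∀ a x, ψ (X.act a x) = a * ψ x)
    (hdeg : ∀ n x, x ∈ X.deg n ↔ ψ x ∈ (augGrading R).deg n) (i j : ℕ) (hij : j ≠ i + 2) :
    (X.omegaPow i).ExtOne j := by
  intro f hf hcoc
  let g : BarCochain R (i + 2) := LinearMap.compMultilinearMap (show Module.Dual ℂ
    (X.omegaPow (i + 1)).carrier from f) (pureTensor X ψ (i + 1))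
  have hdiff : ∀ (n : ℕ) (F : Module.Dual ℂ (X.omegaPow n).carrier) (g : BarCochain R (n + 1)),
      (∀ a, g a = F (pureTensor X ψ n a)) → ∀ a,
      g.diff a = - F ((X.omegaPow n).act (a 0) (pureTensor X ψ n (Fin.tail a))) := by
    intro n F g hg a
    rw [act_pureTensor X ψ hψ, map_sum, BarCochain.diff, ← Finset.sum_neg_distrib]
    refine Finset.sum_congr rfl fun r _ => ?_
    rw [hg, map_smul, pow_succ, smul_eq_mul]
    ring
  obtain ⟨g', hg'deg, hg'⟩ := hK (i + 2) j (Ne.symm hij) g (by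
    intro a k ha hk
    exact hf _ hk _ (pureTensor_mem_deg X ψ (fun n a ha => (hdeg n _).2 (by simpa using ha))
      (i + 1) a k ha)) (by
    intro a
    rw [hdiff (i + 1) f g (fun _ => rfl) a, neg_eq_zero]
    exact hcoc _ _)
  -- The sign is that of `hdiff`: the bar differential is minus the action of the first argument.
  refine ⟨-(ofMultilinear X ψ i g'), ?_, ?_⟩
  · intro k hk x hx
    rw [LinearMap.neg_apply, neg_eq_zero]
    exact ofMultilinear_eq_zero X ψ (fun n x hx => (hdeg n x).1 hx) i g' (fun m => m ≠ j)
      (fun a k ha hk => hg'deg a k ha hk) k hk x hx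
  · intro a x
    have : (f ∘ₗ TensorProduct.mk ℂ (QuadAlg.aug R) (X.omegaPow i).carrier a : Module.Dual ℂ _) =
        -(ofMultilinear X ψ i g') ∘ₗ (X.omegaPow i).act a := by
      apply functional_ext_pureTensor X ψ
      intro b
      have h1 := hg' (Fin.cons a b)
      rw [hdiff i (ofMultilinear X ψ i g') g' (fun a => (ofMultilinear_pureTensor X ψ i g' a).symm),
        Fin.cons_zero, Fin.tail_cons] at h1
      change f (a ⊗ₜ[ℂ] (pureTensor X ψ i b)) = -(ofMultilinear X ψ i g' _)
      rw [← h1]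
      rfl
    exact DFunLike.congr_fun this x

end Bar

/-! ### Linear complexes of free `A`-modules. -/

section LinearComplex

variable {V : Type u} [AddCommGroup V] [Module ℂ V] {R : Submodule ℂ (V ⊗[ℂ] V)}

namespace QuadAlg

variable (R) in
/-- The projection of `T(V)/(R)` to its component of degree `k`. -/
def proj (k : ℕ) : QuadAlg R →ₗ[ℂ] QuadAlg R := (coaction R (1 : ℕ)).proj k

theorem proj_of_mem {k n : ℕ} {a : QuadAlg R} (ha : a ∈ deg R k) :
    proj R n a = if k = n then a else 0 := by
  rw [← comp_coaction_eq_deg] at ha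
  exact (coaction R (1 : ℕ)).proj_of_mem ha n

theorem proj_mem (k : ℕ) (a : QuadAlg R) : proj R k a ∈ deg R k := by
  rw [← comp_coaction_eq_deg]
  exact (coaction R (1 : ℕ)).proj_mem k a

theorem eps_proj_zero (a : QuadAlg R) : eps R (proj R 0 a) = eps R a := by
  induction a using (coaction R (1 : ℕ)).induction_comp with
  | h0 => simp
  | hadd a b ha hb => rw [map_add, map_add, ha, hb, map_add]
  | hcomp n a ha =>
    rw [comp_coaction_eq_deg] at ha
    rw [proj_of_mem ha]
    split_ifs with h
    · rfl
    · rw [eps_deg R (Nat.pos_of_ne_zero h) ha, map_zero]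

theorem proj_zero_eq (a : QuadAlg R) : proj R 0 a = eps R a • 1 := by
  rw [eq_smul_one_of_mem_deg_zero R (proj_mem 0 a), eps_proj_zero]

theorem proj_succ_mul {x : QuadAlg R} (hx : x ∈ deg R 1) (k : ℕ) (a : QuadAlg R) :
    proj R (k + 1) (a * x) = proj R k a * x := by
  rw [← comp_coaction_eq_deg] at hx
  exact (coaction R (1 : ℕ)).proj_add_mul_of_mem hx k a

theorem proj_zero_mul {x : QuadAlg R} (hx : x ∈ deg R 1) (a : QuadAlg R) :
    proj R 0 (a * x) = 0 := by
  rw [proj_zero_eq, map_mul, eps_deg R one_pos hx, mul_zero, zero_smul]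

theorem proj_add_mul_left {i : ℕ} {x : QuadAlg R} (hx : x ∈ deg R i) (k : ℕ) (a : QuadAlg R) :
    proj R (i + k) (x * a) = x * proj R k a := by
  rw [← comp_coaction_eq_deg] at hx
  exact (coaction R (1 : ℕ)).proj_add_mul_of_mem_left hx k a

theorem proj_lt_mul_left {i k : ℕ} (hk : k < i) {x : QuadAlg R} (hx : x ∈ deg R i)
    (a : QuadAlg R) : proj R k (x * a) = 0 := by
  induction a using (coaction R (1 : ℕ)).induction_comp with
  | h0 => simp
  | hadd a b ha hb => rw [mul_add, map_add, ha, hb, add_zero]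
  | hcomp n a ha =>
    rw [comp_coaction_eq_deg] at ha
    rw [proj_of_mem (mul_mem_deg R hx ha), if_neg (by omega)]

theorem finite_proj_ne_zero (a : QuadAlg R) : {k | proj R k a ≠ 0}.Finite := by
  induction a using (coaction R (1 : ℕ)).induction_comp with
  | h0 => simp
  | hadd a b ha hb =>
    refine (ha.union hb).subset fun k hk => ?_
    by_contra h
    simp only [Set.mem_union, Set.mem_ofPred_eq, not_or, not_not] at h
    exact hk (by rw [map_add, h.1, h.2, add_zero])
  | hcomp n a ha =>
    rw [comp_coaction_eq_deg] at ha
    refine (Set.finite_singleton n).subset fun k hk => ?_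
    by_contra h
    exact hk (by rw [proj_of_mem ha, if_neg (Ne.symm h)])

theorem eq_zero_of_proj {a : QuadAlg R} (h : ∀ k, proj R k a = 0) : a = 0 := by
  obtain ⟨s, hs⟩ := (coaction R (1 : ℕ)).exists_sum_proj a
  rw [hs]
  exact Finset.sum_eq_zero fun k _ => h k

end QuadAlg

section Pr

variable {σ : Type w}

variable (R σ) in
/-- The projection of a free module to its component of degree `k`. -/
def pr (k : ℕ) : (σ →₀ QuadAlg R) →ₗ[ℂ] (σ →₀ QuadAlg R) :=
  Finsupp.mapRange.linearMap (QuadAlg.proj R k)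

@[simp]
theorem pr_apply (k : ℕ) (x : σ →₀ QuadAlg R) (t : σ) :
    pr R σ k x t = QuadAlg.proj R k (x t) := by
  simp [pr]

theorem pr_pr (k l : ℕ) (x : σ →₀ QuadAlg R) : pr R σ k (pr R σ l x) =
    if l = k then pr R σ l x else 0 := by
  ext t
  rw [pr_apply, pr_apply, QuadAlg.proj_of_mem (QuadAlg.proj_mem l (x t))]
  split_ifs <;> simp

theorem pr_smul_of_mem {i : ℕ} {a : QuadAlg R} (ha : a ∈ QuadAlg.deg R i) (k : ℕ)
    (x : σ →₀ QuadAlg R) : pr R σ (i + k) (a • x) = a • pr R σ k x := by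
  ext t
  simp [QuadAlg.proj_add_mul_left ha]

theorem pr_smul_of_lt {i k : ℕ} (hk : k < i) {a : QuadAlg R} (ha : a ∈ QuadAlg.deg R i)
    (x : σ →₀ QuadAlg R) : pr R σ k (a • x) = 0 := by
  ext t
  simp [QuadAlg.proj_lt_mul_left hk ha]

theorem finite_pr_ne_zero (x : σ →₀ QuadAlg R) : {k | pr R σ k x ≠ 0}.Finite := by
  refine (x.support.finite_toSet.biUnion
    (fun t _ => QuadAlg.finite_proj_ne_zero (x t))).subset fun k hk => ?_
  obtain ⟨t, ht⟩ := Finsupp.ne_iff.1 hk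
  rw [pr_apply, Finsupp.zero_apply] at ht
  refine Set.mem_biUnion (x := t) ?_ ht
  rw [Finset.mem_coe, Finsupp.mem_support_iff]
  rintro h
  exact ht (by rw [h, map_zero])

theorem eq_zero_of_pr {x : σ →₀ QuadAlg R} (h : ∀ k, pr R σ k x = 0) : x = 0 := by
  ext t
  refine QuadAlg.eq_zero_of_proj fun k => ?_
  rw [← pr_apply, h k, Finsupp.zero_apply]

theorem pr_finsum (g : ℕ → (σ →₀ QuadAlg R)) (hg : (Function.support g).Finite) (k : ℕ) :
    pr R σ k (∑ᶠ l, g l) = ∑ᶠ l, pr R σ k (g l) :=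
  map_finsum (pr R σ k) hg

theorem finsum_pr (x : σ →₀ QuadAlg R) : ∑ᶠ k, pr R σ k x = x := by
  rw [← sub_eq_zero]
  refine eq_zero_of_pr fun k => ?_
  rw [map_sub, pr_finsum _ (finite_pr_ne_zero x)]
  simp only [pr_pr]
  rw [finsum_eq_single _ k (fun l hl => if_neg hl), if_pos rfl, sub_self]

end Pr

variable {S : ℕ → Type w}

/-- The differential of a complex of free modules `A ⊗ ℂ^(S m)`. -/
def bd (X : ∀ m, S (m + 1) → (S m →₀ QuadAlg R)) (m : ℕ) :
    (S (m + 1) →₀ QuadAlg R) →ₗ[QuadAlg R] (S m →₀ QuadAlg R) :=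
  Finsupp.linearCombination (QuadAlg R) (X m)

/-- The cycles, where in degree zero the complex is augmented by `A → ℂ`. -/
def cyc (X : ∀ m, S (m + 1) → (S m →₀ QuadAlg R)) : ∀ m, Submodule (QuadAlg R) (S m →₀ QuadAlg R)
  | 0 =>
    { carrier := {x | ∀ t, QuadAlg.eps R (x t) = 0}
      add_mem' := fun hx hy t => by simp [hx t, hy t]
      zero_mem' := fun t => by simp
      smul_mem' := fun a x hx t => by simp [hx t] }
  | m + 1 => LinearMap.ker (bd X m)

/-- A linear complex of free modules over `A = T(V)/(R)` which is exact in internal degrees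
zero and one. -/
structure IsLinearComplex (X : ∀ m, S (m + 1) → (S m →₀ QuadAlg R)) : Prop where
  deg_one : ∀ m s t, X m s t ∈ QuadAlg.deg R 1
  bd_bd : ∀ m y, bd X m (bd X (m + 1) y) = 0
  exact_zero : ∀ m (z : S (m + 1) →₀ QuadAlg R), (∀ t, z t ∈ QuadAlg.deg R 0) →
    bd X m z = 0 → z = 0
  exact_one : ∀ m, ∀ z ∈ cyc X m, (∀ t, z t ∈ QuadAlg.deg R 1) → ∃ y, bd X m y = z

namespace IsLinearComplex

variable {X : ∀ m, S (m + 1) → (S m →₀ QuadAlg R)}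

/-- The entries of the differential have degree one, so the degree of the coefficients rises by
exactly one. -/
theorem pr_succ_bd (hX : IsLinearComplex X) (m k : ℕ) (x : S (m + 1) →₀ QuadAlg R) :
    pr R (S m) (k + 1) (bd X m x) = bd X m (pr R (S (m + 1)) k x) := by
  induction x using Finsupp.induction_linear with
  | zero => simp
  | add x y hx hy => simp only [map_add, hx, hy]
  | single s a =>
    have : pr R (S (m + 1)) k (Finsupp.single s a) = Finsupp.single s (QuadAlg.proj R k a) := by
      simp [pr]
    rw [this]
    ext t
    simp [bd, QuadAlg.proj_succ_mul (hX.deg_one m s t)]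

theorem pr_zero_bd (hX : IsLinearComplex X) (m : ℕ) (x : S (m + 1) →₀ QuadAlg R) :
    pr R (S m) 0 (bd X m x) = 0 := by
  induction x using Finsupp.induction_linear with
  | zero => simp
  | add x y hx hy => simp only [map_add, hx, hy, add_zero]
  | single s a =>
    ext t
    simp [bd, QuadAlg.proj_zero_mul (hX.deg_one m s t)]

theorem pr_mem_cyc (hX : IsLinearComplex X) {m : ℕ} {x : S m →₀ QuadAlg R} (hx : x ∈ cyc X m) (k : ℕ) :
    pr R (S m) k x ∈ cyc X m := by
  cases m with
  | zero =>
    intro t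
    rw [pr_apply]
    rcases Nat.eq_zero_or_pos k with rfl | hk
    · rw [QuadAlg.eps_proj_zero]; exact hx t
    · exact QuadAlg.eps_deg R hk (QuadAlg.proj_mem k _)
  | succ m =>
    change bd X m _ = 0
    rw [← hX.pr_succ_bd, show bd X m x = 0 from hx, map_zero]

/-- Exactness in internal degree zero is minimality: the cycles have no constant coefficients. -/
theorem pr_zero_of_mem_cyc (hX : IsLinearComplex X) {m : ℕ} {x : S m →₀ QuadAlg R} (hx : x ∈ cyc X m) :
    pr R (S m) 0 x = 0 := by
  cases m with
  | zero =>
    ext t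
    rw [pr_apply, QuadAlg.proj_zero_eq, show QuadAlg.eps R (x t) = 0 from hx t]
    simp
  | succ m =>
    exact hX.exact_zero m _ (fun t => by rw [pr_apply]; exact QuadAlg.proj_mem 0 _)
      (hX.pr_mem_cyc hx 0)

theorem bd_mem_cyc (hX : IsLinearComplex X) (m : ℕ) (y : S (m + 1) →₀ QuadAlg R) : bd X m y ∈ cyc X m := by
  cases m with
  | zero =>
    intro t
    have := congrArg (fun z => QuadAlg.eps R (z t)) (hX.pr_zero_bd 0 y)
    simpa [QuadAlg.eps_proj_zero] using this
  | succ m => exact hX.bd_bd m y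

end IsLinearComplex

end LinearComplex

/-! ### Free modules and their submodules as graded modules over `A_+`. -/

section LinearResolution

variable {V : Type u} [AddCommGroup V] [Module ℂ V] {R : Submodule ℂ (V ⊗[ℂ] V)}
variable {S : ℕ → Type w}

variable (R) in
/-- The component of degree `n` of the free module on generators of degree `m`. -/
def freeDeg (σ : Type w) (m n : ℕ) : Submodule ℂ (σ →₀ QuadAlg R) where
  carrier := {x | ∀ k, k + m ≠ n → pr R σ k x = 0}
  add_mem' := fun hx hy k hk => by rw [map_add, hx k hk, hy k hk, add_zero]
  zero_mem' := fun k _ => map_zero _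
  smul_mem' := fun c x hx k hk => by rw [map_smul, hx k hk, smul_zero]

theorem smul_mem_freeDeg {σ : Type w} {m i n : ℕ} {a : QuadAlg R} (ha : a ∈ QuadAlg.deg R i)
    {x : σ →₀ QuadAlg R} (hx : x ∈ freeDeg R σ m n) : a • x ∈ freeDeg R σ m (i + n) := by
  intro k hk
  rcases lt_or_ge k i with h | h
  · exact pr_smul_of_lt h ha x
  · obtain ⟨k, rfl⟩ := Nat.exists_eq_add_of_le h
    rw [pr_smul_of_mem ha, hx k (by omega), smul_zero]

/-- A submodule of a free module on generators of degree `m`, as a module over `A_+`. -/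
abbrev subMod {σ : Type w} (m : ℕ) (Z : Submodule (QuadAlg R) (σ →₀ QuadAlg R)) :
    AugMod.{u, w} (augGrading R) where
  carrier := Z
  act := LinearMap.mk₂ ℂ (fun (a : QuadAlg.aug R) (x : Z) => (a : QuadAlg R) • x)
    (fun _ _ _ => add_smul _ _ _) (fun _ _ _ => smul_assoc _ _ _)
    (fun _ _ _ => smul_add _ _ _) (fun _ _ _ => smul_comm _ _ _)
  act_mul _ _ _ := mul_smul _ _ _
  deg n := (freeDeg R σ m n).comap (Z.subtype.restrictScalars ℂ)
  act_deg ha hx := smul_mem_freeDeg ha hx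

/-- The free module on generators of degree `m`, as a module over `A_+`. -/
abbrev freeMod (σ : Type w) (m : ℕ) : AugMod.{u, w} (augGrading R) where
  carrier := σ →₀ QuadAlg R
  act := LinearMap.mk₂ ℂ (fun (a : QuadAlg.aug R) (x : σ →₀ QuadAlg R) => (a : QuadAlg R) • x)
    (fun _ _ _ => add_smul _ _ _) (fun _ _ _ => smul_assoc _ _ _)
    (fun _ _ _ => smul_add _ _ _) (fun _ _ _ => smul_comm _ _ _)
  act_mul _ _ _ := mul_smul _ _ _
  deg n := freeDeg R σ m n
  act_deg ha hx := smul_mem_freeDeg ha hx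

theorem freeMod_act {σ : Type w} {m : ℕ} (a : QuadAlg.aug R) (x : σ →₀ QuadAlg R) :
    (freeMod (R := R) σ m).act a x = (a : QuadAlg R) • x := rfl

variable (R) in
/-- The projection `A → A_+`. -/
def toAug : QuadAlg R →ₗ[ℂ] QuadAlg.aug R where
  toFun a := ⟨a - algebraMap ℂ _ (QuadAlg.eps R a), QuadAlg.sub_eps_mem_aug R a⟩
  map_add' a b := Subtype.ext (by
    simp only [map_add, NonUnitalSubalgebra.coe_add]; abel)
  map_smul' c a := Subtype.ext (by
    simp only [map_smul, RingHom.id_apply, NonUnitalSubalgebra.coe_smul, smul_sub,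
      Algebra.algebraMap_eq_smul_one, smul_assoc])

theorem toAug_of_mem (a : QuadAlg.aug R) : toAug R (a : QuadAlg R) = a :=
  Subtype.ext (by simp [toAug, (QuadAlg.mem_aug R).1 a.2])

variable (R) in
/-- The contraction `a s ↦ a_+ ⊗ s` of a free module. -/
def freeContraction (σ : Type w) :
    (σ →₀ QuadAlg R) →ₗ[ℂ] QuadAlg.aug R ⊗[ℂ] (σ →₀ QuadAlg R) :=
  Finsupp.lsum ℂ fun s =>
    (TensorProduct.mk ℂ (QuadAlg.aug R) (σ →₀ QuadAlg R)).flip (Finsupp.single s 1) ∘ₗ toAug R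

theorem freeContraction_single {σ : Type w} (s : σ) (a : QuadAlg R) :
    freeContraction R σ (Finsupp.single s a) = toAug R a ⊗ₜ[ℂ] Finsupp.single s 1 := by
  simp [freeContraction]

/-- On `a s` this is the splitting `a = a_+ + ε(a)`: the part `ε(a)` accounts for `b ⊗ ε(a) s`, and
the rest cancels against the correction term in the action on the syzygy. Through this identity free
modules have no `Ext^1`. -/
theorem freeContraction_act {σ : Type w} (m : ℕ) (b : QuadAlg.aug R) (y : σ →₀ QuadAlg R) :
    freeContraction R σ ((b : QuadAlg R) • y) =
      b ⊗ₜ[ℂ] y + (freeMod (R := R) σ m).omega.act b (freeContraction R σ y) := by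
  induction y using Finsupp.induction_linear with
  | zero => simp
  | add x y hx hy =>
    rw [smul_add, map_add, map_add, hx, hy, map_add, TensorProduct.tmul_add]
    abel
  | single s a =>
    rw [Finsupp.smul_single, freeContraction_single, freeContraction_single,
      AugMod.omega_act_tmul, freeMod_act, Finsupp.smul_single, smul_eq_mul, smul_eq_mul, mul_one]
    have e1 : a = (toAug R a : QuadAlg R) + algebraMap ℂ _ (QuadAlg.eps R a) := by
      simp [toAug]
    have e2 : toAug R ((b : QuadAlg R) * a) = b * toAug R a + QuadAlg.eps R a • b := by
      have : (b : QuadAlg R) * a = ((b * toAug R a + QuadAlg.eps R a • b : QuadAlg.aug R) :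
          QuadAlg R) := by
        conv_lhs => rw [e1]
        rw [mul_add, ← Algebra.commutes, ← Algebra.smul_def]
        rfl
      rw [this, toAug_of_mem]
    have e3 : (Finsupp.single s a : σ →₀ QuadAlg R) = Finsupp.single s (toAug R a : QuadAlg R) +
        QuadAlg.eps R a • Finsupp.single s 1 := by
      conv_lhs => rw [e1]
      rw [Finsupp.single_add, Finsupp.smul_single, Algebra.algebraMap_eq_smul_one]
    rw [e2, e3, TensorProduct.tmul_add, TensorProduct.add_tmul, TensorProduct.tmul_smul,
      TensorProduct.smul_tmul']
    abel

theorem freeContraction_deg {σ : Type w} (m n : ℕ) (y : σ →₀ QuadAlg R)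
    (hy : y ∈ freeDeg R σ m n) :
    freeContraction R σ y ∈ (freeMod (R := R) σ m).omega.deg n := by
  have hy' := Finsupp.sum_single y
  rw [← hy', map_finsuppSum]
  refine Submodule.sum_mem _ fun s _ => ?_
  change freeContraction R σ (Finsupp.single s (y s)) ∈ _
  rw [freeContraction_single]
  have hk : ∀ k, k + m ≠ n → QuadAlg.proj R k (y s) = 0 := fun k hk => by
    rw [← pr_apply, hy k hk, Finsupp.zero_apply]
  by_cases hmn : m ≤ n
  · obtain ⟨k, rfl⟩ := Nat.exists_eq_add_of_le hmn
    have hys : y s ∈ QuadAlg.deg R k := by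
      have : y s = QuadAlg.proj R k (y s) := by
        rw [← sub_eq_zero]
        refine QuadAlg.eq_zero_of_proj fun l => ?_
        rw [map_sub, QuadAlg.proj_of_mem (QuadAlg.proj_mem k (y s))]
        split_ifs with h
        · rw [h, sub_self]
        · rw [hk l (by omega), sub_zero]
      rw [this]
      exact QuadAlg.proj_mem _ _
    refine Submodule.subset_span ⟨k, m, by omega, toAug R (y s), ?_, Finsupp.single s 1, ?_, rfl⟩
    · rcases Nat.eq_zero_or_pos k with rfl | hk
      · have : toAug R (y s) = 0 := Subtype.ext (by
          rw [QuadAlg.eq_smul_one_of_mem_deg_zero R hys]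
          simp [toAug, Algebra.algebraMap_eq_smul_one])
        rw [this]
        exact Submodule.zero_mem _
      · have : toAug R (y s) = ⟨y s, (QuadAlg.mem_aug R).2 (QuadAlg.eps_deg R hk hys)⟩ :=
          toAug_of_mem ⟨y s, _⟩
        rw [this]
        exact hys
    · classical
      intro l hl
      have : (1 : QuadAlg R) ∈ QuadAlg.deg R 0 := by
        rw [QuadAlg.deg, pow_zero]; exact Submodule.one_le.1 le_rfl
      ext t
      rw [pr_apply, Finsupp.single_apply]
      split_ifs
      · rw [QuadAlg.proj_of_mem this, if_neg (by omega)]; rfl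
      · simp
  · have : y s = 0 := QuadAlg.eq_zero_of_proj fun k => hk k (by omega)
    rw [this, map_zero, TensorProduct.zero_tmul]
    exact Submodule.zero_mem _

end LinearResolution

/-! ### Koszulness forces exactness of linear complexes. -/

section LinearResolution

variable {V : Type u} [AddCommGroup V] [Module ℂ V] {R : Submodule ℂ (V ⊗[ℂ] V)}
variable {S : ℕ → Type w}

namespace IsLinearComplex

variable {X : ∀ m, S (m + 1) → (S m →₀ QuadAlg R)}

/-- The projection of the cycles to their component of degree `k`. -/
def cycPr (hX : IsLinearComplex X) (m k : ℕ) : cyc X m →ₗ[ℂ] cyc X m :=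
  LinearMap.restrict (p := (cyc X m).restrictScalars ℂ) (q := (cyc X m).restrictScalars ℂ)
    (pr R (S m) k) (fun _ hx => hX.pr_mem_cyc hx k)

theorem coe_cycPr (hX : IsLinearComplex X) (m k : ℕ) (z : cyc X m) :
    (hX.cycPr m k z : S m →₀ QuadAlg R) = pr R (S m) k z := rfl

theorem finite_support_section (hX : IsLinearComplex X) {m : ℕ}
    (s : cyc X m →ₗ[ℂ] (S (m + 1) →₀ QuadAlg R)) (z : cyc X m) :
    (Function.support fun k => pr R (S (m + 1)) k (s (hX.cycPr m (k + 1) z))).Finite := by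
  have h := (finite_pr_ne_zero (z : S m →₀ QuadAlg R)).preimage
    ((add_left_injective 1).injOn (s := (fun k => k + 1) ⁻¹' {k | pr R (S m) k z ≠ 0}))
  refine h.subset fun k hk => ?_
  intro h0
  refine hk ?_
  have : hX.cycPr m (k + 1) z = 0 := Subtype.ext h0
  simp only [this, map_zero]

/-- The sum of the homogeneous parts of a section of the differential. -/
def gradedSection (hX : IsLinearComplex X) {m : ℕ}
    (s : cyc X m →ₗ[ℂ] (S (m + 1) →₀ QuadAlg R)) :
    cyc X m →ₗ[ℂ] (S (m + 1) →₀ QuadAlg R) where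
  toFun z := ∑ᶠ k, pr R (S (m + 1)) k (s (hX.cycPr m (k + 1) z))
  map_add' x y := by
    rw [← finsum_add_distrib (hX.finite_support_section s x) (hX.finite_support_section s y)]
    simp only [map_add]
  map_smul' c x := by
    rw [RingHom.id_apply, smul_finsum' _ (hX.finite_support_section s x)]
    simp only [map_smul]

theorem pr_gradedSection (hX : IsLinearComplex X) {m : ℕ}
    (s : cyc X m →ₗ[ℂ] (S (m + 1) →₀ QuadAlg R)) (z : cyc X m) (k : ℕ) :
    pr R (S (m + 1)) k (hX.gradedSection s z) =
      pr R (S (m + 1)) k (s (hX.cycPr m (k + 1) z)) := by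
  change pr R _ k (∑ᶠ k, pr R (S (m + 1)) k (s (hX.cycPr m (k + 1) z))) = _
  rw [pr_finsum _ (hX.finite_support_section s z)]
  simp only [pr_pr]
  rw [finsum_eq_single _ k (fun l hl => if_neg hl), if_pos rfl]

/-- Since the differential shifts degrees by one, replacing a section by its homogeneous parts of
the matching degree leaves it a section. -/
theorem bd_gradedSection (hX : IsLinearComplex X) {m : ℕ}
    (s : cyc X m →ₗ[ℂ] (S (m + 1) →₀ QuadAlg R)) (hs : ∀ z, bd X m (s z) = z) (z : cyc X m) :
    bd X m (hX.gradedSection s z) = z := by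
  rw [← sub_eq_zero]
  refine eq_zero_of_pr fun k => ?_
  rw [map_sub, sub_eq_zero]
  cases k with
  | zero => rw [hX.pr_zero_bd, hX.pr_zero_of_mem_cyc z.2]
  | succ k =>
    rw [hX.pr_succ_bd, pr_gradedSection, ← hX.pr_succ_bd, hs, coe_cycPr, pr_pr, if_pos rfl]

/-- Where the complex is exact, the next cycles are the syzygies of the previous ones: `0 → Z_{m+1}
→ F_{m+1} → Z_m → 0`. A section exists over the field `ℂ` and can be made homogeneous; the
contraction is that of the free module. -/
theorem exists_splitSeq (hX : IsLinearComplex X) {m : ℕ}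
    (hex : ∀ z ∈ cyc X m, ∃ y, bd X m y = z) :
    ∃ Q : AugMod.SplitSeq (subMod (m + 1) (cyc X (m + 1))) (freeMod (S (m + 1)) (m + 1))
      (subMod m (cyc X m)), ∀ z, Q.i z = (z : S (m + 1) →₀ QuadAlg R) := by
  let p : (S (m + 1) →₀ QuadAlg R) →ₗ[ℂ] cyc X m :=
    ((bd X m).codRestrict (cyc X m) (hX.bd_mem_cyc m)).restrictScalars ℂ
  have hp : ∀ y, (p y : S m →₀ QuadAlg R) = bd X m y := fun _ => rfl
  have : Module.Free ℂ (cyc X m) := Module.Free.of_divisionRing ℂ (cyc X m)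
  have : Module.Projective ℂ (cyc X m) := Module.Projective.of_free
  obtain ⟨s0, hs0⟩ := p.exists_rightInverse_of_surjective (LinearMap.range_eq_top.2 fun z => by
    obtain ⟨y, hy⟩ := hex z z.2
    exact ⟨y, Subtype.ext hy⟩)
  have hs0' : ∀ z, bd X m (s0 z) = z := fun z => by
    rw [← hp]; exact congrArg Subtype.val (DFunLike.congr_fun hs0 z)
  let s := hX.gradedSection s0
  have hs : ∀ z, p (s z) = z := fun z => Subtype.ext (hX.bd_gradedSection s0 hs0' z)
  let r : (S (m + 1) →₀ QuadAlg R) →ₗ[ℂ] cyc X (m + 1) :=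
    LinearMap.codRestrict ((cyc X (m + 1)).restrictScalars ℂ) (LinearMap.id - s ∘ₗ p) (fun y => by
      change bd X m (y - s (p y)) = 0
      rw [map_sub, ← hp (s (p y)), hs, hp, sub_self])
  have hr : ∀ y, (r y : S (m + 1) →₀ QuadAlg R) = y - s (p y) := fun _ => rfl
  have hsdeg : ∀ n, ∀ z ∈ (subMod m (cyc X m)).deg n, s z ∈ freeDeg R (S (m + 1)) (m + 1) n := by
    intro n z hz k hk
    rw [hX.pr_gradedSection]
    have : hX.cycPr m (k + 1) z = 0 := Subtype.ext (hz (k + 1) (by omega))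
    rw [this, map_zero, map_zero]
  have hpdeg : ∀ n, ∀ y ∈ freeDeg R (S (m + 1)) (m + 1) n, p y ∈ (subMod m (cyc X m)).deg n := by
    intro n y hy k hk
    change pr R (S m) k (bd X m y) = 0
    cases k with
    | zero => exact hX.pr_zero_bd m y
    | succ k => rw [hX.pr_succ_bd, hy k (by omega), map_zero]
  refine ⟨{
    i := (cyc X (m + 1)).subtype.restrictScalars ℂ
    p := p
    s := s
    r := r
    κ := freeContraction R (S (m + 1))
    i_act := fun a z => rfl
    p_act := fun a y => Subtype.ext (map_smul (bd X m) (a : QuadAlg R) y)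
    p_s := hs
    r_i := fun z => Subtype.ext (by
      rw [hr]
      have : p ((cyc X (m + 1)).subtype.restrictScalars ℂ z) = 0 := Subtype.ext z.2
      rw [this, map_zero, sub_zero]
      rfl)
    split := fun y => sub_add_cancel y (s (p y))
    κ_act := fun b y => freeContraction_act (m + 1) b y
    i_deg := fun n z hz => hz
    p_deg := hpdeg
    s_deg := hsdeg
    r_deg := fun n y hy => Submodule.sub_mem _ hy (hsdeg n _ (hpdeg n y hy))
    κ_deg := fun n y hy => freeContraction_deg (m + 1) n y hy }, fun z => rfl⟩

/-- The homogeneous parts of the elements of `A_+ Z`. -/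
theorem pr_mem_span (hX : IsLinearComplex X) (m k : ℕ) {z : S m →₀ QuadAlg R}
    (hz : z ∈ Submodule.span ℂ {y | ∃ a ∈ QuadAlg.aug R, ∃ x ∈ cyc X m, y = a • x}) :
    pr R (S m) k z ∈ Submodule.span ℂ {y | ∃ a ∈ QuadAlg.aug R, ∃ l < k, ∃ x ∈ cyc X m,
      pr R (S m) l x = x ∧ y = a • x} := by
  induction hz using Submodule.span_induction with
  | zero => simp
  | add x y _ _ hx hy => rw [map_add]; exact Submodule.add_mem _ hx hy
  | smul c x _ hx => rw [map_smul]; exact Submodule.smul_mem _ _ hx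
  | mem y hy =>
    obtain ⟨a, ha, x, hx, rfl⟩ := hy
    obtain ⟨s, hs⟩ := (QuadAlg.coaction R (1 : ℕ)).exists_sum_proj a
    rw [hs, Finset.sum_smul, map_sum]
    refine Submodule.sum_mem _ fun i _ => ?_
    change pr R (S m) k (QuadAlg.proj R i a • x) ∈ _
    have hi := QuadAlg.proj_mem i a
    rcases Nat.eq_zero_or_pos i with rfl | hi0
    · rw [QuadAlg.proj_zero_eq, (QuadAlg.mem_aug R).1 ha, zero_smul, zero_smul, map_zero]
      exact Submodule.zero_mem _
    · rcases lt_or_ge k i with h | h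
      · rw [pr_smul_of_lt h hi]
        exact Submodule.zero_mem _
      · obtain ⟨l, rfl⟩ := Nat.exists_eq_add_of_le h
        rw [pr_smul_of_mem hi]
        exact Submodule.subset_span ⟨_, (QuadAlg.mem_aug R).2 (QuadAlg.eps_deg R hi0 hi), l,
          by omega, _, hX.pr_mem_cyc hx l, by rw [pr_pr, if_pos rfl], rfl⟩

/-- A graded Nakayama argument. A functional detecting generators of the cycles outside total degree
`m + 1` vanishes, so the cycles are generated by their linear part, which consists of boundaries.
The generators of the free module have degree `m`, whence linear coefficients have total degree `m +
1`. -/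
theorem exact_of_functional (hX : IsLinearComplex X) (m : ℕ)
    (h : ∀ j, j ≠ m + 1 → ∀ ζ : Module.Dual ℂ (cyc X m), (subMod m (cyc X m)).HasDeg ζ j →
      (∀ a z, ζ ((subMod m (cyc X m)).act a z) = 0) → ζ = 0) :
    ∀ z ∈ cyc X m, ∃ y, bd X m y = z := by
  have key : ∀ k, ∀ z ∈ cyc X m, pr R (S m) k z = z → z ∈ LinearMap.range (bd X m) := by
    intro k
    induction k using Nat.strong_induction_on with
    | _ k ih =>
      intro z hz hzk
      by_cases hk0 : k = 0
      · subst hk0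
        rw [← hzk, hX.pr_zero_of_mem_cyc hz]
        exact Submodule.zero_mem _
      by_cases hk1 : k = 1
      · subst hk1
        obtain ⟨y, hy⟩ := hX.exact_one m z hz (fun t => by
          rw [← hzk, pr_apply]; exact QuadAlg.proj_mem _ _)
        exact ⟨y, hy⟩
      -- Otherwise a linear form separates `z` from the decomposables. Its part in internal degree
      -- `k ≥ 2` is a homogeneous functional excluded by the hypothesis.
      have hmem : z ∈ Submodule.span ℂ {y | ∃ a ∈ QuadAlg.aug R, ∃ x ∈ cyc X m, y = a • x} := by
        by_contra hcon
        obtain ⟨f, hfz, hf⟩ := Submodule.exists_le_ker_of_notMem hcon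
        have h0 := h (k + m) (by omega) (f ∘ₗ pr R (S m) k ∘ₗ (cyc X m).subtype.restrictScalars ℂ)
          (by
            intro n hn x hx
            have hx' : pr R (S m) k (x : S m →₀ QuadAlg R) = 0 := hx k (Ne.symm hn)
            change f (pr R (S m) k x) = 0
            rw [hx', map_zero])
          (by
            intro a x
            refine hf ?_
            have h1 := hX.pr_mem_span m k (z := (a : QuadAlg R) • (x : S m →₀ QuadAlg R))
              (Submodule.subset_span ⟨a, a.2, x, x.2, rfl⟩)
            refine Submodule.span_mono ?_ h1
            rintro _ ⟨a, ha, l, -, x, hx, -, rfl⟩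
            exact ⟨a, ha, x, hx, rfl⟩)
        have h2 := DFunLike.congr_fun h0 (⟨z, hz⟩ : cyc X m)
        change f (pr R (S m) k z) = 0 at h2
        rw [hzk] at h2
        exact hfz h2
      have h1 := hX.pr_mem_span m k hmem
      rw [hzk] at h1
      have hle : Submodule.span ℂ {y | ∃ a ∈ QuadAlg.aug R, ∃ l < k, ∃ x ∈ cyc X m,
          pr R (S m) l x = x ∧ y = a • x} ≤ (LinearMap.range (bd X m)).restrictScalars ℂ := by
        rw [Submodule.span_le]
        rintro _ ⟨a, -, l, hl, x, hx, hxl, rfl⟩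
        exact Submodule.smul_mem (LinearMap.range (bd X m)) a (ih l hl x hx hxl)
      exact hle h1
  intro z hz
  rw [← finsum_pr z]
  change _ ∈ LinearMap.range (bd X m)
  rw [finsum_eq_sum _ (finite_pr_ne_zero z)]
  exact Submodule.sum_mem _ fun k _ => key k _ (hX.pr_mem_cyc hz k) (by rw [pr_pr, if_pos rfl])

/-- A linear complex that is exact in internal degrees zero and one is exact if `A` is Koszul. -/
theorem exact_of_isKoszul [Unique (S 0)] (hX : IsLinearComplex X) (hK : IsKoszul R) (m : ℕ) :
    ∀ z ∈ cyc X m, ∃ y, bd X m y = z := by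
  -- The second clause is carried along the induction: the `Ext^1` of every iterated syzygy of the
  -- cycles sits in one internal degree. It yields exactness at the next spot and is transported
  -- there by dimension shifting.
  have main : ∀ m, (∀ z ∈ cyc X m, ∃ y, bd X m y = z) ∧
      ∀ i j, j ≠ i + m + 2 → ((subMod m (cyc X m)).omegaPow i).ExtOne j := by
    intro m
    induction m with
    | zero =>
      -- With a single generator in degree zero, the cycles there are `A_+`, so bar cohomology
      -- applies directly.
      let ψ : cyc X 0 ≃ₗ[ℂ] QuadAlg.aug R :=
        { toFun := fun z => ⟨(z : S 0 →₀ QuadAlg R) default, (QuadAlg.mem_aug R).2 (z.2 default)⟩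
          map_add' := fun _ _ => rfl
          map_smul' := fun _ _ => rfl
          invFun := fun a => ⟨Finsupp.single default (a : QuadAlg R), fun t => by
            rw [Subsingleton.elim t default, Finsupp.single_eq_same]
            exact (QuadAlg.mem_aug R).1 a.2⟩
          left_inv := fun z => Subtype.ext (Finsupp.ext fun t => by
            change (Finsupp.single default ((z : S 0 →₀ QuadAlg R) default) : S 0 →₀ QuadAlg R) t = _
            rw [Subsingleton.elim t default, Finsupp.single_eq_same])
          right_inv := fun a => Subtype.ext (by simp) }
      have hψ : ∀ z, (ψ z : QuadAlg R) = (z : S 0 →₀ QuadAlg R) default := fun _ => rfl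
      have hE : ∀ i j, j ≠ i + 2 → ((subMod 0 (cyc X 0)).omegaPow i).ExtOne j := by
        intro i j hij
        refine extOne_omegaPow_of_isKoszul hK (subMod 0 (cyc X 0)) ψ (fun a x => rfl) ?_ i j hij
        intro n x
        change _ ↔ (x : S 0 →₀ QuadAlg R) default ∈ QuadAlg.deg R n
        constructor
        · intro hx
          have : (x : S 0 →₀ QuadAlg R) default = QuadAlg.proj R n (x.1 default) := by
            rw [← sub_eq_zero]
            refine QuadAlg.eq_zero_of_proj fun l => ?_
            rw [map_sub, QuadAlg.proj_of_mem (QuadAlg.proj_mem n _)]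
            split_ifs with h
            · rw [h, sub_self]
            · have := hx l (by omega)
              rw [sub_zero, ← pr_apply]
              exact DFunLike.congr_fun this default
          rw [this]
          exact QuadAlg.proj_mem _ _
        · intro hx k hk
          refine Finsupp.ext fun t => ?_
          change pr R (S 0) k x.1 t = 0
          rw [pr_apply, Subsingleton.elim t default, QuadAlg.proj_of_mem hx, if_neg (by omega)]
      refine ⟨fun z hz => ?_, hE⟩
      -- The ideal `A_+` is generated by `V`, and elements of `V` are boundaries by exactness in
      -- internal degree one.
      have key : ∀ a ∈ QuadAlg.aug R,
          (Finsupp.single default a : S 0 →₀ QuadAlg R) ∈ LinearMap.range (bd X 0) := by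
        intro a ha
        induction ha using NonUnitalAlgebra.adjoin_induction with
        | mem x hx =>
          obtain ⟨v, rfl⟩ := hx
          refine hX.exact_one 0 _ (fun t => ?_) fun t => ?_
          · rw [Subsingleton.elim t default, Finsupp.single_eq_same, QuadAlg.eps_gen]
          · rw [Subsingleton.elim t default, Finsupp.single_eq_same]
            exact QuadAlg.gen_mem_deg R v
        | zero => simp
        | add x y _ _ hx hy => rw [Finsupp.single_add]; exact Submodule.add_mem _ hx hy
        | mul x y _ _ hx hy =>
          rw [← smul_eq_mul, ← Finsupp.smul_single]; exact Submodule.smul_mem _ x hy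
        | smul r x _ hx =>
          rw [← Finsupp.smul_single, ← algebraMap_smul (QuadAlg R) r]
          exact Submodule.smul_mem _ _ hx
      have e : z = Finsupp.single default (z default) := Finsupp.ext fun t => by
        rw [Subsingleton.elim t default, Finsupp.single_eq_same]
      rw [e]
      exact key _ ((QuadAlg.mem_aug R).2 (hz default))
    | succ m ih =>
      obtain ⟨Q, hQ⟩ := hX.exists_splitSeq ih.1
      refine ⟨hX.exact_of_functional (m + 1) ?_, ?_⟩
      · intro j hj ζ hζ hact
        refine Q.functional_eq_zero (ih.2 0 j (by omega)) ?_ ζ hζ hact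
        intro z
        rw [hQ]
        conv => enter [2]; rw [← Finsupp.sum_single (z : S (m + 1) →₀ QuadAlg R)]
        refine Submodule.sum_mem _ fun s _ => ?_
        -- Absence of constant coefficients means that the cycles lie in `A_+ F`, as
        -- `functional_eq_zero` requires.
        have hz : (z : S (m + 1) →₀ QuadAlg R) s ∈ QuadAlg.aug R := by
          rw [QuadAlg.mem_aug, ← QuadAlg.eps_proj_zero, ← pr_apply, hX.pr_zero_of_mem_cyc z.2]
          simp
        refine Submodule.subset_span ⟨⟨_, hz⟩, Finsupp.single s 1, ?_⟩
        rw [freeMod_act, Finsupp.smul_single, smul_eq_mul, mul_one]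
      · intro i j hij
        -- Dimension shifting trades one syzygy of `Z_m` for the step from `Z_m` to `Z_{m+1}`; the
        -- index `i + m + 2` is unchanged up to that exchange.
        exact (Q.omegaPow i).extOne_of_omega (ih.2 (i + 1) j (by omega))
  exact (main m).1

end IsLinearComplex

end LinearResolution

theorem neg_one_pow_mul_self (n : ℕ) : (-1 : ℂ) ^ n * (-1 : ℂ) ^ n = 1 := by
  rw [← mul_pow]; simp

theorem neg_one_pow_congr {k l : ℕ} (h : k % 2 = l % 2) : (-1 : ℂ) ^ k = (-1 : ℂ) ^ l := by
  rw [neg_one_pow_eq_pow_mod_two, h, ← neg_one_pow_eq_pow_mod_two]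

/-! ### Supercommutative algebras and their derivations. -/

section SuperAlg

/-- A supercommutative algebra with generators `g s` of parity `pr s`, and its parity
automorphism. -/
structure SuperAlg (C : Type u) [Ring C] [Algebra ℂ C] where
  /-- the index type of the generators -/
  Gen : Type u
  /-- the generators -/
  g : Gen → C
  /-- their parities -/
  pr : Gen → ℕ
  /-- the parity automorphism -/
  par : C →ₐ[ℂ] C
  par_g : ∀ s, par (g s) = (-1 : ℂ) ^ pr s • g s
  comm : ∀ s t, g s * g t = (-1 : ℂ) ^ (pr s * pr t) • (g t * g s)
  adjoin_eq_top : Algebra.adjoin ℂ (Set.range g) = ⊤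

namespace SuperAlg

variable {C : Type u} [Ring C] [Algebra ℂ C] (S : SuperAlg C)

theorem induction {p : C → Prop} (h1 : p 1) (hadd : ∀ a b, p a → p b → p (a + b))
    (hsmul : ∀ (r : ℂ) a, p a → p (r • a)) (hgen : ∀ s, p (S.g s))
    (hmul : ∀ a b, p a → p b → p (a * b)) (a : C) : p a := by
  have ha : a ∈ Algebra.adjoin ℂ (Set.range S.g) := by rw [S.adjoin_eq_top]; trivial
  induction ha using Algebra.adjoin_induction with
  | mem x hx => obtain ⟨s, rfl⟩ := hx; exact hgen s
  | algebraMap r => rw [Algebra.algebraMap_eq_smul_one]; exact hsmul r 1 h1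
  | add x y _ _ hx hy => exact hadd x y hx hy
  | mul x y _ _ hx hy => exact hmul x y hx hy

theorem hom_ext {D : Type w} [Ring D] [Algebra ℂ D] {f f' : C →ₐ[ℂ] D}
    (h : ∀ s, f (S.g s) = f' (S.g s)) : f = f' := by
  ext a
  induction a using S.induction with
  | h1 => simp
  | hadd a b ha hb => simp [ha, hb]
  | hsmul r a ha => simp [ha]
  | hgen s => exact h s
  | hmul a b ha hb => simp [ha, hb]

/-- The elements of parity `k`. -/
def hp (k : ℕ) : Submodule ℂ C where
  carrier := {a | S.par a = (-1 : ℂ) ^ k • a}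
  add_mem' := by
    intro a b ha hb
    simp only [Set.mem_ofPred_eq] at *
    rw [map_add, ha, hb, smul_add]
  zero_mem' := by simp
  smul_mem' := by
    intro c a ha
    simp only [Set.mem_ofPred_eq] at *
    rw [map_smul, ha, smul_comm]

variable {S}

theorem mem_hp {k : ℕ} {a : C} : a ∈ S.hp k ↔ S.par a = (-1 : ℂ) ^ k • a := Iff.rfl

theorem hp_congr {k l : ℕ} (h : k % 2 = l % 2) {a : C} (ha : a ∈ S.hp k) : a ∈ S.hp l := by
  rw [mem_hp] at *
  rw [ha, neg_one_pow_congr h]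

theorem g_mem_hp (s : S.Gen) : S.g s ∈ S.hp (S.pr s) := S.par_g s

theorem one_mem_hp : (1 : C) ∈ S.hp 0 := by rw [mem_hp]; simp

theorem mul_mem_hp {k l : ℕ} {a b : C} (ha : a ∈ S.hp k) (hb : b ∈ S.hp l) :
    a * b ∈ S.hp (k + l) := by
  rw [mem_hp] at *
  rw [map_mul, ha, hb, smul_mul_smul_comm, pow_add]

theorem parPow_of_mem {k : ℕ} {a : C} (ha : a ∈ S.hp k) (l : ℕ) :
    (S.par ^ l) a = (-1 : ℂ) ^ (l * k) • a := by
  induction l with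
  | zero => simp
  | succ l ih =>
    rw [pow_succ', AlgHom.mul_apply, ih, map_smul, mem_hp.1 ha, smul_smul, ← pow_add, add_mul,
      one_mul]

variable (S) in
theorem par_mul_par : S.par * S.par = 1 := by
  refine S.hom_ext fun s => ?_
  rw [AlgHom.mul_apply, S.par_g, map_smul, S.par_g, smul_smul, neg_one_pow_mul_self]
  simp

theorem parPow_congr {k l : ℕ} (h : k % 2 = l % 2) : S.par ^ k = S.par ^ l := by
  have key : ∀ k : ℕ, S.par ^ k = S.par ^ (k % 2) := fun k => by
    conv_lhs => rw [← Nat.div_add_mod k 2]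
    rw [pow_add, pow_mul, pow_two, par_mul_par, one_pow, one_mul]
  rw [key, h, ← key]

theorem mul_g (a : C) (s : S.Gen) : a * S.g s = S.g s * (S.par ^ S.pr s) a := by
  induction a using S.induction with
  | h1 => simp
  | hadd a b ha hb => rw [add_mul, ha, hb, map_add, mul_add]
  | hsmul r a ha => rw [smul_mul_assoc, ha, map_smul, mul_smul_comm]
  | hgen t => rw [S.comm, parPow_of_mem (g_mem_hp t), mul_smul_comm, mul_comm (S.pr t)]
  | hmul a b ha hb => rw [mul_assoc, hb, ← mul_assoc, ha, map_mul, mul_assoc]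

/-- An element of parity `k` commutes with all others up to the parity automorphism. -/
theorem mul_eq_of_mem {k : ℕ} {a : C} (ha : a ∈ S.hp k) (b : C) :
    a * b = (S.par ^ k) b * a := by
  induction b using S.induction with
  | h1 => simp
  | hadd b c hb hc => rw [mul_add, hb, hc, map_add, add_mul]
  | hsmul r b hb => rw [mul_smul_comm, hb, map_smul, smul_mul_assoc]
  | hgen t =>
    rw [mul_g, parPow_of_mem ha, parPow_of_mem (g_mem_hp t), mul_smul_comm, smul_mul_assoc,
      mul_comm k]
  | hmul b c hb hc => rw [← mul_assoc, hb, mul_assoc, hc, map_mul, mul_assoc]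

theorem mul_comm_of_mem {k l : ℕ} {a b : C} (ha : a ∈ S.hp k) (hb : b ∈ S.hp l) :
    a * b = (-1 : ℂ) ^ (k * l) • (b * a) := by
  rw [mul_eq_of_mem ha, parPow_of_mem hb, smul_mul_assoc]

variable (S) in
/-- A derivation of parity `k`. -/
structure IsDer (k : ℕ) (D : C →ₗ[ℂ] C) : Prop where
  mul : ∀ a b, D (a * b) = D a * b + (S.par ^ k) a * D b
  par : ∀ a, D (S.par a) = (-1 : ℂ) ^ k • S.par (D a)

namespace IsDer

variable {k l : ℕ} {D D' : C →ₗ[ℂ] C}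

theorem congr (h : k % 2 = l % 2) (hD : S.IsDer k D) : S.IsDer l D where
  mul a b := by rw [hD.mul, parPow_congr h]
  par a := by rw [hD.par, neg_one_pow_congr h]

theorem one (hD : S.IsDer k D) : D 1 = 0 := by
  have h := hD.mul 1 1
  simpa using h

theorem parPow (hD : S.IsDer k D) (l : ℕ) (a : C) :
    D ((S.par ^ l) a) = (-1 : ℂ) ^ (k * l) • (S.par ^ l) (D a) := by
  induction l with
  | zero => simp
  | succ l ih =>
    rw [pow_succ', AlgHom.mul_apply, hD.par, ih, AlgHom.mul_apply, map_smul, smul_smul, ← pow_add,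
      mul_add, mul_one, add_comm]

theorem mem_hp (hD : S.IsDer k D) {l : ℕ} {a : C} (ha : a ∈ S.hp l) : D a ∈ S.hp (k + l) := by
  have h := hD.par a
  rw [SuperAlg.mem_hp.1 ha, map_smul] at h
  rw [SuperAlg.mem_hp, pow_add, mul_smul, h, smul_smul, neg_one_pow_mul_self, one_smul]

theorem mul_of_mem (hD : S.IsDer k D) {l : ℕ} {a : C} (ha : a ∈ S.hp l) (b : C) :
    D (a * b) = D a * b + (-1 : ℂ) ^ (k * l) • (a * D b) := by
  rw [hD.mul, parPow_of_mem ha, smul_mul_assoc]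

theorem smul (hD : S.IsDer k D) (c : ℂ) : S.IsDer k (c • D) where
  mul a b := by simp [hD.mul, smul_add]
  par a := by simp [hD.par, smul_comm c]

theorem add (hD : S.IsDer k D) (hD' : S.IsDer k D') : S.IsDer k (D + D') where
  mul a b := by simp only [LinearMap.add_apply, hD.mul, hD'.mul, add_mul, mul_add]; abel
  par a := by simp only [LinearMap.add_apply, hD.par, hD'.par, map_add, smul_add]

/-- The graded commutator of derivations is a derivation. -/
theorem commutator (hD : S.IsDer k D) (hD' : S.IsDer l D') :
    S.IsDer (k + l) (D ∘ₗ D' - (-1 : ℂ) ^ (k * l) • (D' ∘ₗ D)) where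
  mul a b := by
    have e : (S.par ^ l) ((S.par ^ k) a) = (S.par ^ (k + l)) a := by
      rw [add_comm, pow_add, AlgHom.mul_apply]
    have e' : (S.par ^ k) ((S.par ^ l) a) = (S.par ^ (k + l)) a := by
      rw [pow_add, AlgHom.mul_apply]
    simp only [LinearMap.sub_apply, LinearMap.comp_apply, LinearMap.smul_apply, hD.mul, hD'.mul,
      map_add, hD.parPow, hD'.parPow, smul_mul_assoc, e, e', smul_add, smul_smul, sub_mul, mul_sub,
      mul_smul_comm, mul_comm l k, neg_one_pow_mul_self, one_smul]
    abel
  par a := by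
    simp only [LinearMap.sub_apply, LinearMap.comp_apply, LinearMap.smul_apply, hD.par, hD'.par,
      map_smul, map_sub, smul_sub, smul_smul, pow_add]
    congr 2 <;> ring

theorem ext (hD : S.IsDer k D) (hD' : S.IsDer k D') (h : ∀ s, D (S.g s) = D' (S.g s)) : D = D' := by
  ext a
  induction a using S.induction with
  | h1 => rw [hD.one, hD'.one]
  | hadd b c hb hc => rw [map_add, hb, hc, map_add]
  | hsmul r b hb => rw [map_smul, hb, map_smul]
  | hgen t => exact h t
  | hmul b c hb hc => rw [hD.mul, hD'.mul, hb, hc]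

end IsDer

/-- The skew-derivation encoded by a homomorphism `b ↦ !![σ b, δ b; 0, b]`. -/
def matDer (M : C →ₐ[ℂ] Matrix (Fin 2) (Fin 2) C) : C →ₗ[ℂ] C where
  toFun b := M b 0 1
  map_add' a b := by simp
  map_smul' c a := by simp

/-- The diagonal entries and the zero corner are fixed by their values on generators.
Multiplicativity in the upper right corner is then the twisted Leibniz rule. -/
theorem isDer_matDer (k : ℕ) (M : C →ₐ[ℂ] Matrix (Fin 2) (Fin 2) C)
    (δ : S.Gen → C) (hδ : ∀ s, δ s ∈ S.hp (S.pr s + k))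
    (hM : ∀ s, M (S.g s) = !![(-1 : ℂ) ^ (k * S.pr s) • S.g s, δ s; 0, S.g s]) :
    S.IsDer k (matDer M) := by
  have h : ∀ b, M b 1 0 = 0 ∧ M b 1 1 = b ∧ M b 0 0 = (S.par ^ k) b := by
    intro b
    induction b using S.induction with
    | h1 => simp
    | hadd b c hb hc => simp [hb.1, hb.2.1, hc.1, hc.2.1, hb.2.2, hc.2.2]
    | hsmul r b hb => simp [hb.1, hb.2.1, hb.2.2]
    | hgen t => rw [hM, parPow_of_mem (g_mem_hp t)]; simp
    | hmul b c hb hc =>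
      simp [Matrix.mul_apply, Fin.sum_univ_two, hb.1, hb.2.1, hc.1, hc.2.1, hb.2.2, hc.2.2]
  have hmul : ∀ a b, matDer M (a * b) = matDer M a * b + (S.par ^ k) a * matDer M b := by
    intro a b
    change M (a * b) 0 1 = M a 0 1 * b + _ * M b 0 1
    simp [Matrix.mul_apply, Fin.sum_univ_two, (h a).2.2, (h b).2.1, add_comm]
  refine ⟨hmul, fun a => ?_⟩
  induction a using S.induction with
  | h1 =>
    have : matDer M 1 = 0 := by change M 1 0 1 = 0; simp
    simp [this]
  | hadd b c hb hc => simp only [map_add, hb, hc, smul_add]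
  | hsmul r b hb => simp only [map_smul, hb, smul_comm r]
  | hgen t =>
    have : matDer M (S.g t) = δ t := by change M (S.g t) 0 1 = _; rw [hM]; simp
    rw [S.par_g, map_smul, this, mem_hp.1 (hδ t), smul_smul, pow_add, mul_left_comm,
      neg_one_pow_mul_self, mul_one]
  | hmul b c hb hc =>
    have e : (S.par ^ k) (S.par b) = S.par ((S.par ^ k) b) := by
      rw [← AlgHom.mul_apply, ← pow_succ, pow_succ', AlgHom.mul_apply]
    rw [map_mul, hmul, hb, hc, hmul, map_add, map_mul, map_mul, smul_add, e, smul_mul_assoc,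
      mul_smul_comm]

end SuperAlg

end SuperAlg

/-! ### Derivations of free graded-commutative algebras. -/

namespace FGC

variable {ι : Type} [DecidableEq ι] (pr : ι → ℕ) {P : ι → Type v} [∀ i, AddCommGroup (P i)]
  [∀ i, Module ℂ (P i)]

/-- The parity automorphism of a free graded-commutative algebra. -/
def par : FGC pr P →ₐ[ℂ] FGC pr P :=
  lift pr (fun i => (-1 : ℂ) ^ pr i • gen pr i) fun i j x y => by
    simp only [LinearMap.smul_apply, smul_mul_smul_comm]
    rw [gen_mul_gen, mul_comm ((-1 : ℂ) ^ pr i), smul_comm]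

/-- A free graded-commutative algebra as a supercommutative algebra. -/
def super : SuperAlg (FGC pr P) where
  Gen := Σ i, P i
  g := sgen pr
  pr s := pr s.1
  par := par pr
  par_g s := by rw [sgen, par, lift_gen]; rfl
  comm s t := gen_mul_gen pr _ _ _ _
  adjoin_eq_top := adjoin_eq_top pr

theorem gen_mem_hp (i : ι) (x : P i) : gen pr i x ∈ (super pr (P := P)).hp (pr i) :=
  SuperAlg.g_mem_hp (S := super pr) ⟨i, x⟩

/-- The homomorphism that encodes the derivation of parity `k` with given values on the
generators. -/
def derMat (k : ℕ) (δ : ∀ i, P i →ₗ[ℂ] FGC pr P)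
    (hδ : ∀ i x, δ i x ∈ (super pr (P := P)).hp (pr i + k)) :
    FGC pr P →ₐ[ℂ] Matrix (Fin 2) (Fin 2) (FGC pr P) :=
  lift pr (fun i =>
    { toFun := fun x => !![(-1 : ℂ) ^ (k * pr i) • gen pr i x, δ i x; 0, gen pr i x]
      map_add' := fun a b => by
        ext i j
        fin_cases i <;> fin_cases j <;> simp
      map_smul' := fun c a => by
        ext i j
        fin_cases i <;> fin_cases j <;> simp [smul_comm c] }) (by
    intro p q φ ψ
    have h1 := gen_mul_gen pr p q φ ψ
    have h2 := SuperAlg.mul_comm_of_mem (hδ p φ) (gen_mem_hp pr q ψ)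
    have h3 := SuperAlg.mul_comm_of_mem (hδ q ψ) (gen_mem_hp pr p φ)
    have s1 : (-1 : ℂ) ^ (pr p * pr q) * (-1 : ℂ) ^ (k * pr q) = (-1 : ℂ) ^ ((pr p + k) * pr q) := by
      rw [← pow_add]; congr 1; ring
    have s2 : (-1 : ℂ) ^ (pr p * pr q) * (-1 : ℂ) ^ ((pr q + k) * pr p) =
        (-1 : ℂ) ^ (k * pr p) := by
      rw [show (pr q + k) * pr p = pr p * pr q + k * pr p by ring, pow_add, ← mul_assoc,
        neg_one_pow_mul_self, one_mul]
    ext i j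
    fin_cases i <;> fin_cases j
    · simp [Matrix.mul_apply, Fin.sum_univ_two]
      rw [h1]
      simp only [smul_smul]
      congr 1
      ring
    · simp [Matrix.mul_apply, Fin.sum_univ_two]
      rw [h2, h3]
      simp only [smul_smul, s1, s2]
      rw [add_comm]
    · simp [Matrix.mul_apply, Fin.sum_univ_two]
    · simp [Matrix.mul_apply, Fin.sum_univ_two]
      exact h1)

/-- The derivation of parity `k` with given values on the generators. -/
def der (k : ℕ) (δ : ∀ i, P i →ₗ[ℂ] FGC pr P)
    (hδ : ∀ i x, δ i x ∈ (super pr (P := P)).hp (pr i + k)) : FGC pr P →ₗ[ℂ] FGC pr P :=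
  SuperAlg.matDer (derMat pr k δ hδ)

variable (k : ℕ) (δ : ∀ i, P i →ₗ[ℂ] FGC pr P)
    (hδ : ∀ i x, δ i x ∈ (super pr (P := P)).hp (pr i + k))

theorem isDer_der : (super pr).IsDer k (der pr k δ hδ) :=
  SuperAlg.isDer_matDer (S := super pr) k _ (fun s => δ s.1 s.2) (fun s => hδ s.1 s.2)
    fun ⟨i, x⟩ => lift_gen pr _ _ i x

theorem der_gen (i : ι) (x : P i) : der pr k δ hδ (gen pr i x) = δ i x := by
  change derMat pr k δ hδ (gen pr i x) 0 1 = _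
  simp [derMat]

end FGC

/-! ### The differential of `CE(L)` as an odd derivation. -/

namespace CE

variable {L : Type v} [AddCommGroup L] [Module ℂ L] (G : GradedLieSuperalgebra L)

/-- The parity automorphism of `CE(L)`. -/
def par : CE G →ₐ[ℂ] CE G :=
  lift G (fun p => (-1 : ℂ) ^ (p + 1) • gen G p) fun i j x y => by
    simp only [LinearMap.smul_apply, smul_mul_smul_comm]
    rw [gen_mul_gen, mul_comm ((-1 : ℂ) ^ (i + 1)), smul_comm]

/-- `CE(L)` as a supercommutative algebra. -/
def super : SuperAlg (CE G) where
  Gen := Σ p, Module.Dual ℂ (G.comp p)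
  g := sgen G
  pr s := s.1 + 1
  par := par G
  par_g s := by rw [sgen, par, lift_gen]; rfl
  comm s t := gen_mul_gen G _ _ _ _
  adjoin_eq_top := adjoin_eq_top G

theorem gen_mem_hp (p : ℕ) (x : Module.Dual ℂ (G.comp p)) : gen G p x ∈ (super G).hp (p + 1) :=
  SuperAlg.g_mem_hp (S := super G) ⟨p, x⟩

theorem mulGen_tmul (i j : ℕ) (φ : Module.Dual ℂ (G.comp i)) (ψ : Module.Dual ℂ (G.comp j)) :
    mulGen G i j (φ ⊗ₜ ψ) = gen G i φ * gen G j ψ := by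
  simp [mulGen]

variable [∀ m, FiniteDimensional ℂ (G.comp m)]

/-- The values of the map dual to the bracket lie in any submodule that contains the products
`L_i^* L_j^*` for `i + j = n`. -/
theorem dualBracket_mem {n : ℕ} {M : Submodule ℂ (CE G)}
    (hM : ∀ i j, i + j = n → ∀ φ ψ, gen G i φ * gen G j ψ ∈ M) (φ : Module.Dual ℂ (G.comp n)) :
    dualBracket G n φ ∈ M := by
  simp only [dualBracket, LinearMap.smul_apply, LinearMap.sum_apply, LinearMap.comp_apply]
  refine M.smul_mem _ (M.sum_mem fun x _ => M.smul_mem _ ?_)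
  generalize (TensorProduct.dualDistribEquiv ℂ (G.comp x.1.1) (G.comp x.1.2)).symm.toLinearMap _ = t
  induction t using TensorProduct.induction_on with
  | zero => simp
  | add x y hx hy => rw [map_add]; exact M.add_mem hx hy
  | tmul a b =>
    rw [mulGen_tmul]
    exact hM _ _ (Finset.HasAntidiagonal.mem_antidiagonal.mp x.2) a b

theorem dualBracket_mem_hp (p : ℕ) (φ : Module.Dual ℂ (G.comp p)) :
    dualBracket G p φ ∈ (super G).hp p :=
  dualBracket_mem G (fun i j h φ ψ => SuperAlg.hp_congr (by omega)
    (SuperAlg.mul_mem_hp (gen_mem_hp G i φ) (gen_mem_hp G j ψ))) φ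

theorem mat_gen (p : ℕ) (φ : Module.Dual ℂ (G.comp p)) : mat G (gen G p φ) = matGen G p φ := by
  have : mat G (gen G p φ) =
      TensorAlgebra.lift ℂ (DirectSum.toModule ℂ ℕ _ (matGen G)) (preGen G p φ) :=
    RingQuot.liftAlgHom_mkAlgHom_apply _ _ _ _
  rw [this]
  simp [preGen]

theorem isDer_d : (super G).IsDer 1 (d G) :=
  SuperAlg.isDer_matDer (S := super G) 1 (mat G) (fun s => dualBracket G s.1 s.2)
    (fun ⟨p, φ⟩ => SuperAlg.hp_congr (k := p) (l := p + 1 + 1) (by omega)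
      (dualBracket_mem_hp G p φ))
    fun ⟨p, φ⟩ => by
      change mat G (gen G p φ) = !![(-1 : ℂ) ^ (1 * (p + 1)) • gen G p φ, _; 0, gen G p φ]
      rw [mat_gen, one_mul]
      rfl

theorem d_gen (p : ℕ) (φ : Module.Dual ℂ (G.comp p)) : d G (gen G p φ) = dualBracket G p φ := by
  change mat G (gen G p φ) 0 1 = _
  simp [mat_gen, matGen]

end CE

theorem neg_one_pow_of_eq {k l : ℕ} (t : ℕ) (h : k = l + 2 * t) : (-1 : ℂ) ^ k = (-1 : ℂ) ^ l :=
  neg_one_pow_congr (by omega)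

theorem sum_cyc {ι : Type*} [Fintype ι] {M : Type*} [AddCommMonoid M] (f : ι → ι → ι → M) :
    ∑ a, ∑ b, ∑ c, f a b c = ∑ a, ∑ b, ∑ c, f b c a := by
  symm
  rw [Finset.sum_comm]
  exact Finset.sum_congr rfl fun _ _ => Finset.sum_comm

theorem SuperAlg.IsDer.zero {C : Type u} [Ring C] [Algebra ℂ C] {S : SuperAlg C} (k : ℕ) :
    S.IsDer k 0 :=
  ⟨fun a b => by simp, fun a => by simp⟩

/-- An odd derivation has square zero if its square vanishes on the generators. -/
theorem SuperAlg.IsDer.sq_eq_zero {C : Type u} [Ring C] [Algebra ℂ C] {S : SuperAlg C}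
    {D : C →ₗ[ℂ] C} (hD : S.IsDer 1 D) (h : ∀ s, D (D (S.g s)) = 0) (a : C) : D (D a) = 0 := by
  -- The graded commutator of an odd derivation with itself is twice its square, and it is a
  -- derivation, so it is determined by the generators.
  have h := DFunLike.congr_fun ((hD.commutator hD).ext (.zero _) fun s => by simp [h]) a
  simp only [LinearMap.sub_apply, LinearMap.smul_apply, LinearMap.comp_apply, LinearMap.zero_apply,
    mul_one, pow_one, neg_smul, one_smul, sub_neg_eq_add, ← two_smul ℂ (D (D a))] at h
  exact (smul_eq_zero.1 h).resolve_left (by norm_num)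

/-! ### Truncated homogeneous bases of `L`. -/

namespace GradedLieSuperalgebra

variable {L : Type v} [AddCommGroup L] [Module ℂ L] (G : GradedLieSuperalgebra L)

theorem br_mem_of_eq {i j n : ℕ} (h : i + j = n) {x y : L} (hx : x ∈ G.comp i)
    (hy : y ∈ G.comp j) : G.br x y ∈ G.comp n := h ▸ G.br_mem hx hy

/-- The decomposition of `L` into its components. -/
def decomp : (⨁ p, G.comp p) ≃ₗ[ℂ] L :=
  LinearEquiv.ofBijective (DirectSum.coeLinearMap G.comp) (by exact G.isInternal)

/-- The projection to the component of degree `p`. -/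
def proj (p : ℕ) : L →ₗ[ℂ] G.comp p :=
  DirectSum.component ℂ ℕ (fun p => G.comp p) p ∘ₗ G.decomp.symm.toLinearMap

theorem symm_coe {p : ℕ} (x : G.comp p) :
    G.decomp.symm (x : L) = DirectSum.lof ℂ ℕ (fun p => G.comp p) p x := by
  rw [LinearEquiv.symm_apply_eq]
  exact (DirectSum.coeLinearMap_lof _ _ _).symm

@[simp]
theorem proj_coe {p : ℕ} (x : G.comp p) : G.proj p x = x := by
  simp only [proj, LinearMap.comp_apply, LinearEquiv.coe_coe, symm_coe]
  exact DirectSum.component.lof_self ℂ _ _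

theorem proj_of_ne {p q : ℕ} (h : p ≠ q) {x : L} (hx : x ∈ G.comp p) : G.proj q x = 0 := by
  lift x to G.comp p using hx
  simp only [proj, LinearMap.comp_apply, LinearEquiv.coe_coe, symm_coe]
  rw [DirectSum.component.of, dif_neg h]

theorem proj_of_mem {p : ℕ} {x : L} (hx : x ∈ G.comp p) : G.proj p x = ⟨x, hx⟩ :=
  G.proj_coe ⟨x, hx⟩

theorem dual_comp_zero (φ : Module.Dual ℂ (G.comp 0)) : φ = 0 := by
  ext x
  have : x = 0 := by
    have h : (x : L) ∈ (⊥ : Submodule ℂ L) := G.comp_zero ▸ x.2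
    exact Subtype.ext ((Submodule.mem_bot ℂ).1 h)
  rw [this, map_zero, map_zero]

/-- The form on `L` that extends a form on `L_p` by zero. -/
def ext (p : ℕ) : Module.Dual ℂ (G.comp p) →ₗ[ℂ] Module.Dual ℂ L :=
  (G.proj p).dualMap

theorem ext_apply (p : ℕ) (φ : Module.Dual ℂ (G.comp p)) (x : L) : G.ext p φ x = φ (G.proj p x) :=
  rfl

theorem ext_of_ne {p q : ℕ} (h : p ≠ q) {x : L} (hx : x ∈ G.comp p)
    (φ : Module.Dual ℂ (G.comp q)) : G.ext q φ x = 0 := by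
  rw [ext_apply, G.proj_of_ne h hx, map_zero]

variable [∀ m, FiniteDimensional ℂ (G.comp m)]

/-- The index set of a homogeneous basis of `⨁_{p ≤ N} L_p`. -/
abbrev Idx (N : ℕ) : Type := Σ p : Fin (N + 1), Fin (Module.finrank ℂ (G.comp p))

variable {N : ℕ}

/-- The degree of a basis element. -/
abbrev wt (a : G.Idx N) : ℕ := a.1

/-- The basis elements. -/
def bas (a : G.Idx N) : L := Module.finBasis ℂ (G.comp a.1) a.2

/-- The dual basis. -/
def dbas (a : G.Idx N) : Module.Dual ℂ (G.comp (G.wt a)) := (Module.finBasis ℂ (G.comp a.1)).coord a.2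

theorem wt_le (a : G.Idx N) : G.wt a ≤ N := Nat.lt_succ_iff.1 a.1.2

theorem bas_mem (a : G.Idx N) : G.bas a ∈ G.comp (G.wt a) := Subtype.coe_prop _

/-- Every form on `L_p` is a combination of the elements of the dual basis. -/
theorem sum_dbas {M : Type w} [AddCommGroup M] [Module ℂ M]
    (F : ∀ p, Module.Dual ℂ (G.comp p) →ₗ[ℂ] M) {p : ℕ} (hp : p ≤ N)
    (φ : Module.Dual ℂ (G.comp p)) :
    ∑ a : G.Idx N, G.ext p φ (G.bas a) • F (G.wt a) (G.dbas a) = F p φ := by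
  rw [Fintype.sum_sigma, Finset.sum_eq_single (⟨p, by omega⟩ : Fin (N + 1))]
  · have h : ∀ k, G.ext p φ (G.bas (⟨⟨p, by omega⟩, k⟩ : G.Idx N)) =
        φ (Module.finBasis ℂ (G.comp p) k) := fun k => by
      rw [ext_apply]; congr 1; exact G.proj_coe _
    simp only [h]
    have h2 := (Module.finBasis ℂ (G.comp p)).sum_dual_apply_smul_coord φ
    conv_rhs => rw [← h2]
    rw [map_sum]
    refine Finset.sum_congr rfl fun k _ => ?_
    rw [map_smul]; rfl
  · rintro ⟨q, hq⟩ - hne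
    refine Finset.sum_eq_zero fun k _ => ?_
    rw [G.ext_of_ne (fun h => hne (Fin.ext h)) (G.bas_mem ⟨⟨q, hq⟩, k⟩) φ, zero_smul]
  · simp

/-- Every element of `L_p` is a combination of basis elements. -/
theorem sum_bas {p : ℕ} (hp : p ≤ N) {y : L} (hy : y ∈ G.comp p) :
    ∑ a : G.Idx N, G.ext (G.wt a) (G.dbas a) y • G.bas a = y := by
  rw [Fintype.sum_sigma, Finset.sum_eq_single (⟨p, by omega⟩ : Fin (N + 1))]
  · have h2 := (Module.finBasis ℂ (G.comp p)).sum_repr ⟨y, hy⟩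
    conv_rhs => rw [← show _ = y from congrArg Subtype.val h2]
    rw [AddSubmonoidClass.coe_finsetSum]
    refine Finset.sum_congr rfl fun k _ => ?_
    rw [ext_apply, show G.proj (G.wt (⟨⟨p, by omega⟩, k⟩ : G.Idx N)) y = ⟨y, hy⟩ from
      G.proj_of_mem hy]
    rfl
  · rintro ⟨q, hq⟩ - hne
    refine Finset.sum_eq_zero fun k _ => ?_
    rw [G.ext_of_ne (q := q) (fun h => hne (Fin.ext h.symm)) hy, zero_smul]
  · simp

/-- The expansion of a bilinear expression `F` in a form on `L_i ⊗ L_j`. -/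
theorem sum_tensor_dbas {M : Type w} [AddCommGroup M] [Module ℂ M] (i j : ℕ)
    (F : Module.Dual ℂ (G.comp i) ⊗[ℂ] Module.Dual ℂ (G.comp j) →ₗ[ℂ] M)
    (ψ : Module.Dual ℂ (G.comp i ⊗[ℂ] G.comp j)) :
    F ((TensorProduct.dualDistribEquiv ℂ (G.comp i) (G.comp j)).symm ψ) =
      ∑ k, ∑ l, ψ (Module.finBasis ℂ (G.comp i) k ⊗ₜ Module.finBasis ℂ (G.comp j) l) •
        F ((Module.finBasis ℂ (G.comp i)).coord k ⊗ₜ (Module.finBasis ℂ (G.comp j)).coord l) := by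
  have : (TensorProduct.dualDistribEquiv ℂ (G.comp i) (G.comp j)).symm ψ =
      ∑ k, ∑ l, ψ (Module.finBasis ℂ (G.comp i) k ⊗ₜ Module.finBasis ℂ (G.comp j) l) •
        ((Module.finBasis ℂ (G.comp i)).coord k ⊗ₜ (Module.finBasis ℂ (G.comp j)).coord l) := by
    rw [LinearEquiv.symm_apply_eq]
    refine ((Module.finBasis ℂ (G.comp i)).tensorProduct (Module.finBasis ℂ (G.comp j))).ext ?_
    rintro ⟨k, l⟩
    have e : ∀ t, TensorProduct.dualDistribEquiv ℂ (G.comp i) (G.comp j) t =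
      TensorProduct.dualDistrib ℂ (G.comp i) (G.comp j) t := fun t => rfl
    rw [e]
    simp [Module.Basis.tensorProduct_apply, LinearMap.sum_apply, TensorProduct.dualDistrib_apply,
      Finsupp.single_apply]
  rw [this]
  simp only [map_sum, map_smul]

end GradedLieSuperalgebra

/-! ### The square of the Chevalley–Eilenberg differential. -/

namespace CE

variable {L : Type v} [AddCommGroup L] [Module ℂ L] (G : GradedLieSuperalgebra L)
  [∀ m, FiniteDimensional ℂ (G.comp m)] {N : ℕ}

/-- The generators of `CE(L)` that correspond to basis elements. -/
def bgen (a : G.Idx N) : CE G := gen G (G.wt a) (G.dbas a)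

theorem bgen_mem_hp (a : G.Idx N) : bgen G a ∈ (super G).hp (G.wt a + 1) := gen_mem_hp G _ _

/-- The map dual to the bracket in terms of a basis. -/
theorem dualBracket_eq_sum {n : ℕ} (hn : n ≤ N) (φ : Module.Dual ℂ (G.comp n)) :
    dualBracket G n φ = (1 / 2 : ℂ) • ∑ a : G.Idx N, ∑ b : G.Idx N,
      ((-1 : ℂ) ^ (G.wt a + 1) * G.ext n φ (G.br (G.bas a) (G.bas b))) •
        (bgen G a * bgen G b) := by
  let F : ℕ → ℕ → CE G := fun i j =>
    ∑ k : Fin (Module.finrank ℂ (G.comp i)), ∑ l : Fin (Module.finrank ℂ (G.comp j)),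
      ((-1 : ℂ) ^ (i + 1) * G.ext n φ (G.br (Module.finBasis ℂ (G.comp i) k)
        (Module.finBasis ℂ (G.comp j) l))) •
        (gen G i ((Module.finBasis ℂ (G.comp i)).coord k) *
          gen G j ((Module.finBasis ℂ (G.comp j)).coord l))
  -- Only pairs of degrees summing to `n` contribute, so the antidiagonal sum may be replaced by a
  -- sum over all pairs of basis elements.
  have hF : ∀ i j, i + j ≠ n → F i j = 0 := fun i j h => by
    refine Finset.sum_eq_zero fun k _ => Finset.sum_eq_zero fun l _ => ?_
    rw [G.ext_of_ne h (G.br_mem (Subtype.coe_prop _) (Subtype.coe_prop _)), mul_zero, zero_smul]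
  have h1 : dualBracket G n φ = (1 / 2 : ℂ) •
      ∑ x ∈ Finset.HasAntidiagonal.antidiagonal n, F x.1 x.2 := by
    rw [dualBracket, LinearMap.smul_apply, LinearMap.sum_apply,
      ← Finset.sum_attach (Finset.HasAntidiagonal.antidiagonal n)]
    congr 1
    refine Finset.sum_congr rfl fun x _ => ?_
    have hx := Finset.HasAntidiagonal.mem_antidiagonal.mp x.2
    rw [LinearMap.smul_apply, LinearMap.comp_apply, LinearMap.comp_apply, LinearEquiv.coe_coe,
      G.sum_tensor_dbas, Finset.smul_sum]
    refine Finset.sum_congr rfl fun k _ => ?_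
    rw [Finset.smul_sum]
    refine Finset.sum_congr rfl fun l _ => ?_
    rw [smul_smul, mulGen_tmul, GradedLieSuperalgebra.ext_apply,
      G.proj_of_mem (G.br_mem_of_eq hx (Subtype.coe_prop _) (Subtype.coe_prop _))]
    rfl
  rw [h1]
  congr 1
  have h2 : ∑ a : G.Idx N, ∑ b : G.Idx N,
      ((-1 : ℂ) ^ (G.wt a + 1) * G.ext n φ (G.br (G.bas a) (G.bas b))) • (bgen G a * bgen G b) =
      ∑ i : Fin (N + 1), ∑ j : Fin (N + 1), F i j := by
    rw [Fintype.sum_sigma]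
    refine Finset.sum_congr rfl fun i _ => ?_
    rw [Finset.sum_comm, Fintype.sum_sigma]
    refine Finset.sum_congr rfl fun j _ => ?_
    rw [Finset.sum_comm]
    rfl
  rw [h2]
  have h3 : ∑ i : Fin (N + 1), ∑ j : Fin (N + 1), F i j =
      ∑ i ∈ Finset.range (N + 1), ∑ j ∈ Finset.range (N + 1), F i j := by
    rw [← Fin.sum_univ_eq_sum_range (fun i => ∑ j ∈ Finset.range (N + 1), F i j)]
    exact Finset.sum_congr rfl fun i _ => Fin.sum_univ_eq_sum_range (fun j => F i j) _
  rw [h3, ← Finset.sum_product']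
  refine Finset.sum_subset ?_ ?_
  · rintro ⟨i, j⟩ h
    have h := Finset.HasAntidiagonal.mem_antidiagonal.mp h
    simp only [Finset.mem_product, Finset.mem_range]
    omega
  · rintro ⟨i, j⟩ - h
    exact hF i j fun hij => h (Finset.HasAntidiagonal.mem_antidiagonal.mpr hij)

/-- The first half of the computation of the square of the differential. -/
theorem d_dualBracket_eq_sum {n : ℕ} (φ : Module.Dual ℂ (G.comp n)) :
    d G (dualBracket G n φ) = ∑ a : G.Idx n, ∑ b : G.Idx n,
      G.ext n φ (G.br (G.bas a) (G.bas b)) • (bgen G a * dualBracket G _ (G.dbas b)) := by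
  set D : G.Idx n → CE G := fun b => dualBracket G _ (G.dbas b) with hD
  have hd : ∀ a : G.Idx n, d G (bgen G a) = D a := fun a => d_gen G _ _
  -- The Leibniz rule gives two terms. Graded commutativity and the skew-symmetry of the bracket
  -- turn one into the other with `a` and `b` exchanged, which absorbs the factor `1/2`.
  have h1 : d G (dualBracket G n φ) = (1 / 2 : ℂ) • ∑ a : G.Idx n, ∑ b : G.Idx n,
      (G.ext n φ (G.br (G.bas b) (G.bas a)) • (bgen G b * D a) +
        G.ext n φ (G.br (G.bas a) (G.bas b)) • (bgen G a * D b)) := by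
    rw [dualBracket_eq_sum G le_rfl, map_smul, map_sum]
    congr 1
    refine Finset.sum_congr rfl fun a _ => ?_
    rw [map_sum]
    refine Finset.sum_congr rfl fun b _ => ?_
    rw [map_smul, (isDer_d G).mul_of_mem (bgen_mem_hp G a), hd, hd,
      SuperAlg.mul_comm_of_mem (dualBracket_mem_hp G _ _) (bgen_mem_hp G b), smul_add, smul_smul,
      smul_smul, G.skew (G.bas_mem b) (G.bas_mem a), map_neg, map_smul, smul_eq_mul]
    congr 2
    · rw [mul_right_comm, ← pow_add, neg_one_pow_of_eq (G.wt a)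
        (show G.wt a + 1 + G.wt a * (G.wt b + 1) = G.wt b * G.wt a + 1 + 2 * G.wt a by ring),
        pow_succ]
      ring
    · rw [mul_right_comm, one_mul, neg_one_pow_mul_self, one_mul]
  rw [h1]
  simp only [Finset.sum_add_distrib]
  rw [Finset.sum_comm, ← two_smul ℂ, smul_smul]
  norm_num [hD]

/-- The result is cubic with coefficients `φ([a, [b, c]])`. Its monomials are invariant under cyclic
permutations up to sign, and these signs are those of the Jacobi identity; averaging over the three
rotations gives zero. -/
theorem d_dualBracket {n : ℕ} (φ : Module.Dual ℂ (G.comp n)) : d G (dualBracket G n φ) = 0 := by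
  let J : G.Idx n → G.Idx n → G.Idx n → ℂ := fun a b c =>
    G.ext n φ (G.br (G.bas a) (G.br (G.bas b) (G.bas c)))
  let M : G.Idx n → G.Idx n → G.Idx n → CE G := fun a b c => bgen G a * (bgen G b * bgen G c)
  let S : CE G := ∑ a, ∑ b, ∑ c, ((-1 : ℂ) ^ (G.wt b + 1) * J a b c) • M a b c
  have h1 : d G (dualBracket G n φ) = (1 / 2 : ℂ) • S := by
    rw [d_dualBracket_eq_sum]
    simp only [S, Finset.smul_sum]
    refine Finset.sum_congr rfl fun a _ => ?_
    -- The inner bracket is expanded in the basis. The truncation at weight `n` is harmless: if the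
    -- inner bracket has larger weight, both sides vanish.
    have hJ : ∀ c e : G.Idx n, J a c e = ∑ b : G.Idx n,
        G.ext n φ (G.br (G.bas a) (G.bas b)) *
          G.ext _ (G.dbas b) (G.br (G.bas c) (G.bas e)) := by
      intro c e
      have hm := G.br_mem (G.bas_mem c) (G.bas_mem e)
      by_cases h : G.wt c + G.wt e ≤ n
      · simp only [J]
        conv_lhs => rw [← G.sum_bas h hm]
        rw [map_sum, map_sum]
        refine Finset.sum_congr rfl fun b _ => ?_
        rw [map_smul, map_smul, smul_eq_mul, mul_comm]
      · have : J a c e = 0 := G.ext_of_ne (by omega) (G.br_mem (G.bas_mem a) hm) φ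
        rw [this]
        refine (Finset.sum_eq_zero fun b _ => ?_).symm
        have hb := b.1.2
        rw [G.ext_of_ne (by simp only [GradedLieSuperalgebra.wt] at h hb ⊢; omega) hm, mul_zero]
    have hD : ∀ b : G.Idx n, G.ext n φ (G.br (G.bas a) (G.bas b)) •
        (bgen G a * dualBracket G _ (G.dbas b)) = ∑ c : G.Idx n, ∑ e : G.Idx n,
          (1 / 2 * ((-1 : ℂ) ^ (G.wt c + 1) * (G.ext n φ (G.br (G.bas a) (G.bas b)) *
          G.ext _ (G.dbas b) (G.br (G.bas c) (G.bas e))))) • M a c e := by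
      intro b
      have hb := b.1.2
      rw [dualBracket_eq_sum G (N := n) (Nat.lt_succ_iff.1 hb), mul_smul_comm, smul_smul, Finset.mul_sum,
        Finset.smul_sum]
      refine Finset.sum_congr rfl fun c _ => ?_
      rw [Finset.mul_sum, Finset.smul_sum]
      refine Finset.sum_congr rfl fun e _ => ?_
      rw [mul_smul_comm, smul_smul]
      congr 1
      ring
    simp only [hD]
    rw [Finset.sum_comm]
    refine Finset.sum_congr rfl fun c _ => ?_
    rw [Finset.sum_comm]
    refine Finset.sum_congr rfl fun e _ => ?_
    rw [← Finset.sum_smul, ← Finset.mul_sum, ← Finset.mul_sum, ← hJ, smul_smul]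
  have hM : ∀ a b c, M b c a = (-1 : ℂ) ^ ((G.wt a + 1) * (G.wt b + G.wt c)) • M a b c := by
    intro a b c
    have := SuperAlg.mul_comm_of_mem
      (SuperAlg.mul_mem_hp (bgen_mem_hp G b) (bgen_mem_hp G c)) (bgen_mem_hp G a)
    simp only [M]
    rw [← mul_assoc, this]
    congr 1
    exact neg_one_pow_of_eq (G.wt a + 1) (by ring)
  have hM' : ∀ a b c, M c a b = (-1 : ℂ) ^ ((G.wt c + 1) * (G.wt a + G.wt b)) • M a b c := by
    intro a b c
    rw [hM c a b, smul_smul, neg_one_pow_mul_self, one_smul]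
  have hjac : ∀ a b c, (-1 : ℂ) ^ (G.wt a * G.wt c) * J a b c +
      (-1 : ℂ) ^ (G.wt b * G.wt a) * J b c a + (-1 : ℂ) ^ (G.wt c * G.wt b) * J c a b = 0 := by
    intro a b c
    have := congrArg (G.ext n φ) (G.jacobi (G.bas_mem a) (G.bas_mem b) (G.bas_mem c))
    simpa only [map_add, map_smul, smul_eq_mul, map_zero] using this
  have hS1 : S = ∑ a, ∑ b, ∑ c, ((-1 : ℂ) ^ (G.wt c + 1) * J b c a) • M b c a := by
    exact sum_cyc fun a b c => ((-1 : ℂ) ^ (G.wt b + 1) * J a b c) • M a b c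
  have hS2 : S = ∑ a, ∑ b, ∑ c, ((-1 : ℂ) ^ (G.wt a + 1) * J c a b) • M c a b := by
    rw [hS1]
    exact sum_cyc fun a b c => ((-1 : ℂ) ^ (G.wt c + 1) * J b c a) • M b c a
  -- The three rotated forms of `S` are added; the coefficient of each monomial becomes a sign times
  -- the Jacobi sum.
  have h3 : S + S + S = 0 := by
    conv_lhs => enter [1, 2]; rw [hS1]
    conv_lhs => enter [2]; rw [hS2]
    simp only [S, ← Finset.sum_add_distrib]
    refine Finset.sum_eq_zero fun a _ => Finset.sum_eq_zero fun b _ => Finset.sum_eq_zero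
      fun c _ => ?_
    rw [hM a b c, hM' a b c, smul_smul, smul_smul, ← add_smul, ← add_smul]
    convert zero_smul ℂ (M a b c)
    have e1 : (-1 : ℂ) ^ (G.wt c + 1) * (-1 : ℂ) ^ ((G.wt a + 1) * (G.wt b + G.wt c)) =
        (-1 : ℂ) ^ (G.wt b + 1 + G.wt a * G.wt c) * (-1 : ℂ) ^ (G.wt b * G.wt a) := by
      rw [← pow_add, ← pow_add]
      exact neg_one_pow_of_eq (G.wt c) (by ring)
    have e2 : (-1 : ℂ) ^ (G.wt a + 1) * (-1 : ℂ) ^ ((G.wt c + 1) * (G.wt a + G.wt b)) =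
        (-1 : ℂ) ^ (G.wt b + 1 + G.wt a * G.wt c) * (-1 : ℂ) ^ (G.wt c * G.wt b) := by
      rw [← pow_add, ← pow_add]
      exact neg_one_pow_of_eq (G.wt a) (by ring)
    have e3 : (-1 : ℂ) ^ (G.wt b + 1) =
        (-1 : ℂ) ^ (G.wt b + 1 + G.wt a * G.wt c) * (-1 : ℂ) ^ (G.wt a * G.wt c) := by
      rw [← pow_add]
      exact (neg_one_pow_of_eq (G.wt a * G.wt c) (by ring)).symm
    rw [mul_right_comm, e1, mul_right_comm _ (J c a b), e2, e3]
    linear_combination ((-1 : ℂ) ^ (G.wt b + 1 + G.wt a * G.wt c)) * hjac a b c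
  have h4 : (3 : ℂ) • S = 0 := by
    rw [show (3 : ℂ) = 1 + 1 + 1 by norm_num, add_smul, add_smul, one_smul, h3]
  rw [h1, (smul_eq_zero.1 h4).resolve_left (by norm_num), smul_zero]

/-- The Chevalley–Eilenberg differential has square zero. -/
theorem d_d (b : CE G) : d G (d G b) = 0 := by
  refine (isDer_d G).sq_eq_zero ?_ b
  rintro ⟨p, φ⟩
  change d G (d G (gen G p φ)) = 0
  rw [d_gen, d_dualBracket]

end CE

namespace SuperAlg

variable {C : Type u} [Ring C] [Algebra ℂ C] {S : SuperAlg C} {Γ : Type} [AddCommMonoid Γ]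
  [DecidableEq Γ] {γ : S.Gen → Γ} (Δ : Coaction S.g γ) {k : ℕ} {D : C →ₗ[ℂ] C}

/-- A derivation that shifts the degrees of the generators by `c` shifts all degrees by `c`. -/
theorem IsDer.mem_comp (hD : S.IsDer k D) {c : Γ} (h : ∀ s, D (S.g s) ∈ Δ.comp (γ s + c)) {n : Γ}
    {a : C} (ha : a ∈ Δ.comp n) : D a ∈ Δ.comp (n + c) := by
  rw [Δ.comp_eq_span] at ha
  induction ha using Submodule.span_induction with
  | zero => simp
  | add a b _ _ ha hb => rw [map_add]; exact Submodule.add_mem _ ha hb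
  | smul r a _ ha => rw [map_smul]; exact Submodule.smul_mem _ _ ha
  | mem a ha =>
    obtain ⟨l, rfl, rfl⟩ := ha
    induction l with
    | nil => simp [hD.one]
    | cons s l ih =>
      have hl : (l.map S.g).prod ∈ Δ.comp (l.map γ).sum := by
        rw [Δ.comp_eq_span]
        exact Submodule.subset_span ⟨l, rfl, rfl⟩
      simp only [List.map_cons, List.prod_cons, List.sum_cons]
      rw [hD.mul_of_mem (g_mem_hp s)]
      refine Submodule.add_mem _ ?_ (Submodule.smul_mem _ _ ?_)
      · have := Δ.mul_mem (h s) hl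
        rwa [add_right_comm] at this
      · have := Δ.mul_mem (Δ.gen_mem s) ih
        rwa [← add_assoc] at this

/-- An even derivation that multiplies the generators by their weights multiplies all elements
by their weights. -/
theorem IsDer.eq_weight_smul {γ : S.Gen → ℕ} (Δ : Coaction S.g γ) (hD : S.IsDer 2 D)
    (h : ∀ s, D (S.g s) = (γ s : ℂ) • S.g s) {n : ℕ} {a : C} (ha : a ∈ Δ.comp n) :
    D a = (n : ℂ) • a := by
  rw [Δ.comp_eq_span] at ha
  induction ha using Submodule.span_induction with
  | zero => simp
  | add a b _ _ ha hb => rw [map_add, ha, hb, smul_add]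
  | smul r a _ ha => rw [map_smul, ha, smul_comm]
  | mem a ha =>
    obtain ⟨l, rfl, rfl⟩ := ha
    induction l with
    | nil => simp [hD.one]
    | cons s l ih =>
      simp only [List.map_cons, List.prod_cons, List.sum_cons]
      rw [hD.mul_of_mem (g_mem_hp s), ih, h, smul_mul_assoc, mul_smul_comm, pow_mul]
      simp [add_smul]

end SuperAlg

/-! ### The acyclic extension of `CE(L)` and its contracting homotopy. -/

section Acyc

/-- The parities of the generators of the acyclic extension. -/
def ePr (i : Bool × ℕ) : ℕ := bif i.1 then i.2 else i.2 + 1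

variable {L : Type v} [AddCommGroup L] [Module ℂ L] (G : GradedLieSuperalgebra L)

/-- The generators of the acyclic extension. -/
abbrev eSp (i : Bool × ℕ) : Type v := Module.Dual ℂ (G.comp i.2)

/-- The acyclic extension of `CE(L)`: each generator `x φ` of `CE(L)` gets a partner `y φ` of
opposite parity. -/
abbrev Acyc : Type v := FGC ePr (eSp G)

/-- The free graded-commutative algebra on the partners `y φ`. -/
abbrev Cof : Type v := FGC (fun p : ℕ => p) (fun p => Module.Dual ℂ (G.comp p))

namespace Cof

/-- `Cof` as a supercommutative algebra. -/
abbrev super : SuperAlg (Cof G) := FGC.super _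

/-- The generators. -/
def y (p : ℕ) : Module.Dual ℂ (G.comp p) →ₗ[ℂ] Cof G := FGC.gen (P := fun p => Module.Dual ℂ (G.comp p)) (fun p : ℕ => p) p

theorem y_mem_hp (p : ℕ) (φ : Module.Dual ℂ (G.comp p)) : y G p φ ∈ (super G).hp p :=
  FGC.gen_mem_hp (P := fun p => Module.Dual ℂ (G.comp p)) (fun p : ℕ => p) p φ

/-- The grading by weight. -/
abbrev wt : Coaction (super G).g (fun s => s.1) := FGC.coaction (fun p : ℕ => p) (fun p => p)

theorem y_mem_wt (p : ℕ) (φ : Module.Dual ℂ (G.comp p)) : y G p φ ∈ (wt G).comp p :=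
  (wt G).gen_mem ⟨p, φ⟩

end Cof

namespace Acyc

/-- The acyclic extension as a supercommutative algebra. -/
abbrev super : SuperAlg (Acyc G) := FGC.super _

/-- The generators of `CE(L)`. -/
def x (p : ℕ) : Module.Dual ℂ (G.comp p) →ₗ[ℂ] Acyc G := FGC.gen (P := eSp G) ePr (false, p)

/-- Their partners. -/
def y (p : ℕ) : Module.Dual ℂ (G.comp p) →ₗ[ℂ] Acyc G := FGC.gen (P := eSp G) ePr (true, p)

theorem x_mem_hp (p : ℕ) (φ : Module.Dual ℂ (G.comp p)) : x G p φ ∈ (super G).hp (p + 1) :=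
  FGC.gen_mem_hp (P := eSp G) ePr (false, p) φ

theorem y_mem_hp (p : ℕ) (φ : Module.Dual ℂ (G.comp p)) : y G p φ ∈ (super G).hp p :=
  FGC.gen_mem_hp (P := eSp G) ePr (true, p) φ

theorem forall_gen {P : Acyc G → Prop} (hx : ∀ p φ, P (x G p φ)) (hy : ∀ p φ, P (y G p φ))
    (s : (super G).Gen) : P ((super G).g s) := by
  obtain ⟨⟨b, p⟩, φ⟩ := s
  cases b
  · exact hx p φ
  · exact hy p φ

/-- The grading by weight. -/
abbrev wt : Coaction (super G).g (fun s => s.1.2) := FGC.coaction ePr (fun i => i.2)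

theorem x_mem_wt (p : ℕ) (φ : Module.Dual ℂ (G.comp p)) : x G p φ ∈ (wt G).comp p :=
  (wt G).gen_mem ⟨(false, p), φ⟩

theorem y_mem_wt (p : ℕ) (φ : Module.Dual ℂ (G.comp p)) : y G p φ ∈ (wt G).comp p :=
  (wt G).gen_mem ⟨(true, p), φ⟩

/-- The inclusion of `CE(L)`. -/
def i : CE G →ₐ[ℂ] Acyc G :=
  CE.lift G (x G) fun p q φ ψ => SuperAlg.mul_comm_of_mem (x_mem_hp G p φ) (x_mem_hp G q ψ)

@[simp]
theorem i_gen (p : ℕ) (φ : Module.Dual ℂ (G.comp p)) : i G (CE.gen G p φ) = x G p φ :=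
  CE.lift_gen G _ _ p φ

/-- The inclusion of the algebra on the partners. -/
def j : Cof G →ₐ[ℂ] Acyc G :=
  FGC.lift _ (y G) fun p q φ ψ => SuperAlg.mul_comm_of_mem (y_mem_hp G p φ) (y_mem_hp G q ψ)

@[simp]
theorem j_y (p : ℕ) (φ : Module.Dual ℂ (G.comp p)) : j G (Cof.y G p φ) = y G p φ :=
  FGC.lift_gen (P := fun p => Module.Dual ℂ (G.comp p)) (fun p : ℕ => p) _ _ p φ

theorem i_par (b : CE G) : i G ((CE.super G).par b) = (super G).par (i G b) := by
  have h : (i G).comp (CE.super G).par = (super G).par.comp (i G) := CE.hom_ext G fun p φ => by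
    simp only [AlgHom.comp_apply, i_gen]
    rw [CE.gen_mem_hp G p φ, map_smul, i_gen, x_mem_hp G p φ]
  exact DFunLike.congr_fun h b

theorem i_mem_hp {k : ℕ} {b : CE G} (hb : b ∈ (CE.super G).hp k) : i G b ∈ (super G).hp k := by
  rw [SuperAlg.mem_hp, ← i_par, SuperAlg.mem_hp.1 hb, map_smul]

/-- The homotopy. -/
def h : Acyc G →ₗ[ℂ] Acyc G :=
  -- The factor `p` makes `dh + hd` act on `L_p^*` as multiplication by `p`, so that it can be the
  -- weight derivation without further normalization.
  FGC.der ePr 1 (fun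
    | (false, p) => (p : ℂ) • y G p
    | (true, _) => 0) (fun
    | (false, p), φ => Submodule.smul_mem _ _
        (SuperAlg.hp_congr (k := p) (l := p + 1 + 1) (by omega) (y_mem_hp G p φ))
    | (true, _), _ => Submodule.zero_mem _)

theorem isDer_h : (super G).IsDer 1 (h G) := FGC.isDer_der _ _ _ _

@[simp]
theorem h_x (p : ℕ) (φ : Module.Dual ℂ (G.comp p)) : h G (x G p φ) = (p : ℂ) • y G p φ :=
  FGC.der_gen (P := eSp G) ePr _ _ _ (false, p) φ

@[simp]
theorem h_y (p : ℕ) (φ : Module.Dual ℂ (G.comp p)) : h G (y G p φ) = 0 :=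
  FGC.der_gen (P := eSp G) ePr _ _ _ (true, p) φ

theorem h_h (a : Acyc G) : h G (h G a) = 0 :=
  (isDer_h G).sq_eq_zero (forall_gen G (P := fun a => h G (h G a) = 0) (by simp) (by simp)) a

theorem h_mem_wt {n : ℕ} {a : Acyc G} (ha : a ∈ (wt G).comp n) : h G a ∈ (wt G).comp n :=
  (isDer_h G).mem_comp (wt G) (c := 0) (by
    rintro ⟨⟨b, p⟩, φ⟩
    cases b
    · change h G (x G p φ) ∈ _
      rw [h_x]
      exact Submodule.smul_mem _ _ (y_mem_wt G p φ)
    · change h G (y G p φ) ∈ _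
      rw [h_y]
      exact Submodule.zero_mem _) ha

theorem h_j (o : Cof G) : h G (j G o) = 0 := by
  induction o using (Cof.super G).induction with
  | h1 => rw [map_one, (isDer_h G).one]
  | hadd a b ha hb => rw [map_add, map_add, ha, hb, add_zero]
  | hsmul r a ha => rw [map_smul, map_smul, ha, smul_zero]
  | hgen s => exact (congrArg _ (j_y G s.1 s.2)).trans (h_y G s.1 s.2)
  | hmul a b ha hb => rw [map_mul, (isDer_h G).mul, ha, hb, zero_mul, mul_zero, add_zero]

variable [∀ m, FiniteDimensional ℂ (G.comp m)]

/-- The differential. -/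
def d : Acyc G →ₗ[ℂ] Acyc G :=
  -- The correction to `d y = x` is dictated by the homotopy formula on `x`: from `h x = p y` one
  -- needs `p d y + h d x = p x`. In weight zero the division by `p` is immaterial, as `L_0 = 0`.
  FGC.der ePr 1 (fun
    | (false, p) => (i G).toLinearMap ∘ₗ CE.dualBracket G p
    | (true, p) => x G p - (1 / p : ℂ) • (h G ∘ₗ (i G).toLinearMap ∘ₗ CE.dualBracket G p)) (fun
    | (false, p), φ => SuperAlg.hp_congr (k := p) (l := p + 1 + 1) (by omega)
        (i_mem_hp G (CE.dualBracket_mem_hp G p φ))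
    | (true, p), φ => Submodule.sub_mem _ (x_mem_hp G p φ) (Submodule.smul_mem _ _
        (SuperAlg.hp_congr (k := 1 + p) (l := p + 1) (by omega)
          ((isDer_h G).mem_hp (i_mem_hp G (CE.dualBracket_mem_hp G p φ))))))

theorem isDer_d : (super G).IsDer 1 (d G) := FGC.isDer_der _ _ _ _

theorem d_x (p : ℕ) (φ : Module.Dual ℂ (G.comp p)) : d G (x G p φ) = i G (CE.dualBracket G p φ) :=
  FGC.der_gen (P := eSp G) ePr _ _ _ (false, p) φ

theorem d_y (p : ℕ) (φ : Module.Dual ℂ (G.comp p)) :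
    d G (y G p φ) = x G p φ - (1 / p : ℂ) • h G (i G (CE.dualBracket G p φ)) :=
  FGC.der_gen (P := eSp G) ePr _ _ _ (true, p) φ

theorem d_i (b : CE G) : d G (i G b) = i G (CE.d G b) := by
  induction b using (CE.super G).induction with
  | h1 => rw [map_one, (isDer_d G).one, (CE.isDer_d G).one, map_zero]
  | hadd a b ha hb => simp only [map_add, ha, hb]
  | hsmul r a ha => simp only [map_smul, ha]
  | hgen s =>
    obtain ⟨p, φ⟩ := s
    change d G (i G (CE.gen G p φ)) = i G (CE.d G (CE.gen G p φ))
    rw [i_gen, d_x, CE.d_gen]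
  | hmul a b ha hb =>
    rw [map_mul, (isDer_d G).mul, ha, hb, (CE.isDer_d G).mul, map_add, map_mul, map_mul, pow_one,
      pow_one, i_par]

theorem i_dualBracket_mem_wt (p : ℕ) (φ : Module.Dual ℂ (G.comp p)) :
    i G (CE.dualBracket G p φ) ∈ (wt G).comp p := by
  have := CE.dualBracket_mem G (n := p) (M := ((wt G).comp p).comap (i G).toLinearMap)
    (fun k l hkl φ ψ => by
      rw [Submodule.mem_comap, AlgHom.toLinearMap_apply, map_mul, i_gen, i_gen, ← hkl]
      exact (wt G).mul_mem (x_mem_wt G k φ) (x_mem_wt G l ψ)) φ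
  exact this

theorem d_mem_wt {n : ℕ} {a : Acyc G} (ha : a ∈ (wt G).comp n) : d G a ∈ (wt G).comp n :=
  (isDer_d G).mem_comp (wt G) (c := 0) (by
    rintro ⟨⟨b, p⟩, φ⟩
    cases b
    · change d G (x G p φ) ∈ _
      rw [d_x]
      exact i_dualBracket_mem_wt G p φ
    · change d G (y G p φ) ∈ _
      rw [d_y]
      exact Submodule.sub_mem _ (x_mem_wt G p φ)
        (Submodule.smul_mem _ _ (h_mem_wt G (i_dualBracket_mem_wt G p φ)))) ha

/-- The homotopy formula. -/
theorem d_h_add_h_d {n : ℕ} {a : Acyc G} (ha : a ∈ (wt G).comp n) :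
    d G (h G a) + h G (d G a) = (n : ℂ) • a := by
  -- The commutator of two odd derivations is an even derivation, so the formula need only be
  -- checked on generators.
  have hT := (isDer_d G).commutator (isDer_h G)
  have key := hT.eq_weight_smul (wt G) ?_ ha
  · simpa using key
  · rintro ⟨⟨b, p⟩, φ⟩
    -- There are no nonzero generators of weight zero; elsewhere `p` can be cancelled.
    rcases Nat.eq_zero_or_pos p with rfl | hp
    · rw [show φ = 0 from G.dual_comp_zero φ]
      have : (super G).g ⟨(b, 0), 0⟩ = 0 := (FGC.gen (P := eSp G) ePr (b, 0)).map_zero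
      rw [this, map_zero, smul_zero]
    · have hp' : (p : ℂ) ≠ 0 := by exact_mod_cast hp.ne'
      cases b
      · have e : (super G).g ⟨(false, p), φ⟩ = x G p φ := rfl
        rw [e]
        simp [d_x, d_y, smul_sub, smul_smul, hp']
      · have e : (super G).g ⟨(true, p), φ⟩ = y G p φ := rfl
        rw [e]
        simp [d_y, h_h]

/-- On the generators `x` this is the statement for `CE(L)`. By the homotopy formula `d²` commutes
with `h`, since `d` preserves weights; hence `p d² y = d² h x = h d² x = 0`. -/
theorem d_d (a : Acyc G) : d G (d G a) = 0 := by
  have hx : ∀ p φ, d G (d G (x G p φ)) = 0 := fun p φ => by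
    rw [d_x, d_i, CE.d_dualBracket, map_zero]
  have hcomm : ∀ {n : ℕ} {a : Acyc G}, a ∈ (wt G).comp n →
      d G (d G (h G a)) = h G (d G (d G a)) := fun {n a} ha => by
    have h1 := congrArg (d G) (d_h_add_h_d G ha)
    have h2 := d_h_add_h_d G (d_mem_wt G ha)
    rw [map_smul, map_add] at h1
    rw [← h1, add_comm] at h2
    exact (add_right_cancel h2).symm
  refine (isDer_d G).sq_eq_zero (forall_gen G (P := fun a => d G (d G a) = 0) hx fun p φ => ?_) a
  rcases Nat.eq_zero_or_pos p with rfl | hp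
  · rw [G.dual_comp_zero φ]; simp
  · have hp' : (p : ℂ) ≠ 0 := by exact_mod_cast hp.ne'
    have h1 := hcomm (x_mem_wt G p φ)
    rw [h_x, hx, map_zero, map_smul, map_smul] at h1
    exact (smul_eq_zero.1 h1).resolve_left hp'

end Acyc

end Acyc

namespace GradedLieSuperalgebra

variable {L : Type v} [AddCommGroup L] [Module ℂ L] (G : GradedLieSuperalgebra L)

theorem ext_coe {p : ℕ} (φ : Module.Dual ℂ (G.comp p)) (x : G.comp p) : G.ext p φ x = φ x := by
  rw [ext_apply, proj_coe]

/-- A sign that depends on the degree of `x` can be read off from any form not vanishing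
on `x`. -/
theorem sign_mul_ext (F : ℕ → ℂ) {p n : ℕ} (φ : Module.Dual ℂ (G.comp p)) {x : L}
    (hx : x ∈ G.comp n) : F p * G.ext p φ x = F n * G.ext p φ x := by
  by_cases h : n = p
  · rw [h]
  · rw [G.ext_of_ne h hx, mul_zero, mul_zero]

end GradedLieSuperalgebra

/-! ### Contractions, and the parts linear and quadratic in the generators `x`. -/

namespace Acyc

variable {L : Type v} [AddCommGroup L] [Module ℂ L] (G : GradedLieSuperalgebra L)

/-- The contraction with an element of `L_n`, as a map. -/
def conMap (n : ℕ) (z : G.comp n) : Acyc G →ₗ[ℂ] Acyc G :=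
  FGC.der ePr (n + 1) (fun
    | (false, p) => Algebra.linearMap ℂ (Acyc G) ∘ₗ LinearMap.applyₗ (z : L) ∘ₗ G.ext p
    | (true, _) => 0) (fun
    | (false, p), φ => by
        change algebraMap ℂ (Acyc G) (G.ext p φ z) ∈ _
        by_cases h : n = p
        · subst h
          rw [Algebra.algebraMap_eq_smul_one]
          exact Submodule.smul_mem _ _ (SuperAlg.hp_congr (k := 0) (l := n + 1 + (n + 1))
            (by omega) SuperAlg.one_mem_hp)
        · rw [G.ext_of_ne h z.2, map_zero]
          exact Submodule.zero_mem _
    | (true, _), _ => Submodule.zero_mem _)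

theorem isDer_conMap (n : ℕ) (z : G.comp n) : (super G).IsDer (n + 1) (conMap G n z) :=
  FGC.isDer_der _ _ _ _

theorem conMap_x (n : ℕ) (z : G.comp n) (p : ℕ) (φ : Module.Dual ℂ (G.comp p)) :
    conMap G n z (x G p φ) = G.ext p φ z • 1 :=
  (FGC.der_gen (P := eSp G) ePr _ _ _ (false, p) φ).trans
    (Algebra.algebraMap_eq_smul_one (A := Acyc G) (G.ext p φ z))

theorem conMap_y (n : ℕ) (z : G.comp n) (p : ℕ) (φ : Module.Dual ℂ (G.comp p)) :
    conMap G n z (y G p φ) = 0 :=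
  FGC.der_gen (P := eSp G) ePr _ _ _ (true, p) φ

/-- The contraction with an element of `L_n`: the derivation of parity `n + 1` that evaluates
the generators `x φ` and kills the generators `y φ`. -/
def con (n : ℕ) : G.comp n →ₗ[ℂ] Acyc G →ₗ[ℂ] Acyc G where
  toFun z := conMap G n z
  map_add' a b := by
    refine (isDer_conMap G n _).ext ((isDer_conMap G n a).add (isDer_conMap G n b))
      (forall_gen G (P := fun e => conMap G n (a + b) e = (conMap G n a + conMap G n b) e) ?_ ?_)
    · intro p φ
      rw [LinearMap.add_apply, conMap_x, conMap_x, conMap_x, Submodule.coe_add, map_add, add_smul]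
    · intro p φ
      rw [LinearMap.add_apply, conMap_y, conMap_y, conMap_y, add_zero]
  map_smul' c a := by
    refine (isDer_conMap G n _).ext ((isDer_conMap G n a).smul c)
      (forall_gen G (P := fun e => conMap G n (c • a) e = (c • conMap G n a) e) ?_ ?_)
    · intro p φ
      rw [LinearMap.smul_apply, conMap_x, conMap_x, Submodule.coe_smul, map_smul, smul_assoc]
    · intro p φ
      rw [LinearMap.smul_apply, conMap_y, conMap_y, smul_zero]

variable {n : ℕ} (z : G.comp n)

theorem isDer_con : (super G).IsDer (n + 1) (con G n z) := isDer_conMap G n z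

theorem con_x (p : ℕ) (φ : Module.Dual ℂ (G.comp p)) :
    con G n z (x G p φ) = G.ext p φ z • 1 := conMap_x G n z p φ

theorem con_y (p : ℕ) (φ : Module.Dual ℂ (G.comp p)) : con G n z (y G p φ) = 0 := conMap_y G n z p φ

theorem con_j (o : Cof G) : con G n z (j G o) = 0 := by
  induction o using (Cof.super G).induction with
  | h1 => rw [map_one, (isDer_con G z).one]
  | hadd a b ha hb => rw [map_add, map_add, ha, hb, add_zero]
  | hsmul r a ha => rw [map_smul, map_smul, ha, smul_zero]
  | hgen s => exact (congrArg _ (j_y G s.1 s.2)).trans (con_y G z s.1 s.2)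
  | hmul a b ha hb => rw [map_mul, (isDer_con G z).mul, ha, hb, zero_mul, mul_zero, add_zero]

theorem con_x_mul (p : ℕ) (φ : Module.Dual ℂ (G.comp p)) (a : Acyc G) :
    con G n z (x G p φ * a) =
      G.ext p φ z • a + (-1 : ℂ) ^ ((n + 1) * (p + 1)) • (x G p φ * con G n z a) := by
  rw [(isDer_con G z).mul_of_mem (x_mem_hp G p φ), con_x, smul_mul_assoc, one_mul]

/-- The quotient map that kills the generators `x φ`. -/
def q : Acyc G →ₐ[ℂ] Cof G :=
  FGC.lift ePr (fun
    | (false, _) => 0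
    | (true, p) => Cof.y G p) (by
    rintro ⟨_ | _, p⟩ ⟨_ | _, r⟩ φ ψ
    · simp
    · simp
    · simp
    · exact SuperAlg.mul_comm_of_mem (Cof.y_mem_hp G p φ) (Cof.y_mem_hp G r ψ))

@[simp]
theorem q_x (p : ℕ) (φ : Module.Dual ℂ (G.comp p)) : q G (x G p φ) = 0 :=
  FGC.lift_gen (P := eSp G) ePr _ _ (false, p) φ

@[simp]
theorem q_y (p : ℕ) (φ : Module.Dual ℂ (G.comp p)) : q G (y G p φ) = Cof.y G p φ :=
  FGC.lift_gen (P := eSp G) ePr _ _ (true, p) φ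

@[simp]
theorem q_j (o : Cof G) : q G (j G o) = o := by
  have h : (q G).comp (j G) = AlgHom.id ℂ _ := FGC.hom_ext _ fun p φ => by
    change q G (j G (Cof.y G p φ)) = Cof.y G p φ
    rw [j_y, q_y]
  exact DFunLike.congr_fun h o

theorem q_par (a : Acyc G) : q G ((super G).par a) = (Cof.super G).par (q G a) := by
  have h : (q G).comp (super G).par = (Cof.super G).par.comp (q G) := by
    refine (super G).hom_ext (forall_gen G
      (P := fun a => ((q G).comp (super G).par) a = ((Cof.super G).par.comp (q G)) a) ?_ ?_)
    · intro p φ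
      rw [AlgHom.comp_apply, AlgHom.comp_apply, x_mem_hp G p φ, map_smul, q_x, smul_zero, map_zero]
    · intro p φ
      rw [AlgHom.comp_apply, AlgHom.comp_apply, y_mem_hp G p φ, map_smul, q_y, Cof.y_mem_hp G p φ]
  exact DFunLike.congr_fun h a

theorem q_parPow (k : ℕ) (a : Acyc G) :
    q G (((super G).par ^ k) a) = ((Cof.super G).par ^ k) (q G a) := by
  induction k with
  | zero => simp
  | succ k ih => rw [pow_succ', AlgHom.mul_apply, q_par, ih, pow_succ', AlgHom.mul_apply]

/-- The span of the products `x φ * j o` of total weight `n`. -/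
def lin (n : ℕ) : Submodule ℂ (Acyc G) :=
  Submodule.span ℂ {a | ∃ (p m : ℕ) (φ : Module.Dual ℂ (G.comp p)) (o : Cof G),
    p + m = n ∧ o ∈ (Cof.wt G).comp m ∧ a = x G p φ * j G o}

/-- The span of the products `x φ * j o` with `φ` of degree at most `N`. -/
def linLE (N : ℕ) : Submodule ℂ (Acyc G) :=
  Submodule.span ℂ {a | ∃ (p : ℕ) (φ : Module.Dual ℂ (G.comp p)) (o : Cof G),
    p ≤ N ∧ a = x G p φ * j G o}

/-- The span of the products `x φ * x ψ * j o` with `φ`, `ψ` of degree at most `N`. -/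
def quadLE (N : ℕ) : Submodule ℂ (Acyc G) :=
  Submodule.span ℂ {a | ∃ (p r : ℕ) (φ : Module.Dual ℂ (G.comp p)) (ψ : Module.Dual ℂ (G.comp r))
    (o : Cof G), p ≤ N ∧ r ≤ N ∧ a = x G p φ * (x G r ψ * j G o)}

theorem mem_lin {n p m : ℕ} (h : p + m = n) (φ : Module.Dual ℂ (G.comp p)) {o : Cof G}
    (ho : o ∈ (Cof.wt G).comp m) : x G p φ * j G o ∈ lin G n :=
  Submodule.subset_span ⟨p, m, φ, o, h, ho, rfl⟩

theorem lin_le_linLE {n N : ℕ} (h : n ≤ N) : lin G n ≤ linLE G N := by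
  refine Submodule.span_mono ?_
  rintro _ ⟨p, m, φ, o, hpm, -, rfl⟩
  exact ⟨p, φ, o, by omega, rfl⟩

theorem x_mul_linLE {N p : ℕ} (hp : p ≤ N) (φ : Module.Dual ℂ (G.comp p)) {a : Acyc G}
    (ha : a ∈ linLE G N) : x G p φ * a ∈ quadLE G N := by
  induction ha using Submodule.span_induction with
  | zero => simp
  | add a b _ _ ha hb => rw [mul_add]; exact Submodule.add_mem _ ha hb
  | smul r a _ ha => rw [mul_smul_comm]; exact Submodule.smul_mem _ _ ha
  | mem a ha =>
    obtain ⟨r, ψ, o, hr, rfl⟩ := ha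
    exact Submodule.subset_span ⟨p, r, φ, ψ, o, hp, hr, rfl⟩

theorem lin_mul_j {n m : ℕ} {a : Acyc G} (ha : a ∈ lin G n) {o : Cof G}
    (ho : o ∈ (Cof.wt G).comp m) : a * j G o ∈ lin G (n + m) := by
  induction ha using Submodule.span_induction with
  | zero => simp
  | add a b _ _ ha hb => rw [add_mul]; exact Submodule.add_mem _ ha hb
  | smul r a _ ha => rw [smul_mul_assoc]; exact Submodule.smul_mem _ _ ha
  | mem a ha =>
    obtain ⟨p, k, φ, o', h, ho', rfl⟩ := ha
    rw [mul_assoc, ← map_mul]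
    exact mem_lin G (by omega) φ ((Cof.wt G).mul_mem ho' ho)

theorem y_mul_lin {n p : ℕ} (φ : Module.Dual ℂ (G.comp p)) {a : Acyc G} (ha : a ∈ lin G n) :
    y G p φ * a ∈ lin G (p + n) := by
  induction ha using Submodule.span_induction with
  | zero => simp
  | add a b _ _ ha hb => rw [mul_add]; exact Submodule.add_mem _ ha hb
  | smul r a _ ha => rw [mul_smul_comm]; exact Submodule.smul_mem _ _ ha
  | mem a ha =>
    obtain ⟨r, k, ψ, o', h, ho', rfl⟩ := ha
    rw [← mul_assoc, SuperAlg.mul_comm_of_mem (y_mem_hp G p φ) (x_mem_hp G r ψ), smul_mul_assoc,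
      mul_assoc, ← j_y, ← map_mul]
    exact Submodule.smul_mem _ _
      (mem_lin G (by omega) ψ ((Cof.wt G).mul_mem (Cof.y_mem_wt G p φ) ho'))

variable [∀ m, FiniteDimensional ℂ (G.comp m)]

/-- The derivation `h` replaces one of the two factors `x` by a `y`, leaving a product linear in the
`x`. -/
theorem h_i_dualBracket_mem (p : ℕ) (φ : Module.Dual ℂ (G.comp p)) :
    h G (i G (CE.dualBracket G p φ)) ∈ lin G p := by
  have := CE.dualBracket_mem G (n := p) (M := (lin G p).comap (h G ∘ₗ (i G).toLinearMap))
    (fun k l hkl φ ψ => by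
      rw [Submodule.mem_comap, LinearMap.comp_apply, AlgHom.toLinearMap_apply, map_mul, i_gen,
        i_gen, (isDer_h G).mul_of_mem (x_mem_hp G k φ), h_x, h_x, smul_mul_assoc, mul_smul_comm]
      refine Submodule.add_mem _ (Submodule.smul_mem _ _ ?_)
        (Submodule.smul_mem _ _ (Submodule.smul_mem _ _ ?_))
      · rw [SuperAlg.mul_comm_of_mem (y_mem_hp G k φ) (x_mem_hp G l ψ), ← j_y]
        exact Submodule.smul_mem _ _ (mem_lin G (by omega) ψ (Cof.y_mem_wt G k φ))
      · rw [← j_y]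
        exact mem_lin G hkl φ (Cof.y_mem_wt G l ψ)) φ
  exact this

theorem d_y_mem (p : ℕ) (φ : Module.Dual ℂ (G.comp p)) : d G (y G p φ) ∈ lin G p := by
  rw [d_y]
  refine Submodule.sub_mem _ ?_ (Submodule.smul_mem _ _ (h_i_dualBracket_mem G p φ))
  have := mem_lin G (add_zero p) φ (Cof.wt G).one_mem
  rwa [map_one, mul_one] at this

/-- The differential of an element of `Cof` is a combination of products `x φ * j o`. Its
coefficients in `Cof` are what later becomes the action of `L`. -/
theorem d_j_mem {n : ℕ} {o : Cof G} (ho : o ∈ (Cof.wt G).comp n) : d G (j G o) ∈ lin G n := by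
  rw [Coaction.comp_eq_span] at ho
  induction ho using Submodule.span_induction with
  | zero => simp
  | add a b _ _ ha hb => rw [map_add, map_add]; exact Submodule.add_mem _ ha hb
  | smul r a _ ha => rw [map_smul, map_smul]; exact Submodule.smul_mem _ _ ha
  | mem a ha =>
    obtain ⟨l, rfl, rfl⟩ := ha
    induction l with
    | nil => simp [(isDer_d G).one]
    | cons s l ih =>
      obtain ⟨p, φ⟩ := s
      have hl : (l.map (Cof.super G).g).prod ∈ (Cof.wt G).comp (l.map fun s => s.1).sum := by
        rw [Coaction.comp_eq_span]
        exact Submodule.subset_span ⟨l, rfl, rfl⟩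
      have e : j G ((Cof.super G).g ⟨p, φ⟩) = y G p φ := j_y G p φ
      change d G (j G ((Cof.super G).g ⟨p, φ⟩ * (l.map (Cof.super G).g).prod)) ∈
        lin G (p + (l.map fun s => s.1).sum)
      rw [map_mul, e, (isDer_d G).mul_of_mem (y_mem_hp G p φ)]
      exact Submodule.add_mem _ (lin_mul_j G (d_y_mem G p φ) hl)
        (Submodule.smul_mem _ _ (y_mul_lin G φ ih))

theorem i_dualBracket_mul_j_mem {p N : ℕ} (hp : p ≤ N) (φ : Module.Dual ℂ (G.comp p)) (o : Cof G) :
    i G (CE.dualBracket G p φ) * j G o ∈ quadLE G N := by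
  have := CE.dualBracket_mem G (n := p) (M := (quadLE G N).comap
    (LinearMap.mulRight ℂ (j G o) ∘ₗ (i G).toLinearMap))
    (fun k l hkl φ ψ => by
      rw [Submodule.mem_comap, LinearMap.comp_apply, AlgHom.toLinearMap_apply, map_mul, i_gen,
        i_gen, LinearMap.mulRight_apply, mul_assoc]
      exact Submodule.subset_span ⟨k, l, φ, ψ, o, by omega, by omega, rfl⟩) φ
  exact this

theorem d_lin_mem {n : ℕ} {a : Acyc G} (ha : a ∈ lin G n) : d G a ∈ quadLE G n := by
  induction ha using Submodule.span_induction with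
  | zero => simp
  | add a b _ _ ha hb => rw [map_add]; exact Submodule.add_mem _ ha hb
  | smul r a _ ha => rw [map_smul]; exact Submodule.smul_mem _ _ ha
  | mem a ha =>
    obtain ⟨r, k, ψ, o, h, ho, rfl⟩ := ha
    rw [(isDer_d G).mul_of_mem (x_mem_hp G r ψ), d_x]
    exact Submodule.add_mem _ (i_dualBracket_mul_j_mem G (by omega) ψ o)
      (Submodule.smul_mem _ _ (x_mul_linLE G (by omega) ψ
        (lin_le_linLE G (by omega) (d_j_mem G ho))))

theorem con_x_mul_j (p : ℕ) (φ : Module.Dual ℂ (G.comp p)) (o : Cof G) :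
    con G n z (x G p φ * j G o) = G.ext p φ z • j G o := by
  rw [con_x_mul, con_j, mul_zero, smul_zero, add_zero]

theorem con_linLE {N : ℕ} {a : Acyc G} (ha : a ∈ linLE G N) :
    con G n z a = j G (q G (con G n z a)) := by
  induction ha using Submodule.span_induction with
  | zero => simp
  | add a b _ _ ha hb => simp only [map_add]; rw [← ha, ← hb]
  | smul r a _ ha => simp only [map_smul]; rw [← ha]
  | mem a ha =>
    obtain ⟨r, ψ, o, hr, rfl⟩ := ha
    rw [con_x_mul_j, map_smul, q_j, map_smul]

theorem con_quadLE {N : ℕ} {a : Acyc G} (ha : a ∈ quadLE G N) : con G n z a ∈ linLE G N := by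
  induction ha using Submodule.span_induction with
  | zero => simp
  | add a b _ _ ha hb => rw [map_add]; exact Submodule.add_mem _ ha hb
  | smul r a _ ha => rw [map_smul]; exact Submodule.smul_mem _ _ ha
  | mem a ha =>
    obtain ⟨p, r, φ, ψ, o, hp, hr, rfl⟩ := ha
    rw [con_x_mul, con_x_mul_j, mul_smul_comm]
    exact Submodule.add_mem _ (Submodule.smul_mem _ _ (Submodule.subset_span ⟨r, ψ, o, hr, rfl⟩))
      (Submodule.smul_mem _ _ (Submodule.smul_mem _ _
        (Submodule.subset_span ⟨p, φ, o, hp, rfl⟩)))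

/-- The basis elements, in their components. -/
def bas {N : ℕ} (a : G.Idx N) : G.comp (G.wt a) := ⟨G.bas a, G.bas_mem a⟩

/-- Euler's identity for expressions of degree one in the `x`; it shows that they are determined by
their contractions. -/
theorem sum_x_mul_con_lin {N : ℕ} {w : Acyc G} (hw : w ∈ linLE G N) :
    ∑ a : G.Idx N, x G _ (G.dbas a) * con G _ (bas G a) w = w := by
  induction hw using Submodule.span_induction with
  | zero => simp
  | add a b _ _ ha hb => simp only [map_add, mul_add, Finset.sum_add_distrib, ha, hb]
  | smul r a _ ha => simp only [map_smul, mul_smul_comm, ← Finset.smul_sum, ha]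
  | mem a ha =>
    obtain ⟨r, ψ, o, hr, rfl⟩ := ha
    simp only [con_x_mul_j, mul_smul_comm, ← smul_mul_assoc, ← Finset.sum_mul]
    rw [show ∑ a : G.Idx N, G.ext r ψ (bas G a) • x G _ (G.dbas a) = x G r ψ from
      G.sum_dbas (x G) hr ψ]

/-- Euler's identity in degree two: each of the two factors `x` is recovered once. -/
theorem sum_x_mul_con_quad {N : ℕ} {w : Acyc G} (hw : w ∈ quadLE G N) :
    ∑ a : G.Idx N, x G _ (G.dbas a) * con G _ (bas G a) w = (2 : ℂ) • w := by
  induction hw using Submodule.span_induction with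
  | zero => simp
  | add a b _ _ ha hb => simp only [map_add, mul_add, Finset.sum_add_distrib, ha, hb, smul_add]
  | smul r a _ ha => simp only [map_smul, mul_smul_comm, ← Finset.smul_sum, ha, smul_comm r]
  | mem a ha =>
    obtain ⟨p, r, φ, ψ, o, hp, hr, rfl⟩ := ha
    have h1 : ∀ a : G.Idx N, x G _ (G.dbas a) * con G _ (bas G a) (x G p φ * (x G r ψ * j G o)) =
        (G.ext p φ (bas G a) • x G _ (G.dbas a)) * (x G r ψ * j G o) +
        x G p φ * ((G.ext r ψ (bas G a) • x G _ (G.dbas a)) * j G o) := by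
      intro a
      rw [con_x_mul, con_x_mul_j, mul_add, mul_smul_comm, smul_mul_assoc, mul_smul_comm,
        mul_smul_comm, mul_smul_comm, smul_mul_assoc, mul_smul_comm, ← mul_assoc, ← mul_assoc,
        SuperAlg.mul_comm_of_mem (x_mem_hp G _ (G.dbas a)) (x_mem_hp G p φ)]
      congr 1
      rw [smul_mul_assoc, smul_comm, smul_smul ((-1 : ℂ) ^ _), neg_one_pow_mul_self, one_smul,
        mul_assoc]
    simp only [h1, Finset.sum_add_distrib, ← Finset.mul_sum, ← Finset.sum_mul]
    rw [show ∑ a : G.Idx N, G.ext r ψ (bas G a) • x G _ (G.dbas a) = x G r ψ from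
      G.sum_dbas (x G) hr ψ, show ∑ a : G.Idx N, G.ext p φ (bas G a) • x G _ (G.dbas a) = x G p φ
      from G.sum_dbas (x G) hp φ, ← two_smul ℂ]

theorem lin_eq_zero {N : ℕ} {w : Acyc G} (hw : w ∈ linLE G N)
    (h : ∀ n (z : G.comp n), q G (con G n z w) = 0) : w = 0 := by
  rw [← sum_x_mul_con_lin G hw]
  refine Finset.sum_eq_zero fun a _ => ?_
  rw [con_linLE G _ hw, h, map_zero, mul_zero]

/-- One contraction of a quadratic expression is linear, so two contractions detect it, as `2` is
invertible. -/
theorem quad_eq_zero {N : ℕ} {w : Acyc G} (hw : w ∈ quadLE G N)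
    (h : ∀ n (z : G.comp n) m (z' : G.comp m), q G (con G m z' (con G n z w)) = 0) : w = 0 := by
  have h2 : (2 : ℂ) • w = 0 := by
    rw [← sum_x_mul_con_quad G hw]
    refine Finset.sum_eq_zero fun a _ => ?_
    rw [lin_eq_zero G (con_quadLE G (bas G a) hw) (h _ _), mul_zero]
  exact (smul_eq_zero.1 h2).resolve_left (by norm_num)

end Acyc

/-! ### The universal property of `U(L)` and expansions of brackets. -/

section

variable {L : Type v} [AddCommGroup L] [Module ℂ L] (G : GradedLieSuperalgebra L)

namespace GradedLieSuperalgebra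

/-- The bracket `L_i × L_j → L_{i+j}`. -/
def brk {i j : ℕ} (z : G.comp i) (t : G.comp j) : G.comp (i + j) :=
  ⟨G.br z t, G.br_mem z.2 t.2⟩

/-- The linear map on `L` with given restrictions to the components. -/
def linExt {M : Type w} [AddCommGroup M] [Module ℂ M] (f : ∀ p, G.comp p →ₗ[ℂ] M) : L →ₗ[ℂ] M :=
  DirectSum.toModule ℂ ℕ M f ∘ₗ G.decomp.symm.toLinearMap

theorem linExt_coe {M : Type w} [AddCommGroup M] [Module ℂ M] (f : ∀ p, G.comp p →ₗ[ℂ] M) {p : ℕ}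
    (z : G.comp p) : G.linExt f z = f p z := by
  rw [linExt, LinearMap.comp_apply, LinearEquiv.coe_coe, symm_coe, DirectSum.toModule_lof]

/-- The expansion of a bracket in terms of a basis. -/
theorem sum_ext_br [∀ m, FiniteDimensional ℂ (G.comp m)] {p k l N : ℕ} (hk : k ≤ N) (hl : l ≤ N)
    (φ : Module.Dual ℂ (G.comp p)) (u : G.comp k) (u' : G.comp l) :
    ∑ a : G.Idx N, ∑ b : G.Idx N, G.ext p φ (G.br (G.bas a) (G.bas b)) *
      (G.ext _ (G.dbas a) u * G.ext _ (G.dbas b) u') = G.ext p φ (G.br u u') := by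
  conv_rhs => rw [← G.sum_bas hk u.2, ← G.sum_bas hl u'.2]
  simp only [map_sum, LinearMap.sum_apply, map_smul, LinearMap.smul_apply, smul_eq_mul,
    Finset.mul_sum]
  rw [Finset.sum_comm]
  refine Finset.sum_congr rfl fun b _ => Finset.sum_congr rfl fun a _ => ?_
  ring

end GradedLieSuperalgebra

namespace Env

/-- The universal property of `U(L)`. -/
def lift {D : Type w} [Ring D] [Algebra ℂ D] (f : L →ₗ[ℂ] D)
    (hf : ∀ (i j : ℕ) (z : G.comp i) (z' : G.comp j),
      f z * f z' - (-1 : ℂ) ^ (i * j) • (f z' * f z) = f (G.br z z')) : Env G →ₐ[ℂ] D :=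
  RingQuot.liftAlgHom ℂ ⟨TensorAlgebra.lift ℂ f, by
    rintro _ _ ⟨i, j, z, z', hz, hz'⟩
    simpa using hf i j ⟨z, hz⟩ ⟨z', hz'⟩⟩

@[simp]
theorem lift_ι {D : Type w} [Ring D] [Algebra ℂ D] (f : L →ₗ[ℂ] D)
    (hf : ∀ (i j : ℕ) (z : G.comp i) (z' : G.comp j),
      f z * f z' - (-1 : ℂ) ^ (i * j) • (f z' * f z) = f (G.br z z')) (z : L) :
    lift G f hf (ι G z) = f z := by
  have : lift G f hf (ι G z) = TensorAlgebra.lift ℂ f (TensorAlgebra.ι ℂ z) :=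
    RingQuot.liftAlgHom_mkAlgHom_apply _ _ _ _
  rw [this]
  simp

theorem ι_br {i j : ℕ} (z : G.comp i) (z' : G.comp j) :
    ι G (G.br z z') = ι G z * ι G z' - (-1 : ℂ) ^ (i * j) • (ι G z' * ι G z) := by
  have h := RingQuot.mkAlgHom_rel ℂ (EnvRel.of (G := G) i j z z' z.2 z'.2)
  rw [map_sub, map_smul, map_mul, map_mul] at h
  exact h.symm

end Env

/-! ### Lie derivatives and the representation of `U(L)` on `Cof`. -/

namespace Acyc

variable [∀ m, FiniteDimensional ℂ (G.comp m)] {m n : ℕ} (z : G.comp m) (z' : G.comp n)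

/-- The action of an element of `L_n` by a derivation of parity `n`. -/
def th (n : ℕ) : G.comp n →ₗ[ℂ] Acyc G →ₗ[ℂ] Acyc G where
  toFun z := d G ∘ₗ con G n z + (-1 : ℂ) ^ n • (con G n z ∘ₗ d G)
  map_add' a b := by
    ext e
    simp only [map_add, LinearMap.add_apply, LinearMap.comp_apply, LinearMap.smul_apply, smul_add]
    abel
  map_smul' c a := by
    ext e
    simp only [map_smul, LinearMap.add_apply, LinearMap.comp_apply, LinearMap.smul_apply, smul_add,
      RingHom.id_apply, smul_comm c]

theorem th_apply (e : Acyc G) :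
    th G m z e = d G (con G m z e) + (-1 : ℂ) ^ m • con G m z (d G e) := rfl

/-- Cartan's formula defines the Lie derivative as the graded commutator of `d` with a contraction;
its parity is `1 + (m + 1)`, that is, `m`. -/
theorem isDer_th : (super G).IsDer m (th G m z) := by
  have h := ((isDer_d G).commutator (isDer_con G z)).congr (l := m) (by omega)
  convert h using 1
  ext e
  simp [th_apply, pow_succ]

theorem d_th (e : Acyc G) : d G (th G m z e) = (-1 : ℂ) ^ m • th G m z (d G e) := by
  simp only [th_apply, d_d, map_add, map_smul, map_zero, zero_add, smul_zero, add_zero]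

theorem th_j (o : Cof G) : th G m z (j G o) = (-1 : ℂ) ^ m • con G m z (d G (j G o)) := by
  rw [th_apply, con_j, map_zero, zero_add]

theorem con_con_x_mul_x (p r : ℕ) (φ : Module.Dual ℂ (G.comp p)) (ψ : Module.Dual ℂ (G.comp r)) :
    con G n z' (con G m z (x G p φ * x G r ψ)) =
      (G.ext p φ z * G.ext r ψ z' +
        (-1 : ℂ) ^ ((m + 1) * (p + 1)) * (G.ext p φ z' * G.ext r ψ z)) • 1 := by
  rw [con_x_mul, con_x, mul_smul_comm, mul_one, map_add, map_smul, map_smul, map_smul, con_x,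
    con_x, smul_smul, smul_smul, smul_smul, add_smul]
  congr 2
  ring

/-- The double contraction of the differential gives the bracket. -/
theorem con_con_d_x (p : ℕ) (φ : Module.Dual ℂ (G.comp p)) :
    con G n z' (con G m z (d G (x G p φ))) =
      ((-1 : ℂ) ^ (m + 1) * G.ext p φ (G.br z z')) • 1 := by
  set N := m + n + p with hN
  have h1 : con G n z' (con G m z (d G (x G p φ))) = ((1 / 2 : ℂ) *
      ∑ a : G.Idx N, ∑ b : G.Idx N, (-1 : ℂ) ^ (G.wt a + 1) *
        G.ext p φ (G.br (G.bas a) (G.bas b)) *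
        (G.ext _ (G.dbas a) z * G.ext _ (G.dbas b) z' +
        (-1 : ℂ) ^ ((m + 1) * (G.wt a + 1)) *
          (G.ext _ (G.dbas a) z' * G.ext _ (G.dbas b) z))) • 1 := by
    rw [d_x, CE.dualBracket_eq_sum G (N := N) (by omega)]
    simp only [map_smul, map_sum, map_mul]
    rw [mul_smul]
    congr 1
    rw [Finset.sum_smul]
    refine Finset.sum_congr rfl fun a _ => ?_
    rw [Finset.sum_smul]
    refine Finset.sum_congr rfl fun b _ => ?_
    rw [CE.bgen, CE.bgen, i_gen, i_gen, con_con_x_mul_x, smul_smul]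
  rw [h1]
  congr 1
  -- A dual basis element pairs nontrivially only with elements of its own degree, so the signs in
  -- `wt a` may be replaced by signs in `m` and `n` and leave the sum. The two halves then agree by
  -- skew-symmetry and absorb the factor `1/2`.
  have h2 : ∀ a b : G.Idx N, (-1 : ℂ) ^ (G.wt a + 1) *
        G.ext p φ (G.br (G.bas a) (G.bas b)) *
        (G.ext _ (G.dbas a) z * G.ext _ (G.dbas b) z' +
        (-1 : ℂ) ^ ((m + 1) * (G.wt a + 1)) *
          (G.ext _ (G.dbas a) z' * G.ext _ (G.dbas b) z)) =
      (-1 : ℂ) ^ (m + 1) * (G.ext p φ (G.br (G.bas a) (G.bas b)) *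
        (G.ext _ (G.dbas a) z * G.ext _ (G.dbas b) z')) +
      ((-1 : ℂ) ^ (n + 1) * (-1 : ℂ) ^ ((m + 1) * (n + 1))) *
        (G.ext p φ (G.br (G.bas a) (G.bas b)) *
        (G.ext _ (G.dbas a) z' * G.ext _ (G.dbas b) z)) := by
    intro a b
    have e1 := G.sign_mul_ext (fun p => (-1 : ℂ) ^ (p + 1)) (G.dbas a) z.2
    have e2 := G.sign_mul_ext (fun p => (-1 : ℂ) ^ (p + 1) * (-1 : ℂ) ^ ((m + 1) * (p + 1)))
      (G.dbas a) z'.2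
    linear_combination G.ext p φ (G.br (G.bas a) (G.bas b)) * G.ext _ (G.dbas b) z' * e1 +
      G.ext p φ (G.br (G.bas a) (G.bas b)) * G.ext _ (G.dbas b) z * e2
  simp only [h2, Finset.sum_add_distrib, ← Finset.mul_sum]
  rw [G.sum_ext_br (by omega) (by omega), G.sum_ext_br (by omega) (by omega), G.skew z'.2 z.2, map_neg, map_smul,
    smul_eq_mul]
  have e3 : (-1 : ℂ) ^ (n + 1) * (-1 : ℂ) ^ ((m + 1) * (n + 1)) * (-1 : ℂ) ^ (n * m) =
      -(-1 : ℂ) ^ (m + 1) := by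
    rw [← pow_add, ← pow_add, neg_one_pow_of_eq (n * m + n) (show n + 1 + (m + 1) * (n + 1) + n * m
      = (m + 1 + 1) + 2 * (n * m + n) by ring), pow_succ _ (m + 1)]
    ring
  linear_combination (-(1 / 2 : ℂ)) * G.ext p φ (G.br z z') * e3

/-- The commutator of the action and a contraction. -/
theorem th_con (e : Acyc G) : th G m z (con G n z' e) =
    (-1 : ℂ) ^ (m * n + m) • con G n z' (th G m z e) +
      (-1 : ℂ) ^ (m * n + m) • con G (m + n) (G.brk z z') e := by
  have h1 := (isDer_th G z).commutator (isDer_con G z')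
  have h2 : th G m z ∘ₗ con G n z' - (-1 : ℂ) ^ (m * (n + 1)) • con G n z' ∘ₗ th G m z =
      (-1 : ℂ) ^ (m * n + m) • con G (m + n) (G.brk z z') := by
    refine h1.ext (((isDer_con G (G.brk z z')).smul _).congr (by omega)) (forall_gen G
      (P := fun e => (th G m z ∘ₗ con G n z' - (-1 : ℂ) ^ (m * (n + 1)) • con G n z' ∘ₗ th G m z) e
        = ((-1 : ℂ) ^ (m * n + m) • con G (m + n) (G.brk z z')) e) ?_ ?_)
    · intro p φ
      simp only [LinearMap.sub_apply, LinearMap.smul_apply, LinearMap.comp_apply]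
      have e1 : th G m z (con G n z' (x G p φ)) = 0 := by
        rw [con_x, map_smul, (isDer_th G z).one, smul_zero]
      have e2 : d G (con G m z (x G p φ)) = 0 := by
        rw [con_x, map_smul, (isDer_d G).one, smul_zero]
      rw [e1, th_apply, e2, zero_add, map_smul, con_con_d_x, con_x, zero_sub, ← neg_smul, smul_smul,
        smul_smul, smul_smul, pow_succ]
      congr 1
      have e3 := neg_one_pow_mul_self m
      have : (G.brk z z' : L) = G.br z z' := rfl
      rw [this, mul_add, mul_one]
      linear_combination (-1 : ℂ) ^ (m * n + m) * G.ext p φ (G.br z z') * e3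
    · intro p φ
      simp only [LinearMap.sub_apply, LinearMap.smul_apply, LinearMap.comp_apply]
      -- `d y` is linear in the `x`, so a second contraction kills it.
      have e1 : con G n z' (con G m z (d G (y G p φ))) = 0 := by
        rw [con_linLE G z (lin_le_linLE G le_rfl (d_y_mem G p φ)), con_j]
      rw [con_y, con_y, map_zero, th_apply, con_y, map_zero, zero_add, map_smul, e1]
      simp
  have h3 := DFunLike.congr_fun h2 e
  simp only [LinearMap.sub_apply, LinearMap.smul_apply, LinearMap.comp_apply] at h3
  rw [sub_eq_iff_eq_add, mul_add, mul_one] at h3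
  rw [h3, add_comm]

/-- Formal from Cartan calculus: `th_con` expresses the contraction with a bracket as a commutator,
and `d` commutes with Lie derivatives up to sign. -/
theorem th_brk (e : Acyc G) : th G (m + n) (G.brk z z') e =
    (-1 : ℂ) ^ (m * n) • th G m z (th G n z' e) - th G n z' (th G m z e) := by
  have s1 := neg_one_pow_mul_self m
  have hc : ∀ e, con G (m + n) (G.brk z z') e =
      (-1 : ℂ) ^ (m * n + m) • th G m z (con G n z' e) - con G n z' (th G m z e) := by
    intro e
    rw [th_con, smul_add, smul_smul, smul_smul, neg_one_pow_mul_self, one_smul, one_smul,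
      add_sub_cancel_left]
  have hth : th G m z (d G e) = (-1 : ℂ) ^ m • d G (th G m z e) := by
    rw [d_th, smul_smul, s1, one_smul]
  rw [th_apply, hc, hc, map_sub, map_smul, d_th, hth, th_apply G z', th_apply G z', map_add,
    map_smul, map_smul]
  simp only [smul_add, smul_sub, smul_smul]
  have e1 : (-1 : ℂ) ^ (m * n + m) * (-1 : ℂ) ^ m = (-1 : ℂ) ^ (m * n) := by
    rw [pow_add, mul_assoc, s1, mul_one]
  have e2 : (-1 : ℂ) ^ (m + n) * (-1 : ℂ) ^ (m * n + m) = (-1 : ℂ) ^ (m * n) * (-1 : ℂ) ^ n := by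
    rw [← pow_add, ← pow_add]; exact neg_one_pow_of_eq m (by ring)
  have e3 : (-1 : ℂ) ^ (m + n) * (-1 : ℂ) ^ m = (-1 : ℂ) ^ n := by
    rw [← pow_add]; exact neg_one_pow_of_eq m (by ring)
  rw [e1, e2, e3]
  abel

/-- Contracting a product of two `x` leaves one `x`, which the quotient map kills. -/
theorem q_con_i_dualBracket (p : ℕ) (φ : Module.Dual ℂ (G.comp p)) :
    q G (con G m z (i G (CE.dualBracket G p φ))) = 0 := by
  have := CE.dualBracket_mem G (n := p) (M := LinearMap.ker ((q G).toLinearMap ∘ₗ con G m z ∘ₗ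
    (i G).toLinearMap))
    (fun k l hkl φ ψ => by
      rw [LinearMap.mem_ker, LinearMap.comp_apply, LinearMap.comp_apply, AlgHom.toLinearMap_apply,
        AlgHom.toLinearMap_apply, map_mul, i_gen, i_gen, con_x_mul, map_add, map_smul, map_smul,
        map_mul, q_x, q_x]
      simp) φ
  exact this

/-- Lie derivatives preserve the ideal generated by the `x`: this is checked on generators. Hence
they descend to the quotient `Cof`. -/
theorem q_th (e : Acyc G) : q G (th G m z e) = q G (th G m z (j G (q G e))) := by
  induction e using (super G).induction with
  | h1 => simp
  | hadd a b ha hb => simp only [map_add, ha, hb]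
  | hsmul r a ha => simp only [map_smul, ha]
  | hgen s =>
    refine forall_gen G (P := fun e => q G (th G m z e) = q G (th G m z (j G (q G e)))) ?_ ?_ s
    · intro p φ
      rw [q_x, map_zero, map_zero, map_zero, th_apply, con_x, map_smul, (isDer_d G).one, smul_zero,
        zero_add, d_x, map_smul, q_con_i_dualBracket, smul_zero]
    · intro p φ
      rw [q_y, j_y]
  | hmul a b ha hb =>
    rw [(isDer_th G z).mul, map_add, map_mul, map_mul, ha, hb, map_mul, map_mul,
      (isDer_th G z).mul, map_add, map_mul, map_mul, q_j, q_parPow, q_parPow, q_j]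

/-- The action of `L_n` on `Cof`. -/
def rho (n : ℕ) : G.comp n →ₗ[ℂ] Module.End ℂ (Cof G) where
  toFun z := (q G).toLinearMap ∘ₗ th G n z ∘ₗ (j G).toLinearMap
  map_add' a b := by ext e; simp
  map_smul' c a := by ext e; simp

theorem rho_apply (o : Cof G) : rho G m z o = q G (th G m z (j G o)) := rfl

theorem rho_q (e : Acyc G) : rho G m z (q G e) = q G (th G m z e) := by
  rw [rho_apply, ← q_th]

/-- The sign sits on the wrong term for a representation of `L`; the twist by `eta` moves it. -/
theorem rho_brk : rho G (m + n) (G.brk z z') =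
    (-1 : ℂ) ^ (m * n) • (rho G m z * rho G n z') - rho G n z' * rho G m z := by
  ext o
  simp only [LinearMap.sub_apply, LinearMap.smul_apply, Module.End.mul_apply]
  rw [rho_apply, th_brk, rho_apply G z' o, rho_apply G z o, rho_q, rho_q, map_sub, map_smul]

/-- The signs that turn `rho` into a representation. -/
def eta (n : ℕ) : ℂ := (-1) ^ (n.choose 2)

theorem eta_mul_self (n : ℕ) : eta n * eta n = 1 := neg_one_pow_mul_self _

/-- The binomial `n.choose 2` is a quadratic function whose polarization is `m n`. The twist by
`eta` thus absorbs the factor `(-1)^{mn}` of `rho_brk`. -/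
theorem eta_add (m n : ℕ) : eta (m + n) = (-1 : ℂ) ^ (m * n) * (eta m * eta n) := by
  have h : (m + n).choose 2 = m * n + (m.choose 2 + n.choose 2) := by
    induction n with
    | zero => simp
    | succ n ih =>
      rw [← add_assoc, Nat.choose_succ_succ' (m + n) 1, Nat.choose_succ_succ' n 1, ih]
      simp
      ring
  rw [eta, h, pow_add, pow_add]
  rfl

theorem rep_aux (i j : ℕ) (z : G.comp i) (z' : G.comp j) :
    G.linExt (fun n => eta n • rho G n) z * G.linExt (fun n => eta n • rho G n) z' -
      (-1 : ℂ) ^ (i * j) • (G.linExt (fun n => eta n • rho G n) z' *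
        G.linExt (fun n => eta n • rho G n) z) =
      G.linExt (fun n => eta n • rho G n) (G.br z z') := by
  have hb : G.br z z' = (G.brk z z' : L) := rfl
  rw [hb, G.linExt_coe, G.linExt_coe, G.linExt_coe, LinearMap.smul_apply, LinearMap.smul_apply,
    LinearMap.smul_apply, rho_brk, smul_mul_smul_comm, smul_mul_smul_comm, smul_sub, smul_smul,
    smul_smul, eta_add]
  congr 2
  · linear_combination (-(eta i * eta j)) * neg_one_pow_mul_self (i * j)
  · ring

/-- The representation of `U(L)` on `Cof`. -/
def rep : Env G →ₐ[ℂ] Module.End ℂ (Cof G) :=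
  Env.lift G (G.linExt fun n => eta n • rho G n) (rep_aux G)

theorem rep_ι : rep G (Env.ι G z) = eta m • rho G m z := by
  rw [rep, Env.lift_ι, G.linExt_coe, LinearMap.smul_apply]

end Acyc

end

/-! ### Embedding of `L` into `U(L)`, generation of `L` by `L_1`, and `V` inside `CE(L)`. -/

section

variable {L : Type v} [AddCommGroup L] [Module ℂ L] (G : GradedLieSuperalgebra L)

/-- The augmentation of `Cof`. -/
def Cof.eps : Cof G →ₐ[ℂ] ℂ := FGC.lift _ (fun _ => 0) (by simp)

@[simp]
theorem Cof.eps_y (p : ℕ) (φ : Module.Dual ℂ (G.comp p)) : Cof.eps G (Cof.y G p φ) = 0 :=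
  FGC.lift_gen (P := fun p => Module.Dual ℂ (G.comp p)) (fun p : ℕ => p) _ _ p φ

section Injective

variable [∀ m, FiniteDimensional ℂ (G.comp m)]

/-- Only the term `x φ` of `d y` survives: every product in the correction `h (d x)` contains a `y`,
and so does its contraction modulo the `x`. The formula shows that `rho` is faithful on each `L_n`,
hence that `L_n` embeds into `U(L)` without a Poincaré–Birkhoff–Witt theorem. -/
theorem Acyc.eps_rho_y {n : ℕ} (z : G.comp n) (p : ℕ) (φ : Module.Dual ℂ (G.comp p)) :
    Cof.eps G (Acyc.rho G n z (Cof.y G p φ)) = (-1 : ℂ) ^ n * G.ext p φ z := by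
  have h0 : Cof.eps G (Acyc.q G (Acyc.con G n z (Acyc.h G (Acyc.i G (CE.dualBracket G p φ))))) = 0 := by
    have := CE.dualBracket_mem G (n := p) (M := LinearMap.ker ((Cof.eps G).toLinearMap ∘ₗ
      (Acyc.q G).toLinearMap ∘ₗ Acyc.con G n z ∘ₗ Acyc.h G ∘ₗ (Acyc.i G).toLinearMap))
      (fun k l hkl φ ψ => by
        simp only [LinearMap.mem_ker, LinearMap.comp_apply, AlgHom.toLinearMap_apply, map_mul,
          Acyc.i_gen, (Acyc.isDer_h G).mul_of_mem (Acyc.x_mem_hp G k φ), Acyc.h_x, map_add,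
          smul_mul_assoc, mul_smul_comm, map_smul, Acyc.con_x_mul, Acyc.con_y,
          (Acyc.isDer_con G z).mul_of_mem (Acyc.y_mem_hp G k φ), Acyc.con_x, Acyc.q_y, Cof.eps_y,
          mul_zero, zero_mul, smul_zero, add_zero, map_zero, mul_one]) φ
    exact this
  rw [Acyc.rho_apply, Acyc.j_y, Acyc.th_apply, Acyc.con_y, map_zero, zero_add, Acyc.d_y, map_sub,
    map_smul, Acyc.con_x, map_smul, map_sub, map_smul, map_smul, map_sub, map_smul, map_smul,
    map_smul, h0, map_one, map_one]
  simp

/-- `L_n` embeds into `U(L)`. -/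
theorem Env.ι_injective {n : ℕ} (z : G.comp n) (h : Env.ι G z = 0) : z = 0 := by
  have h1 : Acyc.rho G n z = 0 := by
    have := Acyc.rep_ι G z
    rw [h, map_zero] at this
    exact (smul_eq_zero.1 this.symm).resolve_left fun h => by
      have := Acyc.eta_mul_self n
      rw [h] at this
      simp at this
  refine (Module.forall_dual_apply_eq_zero_iff ℂ z).1 fun φ => ?_
  have h2 := Acyc.eps_rho_y G z n φ
  rw [h1, LinearMap.zero_apply, map_zero, G.ext_coe] at h2
  exact (mul_eq_zero.1 h2.symm).resolve_left (pow_ne_zero _ (by norm_num))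

end Injective

variable {V : Type u} [AddCommGroup V] [Module ℂ V] {R : Submodule ℂ (V ⊗[ℂ] V)}
  (e : DualEnvIso G R)

/-- A form on `L_p`, `p ≥ 2`, that vanishes on all brackets is zero. -/
theorem DualEnvIso.dual_eq_zero (e : DualEnvIso G R) {p : ℕ} (hp : 2 ≤ p) (l : Module.Dual ℂ (G.comp p))
    (hl : ∀ (i j : ℕ), 1 ≤ i → 1 ≤ j → i + j = p → ∀ (z : G.comp i) (z' : G.comp j),
      G.ext p l (G.br z z') = 0) : l = 0 := by
  -- A form that kills brackets defines a homomorphism from `U(L)` to the dual numbers, in which all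
  -- products of such values vanish.
  let F : Env G →ₐ[ℂ] TrivSqZeroExt ℂ ℂ := Env.lift G (TrivSqZeroExt.inrHom ℂ ℂ ∘ₗ G.ext p l) (by
    intro i j z z'
    have : G.ext p l (G.br z z') = 0 := by
      by_cases h : i + j = p
      · rcases Nat.eq_zero_or_pos i with rfl | hi
        · have hz : (z : L) = 0 := (Submodule.mem_bot ℂ).1 (G.comp_zero ▸ z.2)
          rw [hz]; simp
        rcases Nat.eq_zero_or_pos j with rfl | hj
        · have hz : (z' : L) = 0 := (Submodule.mem_bot ℂ).1 (G.comp_zero ▸ z'.2)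
          rw [hz]; simp
        exact hl i j hi hj h z z'
      · exact G.ext_of_ne h (G.br_mem z.2 z'.2) l
    simp [this])
  -- Since `A^!` is generated in degree one, where `l` vanishes as `p ≥ 2`, this homomorphism can
  -- only be the augmentation.
  have hF : F.comp e.equiv.toAlgHom =
      (Algebra.ofId ℂ (TrivSqZeroExt ℂ ℂ)).comp (QuadAlg.eps (annihilator R)) := by
    refine QuadAlg.hom_ext _ fun f => ?_
    have h1 : G.ext p l (e.degOne f : L) = 0 := G.ext_of_ne (by omega) (e.degOne f).2 l
    have h2 : (e.equiv.toAlgHom : KoszulDual R →ₐ[ℂ] Env G) (QuadAlg.gen (annihilator R) f) =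
      Env.ι G (e.degOne f : L) := e.equiv_gen f
    rw [AlgHom.comp_apply, h2, AlgHom.comp_apply, QuadAlg.eps_gen, map_zero]
    simp [F, h1]
  ext z
  have h1 := DFunLike.congr_fun hF (e.equiv.symm (Env.ι G z))
  have h2 : F (Env.ι G z) = algebraMap ℂ _ (QuadAlg.eps (annihilator R) (e.equiv.symm (Env.ι G z))) := by
    rw [AlgHom.comp_apply] at h1
    have h3 : (e.equiv.toAlgHom : KoszulDual R →ₐ[ℂ] Env G) (e.equiv.symm (Env.ι G z)) = Env.ι G z :=
      e.equiv.apply_symm_apply _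
    rw [h3] at h1
    exact h1
  have h3 : F (Env.ι G z) = TrivSqZeroExt.inr (l z) := by
    simp only [F, Env.lift_ι, LinearMap.comp_apply, G.ext_coe]; rfl
  rw [h3] at h2
  have h4 := congrArg TrivSqZeroExt.snd h2
  simpa [TrivSqZeroExt.algebraMap_eq_inl] using h4

/-- `L` is generated by `L_1`. -/
theorem DualEnvIso.le_of_generated (e : DualEnvIso G R) {K : Submodule ℂ L} (h1 : G.comp 1 ≤ K)
    (hbr : ∀ (i j : ℕ) (z : G.comp i) (z' : G.comp j), (z : L) ∈ K → (z' : L) ∈ K →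
      G.br z z' ∈ K) (n : ℕ) : G.comp n ≤ K := by
  induction n using Nat.strong_induction_on with
  | _ n ih =>
    rcases Nat.lt_or_ge n 2 with hn | hn
    · interval_cases n
      · rw [G.comp_zero]; exact bot_le
      · exact h1
    -- If `K` missed part of `L_n`, a nonzero form on `L_n` would kill it. By induction all brackets
    -- of lower components lie in `K`, which contradicts `dual_eq_zero`.
    · by_contra hne
      have hlt : K.comap (G.comp n).subtype < ⊤ := by
        rw [lt_top_iff_ne_top]
        intro h
        exact hne (Submodule.comap_subtype_eq_top.1 h)
      obtain ⟨l, hl0, hl⟩ := Submodule.exists_le_ker_of_lt_top _ hlt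
      refine hl0 (e.dual_eq_zero G hn l fun i j hi hj hij z z' => ?_)
      have hm := G.br_mem_of_eq hij z.2 z'.2
      have hK : (⟨G.br z z', hm⟩ : G.comp n) ∈ K.comap (G.comp n).subtype :=
        hbr i j z z' (ih i (by omega) z.2) (ih j (by omega) z'.2)
      rw [GradedLieSuperalgebra.ext_apply, G.proj_of_mem hm]
      exact hl hK

variable [FiniteDimensional ℂ V]

/-- The vector in `V` that corresponds to a form on `L_p`: zero unless `p = 1`. -/
def DualEnvIso.vec : ∀ p, Module.Dual ℂ (G.comp p) →ₗ[ℂ] V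
  | 1 => (Module.evalEquiv ℂ V).symm.toLinearMap ∘ₗ e.degOne.toLinearMap.dualMap
  | 0 => 0
  | _ + 2 => 0

theorem DualEnvIso.apply_vec (p : ℕ) (φ : Module.Dual ℂ (G.comp p)) (f : Module.Dual ℂ V) :
    f (e.vec G p φ) = G.ext p φ (e.degOne f) := by
  match p with
  | 1 =>
    rw [G.ext_coe]
    exact Module.apply_evalEquiv_symm_apply ℂ V f _
  | 0 => rw [G.ext_of_ne (by omega) (e.degOne f).2]; exact map_zero f
  | n + 2 => rw [G.ext_of_ne (by omega) (e.degOne f).2]; exact map_zero f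

theorem DualEnvIso.vec_of_ne {p : ℕ} (hp : p ≠ 1) (φ : Module.Dual ℂ (G.comp p)) :
    e.vec G p φ = 0 := by
  match p, hp with
  | 0, _ => rfl
  | n + 2, _ => rfl

/-- The form on `L_1` that corresponds to a vector. -/
def DualEnvIso.form (v : V) : Module.Dual ℂ (G.comp 1) :=
  e.degOne.symm.toLinearMap.dualMap (Module.Dual.eval ℂ V v)

theorem DualEnvIso.vec_form (v : V) : e.vec G 1 (e.form G v) = v := by
  refine (Module.forall_dual_apply_eq_zero_iff ℂ _).1 (fun f => ?_) |> sub_eq_zero.1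
  rw [map_sub, e.apply_vec, G.ext_coe, DualEnvIso.form]
  simp

end

/-! ### Commutativity of `A`, symmetry of its relations, and biduality. -/

section Comm

variable {V : Type u} [AddCommGroup V] [Module ℂ V] {R : Submodule ℂ (V ⊗[ℂ] V)}

theorem QuadAlg.mul_comm_of (hcomm : ∀ u v : V, u ⊗ₜ[ℂ] v - v ⊗ₜ[ℂ] u ∈ R) (a b : QuadAlg R) :
    a * b = b * a := by
  have h : ∀ u v, gen R u * gen R v = gen R v * gen R u := fun u v => by
    have := mul_map_gen_eq_zero R (hcomm u v)
    simpa [sub_eq_zero] using this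
  have htop := adjoin_eq_top R
  have ha : a ∈ Algebra.adjoin ℂ (Set.range (gen R)) := by rw [htop]; trivial
  have hb : b ∈ Algebra.adjoin ℂ (Set.range (gen R)) := by rw [htop]; trivial
  refine Algebra.adjoin_induction₂ (p := fun a b _ _ => a * b = b * a) ?_ ?_ ?_ ?_ ?_ ?_ ?_ ?_ ha hb
  · rintro _ _ ⟨u, rfl⟩ ⟨v, rfl⟩; exact h u v
  · intro r s; exact Algebra.commutes _ _
  · intro r x hx; exact Algebra.commutes _ _
  · intro r x hx; exact (Algebra.commutes _ _).symm
  · intro x y z _ _ _ h1 h2; rw [add_mul, mul_add, h1, h2]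
  · intro x y z _ _ _ h1 h2; rw [add_mul, mul_add, h1, h2]
  · intro x y z _ _ _ h1 h2; rw [mul_assoc, h2, ← mul_assoc, h1, mul_assoc]
  · intro x y z _ _ _ h1 h2; rw [← mul_assoc, h1, mul_assoc, h2, mul_assoc]

/-- Since `R` contains all `u ⊗ v - v ⊗ u`, a tensor and its flip agree modulo `R`. By duality the
annihilator is stable under the flip as well. -/
theorem comm_mem_of (hcomm : ∀ u v : V, u ⊗ₜ[ℂ] v - v ⊗ₜ[ℂ] u ∈ R) {t : V ⊗[ℂ] V} (ht : t ∈ R) :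
    TensorProduct.comm ℂ V V t ∈ R := by
  have key : ∀ t : V ⊗[ℂ] V, TensorProduct.comm ℂ V V t - t ∈ R := fun t => by
    induction t using TensorProduct.induction_on with
    | zero => simp
    | tmul u v => exact hcomm v u
    | add a b ha hb =>
      rw [map_add, add_sub_add_comm]
      exact R.add_mem ha hb
  have := R.add_mem (key t) ht
  rwa [sub_add_cancel] at this

theorem comm_mem_annihilator (hcomm : ∀ u v : V, u ⊗ₜ[ℂ] v - v ⊗ₜ[ℂ] u ∈ R)
    {t : Module.Dual ℂ V ⊗[ℂ] Module.Dual ℂ V} (ht : t ∈ annihilator R) :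
    TensorProduct.comm ℂ _ _ t ∈ annihilator R := by
  intro r hr
  have key : ∀ (t : Module.Dual ℂ V ⊗[ℂ] Module.Dual ℂ V) (r : V ⊗[ℂ] V),
      TensorProduct.dualDistrib ℂ V V (TensorProduct.comm ℂ _ _ t) r =
        TensorProduct.dualDistrib ℂ V V t (TensorProduct.comm ℂ V V r) := by
    intro t r
    induction t using TensorProduct.induction_on with
    | zero => simp
    | add a b ha hb => simp only [map_add, LinearMap.add_apply, ha, hb]
    | tmul f g =>
      induction r using TensorProduct.induction_on with
      | zero => simp
      | add a b ha hb => simp only [map_add, ha, hb]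
      | tmul u v => simp [TensorProduct.dualDistrib_apply, mul_comm]
  rw [key]
  exact ht _ (comm_mem_of hcomm hr)

/-- Biduality `R^⊥⊥ = R`: a form separating `t` from `R` comes from a tensor in `V* ⊗ V*` because
`V` is finite-dimensional. -/
theorem mem_of_annihilator [FiniteDimensional ℂ V] {t : V ⊗[ℂ] V}
    (h : ∀ r ∈ annihilator R, TensorProduct.dualDistrib ℂ V V r t = 0) : t ∈ R := by
  by_contra ht
  obtain ⟨l, hl, hR⟩ := Submodule.exists_dual_map_eq_bot_of_notMem ht inferInstance
  refine hl ?_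
  have e := (TensorProduct.dualDistribEquiv ℂ V V).apply_symm_apply l
  have e' : TensorProduct.dualDistrib ℂ V V ((TensorProduct.dualDistribEquiv ℂ V V).symm l) = l := e
  rw [← e']
  refine h _ fun r hr => ?_
  rw [e']
  have : l r ∈ R.map l := Submodule.mem_map_of_mem hr
  rw [hR] at this
  exact this

end Comm

/-- If the generators have positive weights, only the scalars have weight zero. -/
theorem Coaction.exists_eq_smul_one {C : Type u} [Ring C] [Algebra ℂ C] {σ : Type v} {g : σ → C}
    {γ : σ → ℕ} (Δ : Coaction g γ) (h : ∀ s, γ s = 0 → g s = 0) {b : C} (hb : b ∈ Δ.comp 0) :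
    ∃ c : ℂ, b = c • 1 := by
  rw [comp_eq_span] at hb
  rw [← Submodule.mem_span_singleton.trans (exists_congr fun c => eq_comm)]
  refine Submodule.span_le.2 ?_ hb
  rintro _ ⟨l, hl, rfl⟩
  cases l with
  | nil => exact Submodule.mem_span_singleton_self _
  | cons s l =>
    rw [List.map_cons, List.sum_cons] at hl
    rw [List.map_cons, List.prod_cons, h s (by omega), zero_mul]
    exact Submodule.zero_mem _

/-! ### The weight grading of `CE(L)` and the quotient map to `A`. -/

section

variable {L : Type v} [AddCommGroup L] [Module ℂ L] (G : GradedLieSuperalgebra L)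

namespace CE

/-- The grading of `CE(L)` by weight. -/
abbrev wt : Coaction (super G).g (fun s => s.1) := CE.coaction G (fun p => p)

theorem gen_mem_wt (p : ℕ) (φ : Module.Dual ℂ (G.comp p)) : gen G p φ ∈ (wt G).comp p :=
  (wt G).gen_mem ⟨p, φ⟩

/-- Only the scalars have weight zero. -/
theorem exists_eq_smul_one {b : CE G} (hb : b ∈ (wt G).comp 0) : ∃ c : ℂ, b = c • 1 := by
  refine (wt G).exists_eq_smul_one ?_ hb
  rintro ⟨p, φ⟩ hp
  obtain rfl : p = 0 := hp
  rw [G.dual_comp_zero φ]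
  exact (gen G 0).map_zero

variable [∀ m, FiniteDimensional ℂ (G.comp m)]

theorem dualBracket_mem_wt (p : ℕ) (φ : Module.Dual ℂ (G.comp p)) :
    dualBracket G p φ ∈ (wt G).comp p :=
  dualBracket_mem G (fun i j hij φ ψ => by
    rw [← hij]
    exact (wt G).mul_mem (gen_mem_wt G i φ) (gen_mem_wt G j ψ)) φ

theorem d_mem_wt {n : ℕ} {b : CE G} (hb : b ∈ (wt G).comp n) : d G b ∈ (wt G).comp n :=
  (isDer_d G).mem_comp (wt G) (c := 0) (by
    rintro ⟨p, φ⟩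
    change d G (gen G p φ) ∈ _
    rw [d_gen]
    exact dualBracket_mem_wt G p φ) hb

end CE

variable {V : Type u} [AddCommGroup V] [Module ℂ V] [FiniteDimensional ℂ V]
  {R : Submodule ℂ (V ⊗[ℂ] V)} (hcomm : ∀ u v : V, u ⊗ₜ[ℂ] v - v ⊗ₜ[ℂ] u ∈ R)
  (e : DualEnvIso G R)

namespace DualEnvIso

/-- A commutation sign is visible only when both generators come from `L_1`; otherwise one of the
vectors is zero. -/
theorem gen_vec_mul_gen_vec (p q : ℕ) (φ : Module.Dual ℂ (G.comp p))
    (ψ : Module.Dual ℂ (G.comp q)) (c : ℂ) (hc : p = 1 → q = 1 → c = 1) :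
    c • (QuadAlg.gen R (e.vec G p φ) * QuadAlg.gen R (e.vec G q ψ)) =
      QuadAlg.gen R (e.vec G p φ) * QuadAlg.gen R (e.vec G q ψ) := by
  by_cases hp : p = 1
  · by_cases hq : q = 1
    · rw [hc hp hq, one_smul]
    · rw [e.vec_of_ne G hq, map_zero, mul_zero, smul_zero]
  · rw [e.vec_of_ne G hp, map_zero, zero_mul, smul_zero]

/-- The quotient map `CE(L) → A`. -/
def pi : CE G →ₐ[ℂ] QuadAlg R :=
  CE.lift G (fun p => QuadAlg.gen R ∘ₗ e.vec G p) fun p q φ ψ => by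
    simp only [LinearMap.comp_apply]
    rw [e.gen_vec_mul_gen_vec G q p ψ φ _ (by rintro rfl rfl; norm_num),
      QuadAlg.mul_comm_of hcomm]

theorem pi_gen (p : ℕ) (φ : Module.Dual ℂ (G.comp p)) :
    e.pi G hcomm (CE.gen G p φ) = QuadAlg.gen R (e.vec G p φ) := CE.lift_gen G _ _ p φ

theorem pi_gen_of_ne {p : ℕ} (hp : p ≠ 1) (φ : Module.Dual ℂ (G.comp p)) :
    e.pi G hcomm (CE.gen G p φ) = 0 := by
  rw [pi_gen, e.vec_of_ne G hp, map_zero]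

theorem pi_par (b : CE G) : e.pi G hcomm ((CE.super G).par b) = e.pi G hcomm b := by
  have h : (e.pi G hcomm).comp (CE.super G).par = e.pi G hcomm := CE.hom_ext G fun p φ => by
    rw [AlgHom.comp_apply, CE.gen_mem_hp G p φ, map_smul]
    by_cases hp : p = 1
    · subst hp; norm_num
    · rw [pi_gen_of_ne G hcomm e hp, smul_zero]
  exact DFunLike.congr_fun h b

theorem pi_surjective (a : QuadAlg R) : ∃ b, e.pi G hcomm b = a := by
  have ha : a ∈ Algebra.adjoin ℂ (Set.range (QuadAlg.gen R)) := by
    rw [QuadAlg.adjoin_eq_top]; trivial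
  have hle : Algebra.adjoin ℂ (Set.range (QuadAlg.gen R)) ≤ (e.pi G hcomm).range := by
    rw [Algebra.adjoin_le_iff]
    rintro _ ⟨v, rfl⟩
    exact ⟨CE.gen G 1 (e.form G v), by simp [pi_gen, e.vec_form]⟩
  exact hle ha

theorem pi_mem_deg {n : ℕ} {b : CE G} (hb : b ∈ (CE.wt G).comp n) :
    e.pi G hcomm b ∈ QuadAlg.deg R n := by
  rw [Coaction.comp_eq_span] at hb
  induction hb using Submodule.span_induction with
  | zero => simp
  | add a b _ _ ha hb => rw [map_add]; exact Submodule.add_mem _ ha hb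
  | smul r a _ ha => rw [map_smul]; exact Submodule.smul_mem _ _ ha
  | mem a ha =>
    obtain ⟨l, rfl, rfl⟩ := ha
    induction l with
    | nil =>
      change e.pi G hcomm 1 ∈ (LinearMap.range (QuadAlg.gen R)) ^ 0
      rw [map_one, pow_zero]
      exact Submodule.one_le.1 le_rfl
    | cons s l ih =>
      obtain ⟨p, φ⟩ := s
      change e.pi G hcomm (CE.gen G p φ * (l.map (CE.super G).g).prod) ∈
        QuadAlg.deg R (p + (l.map fun s => s.1).sum)
      rw [map_mul]
      refine QuadAlg.mul_mem_deg _ ?_ ih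
      by_cases hp : p = 1
      · subst hp; rw [pi_gen]; exact QuadAlg.gen_mem_deg _ _
      · rw [pi_gen_of_ne G hcomm e hp]; exact Submodule.zero_mem _

theorem pi_proj (n : ℕ) (b : CE G) :
    e.pi G hcomm ((CE.wt G).proj n b) = QuadAlg.proj R n (e.pi G hcomm b) := by
  symm
  refine (CE.wt G).proj_comm (QuadAlg.coaction R (1 : ℕ)) (e.pi G hcomm).toLinearMap ?_ n b
  intro n b hb
  rw [QuadAlg.comp_coaction_eq_deg]
  exact e.pi_mem_deg G hcomm hb

theorem eq_zero_of_pi {b : CE G} (hb : b ∈ (CE.wt G).comp 0) (h : e.pi G hcomm b = 0) : b = 0 := by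
  obtain ⟨c, rfl⟩ := CE.exists_eq_smul_one G hb
  rw [map_smul, map_one] at h
  rw [(smul_eq_zero.1 h).resolve_right one_ne_zero, zero_smul]

variable [∀ m, FiniteDimensional ℂ (G.comp m)]

/-- The bracket `V* ⊗ V* → L_2`. -/
def brTensor : Module.Dual ℂ V ⊗[ℂ] Module.Dual ℂ V →ₗ[ℂ] G.comp 2 :=
  brComp G rfl ∘ₗ TensorProduct.map e.degOne.toLinearMap e.degOne.toLinearMap

/-- The relations of `A^!` hold in `L`. -/
theorem brTensor_eq_zero (hcomm : ∀ u v : V, u ⊗ₜ[ℂ] v - v ⊗ₜ[ℂ] u ∈ R)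
    {r : Module.Dual ℂ V ⊗[ℂ] Module.Dual ℂ V} (hr : r ∈ annihilator R) :
    e.brTensor G r = 0 := by
  refine Env.ι_injective G _ ?_
  -- Elements of `L_1` are odd, so their bracket is `f g + g f` in `U(L)`: a tensor contributes
  -- together with its flip. Both lie in the annihilator of `R`, and `L_2` embeds into `U(L)`.
  have key : ∀ r, Env.ι G (e.brTensor G r) = e.equiv
      (LinearMap.mul' ℂ _ (TensorProduct.map (QuadAlg.gen (annihilator R))
        (QuadAlg.gen (annihilator R)) r) +
      LinearMap.mul' ℂ _ (TensorProduct.map (QuadAlg.gen (annihilator R))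
        (QuadAlg.gen (annihilator R)) (TensorProduct.comm ℂ _ _ r))) := by
    intro r
    induction r using TensorProduct.induction_on with
    | zero => simp
    | add a b ha hb =>
      simp only [map_add, Submodule.coe_add] at ha hb ⊢
      rw [ha, hb]
      abel
    | tmul f g =>
      have h1 : (e.brTensor G (f ⊗ₜ g) : L) = G.br (e.degOne f) (e.degOne g) := by
        simp [brTensor, brComp]
      rw [h1, Env.ι_br]
      simp [e.equiv_gen]
  rw [key, QuadAlg.mul_map_gen_eq_zero _ hr,
    QuadAlg.mul_map_gen_eq_zero _ (comm_mem_annihilator hcomm hr), add_zero, map_zero]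

/-- Only products of two generators from `L_1^*` survive in `A`, which leaves `p = 2`. There the
image is that of a tensor in `V ⊗ V` whose pairing with `r ∈ R^⊥` is `φ` of the bracket of `r`,
hence zero; by biduality the tensor lies in `R`. -/
theorem pi_dualBracket (p : ℕ) (φ : Module.Dual ℂ (G.comp p)) :
    e.pi G hcomm (CE.dualBracket G p φ) = 0 := by
  by_cases hp : p = 2
  · subst hp
    -- The preimage in `V ⊗ V` of twice the element, obtained by replacing each dual basis element
    -- by its vector. Only pairs from `L_1` contribute, and on these the sign is `1`.
    set t : V ⊗[ℂ] V := ∑ a : G.Idx 2, ∑ b : G.Idx 2,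
      ((-1 : ℂ) ^ (G.wt a + 1) * G.ext 2 φ (G.br (G.bas a) (G.bas b))) •
        (e.vec G _ (G.dbas a) ⊗ₜ[ℂ] e.vec G _ (G.dbas b)) with ht
    have h1 : e.pi G hcomm (CE.dualBracket G 2 φ) = (1 / 2 : ℂ) • LinearMap.mul' ℂ _
        (TensorProduct.map (QuadAlg.gen R) (QuadAlg.gen R) t) := by
      rw [CE.dualBracket_eq_sum G (N := 2) le_rfl, ht]
      simp only [map_smul, map_sum, map_mul, CE.bgen, pi_gen, TensorProduct.map_tmul,
        LinearMap.mul'_apply]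
    rw [h1, QuadAlg.mul_map_gen_eq_zero R, smul_zero]
    refine mem_of_annihilator fun r hr => ?_
    have key : ∀ r, TensorProduct.dualDistrib ℂ V V r t = φ (e.brTensor G r) := by
      intro r
      induction r using TensorProduct.induction_on with
      | zero => simp
      | add a b ha hb => simp only [map_add, LinearMap.add_apply, ha, hb]
      | tmul f g =>
        have h2 : e.brTensor G (f ⊗ₜ g) = G.brk (e.degOne f) (e.degOne g) := by
          simp [brTensor, brComp, GradedLieSuperalgebra.brk]
        rw [h2, ← G.ext_coe]
        change _ = G.ext 2 φ (G.br (e.degOne f) (e.degOne g))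
        rw [← G.sum_ext_br (N := 2) (by omega) (by omega), ht]
        simp only [map_sum, map_smul, TensorProduct.dualDistrib_apply, smul_eq_mul]
        refine Finset.sum_congr rfl fun a _ => Finset.sum_congr rfl fun b _ => ?_
        rw [e.apply_vec, e.apply_vec]
        have e1 := G.sign_mul_ext (fun p => (-1 : ℂ) ^ (p + 1)) (G.dbas a) (e.degOne f).2
        norm_num at e1
        linear_combination G.ext 2 φ (G.br (G.bas a) (G.bas b)) *
          G.ext _ (G.dbas b) (e.degOne g) * e1
    rw [key, e.brTensor_eq_zero G hcomm hr, map_zero]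
  · refine CE.dualBracket_mem G (M := LinearMap.ker (e.pi G hcomm).toLinearMap) ?_ φ
    intro i j hij φ ψ
    rw [LinearMap.mem_ker, AlgHom.toLinearMap_apply, map_mul]
    by_cases hi : i = 1
    · rw [pi_gen_of_ne G hcomm e (p := j) (by omega), mul_zero]
    · rw [pi_gen_of_ne G hcomm e hi, zero_mul]

theorem pi_d (b : CE G) : e.pi G hcomm (CE.d G b) = 0 := by
  induction b using (CE.super G).induction with
  | h1 => rw [(CE.isDer_d G).one, map_zero]
  | hadd a b ha hb => simp only [map_add, ha, hb, add_zero]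
  | hsmul r a ha => simp only [map_smul, ha, smul_zero]
  | hgen s =>
    exact (congrArg _ (CE.d_gen G s.1 s.2)).trans (e.pi_dualBracket G hcomm s.1 s.2)
  | hmul a b ha hb =>
    rw [(CE.isDer_d G).mul, map_add, map_mul, map_mul, ha, hb, zero_mul, mul_zero, add_zero]

end DualEnvIso

end

/-! ### The acyclic extension as `CE(L) ⊗ Cof`, and homogeneous bases of `Cof`. -/

section

variable {L : Type v} [AddCommGroup L] [Module ℂ L] (G : GradedLieSuperalgebra L)

namespace Acyc

theorem i_parPow (k : ℕ) (a : CE G) :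
    i G (((CE.super G).par ^ k) a) = ((super G).par ^ k) (i G a) := by
  induction k with
  | zero => simp
  | succ k ih => rw [pow_succ', AlgHom.mul_apply, i_par, ih, pow_succ', AlgHom.mul_apply]

/-- The powers of the parity automorphism of `CE(L)`. -/
def parp (k : ℕ) : CE G →ₐ[ℂ] CE G := (CE.super G).par ^ k

/-- The action of the acyclic extension on `CE(L) ⊗ Cof`. -/
def act : Acyc G →ₐ[ℂ] Module.End ℂ (CE G ⊗[ℂ] Cof G) :=
  FGC.lift ePr (fun
    | (false, p) => (TensorProduct.mapBilinear (RingHom.id ℂ) (CE G) (Cof G) (CE G) (Cof G)).flip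
        LinearMap.id ∘ₗ LinearMap.mul ℂ (CE G) ∘ₗ CE.gen G p
    | (true, p) => TensorProduct.mapBilinear (RingHom.id ℂ) (CE G) (Cof G) (CE G) (Cof G)
        (parp G p).toLinearMap ∘ₗ LinearMap.mul ℂ (Cof G) ∘ₗ Cof.y G p) (by
    rintro ⟨_ | _, p⟩ ⟨_ | _, r⟩ φ ψ
    · refine TensorProduct.ext' fun b o => ?_
      have h := CE.gen_mul_gen G p r φ ψ
      simp [ePr, ← mul_assoc, h, TensorProduct.smul_tmul']
    · refine TensorProduct.ext' fun b o => ?_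
      have h : parp G r (CE.gen G p φ) = _ := SuperAlg.parPow_of_mem (CE.gen_mem_hp G p φ) r
      simp [ePr, h, TensorProduct.smul_tmul', smul_smul, ← pow_add]
      rw [neg_one_pow_of_eq (l := 0) (r * (p + 1)) (by ring)]
      simp
    · refine TensorProduct.ext' fun b o => ?_
      have h : parp G p (CE.gen G r ψ) = _ := SuperAlg.parPow_of_mem (CE.gen_mem_hp G r ψ) p
      simp [ePr, h, TensorProduct.smul_tmul']
    · refine TensorProduct.ext' fun b o => ?_
      have h := SuperAlg.mul_comm_of_mem (Cof.y_mem_hp G p φ) (Cof.y_mem_hp G r ψ)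
      have h2 : parp G p (parp G r b) = parp G r (parp G p b) := by
        rw [parp, parp, ← AlgHom.mul_apply, ← AlgHom.mul_apply, ← pow_add, ← pow_add, add_comm]
      simp [ePr, ← mul_assoc, h, h2])

theorem act_x (p : ℕ) (φ : Module.Dual ℂ (G.comp p)) (b : CE G) (o : Cof G) :
    act G (x G p φ) (b ⊗ₜ o) = (CE.gen G p φ * b) ⊗ₜ o := by
  have h : act G (x G p φ) = _ := FGC.lift_gen (P := eSp G) ePr _ _ (false, p) φ
  rw [h]
  simp

theorem act_y (p : ℕ) (φ : Module.Dual ℂ (G.comp p)) (b : CE G) (o : Cof G) :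
    act G (y G p φ) (b ⊗ₜ o) = ((CE.super G).par ^ p) b ⊗ₜ (Cof.y G p φ * o) := by
  have h : act G (y G p φ) = _ := FGC.lift_gen (P := eSp G) ePr _ _ (true, p) φ
  rw [h]
  rfl

theorem act_i (c b : CE G) (o : Cof G) : act G (i G c) (b ⊗ₜ o) = (c * b) ⊗ₜ o := by
  induction c using (CE.super G).induction generalizing b with
  | h1 => simp
  | hadd c c' h h' => rw [map_add, map_add, LinearMap.add_apply, h, h', add_mul,
      TensorProduct.add_tmul]
  | hsmul r c h => rw [map_smul, map_smul, LinearMap.smul_apply, h, smul_mul_assoc,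
      TensorProduct.smul_tmul']
  | hgen s =>
    have h : i G ((CE.super G).g s) = x G s.1 s.2 := i_gen G s.1 s.2
    rw [h, act_x]
    rfl
  | hmul c c' h h' => rw [map_mul, map_mul, Module.End.mul_apply, h', h, mul_assoc]

theorem act_j (c o : Cof G) : act G (j G c) (1 ⊗ₜ o) = 1 ⊗ₜ (c * o) := by
  induction c using (Cof.super G).induction generalizing o with
  | h1 => simp
  | hadd c c' h h' => rw [map_add, map_add, LinearMap.add_apply, h, h', add_mul,
      TensorProduct.tmul_add]
  | hsmul r c h => rw [map_smul, map_smul, LinearMap.smul_apply, h, smul_mul_assoc,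
      TensorProduct.tmul_smul]
  | hgen s =>
    have h : j G ((Cof.super G).g s) = y G s.1 s.2 := j_y G s.1 s.2
    rw [h, act_y, map_one]
    rfl
  | hmul c c' h h' => rw [map_mul, map_mul, Module.End.mul_apply, h', h, mul_assoc]

/-- The multiplication map. -/
def mult : CE G ⊗[ℂ] Cof G →ₗ[ℂ] Acyc G :=
  LinearMap.mul' ℂ (Acyc G) ∘ₗ TensorProduct.map (i G).toLinearMap (j G).toLinearMap

theorem mult_tmul (b : CE G) (o : Cof G) : mult G (b ⊗ₜ o) = i G b * j G o := by
  simp [mult]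

/-- Acting on `1 ⊗ 1` inverts multiplication on the left, so the tensor product embeds into the
acyclic extension. -/
theorem act_mult (t : CE G ⊗[ℂ] Cof G) : act G (mult G t) (1 ⊗ₜ 1) = t := by
  induction t using TensorProduct.induction_on with
  | zero => simp
  | add a b ha hb => rw [map_add, map_add, LinearMap.add_apply, ha, hb]
  | tmul b o => rw [mult_tmul, map_mul, Module.End.mul_apply, act_j, mul_one, act_i, mul_one]

/-- The image contains `1` and is stable under left multiplication by generators, a `y` being moved
past `CE(L)` at the cost of a parity automorphism. -/
theorem mult_surjective : Function.Surjective (mult G) := by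
  have key : ∀ a e, e ∈ LinearMap.range (mult G) → a * e ∈ LinearMap.range (mult G) := by
    intro a
    induction a using (super G).induction with
    | h1 => intro e he; rwa [one_mul]
    | hadd a b ha hb => intro e he; rw [add_mul]; exact Submodule.add_mem _ (ha e he) (hb e he)
    | hsmul r a ha => intro e he; rw [smul_mul_assoc]; exact Submodule.smul_mem _ _ (ha e he)
    | hmul a b ha hb => intro e he; rw [mul_assoc]; exact ha _ (hb e he)
    | hgen s =>
      rintro _ ⟨t, rfl⟩
      induction t using TensorProduct.induction_on with
      | zero => simp
      | add a b ha hb => rw [map_add, mul_add]; exact Submodule.add_mem _ ha hb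
      | tmul b o =>
        rw [mult_tmul]
        refine forall_gen G (P := fun a => a * (i G b * j G o) ∈ LinearMap.range (mult G)) ?_ ?_ s
        · intro p φ
          exact ⟨(CE.gen G p φ * b) ⊗ₜ o, by rw [mult_tmul, map_mul, i_gen, mul_assoc]⟩
        · intro p φ
          refine ⟨((CE.super G).par ^ p) b ⊗ₜ (Cof.y G p φ * o), ?_⟩
          rw [mult_tmul, map_mul, j_y, i_parPow, ← mul_assoc, ← mul_assoc,
            SuperAlg.mul_eq_of_mem (y_mem_hp G p φ)]
  intro a
  have := key a 1 ⟨1 ⊗ₜ 1, by simp [mult_tmul]⟩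
  rwa [mul_one] at this

/-- The acyclic extension as a tensor product. -/
def tens : CE G ⊗[ℂ] Cof G ≃ₗ[ℂ] Acyc G :=
  LinearEquiv.ofBijective (mult G)
    ⟨Function.LeftInverse.injective (g := fun e => act G e (1 ⊗ₜ 1)) (act_mult G),
      mult_surjective G⟩

/-- An induction principle for additive properties. -/
theorem induction_mul {P : Acyc G → Prop} (h0 : P 0) (hadd : ∀ a b, P a → P b → P (a + b))
    (hmul : ∀ b o, P (i G b * j G o)) (a : Acyc G) : P a := by
  obtain ⟨t, rfl⟩ := mult_surjective G a
  induction t using TensorProduct.induction_on with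
  | zero => rw [map_zero]; exact h0
  | add a b ha hb => rw [map_add]; exact hadd _ _ ha hb
  | tmul b o => rw [mult_tmul]; exact hmul b o

end Acyc

/-- A homogeneous basis of `Cof` that contains `1`. -/
structure HomBasis where
  /-- the index types -/
  S : ℕ → Type v
  /-- the basis -/
  bas : Module.Basis (Σ m, S m) ℂ (Cof G)
  mem : ∀ m s, bas ⟨m, s⟩ ∈ (Cof.wt G).comp m
  /-- the index of `1` -/
  uniq : Unique (S 0)
  one : bas ⟨0, uniq.default⟩ = 1

theorem Cof.exists_eq_smul_one {b : Cof G} (hb : b ∈ (wt G).comp 0) : ∃ c : ℂ, b = c • 1 := by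
  refine (wt G).exists_eq_smul_one ?_ hb
  rintro ⟨p, φ⟩ hp
  obtain rfl : p = 0 := hp
  rw [G.dual_comp_zero φ]
  exact (y G 0).map_zero

instance : Nontrivial (Cof G) := (Cof.eps G).toRingHom.domain_nontrivial

/-- Bases are chosen weight by weight; in weight zero the component consists of scalars, so `1` can
be the basis element. -/
theorem HomBasis.nonempty : Nonempty (HomBasis G) := by
  have key : ∀ m, ∃ (S : Type v) (b : Module.Basis S ℂ ((Cof.wt G).comp m)),
      ∀ hm : m = 0, ∃ u : Unique S, (b u.default : Cof G) = 1 := by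
    intro m
    rcases Nat.eq_zero_or_pos m with rfl | hm
    · have h1 : (⟨1, (Cof.wt G).one_mem⟩ : (Cof.wt G).comp 0) ≠ 0 := fun h =>
        one_ne_zero (congrArg Subtype.val h)
      have hli : LinearIndependent ℂ (fun _ : PUnit.{v + 1} =>
          (⟨1, (Cof.wt G).one_mem⟩ : (Cof.wt G).comp 0)) := LinearIndependent.of_subsingleton PUnit.unit h1
      have hsp : ⊤ ≤ Submodule.span ℂ (Set.range fun _ : PUnit.{v + 1} =>
          (⟨1, (Cof.wt G).one_mem⟩ : (Cof.wt G).comp 0)) := by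
        rintro ⟨b, hb⟩ -
        obtain ⟨c, rfl⟩ := Cof.exists_eq_smul_one G hb
        change c • (⟨1, (Cof.wt G).one_mem⟩ : (Cof.wt G).comp 0) ∈ _
        exact Submodule.smul_mem _ c (Submodule.subset_span ⟨PUnit.unit, rfl⟩)
      exact ⟨PUnit, Module.Basis.mk hli hsp, fun _ => ⟨inferInstance, by simp⟩⟩
    · exact ⟨_, Module.Basis.ofVectorSpace ℂ _, fun h => by omega⟩
  choose S b hb using key
  obtain ⟨u, hu⟩ := hb 0 rfl
  exact ⟨⟨S, (Cof.wt G).isInternal.collectedBasis b,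
    fun m s => (Cof.wt G).isInternal.collectedBasis_mem b ⟨m, s⟩, u, by
      rw [DirectSum.IsInternal.collectedBasis_coe]; exact hu⟩⟩

variable {G}

namespace HomBasis

variable (H : HomBasis G)

theorem repr_proj (n : ℕ) (o : Cof G) (m : ℕ) (s : H.S m) :
    H.bas.repr ((Cof.wt G).proj n o) ⟨m, s⟩ = if m = n then H.bas.repr o ⟨m, s⟩ else 0 := by
  classical
  have h : Finsupp.lapply ⟨m, s⟩ ∘ₗ H.bas.repr.toLinearMap ∘ₗ (Cof.wt G).proj n =
      if m = n then Finsupp.lapply ⟨m, s⟩ ∘ₗ H.bas.repr.toLinearMap else 0 := by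
    refine H.bas.ext ?_
    rintro ⟨m', s'⟩
    rw [LinearMap.comp_apply, LinearMap.comp_apply, (Cof.wt G).proj_of_mem (H.mem m' s')]
    by_cases h1 : m' = n
    · rw [if_pos h1]
      by_cases h2 : m = n
      · rw [if_pos h2]; rfl
      · rw [if_neg h2]
        simp only [LinearEquiv.coe_coe, Module.Basis.repr_self, Finsupp.lapply_apply,
          LinearMap.zero_apply, Finsupp.single_apply]
        rw [if_neg]
        intro h3
        exact h2 ((congrArg Sigma.fst h3).symm.trans h1)
    · rw [if_neg h1]
      by_cases h2 : m = n
      · rw [if_pos h2]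
        simp only [LinearMap.comp_apply, map_zero, LinearEquiv.coe_coe, Module.Basis.repr_self,
          Finsupp.lapply_apply, Finsupp.single_apply]
        rw [if_neg]
        intro h3
        exact h1 ((congrArg Sigma.fst h3).trans h2)
      · rw [if_neg h2]; simp
  have := DFunLike.congr_fun h o
  split_ifs at this ⊢ <;> exact this

theorem repr_of_mem {n : ℕ} {o : Cof G} (ho : o ∈ (Cof.wt G).comp n) {m : ℕ} (hm : m ≠ n)
    (s : H.S m) : H.bas.repr o ⟨m, s⟩ = 0 := by
  rw [← (Cof.wt G).proj_same ho, repr_proj, if_neg hm]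

/-- The coordinates of an element of the acyclic extension, in `CE(L)`. -/
def coord : Acyc G ≃ₗ[ℂ] ((Σ m, H.S m) →₀ CE G) :=
  letI := Classical.decEq (Σ m, H.S m)
  (Acyc.tens G).symm ≪≫ₗ LinearEquiv.lTensor (CE G) H.bas.repr ≪≫ₗ
    TensorProduct.finsuppScalarRight ℂ ℂ (CE G) _

theorem coord_mul (b : CE G) (o : Cof G) (s : Σ m, H.S m) :
    H.coord (Acyc.i G b * Acyc.j G o) s = H.bas.repr o s • b := by
  have h : (Acyc.tens G).symm (Acyc.i G b * Acyc.j G o) = b ⊗ₜ o := by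
    rw [LinearEquiv.symm_apply_eq]; exact (Acyc.mult_tmul G b o).symm
  simp [coord, h]

theorem coord_symm_single (b : CE G) (s : Σ m, H.S m) :
    H.coord.symm (Finsupp.single s b) = Acyc.i G b * Acyc.j G (H.bas s) := by
  classical
  rw [LinearEquiv.symm_apply_eq]
  ext t
  rw [coord_mul, Module.Basis.repr_self, Finsupp.single_apply, Finsupp.single_apply]
  split_ifs <;> simp

theorem coord_i_mul (b : CE G) (a : Acyc G) (s : Σ m, H.S m) :
    H.coord (Acyc.i G b * a) s = b * H.coord a s := by
  induction a using Acyc.induction_mul with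
  | h0 => simp
  | hadd a a' h h' => rw [mul_add, map_add, Finsupp.add_apply, h, h', map_add, Finsupp.add_apply,
      mul_add]
  | hmul c o => rw [← mul_assoc, ← map_mul, coord_mul, coord_mul, mul_smul_comm]

theorem coord_j (o : Cof G) (s : Σ m, H.S m) :
    H.coord (Acyc.j G o) s = H.bas.repr o s • 1 := by
  have := H.coord_mul 1 o s
  rwa [map_one, one_mul] at this

end HomBasis

end

/-! ### Linear forms on `A` that read off its components of degree one and two. -/

namespace QuadAlg

variable {V : Type u} [AddCommGroup V] [Module ℂ V] (R : Submodule ℂ (V ⊗[ℂ] V))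

/-- The component of degree one, as a vector. -/
theorem exists_linear_part : ∃ F : QuadAlg R →ₗ[ℂ] V, ∀ v, F (gen R v) = v := by
  have e : ∀ x ∈ R, LinearMap.mul' ℂ _ (TensorProduct.map
      (detectGen (0 : Module.Dual ℂ (V ⊗[ℂ] V))) (detectGen 0) x) = 0 :=
    fun t ht => LinearMap.ext fun x => by rw [mul_map_detectGen]; simp
  refine ⟨LinearMap.fst ℂ V ℂ ∘ₗ LinearMap.snd ℂ ℂ (V × ℂ) ∘ₗ LinearMap.applyₗ (1, 0, 0) ∘ₗ
    (lift R (detectGen 0) e).toLinearMap, fun v => ?_⟩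
  simp [detectGen]

/-- A form on `V ⊗ V` that vanishes on the relations gives a form on the algebra. -/
theorem exists_quadratic_form (l : Module.Dual ℂ (V ⊗[ℂ] V)) (hl : ∀ t ∈ R, l t = 0) :
    ∃ F : QuadAlg R →ₗ[ℂ] ℂ, ∀ u v, F (gen R u * gen R v) = l (u ⊗ₜ v) := by
  have e : ∀ x ∈ R, LinearMap.mul' ℂ _ (TensorProduct.map (detectGen l) (detectGen l) x) = 0 :=
    fun t ht => LinearMap.ext fun x => by
      rw [mul_map_detectGen, hl t ht]; simp [Prod.zero_eq_mk]
  refine ⟨LinearMap.snd ℂ V ℂ ∘ₗ LinearMap.snd ℂ ℂ (V × ℂ) ∘ₗ LinearMap.applyₗ (1, 0, 0) ∘ₗ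
    (lift R (detectGen l) e).toLinearMap, fun u v => ?_⟩
  simp [detectGen]

end QuadAlg

/-! ### Free modules on a graded set of generators. -/

section Sigma

variable {A : Type u} [Ring A] {S : ℕ → Type v}

/-- The inclusion of the part of degree `m`. -/
def emb (m : ℕ) : (S m →₀ A) →ₗ[A] ((Σ m, S m) →₀ A) := Finsupp.lmapDomain A A (Sigma.mk m)

/-- The restriction to the part of degree `m`. -/
def res (m : ℕ) : ((Σ m, S m) →₀ A) →ₗ[A] (S m →₀ A) :=
  Finsupp.lcomapDomain (Sigma.mk m) sigma_mk_injective

@[simp]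
theorem res_apply (m : ℕ) (x : (Σ m, S m) →₀ A) (s : S m) : res m x s = x ⟨m, s⟩ := rfl

theorem emb_apply (m : ℕ) (x : S m →₀ A) (s : S m) : emb m x ⟨m, s⟩ = x s :=
  Finsupp.mapDomain_apply sigma_mk_injective _ _

theorem emb_apply_of_ne {m k : ℕ} (h : k ≠ m) (x : S m →₀ A) (s : S k) : emb m x ⟨k, s⟩ = 0 :=
  Finsupp.mapDomain_of_notMem_range _ _ (by rintro ⟨t, ht⟩; exact h (congrArg Sigma.fst ht).symm)

theorem emb_injective (m : ℕ) {x x' : S m →₀ A} (h : emb m x = emb m x') : x = x' := by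
  ext s
  rw [← emb_apply, h, emb_apply]

theorem emb_res {m : ℕ} {x : (Σ m, S m) →₀ A} (hx : ∀ k, k ≠ m → ∀ s, x ⟨k, s⟩ = 0) :
    emb m (res m x) = x := by
  refine Finsupp.ext ?_
  rintro ⟨k, s⟩
  by_cases h : k = m
  · subst h; rw [emb_apply, res_apply]
  · rw [emb_apply_of_ne h, hx k h]

theorem emb_single (m : ℕ) (s : S m) (a : A) :
    emb m (Finsupp.single s a) = Finsupp.single (⟨m, s⟩ : Σ m, S m) a := by
  simp [emb]

/-- An element is the sum of its parts. -/
theorem exists_sum_emb_res (x : (Σ m, S m) →₀ A) :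
    ∃ N, ∀ M, N ≤ M → x = ∑ m ∈ Finset.range M, emb m (res m x) := by
  obtain ⟨N, hN⟩ : ∃ N, ∀ s ∈ x.support, s.1 < N :=
    ⟨x.support.sup (fun s => s.1 + 1), fun s hs => Finset.le_sup (f := fun s => s.1 + 1) hs⟩
  refine ⟨N, fun M hM => ?_⟩
  refine Finsupp.ext ?_
  rintro ⟨k, s⟩
  rw [Finsupp.finsetSum_apply]
  by_cases hk : k < M
  · rw [Finset.sum_eq_single k (fun m _ h => emb_apply_of_ne (Ne.symm h) _ _)
      (fun h => absurd (Finset.mem_range.2 hk) h), emb_apply, res_apply]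
  · have h0 : x ⟨k, s⟩ = 0 := by
      by_contra h
      have := hN _ (Finsupp.mem_support_iff.2 h)
      simp only at this
      omega
    rw [h0]
    refine (Finset.sum_eq_zero fun m hm => emb_apply_of_ne ?_ _ _).symm
    have := Finset.mem_range.1 hm
    omega

end Sigma

/-! ### The Koszul complex `A ⊗ Cof`. -/

section

variable {L : Type v} [AddCommGroup L] [Module ℂ L] {G : GradedLieSuperalgebra L}
  {V : Type u} [AddCommGroup V] [Module ℂ V] [FiniteDimensional ℂ V]
  {R : Submodule ℂ (V ⊗[ℂ] V)} (H : HomBasis G)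
  (hcomm : ∀ u v : V, u ⊗ₜ[ℂ] v - v ⊗ₜ[ℂ] u ∈ R) (e : DualEnvIso G R)

namespace HomBasis

/-- The reduction of the acyclic extension to coefficients in `A`. -/
def kap : Acyc G →ₗ[ℂ] ((Σ m, H.S m) →₀ QuadAlg R) :=
  Finsupp.mapRange.linearMap (e.pi G hcomm).toLinearMap ∘ₗ H.coord.toLinearMap

theorem kap_apply (a : Acyc G) (s : Σ m, H.S m) :
    H.kap hcomm e a s = e.pi G hcomm (H.coord a s) := rfl

theorem kap_i_mul (b : CE G) (a : Acyc G) :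
    H.kap hcomm e (Acyc.i G b * a) = e.pi G hcomm b • H.kap hcomm e a := by
  ext s
  rw [kap_apply, coord_i_mul, map_mul, Finsupp.smul_apply, kap_apply, smul_eq_mul]

theorem kap_x_mul (p : ℕ) (φ : Module.Dual ℂ (G.comp p)) (a : Acyc G) :
    H.kap hcomm e (Acyc.x G p φ * a) = QuadAlg.gen R (e.vec G p φ) • H.kap hcomm e a := by
  rw [← Acyc.i_gen, kap_i_mul, e.pi_gen]

theorem kap_j (o : Cof G) (s : Σ m, H.S m) :
    H.kap hcomm e (Acyc.j G o) s = H.bas.repr o s • 1 := by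
  rw [kap_apply, coord_j, map_smul, map_one]

/-- The map to `Cof` induced by a form on `A`. -/
def pair (F : QuadAlg R →ₗ[ℂ] ℂ) : ((Σ m, H.S m) →₀ QuadAlg R) →ₗ[ℂ] Cof G :=
  H.bas.repr.symm.toLinearMap ∘ₗ Finsupp.mapRange.linearMap F

theorem pair_smul_kap_j (F : QuadAlg R →ₗ[ℂ] ℂ) (a : QuadAlg R) (o : Cof G) :
    H.pair F (a • H.kap hcomm e (Acyc.j G o)) = F a • o := by
  rw [pair, LinearMap.comp_apply, LinearEquiv.coe_coe, LinearEquiv.symm_apply_eq, LinearEquiv.map_smul]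
  ext s
  change F (a * H.kap hcomm e (Acyc.j G o) s) = F a * H.bas.repr o s
  rw [kap_j, mul_smul_comm, mul_one, map_smul, smul_eq_mul, mul_comm]

/-- Contraction with the elements of `L_1`. -/
def contr (w : Acyc G) : Module.Dual ℂ V →ₗ[ℂ] Cof G :=
  (Acyc.q G).toLinearMap ∘ₗ (Acyc.con G 1).flip w ∘ₗ e.degOne.toLinearMap

theorem contr_apply (w : Acyc G) (f : Module.Dual ℂ V) :
    contr e w f = Acyc.q G (Acyc.con G 1 (e.degOne f) w) := rfl

variable [∀ m, FiniteDimensional ℂ (G.comp m)]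

theorem contr_x_mul_j (p : ℕ) (φ : Module.Dual ℂ (G.comp p)) (o : Cof G) (f : Module.Dual ℂ V) :
    contr e (Acyc.x G p φ * Acyc.j G o) f = f (e.vec G p φ) • o := by
  rw [contr_apply, Acyc.con_x_mul_j, map_smul, Acyc.q_j, e.apply_vec]

theorem contr_add (w w' : Acyc G) (f : Module.Dual ℂ V) :
    contr e (w + w') f = contr e w f + contr e w' f := by
  simp [contr_apply]

theorem contr_smul (c : ℂ) (w : Acyc G) (f : Module.Dual ℂ V) :
    contr e (c • w) f = c • contr e w f := by
  simp [contr_apply]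

theorem contr_zero (f : Module.Dual ℂ V) : contr e (0 : Acyc G) f = 0 := by
  simp [contr_apply]

/-- Reducing a linear expression to `A ⊗ Cof` and evaluating its degree-one coefficients by `f` is
the same as contracting with `f ∈ V* = L_1`; this is checked on the spanning products. -/
theorem pair_kap_lin {n : ℕ} {w : Acyc G} (hw : w ∈ Acyc.lin G n) (f : Module.Dual ℂ V)
    {F : QuadAlg R →ₗ[ℂ] V} (hF : ∀ v, F (QuadAlg.gen R v) = v) :
    H.pair (f ∘ₗ F) (H.kap hcomm e w) = contr e w f := by
  induction hw using Submodule.span_induction with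
  | zero => simp [contr_zero]
  | add a b _ _ ha hb => rw [map_add, map_add, ha, hb, contr_add]
  | smul r a _ ha => rw [map_smul, map_smul, ha, contr_smul]
  | mem a ha =>
    obtain ⟨p, m, φ, o, -, -, rfl⟩ := ha
    rw [contr_x_mul_j, kap_x_mul, pair_smul_kap_j, LinearMap.comp_apply, hF]

/-- Quadratic relations among linear coefficients are tested by forms on `A_2`, that is, by tensors
`r` in the annihilator of `R`. Here one leg of `r` contracts `w` and the other evaluates `v`;
commutativity of `A` brings the two vectors into this order. -/
theorem pair_gen_smul_kap_lin {n : ℕ} {w : Acyc G} (hw : w ∈ Acyc.lin G n) (v : V)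
    (r : Module.Dual ℂ V ⊗[ℂ] Module.Dual ℂ V) {F : QuadAlg R →ₗ[ℂ] ℂ}
    (hF : ∀ u v, F (QuadAlg.gen R u * QuadAlg.gen R v) =
      TensorProduct.dualDistrib ℂ V V r (u ⊗ₜ v)) :
    H.pair F (QuadAlg.gen R v • H.kap hcomm e w) =
      TensorProduct.rid ℂ (Cof G)
        (TensorProduct.map (contr e w) (Module.Dual.eval ℂ V v) r) := by
  induction hw using Submodule.span_induction with
  | zero =>
    have : contr e (0 : Acyc G) = 0 := LinearMap.ext (contr_zero e)
    simp [this]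
  | add a b _ _ ha hb =>
    have : contr e (a + b) = contr e a + contr e b := LinearMap.ext (contr_add e a b)
    rw [map_add, smul_add, map_add, ha, hb, this, TensorProduct.map_add_left, LinearMap.add_apply,
      map_add]
  | smul c a _ ha =>
    have : contr e (c • a) = c • contr e a := LinearMap.ext (contr_smul e c a)
    rw [(H.kap hcomm e).map_smul, smul_comm, (H.pair F).map_smul, ha, this,
      TensorProduct.map_smul_left, LinearMap.smul_apply, map_smul]
  | mem a ha =>
    obtain ⟨p, m, φ, o, -, -, rfl⟩ := ha
    have key : ∀ r, TensorProduct.rid ℂ (Cof G) (TensorProduct.map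
        (contr e (Acyc.x G p φ * Acyc.j G o)) (Module.Dual.eval ℂ V v) r) =
        TensorProduct.dualDistrib ℂ V V r (e.vec G p φ ⊗ₜ v) • o := by
      intro r
      induction r using TensorProduct.induction_on with
      | zero => simp
      | add a b ha hb => simp only [map_add, LinearMap.add_apply, ha, hb, add_smul]
      | tmul f g =>
        simp [contr_x_mul_j, TensorProduct.dualDistrib_apply, smul_smul, mul_comm]
    rw [key, kap_x_mul, smul_smul, pair_smul_kap_j, QuadAlg.mul_comm_of hcomm, hF]

/-- In `A` only the generators from `L_1^*` survive, so the reduction of a linear expression depends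
only on its contractions with a basis of `L_1`. -/
theorem kap_lin_eq_sum {n : ℕ} {w : Acyc G} (hw : w ∈ Acyc.lin G n) :
    H.kap hcomm e w = ∑ k, QuadAlg.gen R (Module.finBasis ℂ V k) •
      H.kap hcomm e (Acyc.j G (contr e w ((Module.finBasis ℂ V).coord k))) := by
  induction hw using Submodule.span_induction with
  | zero => simp [contr_zero]
  | add a b _ _ ha hb =>
    simp only [contr_add, map_add, smul_add, Finset.sum_add_distrib]
    rw [← ha, ← hb]
  | smul c a _ ha =>
    simp only [contr_smul, map_smul, smul_comm _ c, ← Finset.smul_sum]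
    rw [← ha]
  | mem a ha =>
    obtain ⟨p, m, φ, o, -, -, rfl⟩ := ha
    have h := (Module.finBasis ℂ V).sum_repr (e.vec G p φ)
    simp only [contr_x_mul_j, map_smul, smul_comm _ ((Module.finBasis ℂ V).coord _ _)]
    rw [kap_x_mul]
    conv_lhs => rw [← h, map_sum, Finset.sum_smul]
    refine Finset.sum_congr rfl fun k _ => ?_
    rw [map_smul, smul_assoc]
    rfl

theorem kap_lin_eq_zero {n : ℕ} {w : Acyc G} (hw : w ∈ Acyc.lin G n)
    (h : ∀ f, contr e w f = 0) : H.kap hcomm e w = 0 := by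
  rw [kap_lin_eq_sum H hcomm e hw]
  simp [h]

theorem kap_lin_mem {n : ℕ} {w : Acyc G} (hw : w ∈ Acyc.lin G n) (s : Σ m, H.S m) :
    H.kap hcomm e w s ∈ QuadAlg.deg R 1 := by
  rw [kap_lin_eq_sum H hcomm e hw, Finsupp.finsetSum_apply]
  refine Submodule.sum_mem _ fun k _ => ?_
  rw [Finsupp.smul_apply, kap_j, smul_eq_mul, mul_smul_comm, mul_one]
  exact Submodule.smul_mem _ _ (QuadAlg.gen_mem_deg _ _)

/-- A surviving factor `x φ` has weight one, so the part in `Cof` has weight exactly `n - 1`. This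
makes the reduced differential a complex indexed by the weight of `Cof`. -/
theorem kap_lin_of_ne {n : ℕ} {w : Acyc G} (hw : w ∈ Acyc.lin G n) {m : ℕ} (hm : m + 1 ≠ n)
    (s : H.S m) : H.kap hcomm e w ⟨m, s⟩ = 0 := by
  induction hw using Submodule.span_induction with
  | zero => simp
  | add a b _ _ ha hb => rw [map_add, Finsupp.add_apply, ha, hb, add_zero]
  | smul c a _ ha => rw [map_smul, Finsupp.smul_apply, ha, smul_zero]
  | mem a ha =>
    obtain ⟨p, m', φ, o, hp, ho, rfl⟩ := ha
    rw [kap_x_mul, Finsupp.smul_apply, kap_j]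
    by_cases h : p = 1
    · rw [H.repr_of_mem ho (by omega), zero_smul, smul_zero]
    · rw [e.vec_of_ne G h, map_zero, zero_smul]

/-- The differential with coefficients in `A`. -/
def dK : ((Σ m, H.S m) →₀ QuadAlg R) →ₗ[QuadAlg R] ((Σ m, H.S m) →₀ QuadAlg R) :=
  Finsupp.linearCombination (QuadAlg R)
    (fun s => H.kap hcomm e (Acyc.d G (Acyc.j G (H.bas s))))

theorem dK_single (s : Σ m, H.S m) (a : QuadAlg R) : H.dK hcomm e (Finsupp.single s a) =
    a • H.kap hcomm e (Acyc.d G (Acyc.j G (H.bas s))) := by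
  simp [dK]

/-- The reduction is a chain map because `DualEnvIso.pi` kills boundaries and is insensitive to the
parity automorphism. -/
theorem dK_kap (a : Acyc G) : H.dK hcomm e (H.kap hcomm e a) = H.kap hcomm e (Acyc.d G a) := by
  obtain ⟨f, rfl⟩ := H.coord.symm.surjective a
  induction f using Finsupp.induction_linear with
  | zero => simp
  | add f g hf hg => simp only [map_add, hf, hg]
  | single s b =>
    have h1 : H.kap hcomm e (H.coord.symm (Finsupp.single s b)) =
        Finsupp.single s (e.pi G hcomm b) := by simp [kap]
    rw [h1, dK_single, coord_symm_single, (Acyc.isDer_d G).mul, map_add, Acyc.d_i, kap_i_mul,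
      e.pi_d, zero_smul, zero_add, pow_one, ← Acyc.i_par, kap_i_mul, e.pi_par]

/-- The coefficients of the linear complex. -/
def lc (m : ℕ) (s : H.S (m + 1)) : H.S m →₀ QuadAlg R :=
  res m (H.kap hcomm e (Acyc.d G (Acyc.j G (H.bas ⟨m + 1, s⟩))))

theorem emb_lc (m : ℕ) (s : H.S (m + 1)) : emb m (H.lc hcomm e m s) =
    H.kap hcomm e (Acyc.d G (Acyc.j G (H.bas ⟨m + 1, s⟩))) :=
  emb_res fun _ hk t => H.kap_lin_of_ne hcomm e (Acyc.d_j_mem G (H.mem _ s)) (by omega) t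

theorem dK_emb_succ (m : ℕ) (z : H.S (m + 1) →₀ QuadAlg R) :
    H.dK hcomm e (emb (m + 1) z) = emb m (bd (H.lc hcomm e) m z) := by
  induction z using Finsupp.induction_linear with
  | zero => simp
  | add f g hf hg => simp only [map_add, hf, hg]
  | single s b => rw [emb_single, dK_single, bd, Finsupp.linearCombination_single, map_smul, emb_lc]

theorem dK_emb_zero (z : H.S 0 →₀ QuadAlg R) : H.dK hcomm e (emb 0 z) = 0 := by
  induction z using Finsupp.induction_linear with
  | zero => simp
  | add f g hf hg => simp only [map_add, hf, hg, add_zero]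
  | single s b =>
    rw [emb_single, dK_single]
    convert smul_zero b
    refine Finsupp.ext fun ⟨m, t⟩ => ?_
    exact H.kap_lin_of_ne hcomm e (Acyc.d_j_mem G (H.mem _ s)) (by omega) t

theorem dK_dK (z : (Σ m, H.S m) →₀ QuadAlg R) : H.dK hcomm e (H.dK hcomm e z) = 0 := by
  induction z using Finsupp.induction_linear with
  | zero => simp
  | add f g hf hg => simp only [map_add, hf, hg, add_zero]
  | single s b => rw [dK_single, map_smul, dK_kap, Acyc.d_d, map_zero, smul_zero]

/-- The element of the complex given by a homogeneous element of `Cof`. -/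
theorem emb_res_kap_j {n : ℕ} {o : Cof G} (ho : o ∈ (Cof.wt G).comp n) :
    emb n (res n (H.kap hcomm e (Acyc.j G o))) = H.kap hcomm e (Acyc.j G o) :=
  emb_res fun k hk s => by rw [kap_j, H.repr_of_mem ho hk, zero_smul]

end HomBasis

end

/-! ### Weights of the action, and extension of cochains from `L_1` to `L`. -/

section

variable {L : Type v} [AddCommGroup L] [Module ℂ L] (G : GradedLieSuperalgebra L)

/-- The elements of `Cof` of weight `n - i`, where the weight may be negative. -/
def Cof.low (n i : ℕ) : Submodule ℂ (Cof G) := if i ≤ n then (wt G).comp (n - i) else ⊥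

theorem Cof.low_of_le {n i : ℕ} (h : i ≤ n) : low G n i = (wt G).comp (n - i) := if_pos h

theorem Cof.low_of_lt {n i : ℕ} (h : n < i) : low G n i = ⊥ := if_neg (by omega)

namespace Acyc

theorem j_mem_wt {n : ℕ} {o : Cof G} (ho : o ∈ (Cof.wt G).comp n) : j G o ∈ (wt G).comp n := by
  rw [Coaction.comp_eq_span] at ho
  induction ho using Submodule.span_induction with
  | zero => simp
  | add a b _ _ ha hb => rw [map_add]; exact Submodule.add_mem _ ha hb
  | smul r a _ ha => rw [map_smul]; exact Submodule.smul_mem _ _ ha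
  | mem a ha =>
    obtain ⟨l, rfl, rfl⟩ := ha
    induction l with
    | nil => simpa using (wt G).one_mem
    | cons s l ih =>
      obtain ⟨p, φ⟩ := s
      change j G (Cof.y G p φ * (l.map (Cof.super G).g).prod) ∈
        (wt G).comp (p + (l.map fun s => s.1).sum)
      rw [map_mul, j_y]
      exact (wt G).mul_mem (y_mem_wt G p φ) ih

theorem lin_le_wt (n : ℕ) : lin G n ≤ (wt G).comp n := by
  refine Submodule.span_le.2 ?_
  rintro _ ⟨p, m, φ, o, rfl, ho, rfl⟩
  exact (wt G).mul_mem (x_mem_wt G p φ) (j_mem_wt G ho)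

variable [∀ m, FiniteDimensional ℂ (G.comp m)] {i : ℕ} (z : G.comp i)

theorem q_con_lin {n : ℕ} {w : Acyc G} (hw : w ∈ lin G n) : q G (con G i z w) ∈ Cof.low G n i := by
  induction hw using Submodule.span_induction with
  | zero => simp
  | add a b _ _ ha hb => simp only [map_add]; exact Submodule.add_mem _ ha hb
  | smul r a _ ha => simp only [map_smul]; exact Submodule.smul_mem _ _ ha
  | mem a ha =>
    obtain ⟨p, m, φ, o, hp, ho, rfl⟩ := ha
    rw [con_x_mul_j, map_smul, q_j]
    by_cases h : i = p
    · rw [Cof.low_of_le G (by omega), show n - i = m by omega]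
      exact Submodule.smul_mem _ _ ho
    · rw [G.ext_of_ne h z.2, zero_smul]
      exact Submodule.zero_mem _

/-- Up to sign the action contracts `d (j o)` with an element of weight `i`, which lowers the weight
by `i`. -/
theorem rho_mem_low {n : ℕ} {o : Cof G} (ho : o ∈ (Cof.wt G).comp n) :
    rho G i z o ∈ Cof.low G n i := by
  rw [rho_apply, th_j, map_smul]
  exact Submodule.smul_mem _ _ (q_con_lin G z (d_j_mem G ho))

theorem rho_low {n k : ℕ} {o : Cof G} (ho : o ∈ Cof.low G n k) :
    rho G i z o ∈ Cof.low G n (i + k) := by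
  rcases le_or_gt k n with h | h
  · rw [Cof.low_of_le G h] at ho
    have := rho_mem_low G z ho
    rcases le_or_gt (i + k) n with h' | h'
    · rw [Cof.low_of_le G h', show n - (i + k) = n - k - i by omega]
      rwa [Cof.low_of_le G (by omega)] at this
    · rw [Cof.low_of_lt G h']
      rwa [Cof.low_of_lt G (by omega)] at this
  · rw [Cof.low_of_lt G h, Submodule.mem_bot] at ho
    rw [ho, map_zero]
    exact Submodule.zero_mem _

end Acyc

variable {V : Type u} [AddCommGroup V] [Module ℂ V] [FiniteDimensional ℂ V]
  {R : Submodule ℂ (V ⊗[ℂ] V)} (e : DualEnvIso G R) [∀ m, FiniteDimensional ℂ (G.comp m)]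

namespace DualEnvIso

/-- The pairing `f ⊗ g ↦ ρ(f) c(g)`. -/
def rhoTensor (c : Module.Dual ℂ V →ₗ[ℂ] Cof G) :
    Module.Dual ℂ V ⊗[ℂ] Module.Dual ℂ V →ₗ[ℂ] Cof G :=
  TensorProduct.lift ((Acyc.rho G 1 ∘ₗ e.degOne.toLinearMap :
    Module.Dual ℂ V →ₗ[ℂ] Cof G →ₗ[ℂ] Cof G).compl₂ c)

theorem rhoTensor_tmul (c : Module.Dual ℂ V →ₗ[ℂ] Cof G) (f g : Module.Dual ℂ V) :
    e.rhoTensor G c (f ⊗ₜ g) = Acyc.rho G 1 (e.degOne f) (c g) := by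
  simp [rhoTensor]

/-- The extension of the action of `V*` on `Cof` by the cochain `c`. -/
def extGen (c : Module.Dual ℂ V →ₗ[ℂ] Cof G) :
    Module.Dual ℂ V →ₗ[ℂ] Module.End ℂ (Cof G × ℂ) :=
  LinearMap.mk₂ ℂ (fun f x => (Acyc.rho G 1 (e.degOne f) x.1 + x.2 • c f, 0))
    (fun a b x => by
      ext
      · simp only [map_add, LinearMap.add_apply, smul_add, Prod.fst_add]; abel
      · simp)
    (fun r a x => by ext <;> simp [smul_comm r])
    (fun a x y => by
      ext
      · simp only [map_add, Prod.fst_add, Prod.snd_add, add_smul]; abel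
      · simp)
    (fun r a x => by ext <;> simp [smul_smul])

theorem extGen_apply (c : Module.Dual ℂ V →ₗ[ℂ] Cof G) (f : Module.Dual ℂ V) (x : Cof G × ℂ) :
    e.extGen G c f x = (Acyc.rho G 1 (e.degOne f) x.1 + x.2 • c f, 0) := rfl

theorem eta_one : Acyc.eta 1 = 1 := by simp [Acyc.eta]

/-- On `Cof ⊕ ℂ`, a quadratic tensor acts by its image in `U(L)` plus the off-diagonal term
`rhoTensor`. The extension thus satisfies a relation of `A^!` as soon as that term vanishes on it.
-/
theorem mul_map_extGen (c : Module.Dual ℂ V →ₗ[ℂ] Cof G)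
    (r : Module.Dual ℂ V ⊗[ℂ] Module.Dual ℂ V) (x : Cof G × ℂ) :
    LinearMap.mul' ℂ _ (TensorProduct.map (e.extGen G c) (e.extGen G c) r) x =
      (Acyc.rep G (e.equiv (LinearMap.mul' ℂ _ (TensorProduct.map (QuadAlg.gen (annihilator R))
        (QuadAlg.gen (annihilator R)) r))) x.1 + x.2 • e.rhoTensor G c r, 0) := by
  induction r using TensorProduct.induction_on with
  | zero => simp [Prod.zero_eq_mk]
  | add a b ha hb =>
    simp only [map_add, LinearMap.add_apply, ha, hb, smul_add, Prod.mk_add_mk, add_zero]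
    congr 1
    abel
  | tmul f g =>
    simp only [TensorProduct.map_tmul, LinearMap.mul'_apply, Module.End.mul_apply, extGen_apply,
      zero_smul, add_zero, map_mul, e.equiv_gen, Acyc.rep_ι, eta_one, one_smul, map_add, map_smul,
      rhoTensor_tmul]

/-- A cochain on `L_1` that is compatible with the relations of `A^!` extends to a cocycle
on `L`. -/
theorem exists_cocycle (c : Module.Dual ℂ V →ₗ[ℂ] Cof G)
    (hc : ∀ r ∈ annihilator R, e.rhoTensor G c r = 0) :
    ∃ c' : L →ₗ[ℂ] Cof G, (∀ f, c' (e.degOne f) = c f) ∧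
      ∀ (i j : ℕ) (z : G.comp i) (z' : G.comp j), c' (G.br z z') =
        Acyc.rep G (Env.ι G z) (c' z') - (-1 : ℂ) ^ (i * j) • Acyc.rep G (Env.ι G z') (c' z) := by
  -- A one-cocycle is an extension of the trivial module by `Cof`. The extension is built over
  -- `A^!`, where only generators and quadratic relations matter, and transported to `U(L)`; `c'` is
  -- its off-diagonal entry.
  let T : KoszulDual R →ₐ[ℂ] Module.End ℂ (Cof G × ℂ) :=
    QuadAlg.lift (annihilator R) (e.extGen G c) fun r hr => LinearMap.ext fun x => by
      rw [mul_map_extGen, QuadAlg.mul_map_gen_eq_zero _ hr, hc r hr]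
      simp [Prod.zero_eq_mk]
  let T' : Env G →ₐ[ℂ] Module.End ℂ (Cof G × ℂ) := T.comp e.equiv.symm.toAlgHom
  let c' : L →ₗ[ℂ] Cof G := LinearMap.fst ℂ (Cof G) ℂ ∘ₗ LinearMap.applyₗ (0, 1) ∘ₗ
    T'.toLinearMap ∘ₗ Env.ι G
  have hc' : ∀ z, c' z = (T' (Env.ι G z) (0, 1)).1 := fun z => rfl
  have h1 : ∀ f, T' (Env.ι G (e.degOne f : L)) = e.extGen G c f := by
    intro f
    rw [← e.equiv_gen]
    change T (e.equiv.symm (e.equiv _)) = _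
    rw [AlgEquiv.symm_apply_apply]
    exact QuadAlg.lift_gen _ _ _ f
  have hc1 : ∀ f, c' (e.degOne f) = c f := fun f => by
    rw [hc', h1, extGen_apply]; simp
  -- The elements of `L` that act in the block form of an extension. This space contains `L_1` and
  -- is closed under brackets, so it is all of `L`; the same computation gives the cocycle identity.
  let K : Submodule ℂ L :=
    { carrier := {z | ∀ x : Cof G × ℂ, T' (Env.ι G z) x =
        (Acyc.rep G (Env.ι G z) x.1 + x.2 • c' z, 0)}
      add_mem' := by
        intro a b ha hb x
        simp only [map_add, LinearMap.add_apply, ha x, hb x, smul_add, Prod.mk_add_mk, add_zero]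
        congr 1
        abel
      zero_mem' := by intro x; simp [Prod.zero_eq_mk]
      smul_mem' := by
        intro r a ha x
        simp only [map_smul, LinearMap.smul_apply, ha x, Prod.smul_mk, smul_zero, smul_add]
        rw [smul_comm] }
  have hbr : ∀ (i j : ℕ) (z : G.comp i) (z' : G.comp j), (z : L) ∈ K → (z' : L) ∈ K →
      ∀ x : Cof G × ℂ, T' (Env.ι G (G.br z z')) x =
        (Acyc.rep G (Env.ι G (G.br z z')) x.1 + x.2 • (Acyc.rep G (Env.ι G z) (c' z') -
          (-1 : ℂ) ^ (i * j) • Acyc.rep G (Env.ι G z') (c' z)), 0) := by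
    intro i j z z' hz hz' x
    rw [Env.ι_br, map_sub, map_sub, map_smul, map_smul, map_mul, map_mul, map_mul, map_mul]
    simp only [LinearMap.sub_apply, LinearMap.smul_apply, Module.End.mul_apply]
    rw [hz' x, hz x, hz, hz']
    simp only [map_add, map_smul, zero_smul, add_zero, Prod.smul_mk, Prod.mk_sub_mk, smul_zero,
      sub_zero, smul_add, smul_sub]
    congr 1
    rw [smul_comm x.2]
    abel
  have hbr' : ∀ (i j : ℕ) (z : G.comp i) (z' : G.comp j), (z : L) ∈ K → (z' : L) ∈ K →
      c' (G.br z z') = Acyc.rep G (Env.ι G z) (c' z') -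
        (-1 : ℂ) ^ (i * j) • Acyc.rep G (Env.ι G z') (c' z) := by
    intro i j z z' hz hz'
    rw [hc', hbr i j z z' hz hz']
    simp
  have hK : ∀ n, G.comp n ≤ K := e.le_of_generated G
    (by
      intro z hz x
      obtain ⟨f, hf⟩ := e.degOne.surjective ⟨z, hz⟩
      obtain rfl : z = (e.degOne f : L) := by rw [hf]
      rw [h1, extGen_apply, hc1, Acyc.rep_ι, eta_one, one_smul])
    (by
      intro i j z z' hz hz' x
      rw [hbr i j z z' hz hz', hbr' i j z z' hz hz'])
  exact ⟨c', hc1, fun i j z z' => hbr' i j z z' (hK i z.2) (hK j z'.2)⟩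

/-- The cocycle identity propagates the weight bound through brackets, and `L_1` generates `L`. -/
theorem cocycle_mem_low {n : ℕ} (c' : L →ₗ[ℂ] Cof G)
    (h1 : ∀ f, c' (e.degOne f) ∈ (Cof.wt G).comp n)
    (hc' : ∀ (i j : ℕ) (z : G.comp i) (z' : G.comp j), c' (G.br z z') =
        Acyc.rep G (Env.ι G z) (c' z') - (-1 : ℂ) ^ (i * j) • Acyc.rep G (Env.ι G z') (c' z))
    {i : ℕ} (z : G.comp i) : c' z ∈ Cof.low G (n + 1) i := by
  let K : Submodule ℂ L := ⨅ i, (Cof.low G (n + 1) i).comap (c' ∘ₗ (G.comp i).subtype ∘ₗ G.proj i)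
  have hmem : ∀ {i : ℕ} (z : G.comp i), (z : L) ∈ K ↔ c' z ∈ Cof.low G (n + 1) i := by
    intro i z
    simp only [K, Submodule.mem_iInf, Submodule.mem_comap, LinearMap.comp_apply]
    constructor
    · intro h
      simpa using h i
    · intro h k
      by_cases hk : i = k
      · subst hk; simpa using h
      · rw [G.proj_of_ne hk z.2]; simp
  refine (hmem z).1 (e.le_of_generated G ?_ ?_ i z.2)
  · intro z hz
    obtain ⟨f, hf⟩ := e.degOne.surjective ⟨z, hz⟩
    obtain rfl : z = (e.degOne f : L) := by rw [hf]
    rw [hmem, Cof.low_of_le G (by omega), Nat.add_sub_cancel]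
    exact h1 f
  · intro i j z z' hz hz'
    rw [hmem] at hz hz'
    have : G.br z z' = (G.brk z z' : L) := rfl
    rw [this, hmem, ← this, hc', Acyc.rep_ι, Acyc.rep_ι]
    refine Submodule.sub_mem _ (Submodule.smul_mem _ _ (Acyc.rho_low G z hz'))
      (Submodule.smul_mem _ _ (Submodule.smul_mem _ _ ?_))
    rw [add_comm i j]
    exact Acyc.rho_low G z' hz

end DualEnvIso

end

/-! ### Integration of cocycles by the homotopy. -/

section

variable {L : Type v} [AddCommGroup L] [Module ℂ L] (G : GradedLieSuperalgebra L)

namespace Acyc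

theorem h_lin {n : ℕ} {w : Acyc G} (hw : w ∈ lin G n) :
    ∃ o ∈ (Cof.wt G).comp n, h G w = j G o := by
  induction hw using Submodule.span_induction with
  | zero => exact ⟨0, Submodule.zero_mem _, by simp⟩
  | add a b _ _ ha hb =>
    obtain ⟨o, ho, ha⟩ := ha
    obtain ⟨o', ho', hb⟩ := hb
    exact ⟨o + o', Submodule.add_mem _ ho ho', by rw [map_add, ha, hb, map_add]⟩
  | smul r a _ ha =>
    obtain ⟨o, ho, ha⟩ := ha
    exact ⟨r • o, Submodule.smul_mem _ _ ho, by rw [map_smul, ha, map_smul]⟩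
  | mem a ha =>
    obtain ⟨p, m, φ, o, rfl, ho, rfl⟩ := ha
    refine ⟨(p : ℂ) • (Cof.y G p φ * o),
      Submodule.smul_mem _ _ ((Cof.wt G).mul_mem (Cof.y_mem_wt G p φ) ho), ?_⟩
    rw [(isDer_h G).mul, h_x, h_j, mul_zero, add_zero, map_smul, map_mul, j_y, smul_mul_assoc]

variable [∀ m, FiniteDimensional ℂ (G.comp m)]

/-- The linear cycles are boundaries. -/
theorem exists_d_j {n : ℕ} (hn : 0 < n) {w : Acyc G} (hw : w ∈ lin G n) (hd : d G w = 0) :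
    ∃ o ∈ (Cof.wt G).comp n, d G (j G o) = w := by
  obtain ⟨o, ho, h1⟩ := h_lin G hw
  have h2 := d_h_add_h_d G (lin_le_wt G n hw)
  rw [hd, map_zero, add_zero, h1] at h2
  have hn' : (n : ℂ) ≠ 0 := by exact_mod_cast hn.ne'
  refine ⟨(n : ℂ)⁻¹ • o, Submodule.smul_mem _ _ ho, ?_⟩
  rw [map_smul, map_smul, h2, smul_smul, inv_mul_cancel₀ hn', one_smul]

/-- The contractions of `d (j o)` are `rho` up to sign, so `d (j o)` vanishes. The homotopy formula
then reads `0 = n • j o`. -/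
theorem eq_zero_of_rho {n : ℕ} (hn : 0 < n) {o : Cof G} (ho : o ∈ (Cof.wt G).comp n)
    (h : ∀ i (z : G.comp i), rho G i z o = 0) : o = 0 := by
  have h1 : d G (j G o) = 0 := by
    refine lin_eq_zero G (lin_le_linLE G le_rfl (d_j_mem G ho)) fun i z => ?_
    have := h i z
    rw [rho_apply, th_j, map_smul] at this
    exact (smul_eq_zero.1 this).resolve_left (pow_ne_zero _ (by norm_num))
  have h2 := d_h_add_h_d G (j_mem_wt G ho)
  rw [h_j, h1, map_zero, map_zero, add_zero] at h2
  have hn' : (n : ℂ) ≠ 0 := by exact_mod_cast hn.ne'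
  have h3 := (smul_eq_zero.1 h2.symm).resolve_left hn'
  rw [← q_j G o, h3, map_zero]

/-- The linear element with given contractions. -/
def ofCochain (c : L →ₗ[ℂ] Cof G) (n : ℕ) : Acyc G :=
  -- The signs translate the cocycle identity for the twisted representation into closedness under
  -- `d`. They equal `1` on `L_1`, so contractions with `L_1` return the cochain itself.
  ∑ a : G.Idx n, x G _ (G.dbas a) *
    j G (((-1 : ℂ) ^ (G.wt a + 1) * eta (G.wt a)) • c (G.bas a))

theorem con_ofCochain {c : L →ₗ[ℂ] Cof G} {n : ℕ}
    (hc : ∀ i (z : G.comp i), c z ∈ Cof.low G n i) {i : ℕ} (z : G.comp i) :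
    con G i z (ofCochain G c n) = j G (((-1 : ℂ) ^ (i + 1) * eta i) • c z) := by
  have h1 : con G i z (ofCochain G c n) = j G (((-1 : ℂ) ^ (i + 1) * eta i) •
      c (∑ a : G.Idx n, G.ext _ (G.dbas a) z • G.bas a)) := by
    simp only [ofCochain, map_sum, map_smul, Finset.smul_sum, smul_smul]
    refine Finset.sum_congr rfl fun a _ => ?_
    rw [mul_smul_comm, map_smul, con_x_mul_j, smul_smul]
    have := G.sign_mul_ext (fun p => (-1 : ℂ) ^ (p + 1) * eta p) (G.dbas a) z.2
    rw [← this]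
  rw [h1]
  congr 2
  rcases le_or_gt i n with hi | hi
  · rw [G.sum_bas hi z.2]
  · have h2 := hc i z
    rw [Cof.low_of_lt G hi, Submodule.mem_bot] at h2
    rw [h2, map_sum]
    refine Finset.sum_eq_zero fun a _ => ?_
    rw [G.ext_of_ne _ z.2, zero_smul, map_zero]
    have := G.wt_le a
    omega

theorem ofCochain_mem {c : L →ₗ[ℂ] Cof G} {n : ℕ}
    (hc : ∀ i (z : G.comp i), c z ∈ Cof.low G n i) : ofCochain G c n ∈ lin G n := by
  refine Submodule.sum_mem _ fun a _ => ?_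
  have h1 := G.wt_le a
  have h2 := hc _ (bas G a)
  rw [Cof.low_of_le G h1] at h2
  exact mem_lin G (by omega) _ (Submodule.smul_mem _ _ h2)

/-- The differential is quadratic in the `x`, so two contractions detect it. Commuting a Lie
derivative past a contraction expresses these as the defect of the cocycle identity. -/
theorem d_ofCochain {c : L →ₗ[ℂ] Cof G} {n : ℕ}
    (hc : ∀ i (z : G.comp i), c z ∈ Cof.low G n i)
    (hc' : ∀ (i j : ℕ) (z : G.comp i) (z' : G.comp j), c (G.br z z') =
      rep G (Env.ι G z) (c z') - (-1 : ℂ) ^ (i * j) • rep G (Env.ι G z') (c z)) :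
    d G (ofCochain G c n) = 0 := by
  refine quad_eq_zero G (d_lin_mem G (ofCochain_mem G hc)) fun i z k z' => ?_
  have h1 := th_apply G z (ofCochain G c n)
  have h2 := th_con G z z' (ofCochain G c n)
  have h3 := th_j G z' (c z)
  have hb : ((G.brk z z' : G.comp (i + k)) : L) = G.br z z' := rfl
  rw [con_ofCochain G hc] at h1
  rw [con_ofCochain G hc, con_ofCochain G hc, hb, hc', rep_ι, rep_ι, eta_add, h1] at h2
  have h4 := congrArg (q G) h2
  have h5 := congrArg (q G) h3
  simp only [map_add, map_smul, map_sub, q_j, LinearMap.smul_apply] at h4 h5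
  rw [← rho_apply] at h4 h5
  set A := rho G i z (c z')
  set B := rho G k z' (c z)
  set X := q G (con G k z' (con G i z (d G (ofCochain G c n))))
  set Y := q G (con G k z' (d G (j G (c z))))
  have hY : Y = (-1 : ℂ) ^ k • B := by
    rw [h5, smul_smul, neg_one_pow_mul_self, one_smul]
  rw [hY] at h4
  simp only [pow_add, pow_one, smul_smul, smul_sub, smul_add] at h4
  have sa := neg_one_pow_mul_self i
  have sb := neg_one_pow_mul_self k
  have st := neg_one_pow_mul_self (i * k)
  have sp := eta_mul_self i
  have sq := eta_mul_self k
  -- Beyond this point only the fact that each sign squares to one is used, so the signs become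
  -- letters and the cancellation is polynomial.
  generalize (-1 : ℂ) ^ i = a at *
  generalize (-1 : ℂ) ^ k = b at *
  generalize (-1 : ℂ) ^ (i * k) = t at *
  generalize eta i = p at *
  generalize eta k = r at *
  have hX : (t * a * a) • X = (b * -1 * r - t * a * (a * b * -1 * (t * (p * r))) * p) • A +
      (t * a * (a * b * -1 * (t * (p * r))) * (t * r) - t * a * (a * -1 * p * b)) • B := by
    rw [← sub_eq_zero] at h4 ⊢
    rw [← neg_eq_zero, ← h4]
    module
  have e1 : t * a * a = t := by linear_combination t * sa
  have e2 : b * -1 * r - t * a * (a * b * -1 * (t * (p * r))) * p = 0 := by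
    linear_combination b * r * t * t * p * p * sa + b * r * p * p * st + b * r * sp
  have e3 : t * a * (a * b * -1 * (t * (p * r))) * (t * r) - t * a * (a * -1 * p * b) = 0 := by
    linear_combination (-(t * b * p) * t * t * r * r + t * b * p) * sa -
      t * b * p * r * r * st - t * b * p * sq
  rw [e1, e2, e3, zero_smul, zero_smul, add_zero] at hX
  have hX' := congrArg (t • ·) hX
  simpa [smul_smul, st] using hX'

end Acyc

end

/-! ### Exactness of the Koszul complex in internal degrees zero and one. -/

section

variable {L : Type v} [AddCommGroup L] [Module ℂ L] {G : GradedLieSuperalgebra L}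
  {V : Type u} [AddCommGroup V] [Module ℂ V] [FiniteDimensional ℂ V]
  {R : Submodule ℂ (V ⊗[ℂ] V)} (H : HomBasis G)
  (hcomm : ∀ u v : V, u ⊗ₜ[ℂ] v - v ⊗ₜ[ℂ] u ∈ R) (e : DualEnvIso G R)
  [∀ m, FiniteDimensional ℂ (G.comp m)]

namespace HomBasis

/-- With `kap_lin_eq_sum`, the Koszul differential on `Cof` is minus the sum of `v_k ⊗ rho(v_k^*)`
over a basis of `V`. -/
theorem contr_d_j (o : Cof G) (f : Module.Dual ℂ V) :
    contr e (Acyc.d G (Acyc.j G o)) f = -Acyc.rho G 1 (e.degOne f) o := by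
  rw [contr_apply, Acyc.rho_apply, Acyc.th_j, map_smul]
  simp

/-- Vanishing in `A ⊗ Cof` means that `L_1` kills `o`. The annihilator of `o` in `L` is closed under
brackets, so all of `L` kills `o`. -/
theorem eq_zero_of_kap_d_j {n : ℕ} (hn : 0 < n) {o : Cof G} (ho : o ∈ (Cof.wt G).comp n)
    (h : H.kap hcomm e (Acyc.d G (Acyc.j G o)) = 0) : o = 0 := by
  refine Acyc.eq_zero_of_rho G hn ho fun i z => ?_
  obtain ⟨F, hF⟩ := QuadAlg.exists_linear_part R
  let K : Submodule ℂ L := LinearMap.ker (LinearMap.applyₗ o ∘ₗ (Acyc.rep G).toLinearMap ∘ₗ Env.ι G)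
  have hK : ∀ z, z ∈ K ↔ Acyc.rep G (Env.ι G z) o = 0 := fun z => Iff.rfl
  have h1 := e.le_of_generated G (K := K)
    (by
      intro z hz
      obtain ⟨f, hf⟩ := e.degOne.surjective ⟨z, hz⟩
      obtain rfl : z = (e.degOne f : L) := by rw [hf]
      have h2 := H.pair_kap_lin hcomm e (Acyc.d_j_mem G ho) f hF
      rw [h, map_zero, contr_d_j] at h2
      rw [hK, Acyc.rep_ι, LinearMap.smul_apply, neg_eq_zero.1 h2.symm, smul_zero])
    (by
      intro i j z z' hz hz'
      rw [hK] at hz hz' ⊢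
      rw [Env.ι_br, map_sub, map_smul, map_mul, map_mul]
      simp [hz, hz']) i z.2
  rw [hK, Acyc.rep_ι, LinearMap.smul_apply] at h1
  refine (smul_eq_zero.1 h1).resolve_left fun h0 => ?_
  have := Acyc.eta_mul_self i
  simp [h0] at this

theorem kap_j_bas (s : Σ m, H.S m) :
    H.kap hcomm e (Acyc.j G (H.bas s)) = Finsupp.single s 1 := by
  classical
  ext t
  rw [kap_j, Module.Basis.repr_self, Finsupp.single_apply, Finsupp.single_apply]
  split_ifs <;> simp

theorem lc_exact_zero (m : ℕ) (z : H.S (m + 1) →₀ QuadAlg R)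
    (hz : ∀ t, z t ∈ QuadAlg.deg R 0) (h : bd (H.lc hcomm e) m z = 0) : z = 0 := by
  -- Constant coefficients make `z` the image of an element of `Cof`.
  let o : Cof G := ∑ t ∈ z.support, QuadAlg.eps R (z t) • H.bas ⟨m + 1, t⟩
  have ho : o ∈ (Cof.wt G).comp (m + 1) :=
    Submodule.sum_mem _ fun t _ => Submodule.smul_mem _ _ (H.mem _ _)
  have h1 : H.kap hcomm e (Acyc.j G o) = emb (m + 1) z := by
    conv_rhs => rw [← Finsupp.sum_single z, Finsupp.sum, map_sum]
    simp only [o, map_sum, map_smul]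
    refine Finset.sum_congr rfl fun t _ => ?_
    rw [emb_single, kap_j_bas, Finsupp.smul_single, ← QuadAlg.eq_smul_one_of_mem_deg_zero R (hz t)]
  have h2 : o = 0 := by
    refine H.eq_zero_of_kap_d_j hcomm e (Nat.succ_pos m) ho ?_
    rw [← dK_kap, h1, dK_emb_succ, h, map_zero]
  refine emb_injective (m + 1) ?_
  rw [← h1, h2, map_zero, map_zero, map_zero]

/-- A chain with linear coefficients is a cochain `V* → Cof`, and the cycle condition says that it
respects the quadratic relations of `A^!`. It therefore extends to a cocycle on `L`, which
integrates to an element of `Cof`; boundary and chain have the same contractions with `L_1`, hence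
the same image in `A ⊗ Cof`. -/
theorem lc_exact_one (m : ℕ) (z : H.S m →₀ QuadAlg R) (hz : H.dK hcomm e (emb m z) = 0)
    (hz1 : ∀ t, z t ∈ QuadAlg.deg R 1) : ∃ y, bd (H.lc hcomm e) m y = z := by
  have hv : ∀ t, ∃ v, QuadAlg.gen R v = z t := fun t => by
    have := hz1 t
    rwa [QuadAlg.deg, pow_one] at this
  choose v hv using hv
  let ζ : Acyc G := ∑ t ∈ z.support, Acyc.x G 1 (e.form G (v t)) * Acyc.j G (H.bas ⟨m, t⟩)
  have hζ : ζ ∈ Acyc.lin G (m + 1) :=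
    Submodule.sum_mem _ fun t _ => Acyc.mem_lin G (by omega) _ (H.mem _ _)
  have h1 : H.kap hcomm e ζ = emb m z := by
    conv_rhs => rw [← Finsupp.sum_single z, Finsupp.sum, map_sum]
    simp only [ζ, map_sum]
    refine Finset.sum_congr rfl fun t _ => ?_
    rw [emb_single, kap_x_mul, kap_j_bas, e.vec_form, hv, Finsupp.smul_single, smul_eq_mul, mul_one]
  have hc0 : ∀ g, contr e ζ g = ∑ t ∈ z.support, g (v t) • H.bas ⟨m, t⟩ := by
    intro g
    rw [contr_apply]
    simp only [ζ, map_sum]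
    refine Finset.sum_congr rfl fun t _ => ?_
    rw [← contr_apply, contr_x_mul_j, e.vec_form]
  -- The vanishing of the differential is tested by the quadratic form on `A` that `r` defines,
  -- which is well defined because `r` kills `R`.
  have hrel : ∀ r ∈ annihilator R, e.rhoTensor G (contr e ζ) r = 0 := by
    intro r hr
    obtain ⟨F, hF⟩ := QuadAlg.exists_quadratic_form R (TensorProduct.dualDistrib ℂ V V r)
      (fun t ht => hr t ht)
    have h2 : H.dK hcomm e (emb m z) = ∑ t ∈ z.support, QuadAlg.gen R (v t) •
        H.kap hcomm e (Acyc.d G (Acyc.j G (H.bas ⟨m, t⟩))) := by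
      conv_lhs => rw [← Finsupp.sum_single z, Finsupp.sum, map_sum, map_sum]
      refine Finset.sum_congr rfl fun t _ => ?_
      rw [emb_single, dK_single, hv]
    rw [hz] at h2
    have h3 := congrArg (H.pair F) h2
    rw [map_zero, map_sum, Finset.sum_congr rfl fun t _ =>
      H.pair_gen_smul_kap_lin hcomm e (Acyc.d_j_mem G (H.mem m t)) (v t) r hF] at h3
    have key : ∀ r, ∑ t ∈ z.support, TensorProduct.rid ℂ (Cof G) (TensorProduct.map
        (contr e (Acyc.d G (Acyc.j G (H.bas ⟨m, t⟩)))) (Module.Dual.eval ℂ V (v t)) r) =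
        -e.rhoTensor G (contr e ζ) r := by
      intro r
      induction r using TensorProduct.induction_on with
      | zero => simp
      | add a b ha hb => simp only [map_add, Finset.sum_add_distrib, ha, hb]; abel
      | tmul f g =>
        rw [e.rhoTensor_tmul, hc0, map_sum, ← Finset.sum_neg_distrib]
        refine Finset.sum_congr rfl fun t _ => ?_
        simp [contr_d_j]
    rw [key] at h3
    exact neg_eq_zero.1 h3.symm
  obtain ⟨c, hc1, hc⟩ := e.exists_cocycle G (contr e ζ) hrel
  -- The cochain has values of weight `m` on `L_1`, whence weight `m + 1 - i` on `L_i`.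
  have hlow : ∀ i (z : G.comp i), c z ∈ Cof.low G (m + 1) i := fun i z =>
    e.cocycle_mem_low G c (fun f => by
      rw [hc1, hc0]
      exact Submodule.sum_mem _ fun t _ => Submodule.smul_mem _ _ (H.mem _ _)) hc z
  have hW := Acyc.ofCochain_mem G hlow
  obtain ⟨o, ho, hdo⟩ := Acyc.exists_d_j G (Nat.succ_pos m) hW (Acyc.d_ofCochain G hlow hc)
  refine ⟨res (m + 1) (H.kap hcomm e (Acyc.j G o)), emb_injective m ?_⟩
  -- The two linear elements `ofCochain` and `ζ` may differ on higher components of `L`, but `A`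
  -- sees only their contractions with `L_1`.
  rw [← dK_emb_succ, emb_res_kap_j H hcomm e ho, dK_kap, hdo, ← h1, ← sub_eq_zero, ← map_sub]
  refine H.kap_lin_eq_zero hcomm e (Submodule.sub_mem _ hW hζ) fun f => ?_
  have h2 : contr e (Acyc.ofCochain G c (m + 1)) f = contr e ζ f := by
    rw [contr_apply, Acyc.con_ofCochain G hlow, Acyc.q_j, hc1, DualEnvIso.eta_one]
    norm_num
  rw [sub_eq_add_neg, ← neg_one_smul ℂ, contr_add, contr_smul, h2, neg_one_smul, add_neg_cancel]

theorem isLinearComplex_lc : IsLinearComplex (H.lc hcomm e) where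
  deg_one m s t := H.kap_lin_mem hcomm e (Acyc.d_j_mem G (H.mem _ s)) _
  bd_bd m y := emb_injective m (by
    rw [← dK_emb_succ, ← dK_emb_succ, dK_dK, map_zero])
  exact_zero := H.lc_exact_zero hcomm e
  exact_one m z hz hz1 := H.lc_exact_one hcomm e m z (by
    cases m with
    | zero => exact H.dK_emb_zero hcomm e z
    | succ m => rw [dK_emb_succ, LinearMap.mem_ker.1 hz, map_zero]) hz1

end HomBasis

end

/-! ### Comparison of `CE(L)` with `A` through the fibre `Cof`. -/

section

variable {L : Type v} [AddCommGroup L] [Module ℂ L] {G : GradedLieSuperalgebra L}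

theorem Acyc.i_mem_wt {n : ℕ} {b : CE G} (hb : b ∈ (CE.wt G).comp n) :
    i G b ∈ (wt G).comp n := by
  rw [Coaction.comp_eq_span] at hb
  induction hb using Submodule.span_induction with
  | zero => simp
  | add a b _ _ ha hb => rw [map_add]; exact Submodule.add_mem _ ha hb
  | smul r a _ ha => rw [map_smul]; exact Submodule.smul_mem _ _ ha
  | mem a ha =>
    obtain ⟨l, rfl, rfl⟩ := ha
    induction l with
    | nil => simpa using (wt G).one_mem
    | cons s l ih =>
      obtain ⟨p, φ⟩ := s
      change i G (CE.gen G p φ * (l.map (CE.super G).g).prod) ∈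
        (wt G).comp (p + (l.map fun s => s.1).sum)
      rw [map_mul, i_gen]
      exact (wt G).mul_mem (x_mem_wt G p φ) ih

namespace HomBasis

variable (H : HomBasis G)

theorem coord_proj (n : ℕ) (a : Acyc G) (m : ℕ) (t : H.S m) :
    H.coord ((Acyc.wt G).proj n a) ⟨m, t⟩ =
      if m ≤ n then (CE.wt G).proj (n - m) (H.coord a ⟨m, t⟩) else 0 := by
  classical
  obtain ⟨f, rfl⟩ := H.coord.symm.surjective a
  induction f using Finsupp.induction_linear with
  | zero => simp
  | add f g hf hg =>
    simp only [map_add, Finsupp.add_apply, hf, hg]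
    split_ifs <;> simp
  | single s b =>
    obtain ⟨m', s⟩ := s
    induction b using (CE.wt G).induction_comp with
    | hadd a b ha hb =>
      simp only [Finsupp.single_add, map_add, Finsupp.add_apply, ha, hb]
      split_ifs <;> simp
    | h0 => simp
    | hcomp p b hb =>
      have hmem := (Acyc.wt G).mul_mem (Acyc.i_mem_wt hb) (Acyc.j_mem_wt G (H.mem m' s))
      rw [← coord_symm_single] at hmem
      rw [(Acyc.wt G).proj_of_mem hmem, LinearEquiv.apply_symm_apply]
      by_cases hst : (⟨m', s⟩ : Σ m, H.S m) = ⟨m, t⟩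
      · obtain rfl : m' = m := congrArg Sigma.fst hst
        obtain rfl : s = t := by simpa using hst
        rw [Finsupp.single_eq_same, (CE.wt G).proj_of_mem hb]
        split_ifs <;> first | omega | simp
      · rw [Finsupp.single_apply, if_neg hst, map_zero, ite_self]
        split_ifs
        · rw [LinearEquiv.apply_symm_apply, Finsupp.single_apply, if_neg hst]
        · simp

theorem coord_eq_zero_of_mem {n : ℕ} {a : Acyc G} (ha : a ∈ (Acyc.wt G).comp n) {m : ℕ}
    (hm : n < m) (t : H.S m) : H.coord a ⟨m, t⟩ = 0 := by
  rw [← (Acyc.wt G).proj_same ha, coord_proj, if_neg (by omega)]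

theorem coord_mem {n : ℕ} {a : Acyc G} (ha : a ∈ (Acyc.wt G).comp n) {m : ℕ}
    (hm : m ≤ n) (t : H.S m) : H.coord a ⟨m, t⟩ ∈ (CE.wt G).comp (n - m) := by
  rw [← (Acyc.wt G).proj_same ha, coord_proj, if_pos hm]
  exact (CE.wt G).proj_mem _ _

theorem coord_i (b : CE G) (s : Σ m, H.S m) : H.coord (Acyc.i G b) s = H.bas.repr 1 s • b := by
  have := H.coord_mul b 1 s
  rwa [map_one, mul_one] at this

/-- A factor `x` uses up positive weight, so the fibre part has weight below `n`. Thus `d` strictly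
lowers the filtration by fibre weight on the elements of `Cof`. -/
theorem coord_lin {n : ℕ} {w : Acyc G} (hw : w ∈ Acyc.lin G n) {m : ℕ} (hm : n ≤ m)
    (t : H.S m) : H.coord w ⟨m, t⟩ = 0 := by
  induction hw using Submodule.span_induction with
  | zero => simp
  | add a b _ _ ha hb => rw [map_add, Finsupp.add_apply, ha, hb, add_zero]
  | smul r a _ ha => rw [map_smul, Finsupp.smul_apply, ha, smul_zero]
  | mem a ha =>
    obtain ⟨p, m', φ, o, hp, ho, rfl⟩ := ha
    rw [← Acyc.i_gen, coord_mul]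
    rcases Nat.eq_zero_or_pos p with rfl | hp0
    · rw [G.dual_comp_zero φ, map_zero, smul_zero]
    · rw [H.repr_of_mem ho (by omega), zero_smul]

variable [∀ m, FiniteDimensional ℂ (G.comp m)]

/-- The differential of the leading coordinates. -/
theorem coord_d_of_le {M : ℕ} {w : Acyc G} (hw : ∀ s : Σ m, H.S m, M < s.1 → H.coord w s = 0)
    {m : ℕ} (hm : M ≤ m) (t : H.S m) :
    H.coord (Acyc.d G w) ⟨m, t⟩ = CE.d G (H.coord w ⟨m, t⟩) := by
  classical
  have h1 : w = ∑ s ∈ (H.coord w).support, Acyc.i G (H.coord w s) * Acyc.j G (H.bas s) := by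
    conv_lhs => rw [← H.coord.symm_apply_apply w, ← Finsupp.sum_single (H.coord w), Finsupp.sum,
      map_sum]
    exact Finset.sum_congr rfl fun s _ => H.coord_symm_single _ _
  have h2 : ∀ s ∈ (H.coord w).support,
      H.coord (Acyc.d G (Acyc.i G (H.coord w s) * Acyc.j G (H.bas s))) ⟨m, t⟩ =
        CE.d G (Finsupp.single s (H.coord w s) ⟨m, t⟩) := by
    rintro ⟨k, s⟩ hs
    have hk : k ≤ M := by
      by_contra h
      exact Finsupp.mem_support_iff.1 hs (hw _ (by simpa using h))
    rw [(Acyc.isDer_d G).mul, Acyc.d_i, pow_one, ← Acyc.i_par, map_add, Finsupp.add_apply,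
      coord_mul, coord_i_mul, H.coord_lin (Acyc.d_j_mem G (H.mem k s)) (by omega), mul_zero,
      add_zero, Module.Basis.repr_self, Finsupp.single_apply, Finsupp.single_apply]
    split_ifs <;> simp
  conv_lhs => rw [h1, map_sum, map_sum, Finsupp.finsetSum_apply, Finset.sum_congr rfl h2,
    ← map_sum, ← Finsupp.finsetSum_apply]
  congr 2
  exact Finsupp.sum_single (H.coord w)

variable {V : Type u} [AddCommGroup V] [Module ℂ V] [FiniteDimensional ℂ V]
  {R : Submodule ℂ (V ⊗[ℂ] V)}
  (hcomm : ∀ u v : V, u ⊗ₜ[ℂ] v - v ⊗ₜ[ℂ] u ∈ R) (e : DualEnvIso G R)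

/-- The quotient map to `A` respects weights, so its kernel is graded; this permits passing to a
homogeneous representative. -/
theorem kap_proj_eq_zero {a : Acyc G} (ha : H.kap hcomm e a = 0) (n : ℕ) :
    H.kap hcomm e ((Acyc.wt G).proj n a) = 0 := by
  refine Finsupp.ext fun ⟨m, t⟩ => ?_
  rw [kap_apply, coord_proj]
  split_ifs
  · have h := DFunLike.congr_fun ha (⟨m, t⟩ : Σ m, H.S m)
    rw [kap_apply] at h
    rw [e.pi_proj, h, Finsupp.zero_apply, map_zero]
  · rw [map_zero, Finsupp.zero_apply]

theorem kap_surjective (k : (Σ m, H.S m) →₀ QuadAlg R) : ∃ a, H.kap hcomm e a = k := by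
  obtain ⟨f, hf⟩ := Finsupp.mapRange_surjective (α := Σ m, H.S m) (e.pi G hcomm) (map_zero _)
    (e.pi_surjective G hcomm) k
  refine ⟨H.coord.symm f, ?_⟩
  ext s
  rw [kap_apply, LinearEquiv.apply_symm_apply, ← hf, Finsupp.mapRange_apply]

/-- The exactness of the complex with coefficients in `A`. -/
theorem exists_dK (hK : IsKoszul R) {k : (Σ m, H.S m) →₀ QuadAlg R} (hk : H.dK hcomm e k = 0)
    (h0 : ∀ t, QuadAlg.eps R (k ⟨0, t⟩) = 0) : ∃ k', H.dK hcomm e k' = k := by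
  have := H.uniq
  obtain ⟨N, hN⟩ := exists_sum_emb_res k
  have hbd : ∀ m, bd (H.lc hcomm e) m (res (m + 1) k) = 0 := by
    intro m
    -- The range is taken long enough to contain the summand of index `m + 1`.
    have h1 := hN (N + m + 2) (by omega)
    rw [h1, map_sum, Finset.sum_range_succ', dK_emb_zero, add_zero,
      Finset.sum_congr rfl fun m _ => H.dK_emb_succ hcomm e m _] at hk
    ext t
    have h2 := DFunLike.congr_fun hk (⟨m, t⟩ : Σ m, H.S m)
    rw [Finsupp.finsetSum_apply, Finset.sum_eq_single m
      (fun l _ hl => emb_apply_of_ne (Ne.symm hl) _ _)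
      (fun h => absurd (Finset.mem_range.2 (by omega)) h), emb_apply] at h2
    exact h2
  have hex : ∀ m, ∃ y, bd (H.lc hcomm e) m y = res m k := by
    intro m
    refine (H.isLinearComplex_lc hcomm e).exact_of_isKoszul hK m _ ?_
    cases m with
    | zero => exact h0
    | succ m => exact hbd m
  choose y hy using hex
  refine ⟨∑ m ∈ Finset.range N, emb (m + 1) (y m), ?_⟩
  conv_rhs => rw [hN N le_rfl]
  rw [map_sum]
  exact Finset.sum_congr rfl fun m _ => by rw [dK_emb_succ, hy]

/-- With `K` the kernel of the quotient map to `A`, `u` is a primitive of `z` in `K ⊗ Cof`. Its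
leading coordinates, in fibre weight `M + 1`, are cycles of `K` of smaller weight and so boundaries
by the induction on the weight. Subtracting the boundary of a lift lowers `M`; when only fibre
weight zero is left, the coordinate is a primitive in `K`. -/
theorem descend {n : ℕ} {z : CE G}
    (ih : ∀ k < n, ∀ b ∈ (CE.wt G).comp k, e.pi G hcomm b = 0 → CE.d G b = 0 →
      ∃ c ∈ (CE.wt G).comp k, e.pi G hcomm c = 0 ∧ CE.d G c = b) (M : ℕ) (u : Acyc G)
    (hu : u ∈ (Acyc.wt G).comp n) (hku : H.kap hcomm e u = 0)
    (hM : ∀ s : Σ m, H.S m, M < s.1 → H.coord u s = 0) (hdu : Acyc.d G u = Acyc.i G z) :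
    ∃ c ∈ (CE.wt G).comp n, e.pi G hcomm c = 0 ∧ CE.d G c = z := by
  classical
  have hpi : ∀ s, e.pi G hcomm (H.coord u s) = 0 := fun s => by
    rw [← kap_apply, hku, Finsupp.zero_apply]
  induction M generalizing u with
  | zero =>
    -- Fibre weight zero has the single basis element `1`, and the coordinate of `i z` there is `z`
    -- itself.
    refine ⟨H.coord u ⟨0, H.uniq.default⟩, H.coord_mem hu (Nat.zero_le n) _, hpi _, ?_⟩
    rw [← H.coord_d_of_le hM le_rfl, hdu, coord_i, ← H.one, Module.Basis.repr_self,
      Finsupp.single_eq_same, one_smul]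
  | succ M ihM =>
    have hc : ∀ s : H.S (M + 1), ∃ c, Acyc.i G c * Acyc.j G (H.bas ⟨M + 1, s⟩) ∈ (Acyc.wt G).comp n ∧
        e.pi G hcomm c = 0 ∧ CE.d G c = H.coord u ⟨M + 1, s⟩ := by
      intro s
      rcases Nat.lt_or_ge n (M + 1) with hn | hn
      · exact ⟨0, by simp, by simp, by rw [map_zero, H.coord_eq_zero_of_mem hu hn]⟩
      -- On leading coordinates `d` acts through `CE(L)`, while `d u = i z` has no coordinate in
      -- positive fibre weight; so the leading coordinates are cycles.
      · obtain ⟨c, hc, hc'⟩ := ih (n - (M + 1)) (by omega) _ (H.coord_mem hu hn s) (hpi _) (by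
          rw [← H.coord_d_of_le hM le_rfl, hdu, coord_i,
            H.repr_of_mem (Cof.wt G).one_mem (by omega), zero_smul])
        refine ⟨c, ?_, hc'⟩
        have := (Acyc.wt G).mul_mem (Acyc.i_mem_wt hc) (Acyc.j_mem_wt G (H.mem _ s))
        rwa [Nat.sub_add_cancel hn] at this
    choose c hcn hcpi hcd using hc
    set T := (res (M + 1) (H.coord u)).support with hT
    -- The lift of the primitives of all leading coordinates. Its coefficients lie in `K`, so `u - d
    -- w` stays in `K ⊗ Cof` with the same differential.
    set w : Acyc G := ∑ s ∈ T, Acyc.i G (c s) * Acyc.j G (H.bas ⟨M + 1, s⟩) with hw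
    have hwk : H.kap hcomm e w = 0 := by
      rw [hw, map_sum]
      exact Finset.sum_eq_zero fun s _ => by rw [kap_i_mul, hcpi, zero_smul]
    have hwc : ∀ s, H.coord w s = ∑ t ∈ T, Finsupp.single (⟨M + 1, t⟩ : Σ m, H.S m) (c t) s := by
      intro s
      rw [hw, map_sum, Finsupp.finsetSum_apply]
      refine Finset.sum_congr rfl fun t _ => ?_
      rw [coord_mul, Module.Basis.repr_self, Finsupp.single_apply, Finsupp.single_apply]
      split_ifs <;> simp
    have hw1 : ∀ s : Σ m, H.S m, M + 1 < s.1 → H.coord w s = 0 := by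
      intro s hs
      rw [hwc]
      refine Finset.sum_eq_zero fun t _ => ?_
      rw [Finsupp.single_apply, if_neg]
      rintro rfl
      exact lt_irrefl _ hs
    have hw2 : ∀ s : H.S (M + 1), CE.d G (H.coord w ⟨M + 1, s⟩) = H.coord u ⟨M + 1, s⟩ := by
      intro s
      by_cases hs : s ∈ T
      · rw [hwc, Finset.sum_eq_single s, Finsupp.single_eq_same, hcd]
        · intro t _ ht
          rw [Finsupp.single_apply, if_neg]
          simpa using ht
        · exact fun h => absurd hs h
      · rw [hwc, Finset.sum_eq_zero, map_zero]
        · exact (Finsupp.notMem_support_iff.1 hs).symm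
        · intro t ht
          rw [Finsupp.single_apply, if_neg]
          intro h
          obtain rfl : t = s := by simpa using h
          exact hs ht
    have hk' : H.kap hcomm e (u - Acyc.d G w) = 0 := by
      rw [map_sub, hku, ← dK_kap, hwk, map_zero, sub_zero]
    refine ihM (u - Acyc.d G w) ?_ hk' ?_ ?_ fun s => ?_
    · exact Submodule.sub_mem _ hu (Acyc.d_mem_wt G (Submodule.sum_mem _ fun s _ => hcn s))
    · rintro ⟨m, s⟩ hs
      rw [map_sub, Finsupp.sub_apply, H.coord_d_of_le hw1 (Nat.succ_le_of_lt hs)]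
      by_cases hm : m = M + 1
      · subst hm
        rw [hw2, sub_self]
      · have : M + 1 < m := by simp only at hs; omega
        rw [hM _ this, hw1 _ this, map_zero, sub_zero]
    · rw [map_sub, Acyc.d_d, sub_zero, hdu]
    · rw [← kap_apply, hk', Finsupp.zero_apply]

end HomBasis

variable [∀ m, FiniteDimensional ℂ (G.comp m)]
  {V : Type u} [AddCommGroup V] [Module ℂ V] [FiniteDimensional ℂ V]
  {R : Submodule ℂ (V ⊗[ℂ] V)}
  (hcomm : ∀ u v : V, u ⊗ₜ[ℂ] v - v ⊗ₜ[ℂ] u ∈ R) (e : DualEnvIso G R)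

/-- The exactness of the complex `CE(L) → A`. -/
theorem CE.exists_primitive_of_mem (hK : IsKoszul R) (n : ℕ) : ∀ z ∈ (CE.wt G).comp n,
    e.pi G hcomm z = 0 → CE.d G z = 0 →
      ∃ c ∈ (CE.wt G).comp n, e.pi G hcomm c = 0 ∧ CE.d G c = z := by
  obtain ⟨H⟩ := HomBasis.nonempty G
  induction n using Nat.strong_induction_on with
  | _ n ih =>
    intro z hz hpz hdz
    rcases Nat.eq_zero_or_pos n with rfl | hn
    · exact ⟨0, Submodule.zero_mem _, map_zero _, by
        rw [map_zero, e.eq_zero_of_pi G hcomm hz hpz]⟩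
    · have hn' : (n : ℂ) ≠ 0 := by exact_mod_cast hn.ne'
      -- The homotopy provides a primitive of `i z` in `CE(L) ⊗ Cof`; it need not have coefficients
      -- in the kernel of the quotient map.
      set a : Acyc G := (n : ℂ)⁻¹ • Acyc.h G (Acyc.i G z) with ha
      have han : a ∈ (Acyc.wt G).comp n :=
        Submodule.smul_mem _ _ (Acyc.h_mem_wt G (Acyc.i_mem_wt hz))
      have hda : Acyc.d G a = Acyc.i G z := by
        have h1 := Acyc.d_h_add_h_d G (Acyc.i_mem_wt hz)
        rw [Acyc.d_i, hdz, map_zero, map_zero, add_zero] at h1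
        rw [ha, map_smul, h1, smul_smul, inv_mul_cancel₀ hn', one_smul]
      -- As `z` maps to zero in `A`, the reduction of `a` is a cycle of the Koszul complex. It is a
      -- boundary; positive weight supplies the vanishing of the augmentation in fibre degree zero.
      obtain ⟨k', hk'⟩ := H.exists_dK hcomm e hK (k := H.kap hcomm e a)
        (by
          rw [H.dK_kap, hda, ← mul_one (Acyc.i G z), H.kap_i_mul, hpz, zero_smul])
        (fun t => by
          rw [H.kap_apply]
          exact QuadAlg.eps_deg R hn (e.pi_mem_deg G hcomm (H.coord_mem han (Nat.zero_le n) t)))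
      obtain ⟨b, rfl⟩ := H.kap_surjective hcomm e k'
      have hpd : (Acyc.wt G).proj n (Acyc.d G b) = Acyc.d G ((Acyc.wt G).proj n b) :=
        (Acyc.wt G).proj_comm (Acyc.wt G) (Acyc.d G) (fun _ _ h => Acyc.d_mem_wt G h) n b
      -- Correcting `a` by the boundary of a lift moves it into `K ⊗ Cof`. The lift is projected to
      -- weight `n`, since nothing makes it homogeneous.
      set u : Acyc G := a - Acyc.d G ((Acyc.wt G).proj n b) with hu
      have hu' : u = (Acyc.wt G).proj n (a - Acyc.d G b) := by
        rw [map_sub, hpd, (Acyc.wt G).proj_same han]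
      have hku : H.kap hcomm e u = 0 := by
        rw [hu']
        refine H.kap_proj_eq_zero hcomm e ?_ n
        rw [map_sub, ← H.dK_kap, hk', sub_self]
      refine H.descend hcomm e ih ((H.coord u).support.sup Sigma.fst) u
        (by rw [hu']; exact (Acyc.wt G).proj_mem _ _) hku (fun s hs => ?_) ?_
      · by_contra h
        exact absurd (Finset.le_sup (f := Sigma.fst) (Finsupp.mem_support_iff.2 h)) (not_le.2 hs)
      · rw [hu, map_sub, Acyc.d_d, sub_zero, hda]

end

/-! ### Homological grading, the DG structure, homology and decomposability. -/

section

variable {L : Type v} [AddCommGroup L] [Module ℂ L] (G : GradedLieSuperalgebra L)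

namespace CE

theorem prod_eq_zero {l : List (Σ p : ℕ, Module.Dual ℂ (G.comp p))} (h : ∃ s ∈ l, s.1 = 0) :
    (l.map fun s => gen G s.1 s.2).prod = 0 := by
  obtain ⟨⟨p, φ⟩, hs, rfl⟩ := h
  refine List.prod_eq_zero (List.mem_map.2 ⟨_, hs, ?_⟩)
  rw [G.dual_comp_zero φ, map_zero]

/-- The homological grading, with values in the integers. -/
abbrev hdeg : Coaction (super G).g (fun s => (s.1 : ℤ) - 1) := CE.coaction G (fun p => (p : ℤ) - 1)

/-- The homological grading, as a grading by natural numbers. -/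
abbrev ndeg : Coaction (super G).g (fun s => s.1 - 1) := CE.coaction G (fun p => p - 1)

/-- The integer version admits the shift by `-1` of the differential without truncation, and makes
the vanishing of `d` in degree zero a statement about negative degrees. -/
theorem deg_eq_hdeg (k : ℕ) : deg G k = (hdeg G).comp k := by
  rw [Coaction.comp_eq_span]
  have h : ∀ l : List (Σ p : ℕ, Module.Dual ℂ (G.comp p)),
      (l.map fun s => (s.1 : ℤ) - 1).sum = ((l.map Sigma.fst).sum : ℕ) - (l.length : ℤ) := by
    intro l
    induction l with
    | nil => simp
    | cons s l ih =>
      simp only [List.map_cons, List.sum_cons, ih, List.length_cons]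
      push_cast
      ring
  refine congrArg (Submodule.span ℂ) (Set.ext fun b => exists_congr fun l =>
    and_congr_left fun _ => ?_)
  have := h l
  constructor
  · intro h'
    refine this.trans ?_
    omega
  · intro h'
    have := this.symm.trans h'
    omega

/-- Truncated subtraction misplaces only generators with `p = 0`, and these are zero. The
natural-number version gives the direct sum decomposition over `ℕ`. -/
theorem deg_eq_ndeg (k : ℕ) : deg G k = (ndeg G).comp k := by
  rw [Coaction.comp_eq_span]
  have h : ∀ l : List (Σ p : ℕ, Module.Dual ℂ (G.comp p)), (∀ s ∈ l, s.1 ≠ 0) →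
      (l.map Sigma.fst).sum = (l.map fun s => s.1 - 1).sum + l.length := by
    intro l hl
    induction l with
    | nil => simp
    | cons s l ih =>
      have h1 := hl s (List.mem_cons_self ..)
      have h2 := ih fun t ht => hl t (List.mem_cons_of_mem _ ht)
      simp only [List.map_cons, List.sum_cons, List.length_cons, h2]
      omega
  refine le_antisymm (Submodule.span_le.2 ?_) (Submodule.span_le.2 ?_)
  · rintro _ ⟨l, hl, rfl⟩
    by_cases h0 : ∃ s ∈ l, s.1 = 0
    · rw [prod_eq_zero G h0]
      exact Submodule.zero_mem _
    · push Not at h0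
      have := h l h0
      exact Submodule.subset_span ⟨l, (by omega : (l.map fun s => s.1 - 1).sum = k), rfl⟩
  · rintro _ ⟨l, hl, rfl⟩
    by_cases h0 : ∃ s ∈ l, s.1 = 0
    · have := prod_eq_zero G h0
      exact this ▸ Submodule.zero_mem _
    · push Not at h0
      have := h l h0
      have hl' : (l.map fun s => s.1 - 1).sum = k := hl
      exact Submodule.subset_span ⟨l, this.trans (congrArg (· + l.length) hl'), rfl⟩

theorem hdeg_neg {n : ℤ} (hn : n < 0) : (hdeg G).comp n = ⊥ := by
  rw [Coaction.comp_eq_span, Submodule.span_eq_bot]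
  rintro _ ⟨l, hl, rfl⟩
  have h : (∀ s ∈ l, s.1 ≠ 0) → 0 ≤ (l.map fun s => (s.1 : ℤ) - 1).sum := by
    intro h
    refine List.sum_nonneg fun x hx => ?_
    obtain ⟨s, hs, rfl⟩ := List.mem_map.1 hx
    have := h s hs
    omega
  refine prod_eq_zero G ?_
  by_contra h0
  push Not at h0
  have := h h0
  have hl' : (l.map fun s => (s.1 : ℤ) - 1).sum = n := hl
  omega

theorem deg_le_hp (k : ℕ) : deg G k ≤ (super G).hp k := by
  refine Submodule.span_le.2 ?_
  rintro _ ⟨l, hl, rfl⟩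
  have key : ∀ l : List (Σ p : ℕ, Module.Dual ℂ (G.comp p)),
      (l.map fun s => gen G s.1 s.2).prod ∈ (super G).hp ((l.map Sigma.fst).sum + l.length) := by
    intro l
    induction l with
    | nil => exact SuperAlg.one_mem_hp
    | cons s l ih =>
      simp only [List.map_cons, List.sum_cons, List.length_cons, List.prod_cons]
      exact SuperAlg.hp_congr (by omega) (SuperAlg.mul_mem_hp (gen_mem_hp G s.1 s.2) ih)
  exact SuperAlg.hp_congr (by omega) (key l)

theorem gen_mem_deg {p k : ℕ} (h : p = k + 1) (φ : Module.Dual ℂ (G.comp p)) :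
    gen G p φ ∈ deg G k :=
  Submodule.subset_span ⟨[⟨p, φ⟩], by simpa using h, by simp⟩

variable [∀ m, FiniteDimensional ℂ (G.comp m)]

theorem d_mem_hdeg {n : ℤ} {b : CE G} (hb : b ∈ (hdeg G).comp n) :
    d G b ∈ (hdeg G).comp (n + -1) :=
  (isDer_d G).mem_comp (hdeg G) (by
    rintro ⟨p, φ⟩
    change d G (gen G p φ) ∈ (hdeg G).comp ((p : ℤ) - 1 + -1)
    rw [d_gen]
    refine dualBracket_mem G (fun i j hij φ ψ => ?_) φ
    rw [show (p : ℤ) - 1 + -1 = ((i : ℤ) - 1) + ((j : ℤ) - 1) by omega]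
    exact (hdeg G).mul_mem ((hdeg G).gen_mem ⟨i, φ⟩) ((hdeg G).gen_mem ⟨j, ψ⟩)) hb

theorem isCDGA : IsCDGA (deg G) (d G) where
  isInternal := by
    rw [show deg G = (ndeg G).comp from funext (deg_eq_ndeg G)]
    exact (ndeg G).isInternal
  one_mem := by rw [deg_eq_ndeg]; exact (ndeg G).one_mem
  mul_mem ha hb := by
    rw [deg_eq_ndeg] at *
    exact (ndeg G).mul_mem ha hb
  comm ha hb := SuperAlg.mul_comm_of_mem (deg_le_hp G _ ha) (deg_le_hp G _ hb)
  d_mem {k a} ha := by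
    rw [deg_eq_hdeg] at *
    have := d_mem_hdeg G ha
    rwa [show ((k + 1 : ℕ) : ℤ) + -1 = k by omega] at this
  d_zero {a} ha := by
    rw [deg_eq_hdeg] at ha
    have := d_mem_hdeg G ha
    rwa [hdeg_neg G (by norm_num), Submodule.mem_bot] at this
  leibniz b ha := by
    rw [(isDer_d G).mul_of_mem (deg_le_hp G _ ha), one_mul]
  d_d := d_d G

theorem proj_d (n : ℤ) (b : CE G) : (hdeg G).proj n (d G b) = d G ((hdeg G).proj (n + 1) b) := by
  induction b using (hdeg G).induction_comp with
  | h0 => simp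
  | hadd a b ha hb => simp only [map_add, ha, hb]
  | hcomp m a ha =>
    rw [(hdeg G).proj_of_mem ha, (hdeg G).proj_of_mem (d_mem_hdeg G ha)]
    split_ifs <;> first | rfl | omega | simp

end CE

variable {V : Type u} [AddCommGroup V] [Module ℂ V] [FiniteDimensional ℂ V]
  {R : Submodule ℂ (V ⊗[ℂ] V)}

theorem DualEnvIso.form_vec (e : DualEnvIso G R) (φ : Module.Dual ℂ (G.comp 1)) :
    e.form G (e.vec G 1 φ) = φ := by
  ext x
  change (e.degOne.symm x) (e.vec G 1 φ) = φ x
  rw [e.apply_vec, LinearEquiv.apply_symm_apply, G.ext_coe]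

theorem CE.vmap_eq (e : DualEnvIso G R) (v : V) : CE.vmap G e v = CE.gen G 1 (e.form G v) := rfl

/-- A monomial of positive homological degree has a factor from some `L_p^*` with `p ≠ 1`, which
maps to zero. -/
theorem DualEnvIso.pi_eq_zero (hcomm : ∀ u v : V, u ⊗ₜ[ℂ] v - v ⊗ₜ[ℂ] u ∈ R) (e : DualEnvIso G R)
    {k : ℕ} (hk : 0 < k) {b : CE G} (hb : b ∈ CE.deg G k) : e.pi G hcomm b = 0 := by
  induction hb using Submodule.span_induction with
  | zero => simp
  | add a b _ _ ha hb => rw [map_add, ha, hb, add_zero]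
  | smul r a _ ha => rw [map_smul, ha, smul_zero]
  | mem a ha =>
    obtain ⟨l, hl, rfl⟩ := ha
    have h : ∃ s ∈ l, s.1 ≠ 1 := by
      by_contra h
      push Not at h
      have : (l.map Sigma.fst).sum = l.length := by
        rw [List.map_congr_left h]
        simp
      omega
    obtain ⟨⟨p, φ⟩, hs, hp⟩ := h
    rw [map_list_prod]
    refine List.prod_eq_zero (List.mem_map.2 ⟨_, List.mem_map.2 ⟨_, hs, rfl⟩, ?_⟩)
    exact e.pi_gen_of_ne G hcomm hp φ

variable [∀ m, FiniteDimensional ℂ (G.comp m)]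

/-- Primitives are found in each weight separately, and only finitely many weights occur. The sum is
then projected to homological degree `k + 1`, which is compatible with `d`. -/
theorem CE.exists_primitive (hcomm : ∀ u v : V, u ⊗ₜ[ℂ] v - v ⊗ₜ[ℂ] u ∈ R) (hK : IsKoszul R)
    (e : DualEnvIso G R) {k : ℕ} {b : CE G} (hb : b ∈ CE.deg G k) (hpi : e.pi G hcomm b = 0)
    (hd : CE.d G b = 0) : ∃ c ∈ CE.deg G (k + 1), CE.d G c = b := by
  obtain ⟨s, hs⟩ := (CE.wt G).exists_sum_proj b
  have h1 : ∀ n, ∃ c, CE.d G c = (CE.wt G).proj n b := by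
    intro n
    obtain ⟨c, -, -, hc⟩ := CE.exists_primitive_of_mem hcomm e hK n _ ((CE.wt G).proj_mem n b)
      (by rw [e.pi_proj, hpi, map_zero])
      (by rw [← (CE.wt G).proj_comm (CE.wt G) (CE.d G) (fun _ _ h => CE.d_mem_wt G h) n b, hd,
        map_zero])
    exact ⟨c, hc⟩
  choose c hc using h1
  refine ⟨(CE.hdeg G).proj (k + 1) (∑ n ∈ s, c n), ?_, ?_⟩
  · rw [CE.deg_eq_hdeg]
    exact (CE.hdeg G).proj_mem _ _
  · rw [← CE.proj_d, map_sum, Finset.sum_congr rfl fun n _ => hc n, ← hs]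
    rw [CE.deg_eq_hdeg] at hb
    exact (CE.hdeg G).proj_same hb

theorem CE.isResolution (hcomm : ∀ u v : V, u ⊗ₜ[ℂ] v - v ⊗ₜ[ℂ] u ∈ R) (hK : IsKoszul R)
    (e : DualEnvIso G R) : IsResolution (CE.deg G) (CE.d G) (e.pi G hcomm) where
  map_pos hk hb := e.pi_eq_zero G hcomm hk hb
  map_d := e.pi_d G hcomm
  exact_pos hk hb hd := CE.exists_primitive G hcomm hK e hb (e.pi_eq_zero G hcomm hk hb) hd
  exact_zero hb h := CE.exists_primitive G hcomm hK e hb h ((CE.isCDGA G).d_zero hb)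
  surjective a := by
    obtain ⟨b, rfl⟩ := e.pi_surjective G hcomm a
    refine ⟨(CE.ndeg G).proj 0 b, by rw [CE.deg_eq_ndeg]; exact (CE.ndeg G).proj_mem _ _, ?_⟩
    induction b using (CE.ndeg G).induction_comp with
    | h0 => simp
    | hadd a b ha hb => simp only [map_add, ha, hb]
    | hcomp m a ha =>
      rw [(CE.ndeg G).proj_of_mem ha]
      split_ifs with h
      · rfl
      · rw [← CE.deg_eq_ndeg] at ha
        rw [e.pi_eq_zero G hcomm (Nat.pos_of_ne_zero h) ha, map_zero]

theorem CE.gen_mem_generators (e : DualEnvIso G R) (p : ℕ) (φ : Module.Dual ℂ (G.comp p)) :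
    CE.gen G p φ ∈ (LinearMap.range (CE.vmap G e) ⊔ ⨆ k, LinearMap.range (CE.wmap G k) :
      Submodule ℂ (CE G)) := by
  match p with
  | 0 =>
    rw [G.dual_comp_zero φ, map_zero]
    exact Submodule.zero_mem _
  | 1 =>
    refine Submodule.mem_sup_left ⟨e.vec G 1 φ, ?_⟩
    rw [CE.vmap_eq, e.form_vec]
  | k + 2 =>
    exact Submodule.mem_sup_right (Submodule.mem_iSup_of_mem ⟨k + 1, Nat.succ_pos k⟩ ⟨φ, rfl⟩)

/-- The map dual to the bracket takes values in products of exactly two generators. -/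
theorem CE.d_decomposable (e : DualEnvIso G R) (p : ℕ) (φ : Module.Dual ℂ (G.comp p)) :
    CE.d G (CE.gen G p φ) ∈ ⨆ (n : ℕ) (_ : 2 ≤ n),
      (LinearMap.range (CE.vmap G e) ⊔ ⨆ k, LinearMap.range (CE.wmap G k) :
        Submodule ℂ (CE G)) ^ n := by
  rw [CE.d_gen]
  refine CE.dualBracket_mem G (fun i j _ φ ψ => ?_) φ
  refine Submodule.mem_iSup_of_mem 2 (Submodule.mem_iSup_of_mem le_rfl ?_)
  rw [pow_two]
  exact Submodule.mul_mem_mul (CE.gen_mem_generators G e i φ) (CE.gen_mem_generators G e j ψ)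

end

/-! ### Maps out of direct sums, tensor products and symmetric algebras. -/

section DirectSum

variable {ι : Type v} [DecidableEq ι] {M : ι → Type w} [∀ i, AddCommGroup (M i)]
  [∀ i, Module ℂ (M i)] {B : Type u} [Ring B] [Algebra ℂ B] (f : ∀ i, M i →ₗ[ℂ] B)

theorem toModule_mem {S : Submodule ℂ B} (h : ∀ i x, f i x ∈ S) (x : ⨁ i, M i) :
    DirectSum.toModule ℂ ι B f x ∈ S := by
  induction x using DirectSum.induction_on with
  | zero => rw [map_zero]; exact S.zero_mem
  | add a b ha hb => rw [map_add]; exact S.add_mem ha hb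
  | of k x => exact (DirectSum.toModule_lof (φ := f) ℂ k x).symm ▸ h k x

/-- Anticommutation extends from the summands to the sum by bilinearity; as `2` is invertible,
squares vanish, which is the relation of the exterior algebra. -/
theorem toModule_mul_self (h : ∀ i j x y, f i x * f j y = -(f j y * f i x)) (x : ⨁ i, M i) :
    DirectSum.toModule ℂ ι B f x * DirectSum.toModule ℂ ι B f x = 0 := by
  have h0 : ∀ k x, DirectSum.toModule ℂ ι B f (DirectSum.of M k x) = f k x :=
    fun k x => DirectSum.toModule_lof ℂ k x
  have key : ∀ x y, DirectSum.toModule ℂ ι B f x * DirectSum.toModule ℂ ι B f y =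
      -(DirectSum.toModule ℂ ι B f y * DirectSum.toModule ℂ ι B f x) := by
    intro x y
    induction x using DirectSum.induction_on with
    | zero => simp
    | add a b ha hb => rw [map_add, add_mul, mul_add, ha, hb, neg_add]
    | of k x =>
      induction y using DirectSum.induction_on with
      | zero => simp
      | add a b ha hb => rw [map_add, add_mul, mul_add, ha, hb, neg_add]
      | of l y => rw [h0, h0, h]
  have h2 : (2 : ℂ) • (DirectSum.toModule ℂ ι B f x * DirectSum.toModule ℂ ι B f x) = 0 := by
    rw [two_smul]
    nth_rw 1 [key x x]
    exact neg_add_cancel _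
  exact (smul_eq_zero.1 h2).resolve_left (by norm_num)

end DirectSum

section Tensor

variable {A : Type u} {B : Type v} {C : Type w} [CommRing A] [Algebra ℂ A] [CommRing B]
  [Algebra ℂ B] [Ring C] [Algebra ℂ C]

theorem tmul_commute (a : A) (b : B) (x : A ⊗[ℂ] (B ⊗[ℂ] C)) :
    (a ⊗ₜ (b ⊗ₜ 1)) * x = x * (a ⊗ₜ (b ⊗ₜ 1)) := by
  induction x using TensorProduct.induction_on with
  | zero => simp
  | add x y hx hy => rw [mul_add, add_mul, hx, hy]
  | tmul c y =>
    rw [Algebra.TensorProduct.tmul_mul_tmul, Algebra.TensorProduct.tmul_mul_tmul, mul_comm a]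
    congr 1
    induction y using TensorProduct.induction_on with
    | zero => simp
    | add x y hx hy => rw [mul_add, add_mul, hx, hy]
    | tmul y z =>
      rw [Algebra.TensorProduct.tmul_mul_tmul, Algebra.TensorProduct.tmul_mul_tmul, mul_comm b,
        mul_one, one_mul]

theorem tmul_anticommute {c c' : C} (h : c * c' = -(c' * c)) :
    ((1 : A) ⊗ₜ[ℂ] ((1 : B) ⊗ₜ[ℂ] c)) * (1 ⊗ₜ (1 ⊗ₜ c')) =
      (-1 : ℂ) • ((1 ⊗ₜ (1 ⊗ₜ c')) * ((1 : A) ⊗ₜ[ℂ] ((1 : B) ⊗ₜ[ℂ] c))) := by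
  simp only [Algebra.TensorProduct.tmul_mul_tmul, mul_one, h]
  rw [← TensorProduct.tmul_smul, ← TensorProduct.tmul_smul, neg_one_smul]

/-- Two maps from a symmetric algebra that agree on the generators are equal. -/
theorem symmetricAlgebra_hom_ext {M : Type u} [AddCommGroup M] [Module ℂ M] {D : Type w}
    [Semiring D] [Algebra ℂ D] {f g : SymmetricAlgebra ℂ M →ₐ[ℂ] D}
    (h : f.toLinearMap ∘ₗ SymmetricAlgebra.ι ℂ M = g.toLinearMap ∘ₗ SymmetricAlgebra.ι ℂ M) :
    f = g := by
  refine AlgHom.ext fun x => ?_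
  induction x using SymmetricAlgebra.induction with
  | algebraMap r => simp
  | ι x => exact DFunLike.congr_fun h x
  | mul a b ha hb => rw [map_mul, map_mul, ha, hb]
  | add a b ha hb => rw [map_add, map_add, ha, hb]

end Tensor

/-! ### `CE(L)` as the semi-free algebra `S(V)[W]`. -/

section

variable {L : Type v} [AddCommGroup L] [Module ℂ L] (G : GradedLieSuperalgebra L)

namespace CE

/-- For odd `p` the homological degree `p - 1` is even, so the generator commutes with all others
without signs. -/
theorem gen_mem_center {p : ℕ} (hp : Odd p) (φ : Module.Dual ℂ (G.comp p)) :
    gen G p φ ∈ Subalgebra.center ℂ (CE G) := by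
  rw [Subalgebra.mem_center_iff]
  intro b
  have h : gen G p φ ∈ (super G).hp 0 := SuperAlg.hp_congr (by
    obtain ⟨k, rfl⟩ := hp
    omega) (gen_mem_hp G p φ)
  have hb : ∀ s, (super G).g s * gen G p φ = gen G p φ * (super G).g s := fun s => by
    rw [SuperAlg.mul_comm_of_mem h (SuperAlg.g_mem_hp s), zero_mul, pow_zero, one_smul]
  induction b using (super G).induction with
  | h1 => simp
  | hadd a b ha hb => rw [add_mul, mul_add, ha, hb]
  | hsmul r a ha => rw [smul_mul_assoc, mul_smul_comm, ha]
  | hgen s => exact hb s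
  | hmul a b ha hb => rw [mul_assoc, hb, ← mul_assoc, ha, mul_assoc]

/-- A map to the center extends to the symmetric algebra. -/
def symLift {M : Type w} [AddCommGroup M] [Module ℂ M] (f : M →ₗ[ℂ] CE G)
    (hf : ∀ x, f x ∈ Subalgebra.center ℂ (CE G)) : SymmetricAlgebra ℂ M →ₐ[ℂ] CE G :=
  (Subalgebra.center ℂ (CE G)).val.comp
    (SymmetricAlgebra.lift (f.codRestrict (Subalgebra.toSubmodule (Subalgebra.center ℂ (CE G))) hf :
      M →ₗ[ℂ] Subalgebra.center ℂ (CE G)))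

theorem symLift_ι {M : Type w} [AddCommGroup M] [Module ℂ M] (f : M →ₗ[ℂ] CE G)
    (hf : ∀ x, f x ∈ Subalgebra.center ℂ (CE G)) (x : M) :
    symLift G f hf (SymmetricAlgebra.ι ℂ M x) = f x := by
  rw [symLift, AlgHom.comp_apply, SymmetricAlgebra.lift_ι_apply]
  rfl

theorem symLift_commute {M : Type w} [AddCommGroup M] [Module ℂ M] (f : M →ₗ[ℂ] CE G)
    (hf : ∀ x, f x ∈ Subalgebra.center ℂ (CE G)) (x : SymmetricAlgebra ℂ M) (b : CE G) :
    Commute (symLift G f hf x) b := by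
  have : symLift G f hf x ∈ Subalgebra.center ℂ (CE G) := Subtype.coe_prop _
  exact (Subalgebra.mem_center_iff.1 this b).symm

/-- The generators of positive degree. -/
abbrev W (k : ℕ+) : Type v := Module.Dual ℂ (G.comp ((k : ℕ) + 1))

/-- The inclusion of the generators of even degree. -/
def evenMap : EvenPart (W G) →ₗ[ℂ] CE G :=
  DirectSum.toModule ℂ _ _ fun k => wmap G k.1

/-- The inclusion of the generators of odd degree. -/
def oddMap : OddPart (W G) →ₗ[ℂ] CE G :=
  DirectSum.toModule ℂ _ _ fun k => wmap G k.1

theorem evenMap_lof (k : {k : ℕ+ // Even (k : ℕ)}) (w : W G k.1) : evenMap G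
    (DirectSum.lof ℂ _ (fun k : {k : ℕ+ // Even (k : ℕ)} => W G k.1) k w) = wmap G k.1 w := by
  rw [evenMap, DirectSum.toModule_lof]

theorem oddMap_lof (k : {k : ℕ+ // Odd (k : ℕ)}) (w : W G k.1) : oddMap G
    (DirectSum.lof ℂ _ (fun k : {k : ℕ+ // Odd (k : ℕ)} => W G k.1) k w) = wmap G k.1 w := by
  rw [oddMap, DirectSum.toModule_lof]

theorem evenMap_mem (x : EvenPart (W G)) : evenMap G x ∈ Subalgebra.center ℂ (CE G) :=
  toModule_mem (S := Subalgebra.toSubmodule (Subalgebra.center ℂ (CE G))) _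
    (fun k x => gen_mem_center G k.2.add_one x) x

theorem oddMap_mul_self (x : OddPart (W G)) : oddMap G x * oddMap G x = 0 := by
  refine toModule_mul_self _ (fun k l x y => ?_) x
  have hk : Odd ((k.1 : ℕ) + 1 + 1) := k.2.add_one.add_one
  have hl : Odd ((l.1 : ℕ) + 1 + 1) := l.2.add_one.add_one
  have := gen_mul_gen G ((k.1 : ℕ) + 1) ((l.1 : ℕ) + 1) x y
  rw [(hk.mul hl).neg_one_pow, neg_one_smul] at this
  exact this

variable {V : Type u} [AddCommGroup V] [Module ℂ V]
  {R : Submodule ℂ (V ⊗[ℂ] V)} (e : DualEnvIso G R)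

theorem vmap_mem_center (v : V) : vmap G e v ∈ Subalgebra.center ℂ (CE G) :=
  gen_mem_center G odd_one _

/-- The map `S(V)[W] → CE(L)`. -/
def ofSemiFree : SemiFreeAlg V (W G) →ₐ[ℂ] CE G :=
  Algebra.TensorProduct.lift (symLift G (vmap G e) (vmap_mem_center G e))
    (Algebra.TensorProduct.lift (symLift G (evenMap G) (evenMap_mem G))
      (ExteriorAlgebra.lift ℂ ⟨oddMap G, oddMap_mul_self G⟩)
      fun _ _ => symLift_commute _ _ _ _ _)
    fun _ _ => symLift_commute _ _ _ _ _

theorem ofSemiFree_left (x : SymmetricAlgebra ℂ V) : ofSemiFree G e (x ⊗ₜ (1 ⊗ₜ 1)) =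
    symLift G (vmap G e) (vmap_mem_center G e) x := by
  simp [ofSemiFree]

theorem ofSemiFree_even (x : SymmetricAlgebra ℂ (EvenPart (W G))) :
    ofSemiFree G e (1 ⊗ₜ (x ⊗ₜ 1)) = symLift G (evenMap G) (evenMap_mem G) x := by
  simp [ofSemiFree]

theorem ofSemiFree_odd (x : ExteriorAlgebra ℂ (OddPart (W G))) :
    ofSemiFree G e (1 ⊗ₜ (1 ⊗ₜ x)) = ExteriorAlgebra.lift ℂ ⟨oddMap G, oddMap_mul_self G⟩ x := by
  simp [ofSemiFree]

theorem ofSemiFree_vmap (v : V) :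
    ofSemiFree G e (SymmetricAlgebra.ι ℂ V v ⊗ₜ (1 ⊗ₜ 1)) = vmap G e v := by
  rw [ofSemiFree_left, symLift_ι]

theorem ofSemiFree_wmap_even (k : {k : ℕ+ // Even (k : ℕ)}) (w : W G k.1) :
    ofSemiFree G e (1 ⊗ₜ (SymmetricAlgebra.ι ℂ (EvenPart (W G))
      (DirectSum.lof ℂ _ (fun k : {k : ℕ+ // Even (k : ℕ)} => W G k.1) k w) ⊗ₜ 1)) =
        wmap G k.1 w := by
  rw [ofSemiFree_even, symLift_ι]
  exact evenMap_lof G k w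

theorem ofSemiFree_wmap_odd (k : {k : ℕ+ // Odd (k : ℕ)}) (w : W G k.1) :
    ofSemiFree G e (1 ⊗ₜ (1 ⊗ₜ ExteriorAlgebra.ι ℂ
      (DirectSum.lof ℂ _ (fun k : {k : ℕ+ // Odd (k : ℕ)} => W G k.1) k w))) = wmap G k.1 w := by
  rw [ofSemiFree_odd, ExteriorAlgebra.lift_ι_apply]
  exact oddMap_lof G k w

section Lift

variable [FiniteDimensional ℂ V] {D : Type w} [Semiring D] [Algebra ℂ D] (f : V →ₗ[ℂ] D)
  (g : EvenPart (W G) →ₗ[ℂ] D) (h : OddPart (W G) →ₗ[ℂ] D)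

/-- The images of the generators under a map given on `V`, `W_even` and `W_odd`. -/
def semiGen : ∀ p, Module.Dual ℂ (G.comp p) →ₗ[ℂ] D
  | 0 => 0
  | 1 => f ∘ₗ e.vec G 1
  | k + 2 =>
    if hk : Even (k + 1) then
      g ∘ₗ DirectSum.lof ℂ _ (fun k : {k : ℕ+ // Even (k : ℕ)} => W G k.1) ⟨⟨k + 1, k.succ_pos⟩, hk⟩
    else
      h ∘ₗ DirectSum.lof ℂ _ (fun k : {k : ℕ+ // Odd (k : ℕ)} => W G k.1)
        ⟨⟨k + 1, k.succ_pos⟩, Nat.not_even_iff_odd.1 hk⟩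

theorem semiGen_one (φ : Module.Dual ℂ (G.comp 1)) : semiGen G e f g h 1 φ = f (e.vec G 1 φ) := rfl

theorem semiGen_even (k : {k : ℕ+ // Even (k : ℕ)}) (φ : W G k.1) :
    semiGen G e f g h ((k.1 : ℕ) + 1) φ =
      g (DirectSum.lof ℂ _ (fun k : {k : ℕ+ // Even (k : ℕ)} => W G k.1) k φ) := by
  obtain ⟨⟨k, hk⟩, hk'⟩ := k
  obtain ⟨k, rfl⟩ := Nat.exists_eq_succ_of_ne_zero hk.ne'
  have h' : Even (k + 1) := hk'
  change (semiGen G e f g h (k + 2)) φ = _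
  rw [semiGen, dif_pos h']
  rfl

theorem semiGen_odd (k : {k : ℕ+ // Odd (k : ℕ)}) (φ : W G k.1) :
    semiGen G e f g h ((k.1 : ℕ) + 1) φ =
      h (DirectSum.lof ℂ _ (fun k : {k : ℕ+ // Odd (k : ℕ)} => W G k.1) k φ) := by
  obtain ⟨⟨k, hk⟩, hk'⟩ := k
  obtain ⟨k, rfl⟩ := Nat.exists_eq_succ_of_ne_zero hk.ne'
  have h' : ¬ Even (k + 1) := Nat.not_even_iff_odd.2 hk'
  change (semiGen G e f g h (k + 2)) φ = _
  rw [semiGen, dif_neg h']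
  rfl

/-- The three kinds of generators. -/
theorem gen_cases {P : ∀ p, Module.Dual ℂ (G.comp p) → Prop} (h0 : P 0 0) (h1 : ∀ φ, P 1 φ)
    (he : ∀ (k : {k : ℕ+ // Even (k : ℕ)}) (φ : W G k.1), P ((k.1 : ℕ) + 1) φ)
    (ho : ∀ (k : {k : ℕ+ // Odd (k : ℕ)}) (φ : W G k.1), P ((k.1 : ℕ) + 1) φ)
    (p : ℕ) (φ : Module.Dual ℂ (G.comp p)) : P p φ := by
  match p with
  | 0 => rw [G.dual_comp_zero φ]; exact h0
  | 1 => exact h1 φ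
  | k + 2 =>
    by_cases h : Even (k + 1)
    · exact he ⟨⟨k + 1, k.succ_pos⟩, h⟩ φ
    · exact ho ⟨⟨k + 1, k.succ_pos⟩, Nat.not_even_iff_odd.1 h⟩ φ

variable {f g h}

theorem semiGen_commute (hf : ∀ v x, f v * x = x * f v) (hg : ∀ a x, g a * x = x * g a) {p : ℕ}
    (hp : Odd p) (φ : Module.Dual ℂ (G.comp p)) (x : D) :
    semiGen G e f g h p φ * x = x * semiGen G e f g h p φ := by
  refine gen_cases G (P := fun p φ => Odd p →
    semiGen G e f g h p φ * x = x * semiGen G e f g h p φ) ?_ ?_ ?_ ?_ p φ hp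
  · intro _; simp
  · intro φ _
    rw [semiGen_one, hf]
  · intro k φ _
    rw [semiGen_even, hg]
  · intro k φ h
    exact absurd k.2.add_one (Nat.not_even_iff_odd.2 h)

/-- If either degree `p`, `q` is odd, the corresponding image is central and the sign is `1`. If
both are even, the images come from the odd part, where `h` anticommutes. -/
theorem semiGen_mul (hf : ∀ v x, f v * x = x * f v) (hg : ∀ a x, g a * x = x * g a)
    (hh : ∀ a b, h a * h b = (-1 : ℂ) • (h b * h a)) (p q : ℕ) (φ : Module.Dual ℂ (G.comp p))
    (ψ : Module.Dual ℂ (G.comp q)) :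
    semiGen G e f g h p φ * semiGen G e f g h q ψ =
      (-1 : ℂ) ^ ((p + 1) * (q + 1)) • (semiGen G e f g h q ψ * semiGen G e f g h p φ) := by
  by_cases hp : Odd p
  · rw [semiGen_commute G e hf hg hp, (hp.add_one.mul_right _).neg_one_pow, one_smul]
  by_cases hq : Odd q
  · rw [semiGen_commute G e hf hg hq, (hq.add_one.mul_left _).neg_one_pow, one_smul]
  have hp' := Nat.not_odd_iff_even.1 hp
  have hq' := Nat.not_odd_iff_even.1 hq
  rw [(hp'.add_one.mul hq'.add_one).neg_one_pow]
  have key : ∀ p (φ : Module.Dual ℂ (G.comp p)), Even p → ∃ a, semiGen G e f g h p φ = h a := by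
    refine gen_cases G ?_ ?_ ?_ ?_
    · exact fun _ => ⟨0, by simp⟩
    · exact fun φ h => absurd odd_one (Nat.not_odd_iff_even.2 h)
    · exact fun k φ h => absurd k.2.add_one (Nat.not_odd_iff_even.2 h)
    · exact fun k φ _ => ⟨_, semiGen_odd G e f g h k φ⟩
  obtain ⟨a, ha⟩ := key p φ hp'
  obtain ⟨b, hb⟩ := key q ψ hq'
  rw [ha, hb, hh]

end Lift

variable [FiniteDimensional ℂ V]

/-- The map `CE(L) → S(V)[W]`. -/
def toSemiFree : CE G →ₐ[ℂ] SemiFreeAlg V (W G) :=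
  lift G (semiGen G e
    (Algebra.TensorProduct.includeLeft.toLinearMap ∘ₗ SymmetricAlgebra.ι ℂ V)
    (Algebra.TensorProduct.includeRight.toLinearMap ∘ₗ
      Algebra.TensorProduct.includeLeft.toLinearMap ∘ₗ SymmetricAlgebra.ι ℂ (EvenPart (W G)))
    (Algebra.TensorProduct.includeRight.toLinearMap ∘ₗ
      Algebra.TensorProduct.includeRight.toLinearMap ∘ₗ ExteriorAlgebra.ι ℂ))
    (semiGen_mul G e (fun _ _ => tmul_commute _ _ _) (fun _ _ => tmul_commute _ _ _)
      (fun _ _ => tmul_anticommute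
        (eq_neg_of_add_eq_zero_left (ExteriorAlgebra.ι_add_mul_swap _ _))))

theorem toSemiFree_vmap (v : V) : toSemiFree G e (vmap G e v) =
    SymmetricAlgebra.ι ℂ V v ⊗ₜ (1 ⊗ₜ 1) := by
  rw [vmap_eq, toSemiFree, lift_gen, semiGen_one, e.vec_form]
  rfl

theorem toSemiFree_wmap_even (k : {k : ℕ+ // Even (k : ℕ)}) (w : W G k.1) :
    toSemiFree G e (wmap G k.1 w) = 1 ⊗ₜ (SymmetricAlgebra.ι ℂ (EvenPart (W G))
      (DirectSum.lof ℂ _ (fun k : {k : ℕ+ // Even (k : ℕ)} => W G k.1) k w) ⊗ₜ 1) :=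
  (lift_gen G _ _ _ w).trans (semiGen_even G e _ _ _ k w)

theorem toSemiFree_wmap_odd (k : {k : ℕ+ // Odd (k : ℕ)}) (w : W G k.1) :
    toSemiFree G e (wmap G k.1 w) = 1 ⊗ₜ (1 ⊗ₜ ExteriorAlgebra.ι ℂ
      (DirectSum.lof ℂ _ (fun k : {k : ℕ+ // Odd (k : ℕ)} => W G k.1) k w)) :=
  (lift_gen G _ _ _ w).trans (semiGen_odd G e _ _ _ k w)

/-- Both composites of `ofSemiFree` and `toSemiFree` fix generators, so the universal properties
make the two maps mutually inverse. -/
theorem ofSemiFree_comp_toSemiFree : (ofSemiFree G e).comp (toSemiFree G e) = AlgHom.id ℂ _ := by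
  refine hom_ext G (gen_cases G ?_ ?_ ?_ ?_)
  · simp
  · intro φ
    rw [← e.form_vec G φ, ← vmap_eq, AlgHom.comp_apply, toSemiFree_vmap, ofSemiFree_vmap]
    rfl
  · intro k φ
    exact (congrArg (ofSemiFree G e) (toSemiFree_wmap_even G e k φ)).trans
      (ofSemiFree_wmap_even G e k φ)
  · intro k φ
    exact (congrArg (ofSemiFree G e) (toSemiFree_wmap_odd G e k φ)).trans
      (ofSemiFree_wmap_odd G e k φ)

theorem toSemiFree_comp_ofSemiFree : (toSemiFree G e).comp (ofSemiFree G e) = AlgHom.id ℂ _ := by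
  refine Algebra.TensorProduct.ext ?_ (Algebra.TensorProduct.ext ?_ ?_)
  · refine symmetricAlgebra_hom_ext (LinearMap.ext fun v => ?_)
    exact (congrArg (toSemiFree G e) (ofSemiFree_vmap G e v)).trans (toSemiFree_vmap G e v)
  · refine symmetricAlgebra_hom_ext (DirectSum.linearMap_ext ℂ fun k =>
      LinearMap.ext fun x => ?_)
    exact (congrArg (toSemiFree G e) (ofSemiFree_wmap_even G e k x)).trans
      (toSemiFree_wmap_even G e k x)
  · refine ExteriorAlgebra.hom_ext (DirectSum.linearMap_ext ℂ fun k => LinearMap.ext fun x => ?_)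
    exact (congrArg (toSemiFree G e) (ofSemiFree_wmap_odd G e k x)).trans
      (toSemiFree_wmap_odd G e k x)

theorem isSemiFree : IsSemiFree (W := W G) (deg G) (vmap G e) (wmap G) where
  vmap_mem _ := gen_mem_deg G rfl _
  wmap_mem _ w := gen_mem_deg G rfl w
  exists_equiv := ⟨AlgEquiv.ofAlgHom (ofSemiFree G e) (toSemiFree G e)
      (ofSemiFree_comp_toSemiFree G e) (toSemiFree_comp_ofSemiFree G e),
    ofSemiFree_vmap G e, ofSemiFree_wmap_even G e, ofSemiFree_wmap_odd G e⟩

end CE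

end

end KoszulCE

end

theorem mainTheorem5 {V : Type*} [AddCommGroup V] [Module ℂ V] [FiniteDimensional ℂ V]
    (R : Submodule ℂ (TensorProduct ℂ V V))
    (hcomm : ∀ u v : V, TensorProduct.tmul ℂ u v - TensorProduct.tmul ℂ v u ∈ R)
    (hK : KoszulCE.IsKoszul R)
    {L : Type*} [AddCommGroup L] [Module ℂ L] (G : KoszulCE.GradedLieSuperalgebra L)
    [∀ m, FiniteDimensional ℂ (G.comp m)]
    (e : KoszulCE.DualEnvIso G R) :
    KoszulCE.IsMinimalModel (W := fun k : ℕ+ => Module.Dual ℂ (G.comp ((k : ℕ) + 1)))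
      (KoszulCE.QuadAlg.gen R) (KoszulCE.CE.deg G) (KoszulCE.CE.d G)
      (KoszulCE.CE.vmap G e) (KoszulCE.CE.wmap G) := by
  exact
    { isCDGA := KoszulCE.CE.isCDGA G
      isSemiFree := KoszulCE.CE.isSemiFree G e
      resolution := ⟨e.pi G hcomm,
        fun v => (e.pi_gen G hcomm 1 _).trans (congrArg _ (e.vec_form G v)),
        fun k w => e.pi_gen_of_ne G hcomm (by have := k.pos; omega) w,
        KoszulCE.CE.isResolution G hcomm hK e⟩
      decomposable := fun k w => KoszulCE.CE.d_decomposable G e _ w }
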